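/- **Conventions.** A *virtual double category* $\mathbb E$ has a category of objects and (vertical) arrows, proarrows $J : X \nrightarrow Y$, and 2-cells $\alpha$ whose horizontal domain is a (possibly empty) composable string $J_1,\dots,J_k$ of proarrows $X_0 \nrightarrow X_1 \nrightarrow\cdots\nrightarrow X_k$, whose horizontal codomain is one proarrow $K : Y_0\nrightarrow Y_1$, and whose left and right sides are arrows $f : X_0\to Y_0$, $g : X_k\to Y_1$; there are identity cells and associative, unital composites $\beta(\alpha_1,\dots,\alpha_l)$. A cell $\mu : J_1,\dots,J_k\to J$ with identity sides exhibits $J$ as the *composite* of $J_1,\dots,J_k$ if every cell with domain $K_1,\dots,K_m,J_1,\dots,J_k,Q_1,\dots,Q_n$ factors uniquely through $(\mathrm{id},\dots,\mathrm{id},\mu,\mathrm{id},\dots,\mathrm{id})$. A *unit* $U_A$ is a composite of the empty string at $A$. A cell $\chi : J\to K$ with sides $f,g$ is *cartesian*, and $J=K(f,g)$ is a *restriction* of $K$ along $f$ and $g$, if every cell into $K$ whose sides are $h$ followed by $f$ and $k$ followed by $g$ is $\chi(\beta)$ for a unique cell $\beta$ into $J$ with sides $h,k$. A *virtual equipment*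 is a virtual double category in which all units and all restrictions exist. For objects $A,B$, let $h\mathbb E(A,B)$ be the category of proarrows $A\nrightarrow B$ and cells $J\to K$ with identity sides. Let $\mathbb E$ be a virtual equipment. An *$\mathbb E$-category* $\mathcal C$ has objects $a$, each with an extent $\mathcal C(a)\in\mathbb E$, proarrows $\mathcal C(a,b):\mathcal C(a)\nrightarrow\mathcal C(b)$, and identity and composition cells, with identity sides, that are unital and associative. A *functor* $F:\mathcal C\to\mathcal D$ has a map $a\mapsto Fa$ on objects, arrows $F_a:\mathcal C(a)\to\mathcal D(Fa)$ and cells $\mathcal C(a,b)\to\mathcal D(Fa,Fb)$ with sides $F_a,F_b$, compatible with identities and composition. A *profunctor* $J:\mathcal C\nrightarrow\mathcal D$ has proarrows $J(a,b):\mathcal C(a)\nrightarrow\mathcal D(b)$ with unital, associative, commuting left and right actions of $\mathcal C$ and $\mathcal D$. A *2-cell* from $J_1,\dots,J_k$ to $K$ with sides $F,G$ is a family of cells $\alpha_{c_0\dots c_k}:J_1(c_0,c_1),\dots,J_k(c_{k-1},c_k)\to K(Fc_0,Gc_k)$ with sides $F_{c_0},G_{c_k}$ that equalizes the actions of the inner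 categories and commutes with the two outer actions through $F$ and $G$ (for $k=0$: the family $\alpha_c : ()\to K(Fc,Gc)$ is natural in $c$). With componentwise composition these form the virtual double category $\mathrm{VCat}(\mathbb E)$; $\mathbb E$-categories are allowed as many objects as $\mathbb E$ has objects and arrows. The *canonical embedding* $|\cdot|:\mathbb E\to\mathrm{VCat}(\mathbb E)$ is the following functor of virtual double categories. The objects of $|A|$ are the arrows $x:X\to A$ of $\mathbb E$, with extent $X$, and $|A|(x,y)=U_A(x,y)$; for $f:A\to B$, the functor $|f|$ sends $x$ to its composite with $f$; for $J:A\nrightarrow B$, $|J|(x,y)=J(x,y)$; and for a cell $\alpha$, the components of $|\alpha|$ are obtained by composing $\alpha$ with the cartesian cells of the restrictions $J_i(x_{i-1},x_i)$ and factoring through the cartesian cell of the restriction of the codomain. **Theorem.** Let $\mathbb E$ be a virtual equipment. Then $\mathrm{VCat}(\mathbb E)$ is a virtual equipment, and the canonical embedding $|\cdot|:\mathbb E\to\mathrm{VCat}(\mathbb E)$ has the following properties. 1. It preserves composites of proarrows: if $\mu$ exhibits $J$ as the composite of $J_1,\dots,J_k$ ($k\ge 0$), then $|\mu|$ exhibits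 $|J|$ as the composite of $|J_1|,\dots,|J_k|$. 2. It is fully faithful on 2-cells: for all $J_1,\dots,J_k$, $f$, $g$, $K$, the map $\alpha\mapsto|\alpha|$ is a bijection from the cells $J_1,\dots,J_k\to K$ with sides $f,g$ to the cells $|J_1|,\dots,|J_k|\to|K|$ with sides $|f|,|g|$. 3. It is full on arrows: every functor $|A|\to|B|$ is naturally isomorphic to $|f|$ for some arrow $f:A\to B$. 4. It is coreflective on proarrows: the induced functor $h\mathbb E(A,B)\to h(\mathrm{VCat}(\mathbb E))(|A|,|B|)$ is fully faithful, and it has as right adjoint the functor $J\mapsto J(\mathrm{id}_A,\mathrm{id}_B)$. -/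

import Mathlib

open CategoryTheory

universe t z w v u

section Paths

/-- Composable strings of proarrows from `X` to `Y`, possibly empty. -/
inductive ProPath {V : Type u} (H : V → V → Type w) : V → V → Type (max u w)
  | nil (X : V) : ProPath H X X
  | cons {X Y Z : V} (J : H X Y) (p : ProPath H Y Z) : ProPath H X Z

namespace ProPath

variable {V : Type u} {H : V → V → Type w}

/-- Concatenation of strings of proarrows. -/
def append : ∀ {X Y Z : V}, ProPath H X Y → ProPath H Y Z → ProPath H X Z
  | _, _, _, .nil _, q => q
  | _, _, _, .cons J p, q => .cons J (append p q)

theorem append_nil : ∀ {X Y : V} (p : ProPath H X Y), p.append (.nil Y) = p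
  | _, _, .nil _ => rfl
  | _, _, .cons J p => congrArg (ProPath.cons J) (append_nil p)

theorem append_assoc : ∀ {X Y Z W : V} (p : ProPath H X Y) (q : ProPath H Y Z)
    (r : ProPath H Z W), (p.append q).append r = p.append (q.append r)
  | _, _, _, _, .nil _, _, _ => rfl
  | _, _, _, _, .cons J p, q, r => congrArg (ProPath.cons J) (append_assoc p q r)

/-- The image of a string of proarrows under a map of objects and proarrows. -/
def map {V' : Type*} {H' : V' → V' → Type*} (F : V → V')
    (G : ∀ ⦃X Y : V⦄, H X Y → H' (F X) (F Y)) :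
    ∀ {X Y : V}, ProPath H X Y → ProPath H' (F X) (F Y)
  | _, _, .nil X => .nil (F X)
  | _, _, .cons J p => .cons (G J) (map F G p)

theorem map_append {V' : Type*} {H' : V' → V' → Type*} (F : V → V')
    (G : ∀ ⦃X Y : V⦄, H X Y → H' (F X) (F Y)) :
    ∀ {X Y Z : V} (p : ProPath H X Y) (q : ProPath H Y Z),
      (p.append q).map F G = (p.map F G).append (q.map F G)
  | _, _, _, .nil _, _ => rfl
  | _, _, _, .cons J p, q => congrArg (ProPath.cons (G J)) (map_append F G p q)

end ProPath

end Paths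

section Rows

variable {V : Type u} [Category.{v} V] {H : V → V → Type w}

/-- Rows of horizontally composable cells: a row from the string `p` to the string
`K₁, …, Kₗ`, with outer vertical arrows `f` and `g`, consists of cells `αᵢ` with codomain `Kᵢ`
whose domains concatenate to `p` and for which the right vertical arrow of each cell is the left
one of the next. -/
inductive CellRow
    (C : ∀ ⦃X X' Y Y' : V⦄, ProPath H X X' → (X ⟶ Y) → (X' ⟶ Y') → H Y Y' → Type z) :
    ∀ {X X' Y Y' : V}, ProPath H X X' → (X ⟶ Y) → (X' ⟶ Y') → ProPath H Y Y' →
      Type (max u v w z)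
  | nil {X Y : V} (f : X ⟶ Y) : CellRow C (.nil X) f f (.nil Y)
  | cons {X X' X'' Y Y' Y'' : V} {p : ProPath H X X'} {r : ProPath H X' X''}
      {s : ProPath H X X''} {f : X ⟶ Y} {g : X' ⟶ Y'} {k : X'' ⟶ Y''}
      {K : H Y Y'} {q : ProPath H Y' Y''} (h : s = p.append r)
      (α : C p f g K) (ρ : CellRow C r g k q) : CellRow C s f k (.cons K q)

namespace CellRow

variable {C : ∀ ⦃X X' Y Y' : V⦄, ProPath H X X' → (X ⟶ Y) → (X' ⟶ Y') → H Y Y' → Type z}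

/-- The row with one cell. -/
abbrev single {X X' Y Y' : V} {p : ProPath H X X'} {f : X ⟶ Y} {g : X' ⟶ Y'} {K : H Y Y'}
    (α : C p f g K) : CellRow C p f g (.cons K (.nil Y')) :=
  .cons (ProPath.append_nil p).symm α (.nil g)

/-- The row with two cells. -/
abbrev pair {X X' X'' Y Y' Y'' : V} {p : ProPath H X X'} {q : ProPath H X' X''} {f : X ⟶ Y}
    {g : X' ⟶ Y'} {k : X'' ⟶ Y''} {K : H Y Y'} {L : H Y' Y''}
    (α : C p f g K) (β : C q g k L) : CellRow C (p.append q) f k (.cons K (.cons L (.nil Y''))) :=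
  .cons rfl α (.single β)

/-- The row of chosen cells `J ⟶ J` on a string of proarrows. -/
def ids (i : ∀ ⦃X Y : V⦄ (J : H X Y), C (.cons J (.nil Y)) (𝟙 X) (𝟙 Y) J) :
    ∀ {X Y : V} (p : ProPath H X Y), CellRow C p (𝟙 X) (𝟙 Y) p
  | _, _, .nil X => .nil (𝟙 X)
  | _, _, .cons J p => .cons rfl (i J) (ids i p)

/-- Horizontal concatenation of rows, on exact concatenations of strings. -/
def append₀ : ∀ {X X' X'' Y Y' Y'' : V} {o : ProPath H X X'} {o' : ProPath H X' X''}
    {p : ProPath H Y Y'} {p' : ProPath H Y' Y''} {f : X ⟶ Y} {g : X' ⟶ Y'} {k : X'' ⟶ Y''},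
    CellRow C o f g p → CellRow C o' g k p' → CellRow C (o.append o') f k (p.append p')
  | _, _, _, _, _, _, _, _, _, _, _, _, _, .nil _, σ => σ
  | _, _, _, _, _, _, _, _, _, _, _, _, _, .cons h α ρ, σ =>
      .cons (by rw [h, ProPath.append_assoc]) α (append₀ ρ σ)

/-- Horizontal concatenation of rows. -/
def append {X X' X'' Y Y' Y'' : V} {o : ProPath H X X'} {o' : ProPath H X' X''}
    {o'' : ProPath H X X''} {p : ProPath H Y Y'} {p' : ProPath H Y' Y''} {p'' : ProPath H Y Y''}
    {f : X ⟶ Y} {g : X' ⟶ Y'} {k : X'' ⟶ Y''} (ho : o'' = o.append o') (hp : p'' = p.append p')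
    (ρ : CellRow C o f g p) (σ : CellRow C o' g k p') : CellRow C o'' f k p'' := by
  subst ho hp
  exact append₀ ρ σ

/-- `Paste paste ρ σ τ` says that the row `τ` is obtained by putting the row `ρ` on top of the
row `σ` and composing, by `paste`, each cell of `σ` with the cells of `ρ` above it. -/
inductive Paste
    (paste : ∀ ⦃X X' Y Y' Z Z' : V⦄ ⦃p : ProPath H X X'⦄ ⦃q : ProPath H Y Y'⦄ ⦃K : H Z Z'⦄
      ⦃f : X ⟶ Y⦄ ⦃g : X' ⟶ Y'⦄ ⦃f' : Y ⟶ Z⦄ ⦃g' : Y' ⟶ Z'⦄ ⦃f'' : X ⟶ Z⦄ ⦃g'' : X' ⟶ Z'⦄,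
      CellRow C p f g q → C q f' g' K → f ≫ f' = f'' → g ≫ g' = g'' → C p f'' g'' K) :
    ∀ {X X' Y Y' Z Z' : V} {o : ProPath H X X'} {p : ProPath H Y Y'} {q : ProPath H Z Z'}
      {f : X ⟶ Y} {g : X' ⟶ Y'} {f' : Y ⟶ Z} {g' : Y' ⟶ Z'} {f'' : X ⟶ Z} {g'' : X' ⟶ Z'},
      CellRow C o f g p → CellRow C p f' g' q → CellRow C o f'' g'' q → Prop
  | nil {X Y Z : V} {f : X ⟶ Y} {f' : Y ⟶ Z} {f'' : X ⟶ Z} (hf : f ≫ f' = f'') :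
      Paste paste (.nil f) (.nil f') (.nil f'')
  | cons {X X' X'' Y Y' Y'' Z Z' Z'' : V} {o : ProPath H X X'} {o' : ProPath H X' X''}
      {o'' : ProPath H X X''} {p : ProPath H Y Y'} {p' : ProPath H Y' Y''} {p'' : ProPath H Y Y''}
      {K : H Z Z'} {q : ProPath H Z' Z''} {f : X ⟶ Y} {g : X' ⟶ Y'} {k : X'' ⟶ Y''}
      {f' : Y ⟶ Z} {g' : Y' ⟶ Z'} {k' : Y'' ⟶ Z''} {f'' : X ⟶ Z} {g'' : X' ⟶ Z'}
      {k'' : X'' ⟶ Z''} (ho : o'' = o.append o') (hp : p'' = p.append p')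
      (hf : f ≫ f' = f'') (hg : g ≫ g' = g'') (γ : CellRow C o f g p) (α : C p f' g' K)
      {ρ : CellRow C o' g k p'} {σ : CellRow C p' g' k' q} {τ : CellRow C o' g'' k'' q}
      (h : Paste paste ρ σ τ) :
      Paste paste (γ.append ho hp ρ) (.cons hp α σ) (.cons ho (paste γ α hf hg) τ)

/-- The image of a row under a map of objects, vertical arrows, proarrows and cells. -/
def map {V' : Type*} [Category V'] {H' : V' → V' → Type*}
    {C' : ∀ ⦃X X' Y Y' : V'⦄, ProPath H' X X' → (X ⟶ Y) → (X' ⟶ Y') → H' Y Y' → Type*}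
    (F : V ⥤ V') (G : ∀ ⦃X Y : V⦄, H X Y → H' (F.obj X) (F.obj Y))
    (c : ∀ ⦃X X' Y Y' : V⦄ ⦃p : ProPath H X X'⦄ ⦃f : X ⟶ Y⦄ ⦃g : X' ⟶ Y'⦄ ⦃K : H Y Y'⦄,
      C p f g K → C' (p.map F.obj G) (F.map f) (F.map g) (G K)) :
    ∀ {X X' Y Y' : V} {p : ProPath H X X'} {f : X ⟶ Y} {g : X' ⟶ Y'} {q : ProPath H Y Y'},
      CellRow C p f g q → CellRow C' (p.map F.obj G) (F.map f) (F.map g) (q.map F.obj G)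
  | _, _, _, _, _, _, _, _, .nil f => .nil (F.map f)
  | _, _, _, _, _, _, _, _, .cons h α ρ =>
      .cons (by rw [h, ProPath.map_append]) (c α) (map F G c ρ)

end CellRow

end Rows

/-- A virtual double category. Objects and vertical arrows form a category; `Pro` are the
proarrows; `Cell p f g K` are the 2-cells with horizontal domain the string `p`, vertical domain
`f`, vertical codomain `g` and horizontal codomain `K`. The composite `β(α₁, …, αₗ)` of a cell
with a row of cells is `paste`; its vertical arrows are given together with proofs that they are
the composite arrows, so that the laws are equations. -/
class VirtualDoubleCategory (V : Type u) extends Category.{v} V where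
  Pro : V → V → Type w
  Cell : ∀ ⦃X X' Y Y' : V⦄, ProPath Pro X X' → (X ⟶ Y) → (X' ⟶ Y') → Pro Y Y' → Type z
  cellId : ∀ ⦃X Y : V⦄ (J : Pro X Y), Cell (.cons J (.nil Y)) (𝟙 X) (𝟙 Y) J
  paste : ∀ ⦃X X' Y Y' Z Z' : V⦄ ⦃p : ProPath Pro X X'⦄ ⦃q : ProPath Pro Y Y'⦄ ⦃K : Pro Z Z'⦄
    ⦃f : X ⟶ Y⦄ ⦃g : X' ⟶ Y'⦄ ⦃f' : Y ⟶ Z⦄ ⦃g' : Y' ⟶ Z'⦄ ⦃f'' : X ⟶ Z⦄ ⦃g'' : X' ⟶ Z'⦄,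
    CellRow Cell p f g q → Cell q f' g' K → f ≫ f' = f'' → g ≫ g' = g'' → Cell p f'' g'' K
  ids_paste : ∀ {X X' Y Y' : V} {p : ProPath Pro X X'} {K : Pro Y Y'} {f : X ⟶ Y} {g : X' ⟶ Y'}
    (β : Cell p f g K),
    paste (CellRow.ids cellId p) β (Category.id_comp f) (Category.id_comp g) = β
  paste_id : ∀ {X X' Y Y' : V} {p : ProPath Pro X X'} {K : Pro Y Y'} {f : X ⟶ Y} {g : X' ⟶ Y'}
    (α : Cell p f g K),
    paste (CellRow.single α) (cellId K) (Category.comp_id f) (Category.comp_id g) = α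
  paste_assoc : ∀ {X X' Y Y' Z Z' W W' : V} {o : ProPath Pro X X'} {p : ProPath Pro Y Y'}
    {q : ProPath Pro Z Z'} {K : Pro W W'} {f : X ⟶ Y} {g : X' ⟶ Y'} {f' : Y ⟶ Z} {g' : Y' ⟶ Z'}
    {f'' : X ⟶ Z} {g'' : X' ⟶ Z'} {k : Z ⟶ W} {l : Z' ⟶ W'} {k' : Y ⟶ W} {l' : Y' ⟶ W'}
    {k'' : X ⟶ W} {l'' : X' ⟶ W'} {ρ : CellRow Cell o f g p} {σ : CellRow Cell p f' g' q}
    {τ : CellRow Cell o f'' g'' q} (β : Cell q k l K)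
    (_ : CellRow.Paste paste ρ σ τ) (h₁ : f' ≫ k = k') (h₂ : g' ≫ l = l') (h₃ : f ≫ k' = k'')
    (h₄ : g ≫ l' = l'') (h₅ : f'' ≫ k = k'') (h₆ : g'' ≫ l = l''),
    paste ρ (paste σ β h₁ h₂) h₃ h₄ = paste τ β h₅ h₆

namespace VirtualDoubleCategory

section Basic

variable {V : Type u} [VirtualDoubleCategory.{z, w, v} V]

/-- Strings of proarrows in a virtual double category. -/
abbrev HPath (X Y : V) := ProPath (Pro (V := V)) X Y

/-- Rows of cells in a virtual double category. -/
abbrev Row {X X' Y Y' : V} (p : HPath X X') (f : X ⟶ Y) (g : X' ⟶ Y') (q : HPath Y Y') :=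
  CellRow (Cell (V := V)) p f g q

/-- The row of identity cells. -/
abbrev idRow {X Y : V} (p : HPath X Y) : Row p (𝟙 X) (𝟙 Y) p := CellRow.ids cellId p

/-- Transport of a cell along equations between vertical arrows. -/
def castCell {X X' Y Y' : V} {p : HPath X X'} {f f' : X ⟶ Y} {g g' : X' ⟶ Y'} {K : Pro Y Y'}
    (hf : f = f') (hg : g = g') (α : Cell p f g K) : Cell p f' g' K := by
  subst hf hg
  exact α

/-- The row `id, …, id, μ, id, …, id`. -/
def whisker {X Y : V} {p : HPath X Y} {J : Pro X Y} (μ : Cell p (𝟙 X) (𝟙 Y) J) :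
    ∀ {Z W : V} (k : HPath Z X) (q : HPath Y W),
      Row (k.append (p.append q)) (𝟙 Z) (𝟙 W) (k.append (.cons J q))
  | _, _, .nil _, q => .cons (by rfl) μ (idRow q)
  | _, _, .cons L k, q => .cons (by rfl) (cellId L) (whisker μ k q)

/-- `μ` exhibits `J` as the composite of the string `p`. -/
def IsComposite {X Y : V} {p : HPath X Y} {J : Pro X Y} (μ : Cell p (𝟙 X) (𝟙 Y) J) : Prop :=
  ∀ {Z W Y₀ Y₁ : V} (k : HPath Z X) (q : HPath Y W) (f : Z ⟶ Y₀) (g : W ⟶ Y₁) (K : Pro Y₀ Y₁)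
    (α : Cell (k.append (p.append q)) f g K),
    ∃! β : Cell (k.append (.cons J q)) f g K,
      paste (whisker μ k q) β (Category.id_comp f) (Category.id_comp g) = α

/-- A cell `χ` with one proarrow `J` as its domain is cartesian if every cell with the same
codomain, whose vertical arrows factor through those of `χ`, factors uniquely through `χ`. -/
def IsCartesian {X X' Y Y' : V} {J : Pro X X'} {f : X ⟶ Y} {g : X' ⟶ Y'} {K : Pro Y Y'}
    (χ : Cell (.cons J (.nil X')) f g K) : Prop :=
  ∀ {W W' : V} (p : HPath W W') (h : W ⟶ X) (k : W' ⟶ X') (α : Cell p (h ≫ f) (k ≫ g) K),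
    ∃! β : Cell p h k J, paste (.single β) χ rfl rfl = α

end Basic

end VirtualDoubleCategory

open VirtualDoubleCategory

/-- A virtual equipment: a virtual double category in which every object has a unit (a composite
of the empty string) and every proarrow has a restriction along every pair of arrows. -/
class IsVirtualEquipment (V : Type u) [VirtualDoubleCategory.{z, w, v} V] : Prop where
  exists_unit : ∀ A : V, ∃ (U : Pro A A) (η : Cell (.nil A) (𝟙 A) (𝟙 A) U), IsComposite η
  exists_restriction : ∀ {X X' Y Y' : V} (f : X ⟶ Y) (g : X' ⟶ Y') (K : Pro Y Y'),
    ∃ (J : Pro X X') (χ : Cell (.cons J (.nil X')) f g K), IsCartesian χ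

namespace VirtualDoubleCategory

section Calculus

variable {V : Type u} [VirtualDoubleCategory.{z, w, v} V]

/-- `τ` is the vertical composite of the rows `ρ` (above) and `σ` (below). -/
abbrev IsPaste {X X' Y Y' Z Z' : V} {o : HPath X X'} {p : HPath Y Y'} {q : HPath Z Z'}
    {f : X ⟶ Y} {g : X' ⟶ Y'} {f' : Y ⟶ Z} {g' : Y' ⟶ Z'} {f'' : X ⟶ Z} {g'' : X' ⟶ Z'}
    (ρ : Row o f g p) (σ : Row p f' g' q) (τ : Row o f'' g'' q) : Prop :=
  CellRow.Paste (paste (V := V)) ρ σ τ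

variable {X X' X'' Y Y' Y'' Z Z' Z'' W W' : V}

theorem IsPaste.left {o : HPath X X'} {p : HPath Y Y'} {q : HPath Z Z'}
    {f : X ⟶ Y} {g : X' ⟶ Y'} {f' : Y ⟶ Z} {g' : Y' ⟶ Z'} {f'' : X ⟶ Z} {g'' : X' ⟶ Z'}
    {ρ : Row o f g p} {σ : Row p f' g' q} {τ : Row o f'' g'' q} (h : IsPaste ρ σ τ) :
    f ≫ f' = f'' := by
  cases h <;> assumption

theorem IsPaste.right {o : HPath X X'} {p : HPath Y Y'} {q : HPath Z Z'}
    {f : X ⟶ Y} {g : X' ⟶ Y'} {f' : Y ⟶ Z} {g' : Y' ⟶ Z'} {f'' : X ⟶ Z} {g'' : X' ⟶ Z'}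
    {ρ : Row o f g p} {σ : Row p f' g' q} {τ : Row o f'' g'' q} (h : IsPaste ρ σ τ) :
    g ≫ g' = g'' := by
  induction h <;> assumption

theorem paste_paste {o : HPath X X'} {p : HPath Y Y'} {q : HPath Z Z'} {K : Pro W W'}
    {f : X ⟶ Y} {g : X' ⟶ Y'} {f' : Y ⟶ Z} {g' : Y' ⟶ Z'} {f'' : X ⟶ Z} {g'' : X' ⟶ Z'}
    {k : Z ⟶ W} {l : Z' ⟶ W'} {k' : Y ⟶ W} {l' : Y' ⟶ W'} {k'' : X ⟶ W} {l'' : X' ⟶ W'}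
    {ρ : Row o f g p} {σ : Row p f' g' q} {τ : Row o f'' g'' q} (h : IsPaste ρ σ τ)
    {β : Cell q k l K} {h₁ : f' ≫ k = k'} {h₂ : g' ≫ l = l'} {h₃ : f ≫ k' = k''}
    {h₄ : g ≫ l' = l''} :
    paste ρ (paste σ β h₁ h₂) h₃ h₄ =
      paste τ β (by rw [← h.left, Category.assoc, h₁, h₃])
        (by rw [← h.right, Category.assoc, h₂, h₄]) :=
  paste_assoc β h h₁ h₂ h₃ h₄ _ _

theorem append_cons {o₁ : HPath X X'} {o₂ : HPath X' X''} {o : HPath X X''} {o' : HPath X'' W}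
    {o₂' : HPath X' W} {o'' : HPath X W} {K : Pro Y Y'} {p : HPath Y' Y''} {p' : HPath Y'' W'}
    {p'' : HPath Y' W'} {f : X ⟶ Y} {g : X' ⟶ Y'} {k : X'' ⟶ Y''} {l : W ⟶ W'}
    (h : o = o₁.append o₂) (ho : o'' = o.append o')
    (hp : ProPath.cons K p'' = (ProPath.cons K p).append p') (h' : o'' = o₁.append o₂')
    (ho₂ : o₂' = o₂.append o') (hp₂ : p'' = p.append p') (α : Cell o₁ f g K) (ρ : Row o₂ g k p)
    (σ : Row o' k l p') :
    (CellRow.cons h α ρ).append ho hp σ = .cons h' α (ρ.append ho₂ hp₂ σ) := by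
  subst h ho ho₂ hp₂
  rfl

theorem IsPaste.cons₀ {o : HPath X' X''} {p : HPath Y' Y''} {q : HPath Z' Z''} {K : Pro Z Z'}
    {f : X' ⟶ Y'} {k : X'' ⟶ Y''} {f' : Y' ⟶ Z} {g' : Y' ⟶ Z'} {k' : Y'' ⟶ Z''}
    {f'' : X' ⟶ Z} {g'' : X' ⟶ Z'} {k'' : X'' ⟶ Z''} {ρ : Row o f k p} {σ : Row p g' k' q}
    {τ : Row o g'' k'' q} {α : Cell (.nil Y') f' g' K} (hf : f ≫ f' = f'') (hg : f ≫ g' = g'')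
    {hp : p = (ProPath.nil Y').append p} {ho : o = (ProPath.nil X').append o}
    (h : IsPaste ρ σ τ) :
    IsPaste ρ (.cons hp α σ) (.cons ho (paste (.nil f) α hf hg) τ) :=
  CellRow.Paste.cons (o := .nil X') ho hp hf hg (.nil f) α h

theorem IsPaste.cons₁ {o : HPath X X'} {o' : HPath X' X''} {o'' : HPath X X''} {J : Pro Y Y'}
    {p' : HPath Y' Y''} {q : HPath Z' Z''} {K : Pro Z Z'}
    {f : X ⟶ Y} {g : X' ⟶ Y'} {k : X'' ⟶ Y''} {f' : Y ⟶ Z} {g' : Y' ⟶ Z'} {k' : Y'' ⟶ Z''}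
    {f'' : X ⟶ Z} {g'' : X' ⟶ Z'} {k'' : X'' ⟶ Z''} {α : Cell o f g J}
    {ρ : Row o' g k p'} {β : Cell (.cons J (.nil Y')) f' g' K} {σ : Row p' g' k' q}
    {τ : Row o' g'' k'' q} (hf : f ≫ f' = f'') (hg : g ≫ g' = g'')
    {ho : o'' = o.append o'} {hp : ProPath.cons J p' = (ProPath.cons J (.nil Y')).append p'}
    (h : IsPaste ρ σ τ) :
    IsPaste (.cons ho α ρ) (.cons hp β σ) (.cons ho (paste (.single α) β hf hg) τ) := by
  subst ho
  exact CellRow.Paste.cons rfl rfl hf hg (.single α) β h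

theorem IsPaste.cons₂ {X₀ Y₀ : V} {o₀ : HPath X₀ X} {o₁ : HPath X X'} {o' : HPath X' X''}
    {o₂ : HPath X X''} {o'' : HPath X₀ X''} {J₀ : Pro Y₀ Y} {J : Pro Y Y'}
    {p' : HPath Y' Y''} {q : HPath Z' Z''} {K : Pro Z Z'} {e : X₀ ⟶ Y₀}
    {f : X ⟶ Y} {g : X' ⟶ Y'} {k : X'' ⟶ Y''} {f' : Y₀ ⟶ Z} {g' : Y' ⟶ Z'} {k' : Y'' ⟶ Z''}
    {f'' : X₀ ⟶ Z} {g'' : X' ⟶ Z'} {k'' : X'' ⟶ Z''} {α₀ : Cell o₀ e f J₀} {α : Cell o₁ f g J}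
    {ρ : Row o' g k p'} {β : Cell (.cons J₀ (.cons J (.nil Y'))) f' g' K} {σ : Row p' g' k' q}
    {τ : Row o' g'' k'' q} (hf : e ≫ f' = f'') (hg : g ≫ g' = g'')
    {ho₂ : o₂ = o₁.append o'} {ho : o'' = o₀.append o₂}
    {hp : ProPath.cons J₀ (ProPath.cons J p') =
      (ProPath.cons J₀ (ProPath.cons J (.nil Y'))).append p'}
    {ho' : o'' = (o₀.append o₁).append o'}
    (h : IsPaste ρ σ τ) :
    IsPaste (.cons ho α₀ (.cons ho₂ α ρ)) (.cons hp β σ)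
      (.cons ho' (paste (.pair α₀ α) β hf hg) τ) := by
  subst ho'
  have h₁ := CellRow.Paste.cons rfl rfl hf hg (.pair α₀ α) β h
  subst ho₂
  exact h₁

theorem IsPaste.cons_id {o : HPath X X'} {o' : HPath X' X''} {o'' : HPath X X''} {J : Pro Y Y'}
    {p' : HPath Y' Y''} {q : HPath Y' Z''} {f : X ⟶ Y} {g : X' ⟶ Y'} {k : X'' ⟶ Y''}
    {k' : Y'' ⟶ Z''} {k'' : X'' ⟶ Z''} {α : Cell o f g J} {ρ : Row o' g k p'}
    {σ : Row p' (𝟙 Y') k' q} {τ : Row o' g k'' q}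
    {ho : o'' = o.append o'} {hp : ProPath.cons J p' = (ProPath.cons J (.nil Y')).append p'}
    (h : IsPaste ρ σ τ) :
    IsPaste (.cons ho α ρ) (.cons hp (cellId J) σ) (.cons ho α τ) := by
  have := IsPaste.cons₁ (α := α) (β := cellId J) (ho := ho) (hp := hp) (Category.comp_id f)
    (Category.comp_id g) h
  rwa [paste_id] at this

theorem idRow_append : ∀ {X Y Z : V} (p : HPath X Y) (q : HPath Y Z),
    idRow (p.append q) = (idRow p).append rfl rfl (idRow q)
  | _, _, _, .nil _, _ => rfl
  | _, _, _, .cons J p, q => by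
      have := idRow_append p q
      change CellRow.cons _ _ (idRow (p.append q)) = CellRow.cons _ _ _
      rw [this]
      rfl

theorem IsPaste.id_left {p : HPath X X'} {f : X ⟶ Y} {g : X' ⟶ Y'} {q : HPath Y Y'}
    (ρ : Row p f g q) : IsPaste (idRow p) ρ ρ := by
  induction ρ with
  | nil f => exact .nil (Category.id_comp f)
  | @cons X X' X'' Y Y' Y'' p r s f g k K q h α ρ ih =>
      subst h
      have := CellRow.Paste.cons (paste := paste (V := V)) rfl rfl (Category.id_comp f)
        (Category.id_comp g) (idRow p) α ih
      rwa [← idRow_append, ids_paste] at this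

theorem IsPaste.id_right {p : HPath X X'} {f : X ⟶ Y} {g : X' ⟶ Y'} {q : HPath Y Y'}
    (ρ : Row p f g q) : IsPaste ρ (idRow q) ρ := by
  induction ρ with
  | nil f => exact .nil (Category.comp_id f)
  | cons h α ρ ih => exact IsPaste.cons_id ih

/-- A row over a concatenation is a concatenation of rows. -/
theorem exists_append : ∀ {Y Y' Y'' : V} (p : HPath Y Y') {q : HPath Y' Y''} {X X'' : V}
    {o : HPath X X''} {f : X ⟶ Y} {k : X'' ⟶ Y''} (ρ : Row o f k (p.append q)),
    ∃ (X' : V) (g : X' ⟶ Y') (o₁ : HPath X X') (o₂ : HPath X' X'') (h : o = o₁.append o₂)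
      (ρ₁ : Row o₁ f g p) (ρ₂ : Row o₂ g k q), ρ = ρ₁.append h rfl ρ₂
  | _, _, _, .nil _, _, _, _, _, _, _, ρ => ⟨_, _, .nil _, _, rfl, .nil _, ρ, rfl⟩
  | _, _, _, .cons J p, q, _, _, _, _, _, ρ => by
      change Row _ _ _ (.cons J (p.append q)) at ρ
      cases ρ with
      | cons h α ρ =>
        obtain ⟨X', g, o₁, o₂, h', ρ₁, ρ₂, rfl⟩ := exists_append p ρ
        subst h'
        have h' := h.trans (ProPath.append_assoc _ _ _).symm
        exact ⟨X', g, _, o₂, h', .cons rfl α ρ₁, ρ₂, (append_cons ..).symm⟩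

theorem exists_paste {X X' Y Y' Z Z' : V} {p : HPath Y Y'} {q : HPath Z Z'} {f' : Y ⟶ Z}
    {g' : Y' ⟶ Z'} (σ : Row p f' g' q) {o : HPath X X'} {f : X ⟶ Y} {g : X' ⟶ Y'}
    (ρ : Row o f g p) : ∃ τ : Row o (f ≫ f') (g ≫ g') q, IsPaste ρ σ τ := by
  induction σ generalizing X X' with
  | nil f' => cases ρ; exact ⟨_, .nil rfl⟩
  | cons h α σ ih =>
      subst h
      obtain ⟨X', g, o₁, o₂, h', ρ₁, ρ₂, rfl⟩ := exists_append _ ρ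
      obtain ⟨τ, hτ⟩ := ih ρ₂
      exact ⟨_, .cons h' rfl rfl rfl ρ₁ α hτ⟩

theorem append_nil_right {o : HPath X X'} {p : HPath Y Y'} {f : X ⟶ Y} {g : X' ⟶ Y'}
    (ρ : Row o f g p) (ho : o = o.append (.nil X')) (hp : p = p.append (.nil Y')) :
    ρ.append ho hp (.nil g) = ρ := by
  induction ρ with
  | nil f => rfl
  | @cons X X' X'' Y Y' Y'' p r s f g k K q h α ρ ih =>
    have hr := (ProPath.append_nil r).symm
    have hq := (ProPath.append_nil q).symm
    rw [append_cons h ho hp h hr hq, ih]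

theorem IsPaste.single {o : HPath X X'} {p : HPath Y Y'} {K : Pro Z Z'} {f : X ⟶ Y} {g : X' ⟶ Y'}
    {f' : Y ⟶ Z} {g' : Y' ⟶ Z'} {f'' : X ⟶ Z} {g'' : X' ⟶ Z'} (ρ : Row o f g p)
    (α : Cell p f' g' K) (hf : f ≫ f' = f'') (hg : g ≫ g' = g'') :
    IsPaste ρ (.single α) (.single (paste ρ α hf hg)) := by
  have := CellRow.Paste.cons (paste := paste (V := V)) (ProPath.append_nil o).symm
    (ProPath.append_nil p).symm hf hg ρ α (.nil hg)
  rwa [append_nil_right] at this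

theorem paste_single {o : HPath X X'} {p : HPath Y Y'} {K : Pro Z Z'} {L : Pro W W'}
    {f : X ⟶ Y} {g : X' ⟶ Y'} {f' : Y ⟶ Z} {g' : Y' ⟶ Z'} {f'' : X ⟶ Z} {g'' : X' ⟶ Z'}
    {k : Z ⟶ W} {l : Z' ⟶ W'} {k' : Y ⟶ W} {l' : Y' ⟶ W'} {k'' : X ⟶ W} {l'' : X' ⟶ W'}
    (ρ : Row o f g p) (α : Cell p f' g' K) (β : Cell (.cons K (.nil Z')) k l L)
    (hf : f ≫ f' = f'') (hg : g ≫ g' = g'') {h₁ : f' ≫ k = k'} {h₂ : g' ≫ l = l'}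
    {h₃ : f ≫ k' = k''} {h₄ : g ≫ l' = l''} :
    paste ρ (paste (.single α) β h₁ h₂) h₃ h₄ =
      paste (.single (paste ρ α hf hg)) β (by rw [← hf, Category.assoc, h₁, h₃])
        (by rw [← hg, Category.assoc, h₂, h₄]) :=
  paste_paste (IsPaste.single ρ α hf hg)

theorem paste_nil_nil {L : Pro W W'} {f : X ⟶ Y} {f' : Y ⟶ Z} {f'' : X ⟶ Z}
    {k : Z ⟶ W} {l : Z ⟶ W'} {k' : Y ⟶ W} {l' : Y ⟶ W'} {k'' : X ⟶ W} {l'' : X ⟶ W'}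
    (β : Cell (.nil Z) k l L) (hf : f ≫ f' = f'') {h₁ : f' ≫ k = k'} {h₂ : f' ≫ l = l'}
    {h₃ : f ≫ k' = k''} {h₄ : f ≫ l' = l''} :
    paste (.nil f) (paste (.nil f') β h₁ h₂) h₃ h₄ =
      paste (.nil f'') β (by rw [← hf, Category.assoc, h₁, h₃])
        (by rw [← hf, Category.assoc, h₂, h₄]) :=
  paste_paste (.nil hf)

theorem paste_pair {X'' Y'' Z'' W'' : V} {o : HPath X X'} {o' : HPath X' X''} {J : Pro Y Y'}
    {J' : Pro Y' Y''} {K : Pro Z Z'} {K' : Pro Z' Z''} {L : Pro W W''} {f : X ⟶ Y} {g : X' ⟶ Y'}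
    {h : X'' ⟶ Y''} {f' : Y ⟶ Z} {g' : Y' ⟶ Z'} {h' : Y'' ⟶ Z''} {f'' : X ⟶ Z} {g'' : X' ⟶ Z'}
    {h'' : X'' ⟶ Z''} {k : Z ⟶ W} {l : Z'' ⟶ W''} {k' : Y ⟶ W} {l' : Y'' ⟶ W''} {k'' : X ⟶ W}
    {l'' : X'' ⟶ W''} (α : Cell o f g J) (α' : Cell o' g h J')
    (β : Cell (.cons J (.nil Y')) f' g' K) (β' : Cell (.cons J' (.nil Y'')) g' h' K')
    (γ : Cell (.cons K (.cons K' (.nil Z''))) k l L)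
    (hf : f ≫ f' = f'') (hg : g ≫ g' = g'') (hh : h ≫ h' = h'')
    {h₁ : f' ≫ k = k'} {h₂ : h' ≫ l = l'} {h₃ : f ≫ k' = k''} {h₄ : h ≫ l' = l''} :
    paste (.pair α α') (paste (.pair β β') γ h₁ h₂) h₃ h₄ =
      paste (.pair (paste (.single α) β hf hg) (paste (.single α') β' hg hh)) γ
        (by rw [← hf, Category.assoc, h₁, h₃]) (by rw [← hh, Category.assoc, h₂, h₄]) :=
  paste_paste (.cons₁ hf hg (.cons₁ hg hh (.nil hh)))

theorem heq_paste_id {p : HPath X X'} {J : Pro Y Y'} {f : X ⟶ Y} {g : X' ⟶ Y'} {f' : X ⟶ Y}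
    {g' : X' ⟶ Y'} (α : Cell p f g J) (hf : f ≫ 𝟙 _ = f') (hg : g ≫ 𝟙 _ = g') :
    HEq (paste (.single α) (cellId J) hf hg) α := by
  obtain rfl := (Category.comp_id f).symm.trans hf
  obtain rfl := (Category.comp_id g).symm.trans hg
  rw [paste_id]

theorem heq_id_paste {J : Pro X X'} {K : Pro Y Y'} {f : X ⟶ Y} {g : X' ⟶ Y'} {f' : X ⟶ Y}
    {g' : X' ⟶ Y'} (α : Cell (.cons J (.nil X')) f g K) (hf : 𝟙 _ ≫ f = f') (hg : 𝟙 _ ≫ g = g') :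
    HEq (paste (.single (cellId J)) α hf hg) α := by
  obtain rfl := (Category.id_comp f).symm.trans hf
  obtain rfl := (Category.id_comp g).symm.trans hg
  exact heq_of_eq (ids_paste α)

theorem heq_paste {p : HPath X X'} {q : HPath Y Y'} {K : Pro Z Z'} {f : X ⟶ Y} {g : X' ⟶ Y'}
    {f' : Y ⟶ Z} {g' : Y' ⟶ Z'} {k k' : X ⟶ Z} {l l' : X' ⟶ Z'} (ρ : Row p f g q)
    (α : Cell q f' g' K) (h₁ : f ≫ f' = k) (h₂ : g ≫ g' = l) (h₃ : f ≫ f' = k')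
    (h₄ : g ≫ g' = l') : HEq (paste ρ α h₁ h₂) (paste ρ α h₃ h₄) := by
  subst h₁ h₂ h₃ h₄
  rfl

end Calculus

end VirtualDoubleCategory

section Enriched

variable (E : Type u) [VirtualDoubleCategory.{z, w, v} E]

/-- A category enriched in the virtual double category `E`. -/
structure EnrCat where
  Obj : Type t
  /-- the extent of an object -/
  ext : Obj → E
  hom : ∀ a b : Obj, Pro (ext a) (ext b)
  one : ∀ a : Obj, Cell (.nil (ext a)) (𝟙 _) (𝟙 _) (hom a a)
  mul : ∀ a b c : Obj, Cell (.cons (hom a b) (.cons (hom b c) (.nil _))) (𝟙 _) (𝟙 _) (hom a c)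
  one_mul : ∀ a b : Obj, paste (.pair (one a) (cellId (hom a b))) (mul a a b)
    (Category.comp_id _) (Category.comp_id _) = cellId (hom a b)
  mul_one : ∀ a b : Obj, paste (.pair (cellId (hom a b)) (one b)) (mul a b b)
    (Category.comp_id _) (Category.comp_id _) = cellId (hom a b)
  mul_assoc : ∀ a b c d : Obj, paste (.pair (mul a b c) (cellId (hom c d))) (mul a c d)
      (Category.comp_id _) (Category.comp_id _) =
    paste (.pair (cellId (hom a b)) (mul b c d)) (mul a b d)
      (Category.comp_id _) (Category.comp_id _)

variable {E}

/-- A functor between enriched categories. -/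
structure EnrFunctor (C D : EnrCat.{t} E) where
  obj : C.Obj → D.Obj
  arr : ∀ a : C.Obj, C.ext a ⟶ D.ext (obj a)
  hom : ∀ a b : C.Obj, Cell (.cons (C.hom a b) (.nil _)) (arr a) (arr b) (D.hom (obj a) (obj b))
  map_one : ∀ a : C.Obj, paste (.single (C.one a)) (hom a a)
      (Category.id_comp _) (Category.id_comp _) =
    paste (.nil (arr a)) (D.one (obj a)) (Category.comp_id _) (Category.comp_id _)
  map_mul : ∀ a b c : C.Obj, paste (.single (C.mul a b c)) (hom a c)
      (Category.id_comp _) (Category.id_comp _) =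
    paste (.pair (hom a b) (hom b c)) (D.mul (obj a) (obj b) (obj c))
      (Category.comp_id _) (Category.comp_id _)

/-- A profunctor between enriched categories. -/
structure EnrProfunctor (C D : EnrCat.{t} E) where
  obj : ∀ (a : C.Obj) (b : D.Obj), Pro (C.ext a) (D.ext b)
  lact : ∀ (a a' : C.Obj) (b : D.Obj),
    Cell (.cons (C.hom a a') (.cons (obj a' b) (.nil _))) (𝟙 _) (𝟙 _) (obj a b)
  ract : ∀ (a : C.Obj) (b b' : D.Obj),
    Cell (.cons (obj a b) (.cons (D.hom b b') (.nil _))) (𝟙 _) (𝟙 _) (obj a b')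
  one_lact : ∀ (a : C.Obj) (b : D.Obj), paste (.pair (C.one a) (cellId (obj a b))) (lact a a b)
    (Category.comp_id _) (Category.comp_id _) = cellId (obj a b)
  ract_one : ∀ (a : C.Obj) (b : D.Obj), paste (.pair (cellId (obj a b)) (D.one b)) (ract a b b)
    (Category.comp_id _) (Category.comp_id _) = cellId (obj a b)
  mul_lact : ∀ (a a' a'' : C.Obj) (b : D.Obj),
    paste (.pair (C.mul a a' a'') (cellId (obj a'' b))) (lact a a'' b)
      (Category.comp_id _) (Category.comp_id _) =
    paste (.pair (cellId (C.hom a a')) (lact a' a'' b)) (lact a a' b)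
      (Category.comp_id _) (Category.comp_id _)
  ract_mul : ∀ (a : C.Obj) (b b' b'' : D.Obj),
    paste (.pair (ract a b b') (cellId (D.hom b' b''))) (ract a b' b'')
      (Category.comp_id _) (Category.comp_id _) =
    paste (.pair (cellId (obj a b)) (D.mul b b' b'')) (ract a b b'')
      (Category.comp_id _) (Category.comp_id _)
  lact_ract : ∀ (a a' : C.Obj) (b b' : D.Obj),
    paste (.pair (lact a a' b) (cellId (D.hom b b'))) (ract a b b')
      (Category.comp_id _) (Category.comp_id _) =
    paste (.pair (cellId (C.hom a a')) (ract a' b b')) (lact a a' b')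
      (Category.comp_id _) (Category.comp_id _)

/-- The profunctor `C(-, -)`. -/
def EnrCat.homProfunctor (C : EnrCat.{t} E) : EnrProfunctor C C where
  obj := C.hom
  lact := C.mul
  ract := C.mul
  one_lact := C.one_mul
  ract_one := C.mul_one
  mul_lact := C.mul_assoc
  ract_mul := C.mul_assoc
  lact_ract := C.mul_assoc

namespace EnrFunctor

variable {C D D' : EnrCat.{t} E}

theorem ext_heq {F G : EnrFunctor C D} (h₀ : ∀ a, F.obj a = G.obj a)
    (h₁ : ∀ a, HEq (F.arr a) (G.arr a)) (h₂ : ∀ a b, HEq (F.hom a b) (G.hom a b)) : F = G := by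
  obtain ⟨o, r, h, _, _⟩ := F
  obtain ⟨o', r', h', _, _⟩ := G
  obtain rfl : o = o' := funext h₀
  obtain rfl : r = r' := funext fun a => eq_of_heq (h₁ a)
  obtain rfl : h = h' := funext fun a => funext fun b => eq_of_heq (h₂ a b)
  rfl

/-- The identity functor. -/
def id (C : EnrCat.{t} E) : EnrFunctor C C where
  obj a := a
  arr a := 𝟙 (C.ext a)
  hom a b := cellId (C.hom a b)
  map_one a := by
    rw [paste_id]
    exact (ids_paste (C.one a)).symm
  map_mul a b c := by
    rw [paste_id]
    exact (ids_paste (C.mul a b c)).symm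

/-- Composition of functors. -/
def comp (F : EnrFunctor C D) (G : EnrFunctor D D') : EnrFunctor C D' where
  obj a := G.obj (F.obj a)
  arr a := F.arr a ≫ G.arr (F.obj a)
  hom a b := paste (.single (F.hom a b)) (G.hom (F.obj a) (F.obj b)) rfl rfl
  map_one a := by
    rw [paste_single _ _ _ (Category.id_comp _) (Category.id_comp _)]
    simp only [F.map_one]
    rw [← paste_single _ _ _ (h₁ := Category.id_comp _) (h₂ := Category.id_comp _) (h₃ := rfl)
      (h₄ := rfl)]
    simp only [G.map_one]
    exact paste_nil_nil _ rfl
  map_mul a b c := by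
    rw [paste_single _ _ _ (Category.id_comp _) (Category.id_comp _)]
    simp only [F.map_mul]
    refine Eq.trans (paste_single _ _ _ _ _ (h₁ := Category.id_comp _) (h₂ := Category.id_comp _)
      (h₃ := rfl) (h₄ := rfl)).symm ?_
    simp only [G.map_mul]
    exact paste_pair _ _ _ _ _ _ _ _

end EnrFunctor

instance : Category (EnrCat.{t} E) where
  Hom C D := EnrFunctor C D
  id C := EnrFunctor.id C
  comp F G := EnrFunctor.comp F G
  id_comp _ := EnrFunctor.ext_heq (fun _ => rfl) (fun _ => heq_of_eq (Category.id_comp _))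
    fun _ _ => heq_id_paste _ _ _
  comp_id _ := EnrFunctor.ext_heq (fun _ => rfl) (fun _ => heq_of_eq (Category.comp_id _))
    fun _ _ => heq_paste_id _ _ _
  assoc _ _ _ := EnrFunctor.ext_heq (fun _ => rfl) (fun _ => heq_of_eq (Category.assoc _ _ _))
    fun _ _ => (heq_paste _ _ _ _ _ _).trans (heq_of_eq (paste_single _ _ _ rfl rfl)).symm

/-- Strings of profunctors. -/
abbrev ProfPath (C D : EnrCat.{t} E) := ProPath (EnrProfunctor (E := E)) C D

/-- `Chain p a b` is the type of lists of objects `a = c₀, c₁, …, cₖ = b`, one in each of the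
categories through which the string of profunctors `p` passes. -/
inductive Chain : ∀ {C D : EnrCat.{t} E}, ProfPath C D → C.Obj → D.Obj →
    Type (max (t + 1) u v w z)
  | nil {C : EnrCat.{t} E} (a : C.Obj) : Chain (.nil C) a a
  | cons {C D D' : EnrCat.{t} E} {J : EnrProfunctor C D} {p : ProfPath D D'} (a : C.Obj)
      {b : D.Obj} {d : D'.Obj} (c : Chain p b d) : Chain (.cons J p) a d

/-- The string `J₁(c₀, c₁), …, Jₖ(cₖ₋₁, cₖ)` of proarrows. -/
def Chain.path : ∀ {C D : EnrCat.{t} E} {p : ProfPath C D} {a : C.Obj} {b : D.Obj},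
    Chain p a b → HPath (C.ext a) (D.ext b)
  | _, _, _, _, _, .nil a => .nil _
  | _, _, _, _, _, .cons (J := J) a (b := b) c => .cons (J.obj a b) c.path

/-- A row of cells of `E` with codomain `J₁(c₀, c₁), …, Jₖ(cₖ₋₁, cₖ)` for some list of objects. -/
structure ChainRow {C D : EnrCat.{t} E} {X X' : E} (o : HPath X X') (p : ProfPath C D) (a : C.Obj)
    (b : D.Obj) (f : X ⟶ C.ext a) (g : X' ⟶ D.ext b) where
  chain : Chain p a b
  row : Row o f g chain.path

namespace ChainRow

variable {C D D' : EnrCat.{t} E} {X X' X'' : E}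

/-- The empty row. -/
def nil {a : C.Obj} (f : X ⟶ C.ext a) : ChainRow (.nil X) (.nil C) a a f f := ⟨.nil a, .nil f⟩

/-- Prepend a cell to a row. -/
def cons {o : HPath X X'} {o' : HPath X' X''} {o'' : HPath X X''} {J : EnrProfunctor C D}
    {p : ProfPath D D'} {a : C.Obj} {b : D.Obj} {d : D'.Obj} {f : X ⟶ C.ext a}
    {g : X' ⟶ D.ext b} {k : X'' ⟶ D'.ext d} (h : o'' = o.append o') (α : Cell o f g (J.obj a b))
    (s : ChainRow o' p b d g k) : ChainRow o'' (.cons J p) a d f k :=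
  ⟨.cons a s.chain, .cons h α s.row⟩

/-- The row of identity cells. -/
def ids {p : ProfPath C D} {a : C.Obj} {b : D.Obj} (c : Chain p a b) :
    ChainRow c.path p a b (𝟙 _) (𝟙 _) := ⟨c, idRow c.path⟩

end ChainRow

/-- Families of cells indexed by lists of objects, as in the data of a morphism of profunctors. -/
abbrev ChainFamily {C D C' D' : EnrCat.{t} E} (p : ProfPath C D) (F : C ⟶ C') (G : D ⟶ D')
    (K : EnrProfunctor C' D') :=
  ∀ ⦃a : C.Obj⦄ ⦃b : D.Obj⦄ (c : Chain p a b),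
    Cell c.path (F.arr a) (G.arr b) (K.obj (F.obj a) (G.obj b))

/-- Compose a row of cells with the member of a family on which it lands. -/
def ChainRow.app {C D C' D' : EnrCat.{t} E} {p : ProfPath C D} {F : C ⟶ C'} {G : D ⟶ D'}
    {K : EnrProfunctor C' D'} {X X' : E} {o : HPath X X'} {a : C.Obj} {b : D.Obj}
    {f : X ⟶ C.ext a} {g : X' ⟶ D.ext b} (s : ChainRow o p a b f g) (α : ChainFamily p F G K) :
    Cell o (f ≫ F.arr a) (g ≫ G.arr b) (K.obj (F.obj a) (G.obj b)) :=
  paste s.row (α s.chain) rfl rfl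

/-- `InnerActions o s s'`: for an interior object `d` of a string of profunctors, with
`J` and `J'` the adjacent profunctors, `o` is `…, J(c, d), D(d, d'), J'(d', e), …`, the row `s` is
the action of `D(d, d')` on `J'(d', e)` and the row `s'` is its action on `J(c, d)`. -/
inductive InnerActions : ∀ {C D : EnrCat.{t} E} {p : ProfPath C D} {a : C.Obj} {b : D.Obj}
    (o : HPath (C.ext a) (D.ext b)),
    ChainRow o p a b (𝟙 _) (𝟙 _) → ChainRow o p a b (𝟙 _) (𝟙 _) → Prop
  | here {C D D' D'' : EnrCat.{t} E} {J : EnrProfunctor C D} {J' : EnrProfunctor D D'}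
      {p : ProfPath D' D''} (a : C.Obj) (d d' : D.Obj) {e : D'.Obj} {b : D''.Obj}
      (c : Chain p e b) :
      InnerActions (.cons (J.obj a d) (.cons (D.hom d d') (.cons (J'.obj d' e) c.path)))
        (.cons (by rfl) (cellId (J.obj a d)) (.cons (by rfl) (J'.lact d d' e) (.ids c)))
        (.cons (by rfl) (J.ract a d d') (.cons (by rfl) (cellId (J'.obj d' e)) (.ids c)))
  | cons {C D D' : EnrCat.{t} E} {J : EnrProfunctor C D} {p : ProfPath D D'} (a : C.Obj)
      {d : D.Obj} {b : D'.Obj} {o : HPath (D.ext d) (D'.ext b)}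
      {s s' : ChainRow o p d b (𝟙 _) (𝟙 _)} (h : InnerActions o s s') :
      InnerActions (.cons (J.obj a d) o) (.cons (by rfl) (cellId (J.obj a d)) s)
        (.cons (by rfl) (cellId (J.obj a d)) s')

/-- `RightAction c b' s`: the row `s` is the action of `D(b, b')` on the last profunctor of the
nonempty string `J₁(c₀, c₁), …, Jₖ(cₖ₋₁, b)`. -/
inductive RightAction : ∀ {C D : EnrCat.{t} E} {p : ProfPath C D} {a : C.Obj} {b : D.Obj}
    (c : Chain p a b) (b' : D.Obj),
    ChainRow (c.path.append (.cons (D.hom b b') (.nil _))) p a b' (𝟙 _) (𝟙 _) → Prop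
  | last {C D : EnrCat.{t} E} {J : EnrProfunctor C D} (a : C.Obj) (b b' : D.Obj) :
      RightAction (.cons (J := J) a (.nil b)) b' (.cons (by rfl) (J.ract a b b') (.nil (𝟙 _)))
  | cons {C D D' : EnrCat.{t} E} {J : EnrProfunctor C D} {p : ProfPath D D'} (a : C.Obj)
      {d : D.Obj} {b : D'.Obj} {c : Chain p d b} {b' : D'.Obj}
      {s : ChainRow (c.path.append (.cons (D'.hom b b') (.nil _))) p d b' (𝟙 _) (𝟙 _)}
      (h : RightAction c b' s) :
      RightAction (.cons (J := J) a c) b' (.cons (by rfl) (cellId (J.obj a d)) s)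

/-- Compatibility of a family of cells with the action of the first category: for a nonempty
string, acting on the first profunctor and then applying the family is the same as applying `F`
and the family and then acting on `K`; for the empty string, the family is natural. -/
def LeftLaw : ∀ {C D C' D' : EnrCat.{t} E} (p : ProfPath C D) (F : C ⟶ C') (G : D ⟶ D')
    (K : EnrProfunctor C' D') (_ : ChainFamily p F G K), Prop
  | _, _, _, _, .nil C, F, G, K, α => ∀ a a' : C.Obj,
      (paste (.pair (F.hom a a') (α (.nil a'))) (K.lact (F.obj a) (F.obj a') (G.obj a'))
        (Category.comp_id _) (Category.comp_id _) :
        Cell (.cons (C.hom a a') (.nil _)) (F.arr a) (G.arr a') (K.obj (F.obj a) (G.obj a'))) =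
      paste (.pair (α (.nil a)) (G.hom a a')) (K.ract (F.obj a) (G.obj a) (G.obj a'))
        (Category.comp_id _) (Category.comp_id _)
  | C, D, _, _, .cons (Y := C₁) J p, F, G, K, α => ∀ (a a' : C.Obj) {d : C₁.Obj} {b : D.Obj}
      (c : Chain p d b),
      (ChainRow.cons (by rfl) (J.lact a a' d) (.ids c) :
        ChainRow (.cons (C.hom a a') (.cons (J.obj a' d) c.path)) (.cons J p) a b _ _).app α =
      paste (.pair (F.hom a a') (α (.cons a' c))) (K.lact (F.obj a) (F.obj a') (G.obj b))
        ((Category.comp_id _).trans (Category.id_comp _).symm)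
        ((Category.comp_id _).trans (Category.id_comp _).symm)

/-- A morphism of profunctors `J₁, …, Jₖ ⟶ K` over the functors `F` and `G`. -/
@[ext]
structure EnrMorphism {C D C' D' : EnrCat.{t} E} (p : ProfPath C D) (F : C ⟶ C') (G : D ⟶ D')
    (K : EnrProfunctor C' D') where
  app : ChainFamily p F G K
  inner : ∀ {a : C.Obj} {b : D.Obj} (o : HPath (C.ext a) (D.ext b))
    (s s' : ChainRow o p a b (𝟙 _) (𝟙 _)), InnerActions o s s' → s.app app = s'.app app
  left : LeftLaw p F G K app
  right : ∀ {a : C.Obj} {b : D.Obj} (c : Chain p a b) (b' : D.Obj)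
    (s : ChainRow (c.path.append (.cons (D.hom b b') (.nil _))) p a b' (𝟙 _) (𝟙 _)),
    RightAction c b' s → s.app app =
      paste (.pair (app c) (G.hom b b')) (K.ract (F.obj a) (G.obj b) (G.obj b'))
        ((Category.comp_id _).trans (Category.id_comp _).symm)
        ((Category.comp_id _).trans (Category.id_comp _).symm)

namespace Chain

variable {C D D' D'' : EnrCat.{t} E}

/-- Concatenation of lists of objects. -/
def append : ∀ {C D D' : EnrCat.{t} E} {p : ProfPath C D} {q : ProfPath D D'} {a : C.Obj}
    {b : D.Obj} {d : D'.Obj}, Chain p a b → Chain q b d → Chain (p.append q) a d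
  | _, _, _, _, _, _, _, _, .nil _, c' => c'
  | _, _, _, _, _, _, _, _, .cons a c, c' => .cons a (append c c')

theorem path_append : ∀ {C D D' : EnrCat.{t} E} {p : ProfPath C D} {q : ProfPath D D'} {a : C.Obj}
    {b : D.Obj} {d : D'.Obj} (c : Chain p a b) (c' : Chain q b d),
    (c.append c').path = c.path.append c'.path
  | _, _, _, _, _, _, _, _, .nil _, _ => rfl
  | _, _, _, _, _, _, _, _, .cons a c, c' => congrArg (ProPath.cons _) (path_append c c')

theorem append_assoc_heq : ∀ {C D D' D'' : EnrCat.{t} E} {p : ProfPath C D} {q : ProfPath D D'}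
    {r : ProfPath D' D''} {a : C.Obj} {b : D.Obj} {d : D'.Obj} {e : D''.Obj} (c : Chain p a b)
    (c' : Chain q b d) (c'' : Chain r d e),
    HEq ((c.append c').append c'') (c.append (c'.append c''))
  | _, _, _, _, _, _, _, _, _, _, _, .nil _, _, _ => HEq.rfl
  | _, _, _, _, .cons J p, q, r, _, _, _, _, .cons a c, c', c'' => by
      have h := append_assoc_heq c c' c''
      have hp := ProPath.append_assoc p q r
      change HEq (Chain.cons (J := J) a ((c.append c').append c''))
        (Chain.cons (J := J) a (c.append (c'.append c'')))
      revert h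
      generalize (c.append c').append c'' = x
      generalize c.append (c'.append c'') = y
      revert x y
      rw [hp]
      intro x y h
      rw [eq_of_heq h]

theorem append_nil_heq : ∀ {C D : EnrCat.{t} E} {p : ProfPath C D} {a : C.Obj} {b : D.Obj}
    (c : Chain p a b), HEq (c.append (.nil b)) c
  | _, _, _, _, _, .nil _ => HEq.rfl
  | _, _, .cons J p, _, b, .cons a c => by
      have h := append_nil_heq c
      have hp := ProPath.append_nil p
      change HEq (Chain.cons (J := J) a (c.append (.nil b))) (Chain.cons (J := J) a c)
      revert h
      generalize c.append (.nil b) = x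
      revert x
      rw [hp]
      intro x h
      rw [eq_of_heq h]

/-- A list of objects over a concatenation, cut into two pieces. -/
structure Split (p : ProfPath C D) (q : ProfPath D D') (a : C.Obj) (b : D'.Obj)
    (o : HPath (C.ext a) (D'.ext b)) where
  mid : D.Obj
  fst : Chain p a mid
  snd : Chain q mid b
  path_eq : o = fst.path.append snd.path

/-- The second object of a list. -/
def mid {J : EnrProfunctor C D} {p : ProfPath D D'} {a : C.Obj} {d : D'.Obj} :
    Chain (.cons J p) a d → D.Obj
  | .cons _ (b := b) _ => b

/-- A list of objects without its first object. -/
def tail {J : EnrProfunctor C D} {p : ProfPath D D'} {a : C.Obj} {d : D'.Obj} :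
    ∀ c : Chain (.cons J p) a d, Chain p c.mid d
  | .cons _ c => c

theorem cons_tail {J : EnrProfunctor C D} {p : ProfPath D D'} {a : C.Obj} {d : D'.Obj} :
    ∀ c : Chain (.cons J p) a d, Chain.cons a c.tail = c
  | .cons _ _ => rfl

/-- Cut a list of objects over a concatenation. -/
def split₀ : ∀ {C D D' : EnrCat.{t} E} (p : ProfPath C D) {q : ProfPath D D'} {a : C.Obj}
    {b : D'.Obj} (c : Chain (p.append q) a b), Split p q a b c.path
  | _, _, _, .nil _, _, a, _, c => ⟨a, .nil a, c, rfl⟩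
  | _, _, _, .cons J p, q, a, _, c =>
      let S := split₀ p (tail (J := J) (p := p.append q) c)
      ⟨S.mid, .cons a S.fst, S.snd,
        (congrArg Chain.path (cons_tail (J := J) (p := p.append q) c).symm).trans
          (congrArg (ProPath.cons _) S.path_eq)⟩

/-- Cut a list of objects over a string of profunctors which is a concatenation. -/
def split {p : ProfPath C D} {q : ProfPath D D'} {r : ProfPath C D'} (h : r = p.append q)
    {a : C.Obj} {b : D'.Obj} (c : Chain r a b) : Split p q a b c.path := by
  subst h
  exact split₀ p c

theorem split₀_append : ∀ {C D D' : EnrCat.{t} E} {p : ProfPath C D} {q : ProfPath D D'}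
    {a : C.Obj} {b : D.Obj} {d : D'.Obj} (c : Chain p a b) (c' : Chain q b d),
    split₀ p (c.append c') = ⟨b, c, c', path_append c c'⟩
  | _, _, _, _, _, _, _, _, .nil _, _ => rfl
  | _, _, _, .cons J p, _, _, _, _, .cons a c, c' => by
      have h := split₀_append c c'
      exact congrArg (fun S : Split p _ _ _ (c.append c').path =>
        (⟨S.mid, .cons a S.fst, S.snd, congrArg (ProPath.cons _) S.path_eq⟩ :
          Split (.cons J p) _ a _ (.cons _ (c.append c').path))) h

theorem exists_append : ∀ {C D D' : EnrCat.{t} E} (p : ProfPath C D) {q : ProfPath D D'}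
    {a : C.Obj} {d : D'.Obj} (c : Chain (p.append q) a d),
    ∃ (b : D.Obj) (c₁ : Chain p a b) (c₂ : Chain q b d), c = c₁.append c₂
  | _, _, _, .nil _, _, a, _, c => ⟨a, .nil a, c, rfl⟩
  | _, _, _, .cons J p, q, a, _, c => by
      obtain ⟨b, c₁, c₂, h⟩ := exists_append p (tail (J := J) (p := p.append q) c)
      refine ⟨b, .cons a c₁, c₂, (cons_tail (J := J) (p := p.append q) c).symm.trans ?_⟩
      rw [h]
      rfl

end Chain

/-- Rows of morphisms of profunctors. -/
abbrev EnrRow {C D C' D' : EnrCat.{t} E} (p : ProfPath C D) (F : C ⟶ C') (G : D ⟶ D')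
    (q : ProfPath C' D') :=
  CellRow (fun _ _ _ _ => EnrMorphism (E := E)) p F G q

/-- The components of a row of morphisms of profunctors. -/
def evalRow : ∀ {C D C' D' : EnrCat.{t} E} {p : ProfPath C D} {F : C ⟶ C'} {G : D ⟶ D'}
    {q : ProfPath C' D'} (_ : EnrRow p F G q) {a : C.Obj} {b : D.Obj} (c : Chain p a b),
    ChainRow c.path q (F.obj a) (G.obj b) (F.arr a) (G.arr b)
  | _, _, _, _, _, _, _, _, .nil F, _, _, .nil a => .nil (F.arr a)
  | _, _, _, _, _, _, _, _, .cons h α ρ, _, _, c =>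
      .cons (c.split h).path_eq (α.app (c.split h).fst) (evalRow ρ (c.split h).snd)

theorem evalRow_cons {C D D' C₁ D₁ D₁' : EnrCat.{t} E} {p : ProfPath C D} {q : ProfPath D D'}
    {r : ProfPath C D'} {F : C ⟶ C₁} {G : D ⟶ D₁} {H : D' ⟶ D₁'} {K : EnrProfunctor C₁ D₁}
    {s : ProfPath D₁ D₁'} (h : r = p.append q) (α : EnrMorphism p F G K) (ρ : EnrRow q G H s)
    {a : C.Obj} {b : D.Obj} {d : D'.Obj} (c : Chain r a d) (c₁ : Chain p a b) (c₂ : Chain q b d)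
    (hc : HEq c (c₁.append c₂)) (ho : c.path = c₁.path.append c₂.path) :
    evalRow (CellRow.cons h α ρ : EnrRow r F H (.cons K s)) c =
      .cons ho (α.app c₁) (evalRow ρ c₂) := by
  subst h
  obtain rfl := eq_of_heq hc
  change ChainRow.cons (Chain.split₀ p (c₁.append c₂)).path_eq
    (α.app (Chain.split₀ p (c₁.append c₂)).fst) (evalRow ρ (Chain.split₀ p (c₁.append c₂)).snd) = _
  rw [Chain.split₀_append]

/-- The data of the composite of a row of morphisms with a morphism. -/
def pasteApp {C D C₁ D₁ C₂ D₂ : EnrCat.{t} E} {p : ProfPath C D} {q : ProfPath C₁ D₁}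
    {F : C ⟶ C₁} {G : D ⟶ D₁} {F' : C₁ ⟶ C₂} {G' : D₁ ⟶ D₂} {K : EnrProfunctor C₂ D₂}
    (ρ : EnrRow p F G q) (β : EnrMorphism q F' G' K) : ChainFamily p (F ≫ F') (G ≫ G') K :=
  fun _ _ c => paste (evalRow ρ c).row (β.app (evalRow ρ c).chain) rfl rfl

namespace ChainRow

variable {C D D' : EnrCat.{t} E} {X X' X'' Y Y' Y'' : E}

/-- `t` is the composite of the row `ρ` with the row `s`. -/
inductive IsPre {o : HPath X X'} {o' : HPath Y Y'} {p : ProfPath C D} {a : C.Obj} {b : D.Obj}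
    {f : X ⟶ C.ext a} {g : X' ⟶ D.ext b} {f' : Y ⟶ X} {g' : Y' ⟶ X'} {f'' : Y ⟶ C.ext a}
    {g'' : Y' ⟶ D.ext b} (ρ : Row o' f' g' o) (s : ChainRow o p a b f g) :
    ChainRow o' p a b f'' g'' → Prop
  | mk {τ : Row o' f'' g'' s.chain.path} (h : IsPaste ρ s.row τ) : IsPre ρ s ⟨s.chain, τ⟩

theorem IsPre.cons {J : EnrProfunctor C D} {p : ProfPath D D'} {a : C.Obj} {b : D.Obj}
    {d : D'.Obj} {L : Pro Y Y'} {o₁ : HPath X X'} {o₂ : HPath X' X''} {o : HPath X X''}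
    {o' : HPath Y' Y''} {f : X ⟶ Y} {g : X' ⟶ Y'} {k : X'' ⟶ Y''} {f' : Y ⟶ C.ext a}
    {g' : Y' ⟶ D.ext b} {k' : Y'' ⟶ D'.ext d} {f'' : X ⟶ C.ext a}
    {g'' : X' ⟶ D.ext b} {k'' : X'' ⟶ D'.ext d} {h : o = o₁.append o₂}
    {h' : ProPath.cons L o' = (ProPath.cons L (.nil Y')).append o'}
    {x : Cell o₁ f g L} {y : Cell (.cons L (.nil Y')) f' g' (J.obj a b)}
    {ρ : Row o₂ g k o'} {s : ChainRow o' p b d g' k'} {t : ChainRow o₂ p b d g'' k''}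
    (hs : IsPre ρ s t) (hf : f ≫ f' = f'') (hg : g ≫ g' = g'') :
    IsPre (.cons h x ρ) (.cons h' y s) (ChainRow.cons h (paste (.single x) y hf hg) t) := by
  obtain ⟨hs⟩ := hs
  exact ⟨.cons₁ hf hg hs⟩

theorem IsPre.cons_id {J : EnrProfunctor C D} {p : ProfPath D D'} {a : C.Obj} {b : D.Obj}
    {d : D'.Obj} {o₁ : HPath X X'} {o₂ : HPath X' X''} {o : HPath X X''}
    {o' : HPath (D.ext b) Y''} {f : X ⟶ C.ext a} {g : X' ⟶ D.ext b} {k : X'' ⟶ Y''}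
    {k' : Y'' ⟶ D'.ext d} {k'' : X'' ⟶ D'.ext d} {h : o = o₁.append o₂}
    {h' : ProPath.cons (J.obj a b) o' = (ProPath.cons (J.obj a b) (.nil _)).append o'}
    {x : Cell o₁ f g (J.obj a b)}
    {ρ : Row o₂ g k o'} {s : ChainRow o' p b d (𝟙 _) k'} {t : ChainRow o₂ p b d g k''}
    (hs : IsPre ρ s t) :
    IsPre (.cons h x ρ) (.cons h' (cellId (J.obj a b)) s) (ChainRow.cons h x t) := by
  obtain ⟨hs⟩ := hs
  exact ⟨.cons_id hs⟩

theorem IsPre.paste_eq {C' D' : EnrCat.{t} E} {o : HPath X X'} {o' : HPath Y Y'}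
    {p : ProfPath C D} {a : C.Obj} {b : D.Obj}
    {f : X ⟶ C.ext a} {g : X' ⟶ D.ext b} {f' : Y ⟶ X} {g' : Y' ⟶ X'} {f'' : Y ⟶ C.ext a}
    {g'' : Y' ⟶ D.ext b} {ρ : Row o' f' g' o} {s : ChainRow o p a b f g}
    {t : ChainRow o' p a b f'' g''} (h : IsPre ρ s t) {F : C ⟶ C'} {G : D ⟶ D'}
    {K : EnrProfunctor C' D'} (α : ChainFamily p F G K)
    {k : X ⟶ C'.ext (F.obj a)} {l : X' ⟶ D'.ext (G.obj b)}
    {k' : Y ⟶ C'.ext (F.obj a)} {l' : Y' ⟶ D'.ext (G.obj b)}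
    (h₁ : f ≫ F.arr a = k) (h₂ : g ≫ G.arr b = l) (h₃ : f' ≫ k = k') (h₄ : g' ≫ l = l')
    (h₅ : f'' ≫ F.arr a = k') (h₆ : g'' ≫ G.arr b = l') :
    paste ρ (paste s.row (α s.chain) h₁ h₂) h₃ h₄ = paste t.row (α t.chain) h₅ h₆ := by
  obtain ⟨h⟩ := h
  exact paste_paste h

/-- Rows identified by every morphism of profunctors because of the interior actions. -/
inductive Equi {p : ProfPath C D} {a : C.Obj} {b : D.Obj} :
    ∀ {X X' : E} {o : HPath X X'} {f : X ⟶ C.ext a} {g : X' ⟶ D.ext b},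
    ChainRow o p a b f g → ChainRow o p a b f g → Prop
  | base {X X' : E} {o : HPath X X'} {f : X ⟶ C.ext a} {g : X' ⟶ D.ext b}
      {o' : HPath (C.ext a) (D.ext b)} {ρ : Row o f g o'} {s s' : ChainRow o' p a b (𝟙 _) (𝟙 _)}
      {t t' : ChainRow o p a b f g} (h : InnerActions o' s s') (ht : IsPre ρ s t)
      (ht' : IsPre ρ s' t') : Equi t t'
  | refl {X X' : E} {o : HPath X X'} {f : X ⟶ C.ext a} {g : X' ⟶ D.ext b}
      (s : ChainRow o p a b f g) : Equi s s
  | symm {X X' : E} {o : HPath X X'} {f : X ⟶ C.ext a} {g : X' ⟶ D.ext b}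
      {s s' : ChainRow o p a b f g} (h : Equi s s') : Equi s' s
  | trans {X X' : E} {o : HPath X X'} {f : X ⟶ C.ext a} {g : X' ⟶ D.ext b}
      {s s' s'' : ChainRow o p a b f g} (h : Equi s s') (h' : Equi s' s'') : Equi s s''

theorem Equi.cons {J : EnrProfunctor C D} {p : ProfPath D D'} {a : C.Obj} {b : D.Obj}
    {d : D'.Obj} {o₁ : HPath X X'} {o₂ : HPath X' X''} {o : HPath X X''}
    {f : X ⟶ C.ext a} {g : X' ⟶ D.ext b} {k : X'' ⟶ D'.ext d} (h : o = o₁.append o₂)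
    (x : Cell o₁ f g (J.obj a b)) {s s' : ChainRow o₂ p b d g k} (hs : Equi s s') :
    Equi (ChainRow.cons h x s) (ChainRow.cons h x s') := by
  induction hs with
  | base hi ht ht' => exact .base (.cons a hi) (.cons_id (h := h) ht) (.cons_id ht')
  | refl s => exact .refl _
  | symm _ ih => exact ih.symm
  | trans _ _ ih ih' => exact ih.trans ih'

theorem Equi.slide {D'' : EnrCat.{t} E} {X₀ X₁ X₂ X₃ X₄ : E} {J : EnrProfunctor C D}
    {J' : EnrProfunctor D D'} {p : ProfPath D' D''} {a : C.Obj} {d d' : D.Obj} {e : D'.Obj}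
    {b : D''.Obj} {o₁ : HPath X₀ X₁} {o₂ : HPath X₁ X₂} {o₃ : HPath X₂ X₃} {o₄ : HPath X₃ X₄}
    {o₁₂ : HPath X₀ X₂} {o₂₃ : HPath X₁ X₃} {o₂₃₄ : HPath X₁ X₄} {o₃₄ : HPath X₂ X₄}
    {o : HPath X₀ X₄} {f₀ : X₀ ⟶ C.ext a} {f₁ : X₁ ⟶ D.ext d}
    {f₂ : X₂ ⟶ D.ext d'} {f₃ : X₃ ⟶ D'.ext e} {f₄ : X₄ ⟶ D''.ext b}
    (h₁₂ : o₁₂ = o₁.append o₂) (h₂₃ : o₂₃ = o₂.append o₃)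
    (h₂₃₄ : o₂₃₄ = o₂₃.append o₄) (h₃₄ : o₃₄ = o₃.append o₄)
    (h : o = o₁.append o₂₃₄) (h' : o = o₁₂.append o₃₄)
    (x : Cell o₁ f₀ f₁ (J.obj a d)) (y : Cell o₂ f₁ f₂ (D.hom d d'))
    (w : Cell o₃ f₂ f₃ (J'.obj d' e)) (t : ChainRow o₄ p e b f₃ f₄) :
    Equi (ChainRow.cons h x (ChainRow.cons h₂₃₄ (paste (.cons h₂₃ y (.single w)) (J'.lact d d' e)
        (Category.comp_id _) (Category.comp_id _)) t))
      (ChainRow.cons h' (paste (.cons h₁₂ x (.single y)) (J.ract a d d')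
        (Category.comp_id _) (Category.comp_id _)) (ChainRow.cons h₃₄ w t)) := by
  subst h₁₂ h₂₃ h₃₄ h₂₃₄
  refine .base (ρ := .cons h x (.cons (ProPath.append_assoc _ _ _) y (.cons rfl w t.row)))
    (.here a d d' t.chain) (.mk (.cons_id (.cons₂ _ _ (.id_right _))))
    (.mk (.cons₂ _ _ (.cons_id (.id_right _))))

theorem Equi.paste_eq {C' D' : EnrCat.{t} E} {o : HPath X X'}
    {p : ProfPath C D} {a : C.Obj} {b : D.Obj} {f : X ⟶ C.ext a} {g : X' ⟶ D.ext b}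
    {s s' : ChainRow o p a b f g} (h : Equi s s') {F : C ⟶ C'} {G : D ⟶ D'}
    {K : EnrProfunctor C' D'} (α : EnrMorphism p F G K)
    {k : X ⟶ C'.ext (F.obj a)} {l : X' ⟶ D'.ext (G.obj b)}
    (h₁ : f ≫ F.arr a = k) (h₂ : g ≫ G.arr b = l) :
    paste s.row (α.app s.chain) h₁ h₂ = paste s'.row (α.app s'.chain) h₁ h₂ := by
  induction h with
  | base hi ht ht' =>
      rw [← ht.paste_eq α.app rfl rfl (by simpa using h₁) (by simpa using h₂) h₁ h₂,
        ← ht'.paste_eq α.app rfl rfl (by simpa using h₁) (by simpa using h₂) h₁ h₂]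
      congr 1
      exact α.inner _ _ _ hi
  | refl s => rfl
  | symm _ ih => exact ih.symm
  | trans _ _ ih ih' => exact ih.trans ih'

end ChainRow

namespace ChainRow

/-- `s'` is obtained from `s` by acting with the cell `y` on its first proarrow. -/
inductive LRow : ∀ {C D : EnrCat.{t} E} {X X' X'' : E} {q : ProfPath C D} {a a' : C.Obj} {d : D.Obj}
    {o₁ : HPath X X'} {o₂ : HPath X' X''} {o : HPath X X''} {f : X ⟶ C.ext a} {g : X' ⟶ C.ext a'}
    {k : X'' ⟶ D.ext d} (_ : Cell o₁ f g (C.hom a a')) (_ : ChainRow o₂ q a' d g k)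
    (_ : ChainRow o q a d f k), Prop
  | mk {C D D' : EnrCat.{t} E} {X X' X'' X₃ : E} {J : EnrProfunctor C D} {q : ProfPath D D'}
      {a a' : C.Obj} {b : D.Obj} {d : D'.Obj}
      {o₁ : HPath X X'} {o₂ : HPath X' X''} {o₃ : HPath X'' X₃} {o₂₃ : HPath X' X₃}
      {o₁₂ : HPath X X''} {o : HPath X X₃} {f : X ⟶ C.ext a} {g : X' ⟶ C.ext a'}
      {h : X'' ⟶ D.ext b} {k : X₃ ⟶ D'.ext d} (y : Cell o₁ f g (C.hom a a'))
      (x : Cell o₂ g h (J.obj a' b)) (s : ChainRow o₃ q b d h k)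
      (h₁₂ : o₁₂ = o₁.append o₂) (h₁ : o₂₃ = o₂.append o₃) (h₂ : o = o₁₂.append o₃) :
      LRow y (cons h₁ x s) (cons h₂ (paste (.cons h₁₂ y (.single x)) (J.lact a a' b)
        (Category.comp_id _) (Category.comp_id _)) s)

/-- `s'` is obtained from `s` by acting with the cell `y` on its last proarrow. -/
inductive RRow : ∀ {C D : EnrCat.{t} E} {X X' X'' : E} {q : ProfPath C D} {a : C.Obj} {d d' : D.Obj}
    {o₁ : HPath X X'} {o₂ : HPath X' X''} {o : HPath X X''} {f : X ⟶ C.ext a} {g : X' ⟶ D.ext d}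
    {k : X'' ⟶ D.ext d'} (_ : ChainRow o₁ q a d f g) (_ : Cell o₂ g k (D.hom d d'))
    (_ : ChainRow o q a d' f k), Prop
  | last {C D : EnrCat.{t} E} {X X' X'' : E} {J : EnrProfunctor C D}
      {a : C.Obj} {d d' : D.Obj} {o₁ o₁' : HPath X X'} {o₂ : HPath X' X''} {o o' : HPath X X''}
      {f : X ⟶ C.ext a} {g : X' ⟶ D.ext d} {k : X'' ⟶ D.ext d'}
      (x : Cell o₁ f g (J.obj a d)) (y : Cell o₂ g k (D.hom d d'))
      (h : o = o₁.append o₂) (h₁ : o₁' = o₁.append (.nil _)) (h₂ : o' = o.append (.nil _)) :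
      RRow (cons h₁ x (.nil g)) y (cons h₂ (paste (.cons h x (.single y)) (J.ract a d d')
        (Category.comp_id _) (Category.comp_id _)) (.nil k))
  | cons {C D D' : EnrCat.{t} E} {X X' X'' X₃ : E} {J : EnrProfunctor C D} {q : ProfPath D D'}
      {a : C.Obj} {b : D.Obj} {d d' : D'.Obj} {o₁ : HPath X X'} {o₂ : HPath X' X''}
      {o₃ : HPath X'' X₃} {o₁₂ : HPath X X''} {o₂₃ : HPath X' X₃} {o : HPath X X₃}
      {f : X ⟶ C.ext a} {g : X' ⟶ D.ext b} {h : X'' ⟶ D'.ext d} {k : X₃ ⟶ D'.ext d'}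
      (x : Cell o₁ f g (J.obj a b)) {s : ChainRow o₂ q b d g h} {y : Cell o₃ h k (D'.hom d d')}
      {s' : ChainRow o₂₃ q b d' g k} (hs : RRow s y s') (h₁ : o₁₂ = o₁.append o₂)
      (h₂ : o = o₁.append o₂₃) :
      RRow (cons h₁ x s) y (cons h₂ x s')

theorem LRow.paste_eq {C D C' D' : EnrCat.{t} E} {X X' X'' : E} {q : ProfPath C D} {a a' : C.Obj}
    {d : D.Obj} {o₁ : HPath X X'} {o₂ : HPath X' X''} {o : HPath X X''} {f : X ⟶ C.ext a}
    {g : X' ⟶ C.ext a'} {k : X'' ⟶ D.ext d} {y : Cell o₁ f g (C.hom a a')}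
    {s : ChainRow o₂ q a' d g k} {s' : ChainRow o q a d f k} (h : LRow y s s')
    {F : C ⟶ C'} {G : D ⟶ D'} {K : EnrProfunctor C' D'} (β : EnrMorphism q F G K)
    (ho : o = o₁.append o₂) :
    paste s'.row (β.app s'.chain) rfl rfl =
      paste (.cons ho (paste (.single y) (F.hom a a') rfl rfl)
          (.single (paste s.row (β.app s.chain) rfl rfl)))
        (K.lact _ _ _) (Category.comp_id _) (Category.comp_id _) := by
  cases h with
  | mk y x s h₁₂ h₁ h₂ =>
    subst h₁₂ h₁ ho
    rename_i D₁ X₁ J b h q₁ o₂ o₃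
    have hp := IsPre.mk (ρ := .cons rfl y (.cons rfl x s.row))
      (s := ChainRow.cons (o' := s.chain.path) (by rfl) (J.lact a a' b) (.ids s.chain))
      (.cons₂ (ho' := h₂) (Category.comp_id _) (Category.comp_id _) (.id_right s.row))
    refine Eq.trans ?_ <| (hp.paste_eq β.app rfl rfl (by simp) (by simp) rfl rfl).symm.trans ?_
    · rfl
    have h := congrArg (fun z => paste (CellRow.cons rfl y (.cons rfl x s.row)) z
      (f'' := f ≫ F.arr a) (g'' := k ≫ G.arr d) (by simp) (by simp)) (β.left a a' s.chain)
    refine h.trans ?_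
    exact paste_paste (.cons₁ rfl rfl (.single _ _ rfl rfl))

theorem RRow.path_eq {C D : EnrCat.{t} E} {X X' X'' : E} {q : ProfPath C D} {a : C.Obj}
    {d d' : D.Obj} {o₁ : HPath X X'} {o₂ : HPath X' X''} {o : HPath X X''} {f : X ⟶ C.ext a}
    {g : X' ⟶ D.ext d} {k : X'' ⟶ D.ext d'} {s : ChainRow o₁ q a d f g}
    {y : Cell o₂ g k (D.hom d d')} {s' : ChainRow o q a d' f k} (h : RRow s y s') :
    o = o₁.append o₂ := by
  induction h with
  | last x y h h₁ h₂ => rw [h₂, h₁, h, ProPath.append_nil, ProPath.append_nil]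
  | cons x hs h₁ h₂ ih => rw [h₂, h₁, ih, ProPath.append_assoc]

theorem RRow.isPre {C D : EnrCat.{t} E} {X X' X'' : E} {q : ProfPath C D} {a : C.Obj}
    {d d' : D.Obj} {o₁ : HPath X X'} {o₂ : HPath X' X''} {o : HPath X X''} {f : X ⟶ C.ext a}
    {g : X' ⟶ D.ext d} {k : X'' ⟶ D.ext d'} {s : ChainRow o₁ q a d f g}
    {y : Cell o₂ g k (D.hom d d')} {s' : ChainRow o q a d' f k} (h : RRow s y s')
    (ho : o = o₁.append o₂) :
    ∃ r, RightAction s.chain d' r ∧ IsPre (s.row.append ho rfl (.single y)) r s' := by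
  induction h with
  | last x y h h₁ h₂ =>
    subst h
    refine ⟨_, .last _ _ _, ?_⟩
    have e := append_cons h₁ ho rfl (h₂.trans (ProPath.append_nil _)) rfl rfl x (.nil _) (.single y)
    exact Eq.subst (motive := fun ρ => IsPre ρ _ _) e.symm
      (.mk (.cons₂ (Category.comp_id _) (Category.comp_id _) (.nil (Category.comp_id _))))
  | cons x hs h₁ h₂ ih =>
    have h := hs.path_eq
    subst h
    rename_i s₀ y₀ s₀'
    obtain ⟨r, hr, hp⟩ := ih rfl
    refine ⟨_, .cons _ hr, ?_⟩
    have e := append_cons h₁ ho (by rfl) h₂ rfl rfl x s₀.row (.single y₀)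
    exact Eq.subst (motive := fun ρ => IsPre ρ _ _) e.symm (.cons_id hp)

theorem RRow.paste_eq {C D C' D' : EnrCat.{t} E} {X X' X'' : E} {q : ProfPath C D} {a : C.Obj}
    {d d' : D.Obj} {o₁ : HPath X X'} {o₂ : HPath X' X''} {o : HPath X X''} {f : X ⟶ C.ext a}
    {g : X' ⟶ D.ext d} {k : X'' ⟶ D.ext d'} {s : ChainRow o₁ q a d f g}
    {y : Cell o₂ g k (D.hom d d')} {s' : ChainRow o q a d' f k} (h : RRow s y s')
    {F : C ⟶ C'} {G : D ⟶ D'} {K : EnrProfunctor C' D'} (β : EnrMorphism q F G K)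
    (ho : o = o₁.append o₂) :
    paste s'.row (β.app s'.chain) rfl rfl =
      paste (.cons ho (paste s.row (β.app s.chain) rfl rfl)
          (.single (paste (.single y) (G.hom d d') rfl rfl)))
        (K.ract _ _ _) (Category.comp_id _) (Category.comp_id _) := by
  obtain ⟨r, hr, hp⟩ := h.isPre ho
  rw [← hp.paste_eq β.app rfl rfl (by simp) (by simp) rfl rfl]
  have h := congrArg (fun z => paste (s.row.append ho rfl (.single y)) z
      (f'' := f ≫ F.arr a) (g'' := k ≫ G.arr d') (by simp) (by simp)) (β.right s.chain d' r hr)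
  refine h.trans ?_
  exact paste_paste (.cons ho rfl rfl rfl s.row _ (IsPaste.single _ _ rfl rfl))

end ChainRow

namespace ChainRow

variable {C D D' C₁ D₁ D₁' : EnrCat.{t} E} {X X' X'' Y Y' Y'' : E}

/-- Concatenation of rows. -/
def append {o : HPath X X'} {o' : HPath X' X''} {o'' : HPath X X''} {p : ProfPath C D}
    {q : ProfPath D D'} {a : C.Obj} {b : D.Obj} {d : D'.Obj} {f : X ⟶ C.ext a}
    {g : X' ⟶ D.ext b} {k : X'' ⟶ D'.ext d} (h : o'' = o.append o') (s : ChainRow o p a b f g)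
    (s' : ChainRow o' q b d g k) : ChainRow o'' (p.append q) a d f k :=
  ⟨s.chain.append s'.chain, s.row.append h (Chain.path_append _ _) s'.row⟩

theorem cons_append {J : EnrProfunctor C D} {p : ProfPath D D'} {q : ProfPath D' D₁'}
    {X₃ : E} {o₁ : HPath X X'} {o₂ : HPath X' X''} {o₃ : HPath X'' X₃} {o₁₂ : HPath X X''}
    {o₂₃ : HPath X' X₃} {o : HPath X X₃} {a : C.Obj} {b : D.Obj} {d : D'.Obj} {e : D₁'.Obj}
    {f : X ⟶ C.ext a} {g : X' ⟶ D.ext b} {k : X'' ⟶ D'.ext d} {l : X₃ ⟶ D₁'.ext e}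
    (h₁₂ : o₁₂ = o₁.append o₂) (h : o = o₁₂.append o₃) (h₂₃ : o₂₃ = o₂.append o₃)
    (h' : o = o₁.append o₂₃) (x : Cell o₁ f g (J.obj a b)) (s : ChainRow o₂ p b d g k)
    (s' : ChainRow o₃ q d e k l) :
    (cons h₁₂ x s).append h s' = cons h' x (s.append h₂₃ s') := by
  subst h₁₂ h h₂₃
  exact congrArg (ChainRow.mk (.cons a (s.chain.append s'.chain)))
    (append_cons (ho₂ := rfl) (hp₂ := Chain.path_append _ _) ..)

theorem idCons_append {J : EnrProfunctor C D} {p : ProfPath D D'} {q : ProfPath D' D₁'}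
    {a : C.Obj} {b : D.Obj} {d : D'.Obj} {e : D₁'.Obj}
    {o₂ : HPath (D.ext b) X''} {o₃ : HPath X'' X} {o₂₃ : HPath (D.ext b) X}
    {k : X'' ⟶ D'.ext d} {l : X ⟶ D₁'.ext e} (s : ChainRow o₂ p b d (𝟙 _) k)
    (s' : ChainRow o₃ q d e k l) (h : o₂₃ = o₂.append o₃)
    (h' : ProPath.cons (J.obj a b) o₂₃ = (ProPath.cons (J.obj a b) o₂).append o₃) :
    (cons (o'' := .cons (J.obj a b) o₂) (by rfl) (cellId (J.obj a b)) s).append h' s' =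
      cons (by rfl) (cellId (J.obj a b)) (s.append h s') :=
  cons_append _ _ _ _ _ _ _

theorem ids_append {p : ProfPath C D} {q : ProfPath D D'} {a : C.Obj} {b : D.Obj} {d : D'.Obj}
    (c : Chain p a b) (c' : Chain q b d) :
    (ids c).append (Chain.path_append c c') (ids c') = ids (c.append c') := by
  have key : ∀ (o : HPath (C.ext a) (D'.ext d)) (h : o = c.path.append c'.path),
      (idRow c.path).append h h (idRow c'.path) = idRow o := by
    intro o h
    subst h
    exact (idRow_append _ _).symm
  exact congrArg (ChainRow.mk (c.append c')) (key _ (Chain.path_append c c'))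

theorem evalRow_append_cons {p : ProfPath C D} {q : ProfPath D D'} {F : C ⟶ C₁} {G : D ⟶ D₁}
    {H : D' ⟶ D₁'} {K : EnrProfunctor C₁ D₁} {r : ProfPath D₁ D₁'} (α : EnrMorphism p F G K)
    (ρ : EnrRow q G H r) {a : C.Obj} {b : D.Obj} {d : D'.Obj} (c₁ : Chain p a b)
    (c₂ : Chain q b d) :
    evalRow (CellRow.cons rfl α ρ : EnrRow (p.append q) F H (.cons K r)) (c₁.append c₂) =
      .cons (Chain.path_append c₁ c₂) (α.app c₁) (evalRow ρ c₂) :=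
  evalRow_cons rfl α ρ _ c₁ c₂ HEq.rfl _

theorem IsPre.evalRow_cons {p : ProfPath C D} {q : ProfPath D D'} {F : C ⟶ C₁} {G : D ⟶ D₁}
    {H : D' ⟶ D₁'} {K : EnrProfunctor C₁ D₁} {r : ProfPath D₁ D₁'} {α : EnrMorphism p F G K}
    {ρ : EnrRow q G H r} {a : C.Obj} {b : D.Obj} {d : D'.Obj}
    {o₁ : HPath (C.ext a) (D.ext b)} {o₂ : HPath (D.ext b) (D'.ext d)}
    {o : HPath (C.ext a) (D'.ext d)}
    {s₁ : ChainRow o₁ p a b (𝟙 _) (𝟙 _)} {s₂ : ChainRow o₂ q b d (𝟙 _) (𝟙 _)}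
    {u : ChainRow o₂ r (G.obj b) (H.obj d) (G.arr b) (H.arr d)}
    (h : IsPre s₂.row (evalRow ρ s₂.chain) u) (ho : o = o₁.append o₂) :
    IsPre (s₁.append ho s₂).row
      (evalRow (CellRow.cons rfl α ρ : EnrRow (p.append q) F H (.cons K r))
        (s₁.append ho s₂).chain)
      (.cons ho (paste s₁.row (α.app s₁.chain) (Category.id_comp _) (Category.id_comp _)) u) := by
  have e := evalRow_append_cons (F := F) α ρ s₁.chain s₂.chain
  generalize hv : evalRow ρ s₂.chain = v at *
  obtain ⟨h⟩ := h
  change IsPre _ (evalRow _ (s₁.chain.append s₂.chain)) _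
  rw [e]
  exact .mk (.cons ho (Chain.path_append _ _) (Category.id_comp _) (Category.id_comp _) s₁.row _ h)

theorem IsPre.ids {p : ProfPath C D} {a : C.Obj} {b : D.Obj} {o : HPath X X'} {f : X ⟶ C.ext a}
    {g : X' ⟶ D.ext b} (s : ChainRow o p a b f g) : IsPre (idRow o) s s :=
  .mk (.id_left s.row)

theorem paste_ids_app {p : ProfPath C D} {F : C ⟶ C₁} {G : D ⟶ D₁} {K : EnrProfunctor C₁ D₁}
    (α : ChainFamily p F G K) {a : C.Obj} {b : D.Obj} (c : Chain p a b) :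
    paste (ids c).row (α (ids c).chain) (Category.id_comp _) (Category.id_comp _) = α c :=
  ids_paste _

end ChainRow

/-- A string of length at least one. -/
def ProPath.IsCons {V : Type u} {H : V → V → Type w} : ∀ {X Y : V}, ProPath H X Y → Prop
  | _, _, .nil _ => False
  | _, _, .cons _ _ => True

theorem ProPath.isCons_append {V : Type u} {H : V → V → Type w} : ∀ {X Y Z : V}
    (p : ProPath H X Y) {q : ProPath H Y Z} (_ : q.IsCons), (p.append q).IsCons
  | _, _, _, .nil _, _, h => h
  | _, _, _, .cons _ _, _, _ => trivial

theorem RightAction.cons_inv {C D D' : EnrCat.{t} E} {J : EnrProfunctor C D} {p : ProfPath D D'}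
    (hp : p.IsCons) {a : C.Obj} {b : D.Obj} {d d' : D'.Obj} {c : Chain p b d} {s}
    (h : RightAction (.cons (J := J) a c) d' s) :
    ∃ s', RightAction c d' s' ∧ s = .cons (by rfl) (cellId (J.obj a b)) s' := by
  cases h with
  | last => exact hp.elim
  | cons _ h => exact ⟨_, h, rfl⟩

/-- Decomposition of the right action on a concatenation whose second part is nonempty. -/
theorem RightAction.exists_append : ∀ {C D D' : EnrCat.{t} E} (p : ProfPath C D)
    {q : ProfPath D D'} (_ : q.IsCons) {a : C.Obj} {b : D.Obj} {d d' : D'.Obj}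
    (c₁ : Chain p a b) (c₂ : Chain q b d) {s}
    (_ : RightAction (c₁.append c₂) d' s), ∃ (s₂ : _) (ho : _),
      RightAction c₂ d' s₂ ∧ s = (ChainRow.ids c₁).append ho s₂
  | _, _, _, .nil _, _, _, _, _, _, _, .nil _, c₂, s, h => ⟨s, rfl, h, rfl⟩
  | _, _, _, .cons J p, q, hq, _, _, _, d', .cons a c₁, c₂, s, h => by
      obtain ⟨s', h', rfl⟩ := RightAction.cons_inv (ProPath.isCons_append p hq) h
      obtain ⟨s₂, ho, h₂, rfl⟩ := RightAction.exists_append p hq c₁ c₂ h'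
      exact ⟨s₂, congrArg (ProPath.cons _) ho, h₂, (ChainRow.idCons_append (ChainRow.ids c₁) s₂ ho _).symm⟩

/-- The possible positions of an interior action in a concatenation of two strings. -/
inductive InnerSplit : ∀ {C D D' : EnrCat.{t} E} (p : ProfPath C D) (q : ProfPath D D') {a : C.Obj}
    {b : D'.Obj} (o : HPath (C.ext a) (D'.ext b)),
    ChainRow o (p.append q) a b (𝟙 _) (𝟙 _) → ChainRow o (p.append q) a b (𝟙 _) (𝟙 _) → Prop
  | left {C D D' : EnrCat.{t} E} {p : ProfPath C D} {q : ProfPath D D'} {a : C.Obj} {m : D.Obj}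
      {b : D'.Obj} {o₁ : HPath (C.ext a) (D.ext m)} {o : HPath (C.ext a) (D'.ext b)}
      {s s' : ChainRow o₁ p a m (𝟙 _) (𝟙 _)} (h : InnerActions o₁ s s') (c : Chain q m b)
      (ho : o = o₁.append c.path) :
      InnerSplit p q o (s.append ho (.ids c)) (s'.append ho (.ids c))
  | right {C D D' : EnrCat.{t} E} {p : ProfPath C D} {q : ProfPath D D'} {a : C.Obj} {m : D.Obj}
      {b : D'.Obj} {o₂ : HPath (D.ext m) (D'.ext b)} {o : HPath (C.ext a) (D'.ext b)}
      {s s' : ChainRow o₂ q m b (𝟙 _) (𝟙 _)} (c : Chain p a m) (h : InnerActions o₂ s s')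
      (ho : o = c.path.append o₂) :
      InnerSplit p q o ((ChainRow.ids c).append ho s) ((ChainRow.ids c).append ho s')
  | mid {C D D' D'' : EnrCat.{t} E} {p : ProfPath C D} {J : EnrProfunctor D D'}
      {q : ProfPath D' D''} {a : C.Obj} {d d' : D.Obj} {e : D'.Obj} {b : D''.Obj}
      (c₁ : Chain p a d) (c : Chain q e b) {s} (h : RightAction c₁ d' s)
      {o : HPath (C.ext a) (D''.ext b)}
      (ho : o = c₁.path.append (.cons (D.hom d d') (.cons (J.obj d' e) c.path)))
      (ho' : o = (c₁.path.append (.cons (D.hom d d') (.nil _))).append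
        (.cons (J.obj d' e) c.path)) :
      InnerSplit p (.cons J q) o
        ((ChainRow.ids c₁).append ho (.cons (by rfl) (J.lact d d' e) (.ids c)))
        (s.append ho' (.ids (.cons (J := J) d' c)))

theorem InnerSplit.cons {C D D' D'' : EnrCat.{t} E} {J : EnrProfunctor C D} {p : ProfPath D D'}
    {q : ProfPath D' D''} {a : C.Obj} {d : D.Obj} {b : D''.Obj} {o : HPath (D.ext d) (D''.ext b)}
    {s s' : ChainRow o (p.append q) d b (𝟙 _) (𝟙 _)} (h : InnerSplit p q o s s') :
    InnerSplit (.cons J p) q (.cons (J.obj a d) o) (.cons (by rfl) (cellId (J.obj a d)) s)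
      (.cons (by rfl) (cellId (J.obj a d)) s') := by
  cases h with
  | left h c ho =>
    rename_i o₁ _ _
    have ho' : ProPath.cons (J.obj a d) o = (ProPath.cons (J.obj a d) o₁).append c.path :=
      congrArg (ProPath.cons _) ho
    have e := fun s => ChainRow.idCons_append (a := a) (J := J) (p := p) s (.ids c) ho ho'
    exact e _ ▸ e _ ▸ InnerSplit.left (.cons a h) c ho'
  | right c h ho =>
    have ho' : ProPath.cons (J.obj a d) o = (ProPath.cons (J.obj a d) c.path).append _ :=
      congrArg (ProPath.cons _) ho
    have e := fun s : ChainRow _ q _ b _ (𝟙 (D''.ext b)) =>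
      ChainRow.idCons_append (a := a) (J := J) (.ids c) s ho ho'
    exact e _ ▸ e _ ▸ InnerSplit.right (.cons (J := J) a c) h ho'
  | mid c₁ c h ho ho' =>
    have hc := congrArg (ProPath.cons (J.obj a d)) ho
    have hc' := congrArg (ProPath.cons (J.obj a d)) ho'
    rename_i J₁ _ _ _ q₁ _
    have e := fun s : ChainRow _ (.cons J₁ q₁) _ b _ (𝟙 (D''.ext b)) =>
      ChainRow.idCons_append (a := a) (J := J) (.ids c₁) s ho hc
    have e' := fun s => ChainRow.idCons_append (a := a) (J := J) (p := p) s (.ids (.cons (J := J₁) _ c)) ho' hc'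
    exact e _ ▸ e' _ ▸ InnerSplit.mid (.cons (J := J) a c₁) c (.cons a h) hc hc'

theorem InnerActions.elim {C D D₁ D₂ : EnrCat.{t} E} {J : EnrProfunctor C D}
    {J₁ : EnrProfunctor D D₁} {p : ProfPath D₁ D₂} {a : C.Obj} {b : D₂.Obj}
    (motive : ∀ o : HPath (C.ext a) (D₂.ext b),
      ChainRow o (.cons J (.cons J₁ p)) a b (𝟙 _) (𝟙 _) →
      ChainRow o (.cons J (.cons J₁ p)) a b (𝟙 _) (𝟙 _) → Prop)
    (here : ∀ (d d' : D.Obj) {e : D₁.Obj} (c : Chain p e b),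
      motive (.cons (J.obj a d) (.cons (D.hom d d') (.cons (J₁.obj d' e) c.path)))
        (.cons (by rfl) (cellId (J.obj a d)) (.cons (by rfl) (J₁.lact d d' e) (.ids c)))
        (.cons (by rfl) (J.ract a d d') (.cons (by rfl) (cellId (J₁.obj d' e)) (.ids c))))
    (cons : ∀ {d : D.Obj} {o : HPath (D.ext d) (D₂.ext b)}
      {s s' : ChainRow o (.cons J₁ p) d b (𝟙 _) (𝟙 _)} (_ : InnerActions o s s'),
      motive (.cons (J.obj a d) o) (.cons (by rfl) (cellId (J.obj a d)) s)
        (.cons (by rfl) (cellId (J.obj a d)) s'))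
    {o : HPath (C.ext a) (D₂.ext b)} {s s'} (h : InnerActions o s s') : motive o s s' := by
  cases h with
  | here => exact here _ _ _
  | cons _ h => exact cons h

theorem InnerActions.split : ∀ {C D D' : EnrCat.{t} E} (p : ProfPath C D) {q : ProfPath D D'}
    {a : C.Obj} {b : D'.Obj} {o : HPath (C.ext a) (D'.ext b)}
    {s s' : ChainRow o (p.append q) a b (𝟙 _) (𝟙 _)} (_ : InnerActions o s s'),
    InnerSplit p q o s s'
  | _, _, _, .nil _, _, a, _, _, _, _, h => .right (.nil a) h rfl
  | _, _, _, .cons J (.nil _), q, a, _, o, s, s', h => by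
      change InnerActions (p := .cons J q) o s s' at h
      cases h with
      | here a d d' c => exact .mid (.cons (J := J) a (.nil d)) c (.last a d d') rfl rfl
      | cons a h => exact .right (.cons (J := J) a (.nil _)) h rfl
  | C, _, _, .cons J (.cons J₁ p), q, a, b, o, s, s', h => by
      refine InnerActions.elim (J := J) (J₁ := J₁) (p := p.append q)
        (motive := fun o s s' => InnerSplit (.cons J (.cons J₁ p)) q o s s') ?_ ?_ h
      · intro d d' e c
        obtain ⟨m, c₁, c₂, rfl⟩ := Chain.exists_append p c
        have hc := Chain.path_append c₁ c₂
        have h₁ := congrArg (ProPath.cons (J₁.obj d' e)) hc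
        have h₂ := congrArg (ProPath.cons (EnrCat.hom _ d d')) h₁
        have h₃ := congrArg (ProPath.cons (J.obj a d)) h₂
        have h := InnerSplit.left (InnerActions.here (J := J) (J' := J₁) a d d' c₁) c₂ h₃
        have e₁ : (ChainRow.cons (by rfl) (J₁.lact d d' e) (.ids c₁)).append h₂ (.ids c₂) =
            ChainRow.cons (by rfl) (J₁.lact d d' e) (.ids (c₁.append c₂)) :=
          (ChainRow.cons_append _ _ hc rfl _ _ _).trans
            (congrArg (ChainRow.cons (by rfl) (J₁.lact d d' e)) (ChainRow.ids_append c₁ c₂))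
        have e₂ : (ChainRow.cons (by rfl) (cellId (J.obj a d)) (ChainRow.cons (by rfl) (J₁.lact d d' e) (.ids c₁))).append h₃ (.ids c₂) =
            ChainRow.cons (by rfl) (cellId (J.obj a d)) (ChainRow.cons (by rfl) (J₁.lact d d' e) (.ids (c₁.append c₂))) :=
          (ChainRow.idCons_append _ _ h₂ _).trans
            (congrArg (ChainRow.cons (by rfl) (cellId (J.obj a d))) e₁)
        have e₃ : (ChainRow.cons (by rfl) (J.ract a d d') (ChainRow.cons (by rfl) (cellId (J₁.obj d' e)) (.ids c₁))).append h₃ (.ids c₂) =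
            ChainRow.cons (by rfl) (J.ract a d d') (ChainRow.cons (by rfl) (cellId (J₁.obj d' e)) (.ids (c₁.append c₂))) :=
          (ChainRow.cons_append _ _ h₁ rfl _ _ _).trans
            (congrArg (ChainRow.cons (by rfl) (J.ract a d d')) ((ChainRow.idCons_append _ _ hc _).trans
            (congrArg (ChainRow.cons (by rfl) (cellId (J₁.obj d' e))) (ChainRow.ids_append c₁ c₂))))
        exact e₂ ▸ e₃ ▸ h
      · intro d o s s' h
        exact .cons (InnerActions.split (.cons J₁ p) h)

namespace ChainRow

theorem evalRow_nil : ∀ {C₁ D₁ : EnrCat.{t} E} (q : ProfPath C₁ D₁) (_ : q.IsCons) {C : EnrCat.{t} E}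
    {F : C ⟶ C₁} {G : C ⟶ D₁} (ρ : EnrRow (.nil C) F G q) (a a' : C.Obj),
    ∃ t t' : ChainRow (.cons (C.hom a a') (.nil _)) q (F.obj a) (G.obj a') (F.arr a) (G.arr a'),
      LRow (F.hom a a') (evalRow ρ (.nil a')) t ∧ RRow (evalRow ρ (.nil a)) (G.hom a a') t' ∧
        Equi t t'
  | _, _, .nil _, h, _, _, _, _, _, _ => h.elim
  | _, _, .cons K q, _, C, F, H, ρ, a, a' => by
    cases ρ with
    | @cons _ _ _ _ _ _ p r _ _ G _ _ _ h α ρ =>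
    cases p with
    | cons => cases h
    | nil =>
    change ProPath.nil C = r at h
    subst h
    have hl := α.left a a'
    cases q with
    | nil =>
      cases ρ with
      | nil =>
      refine ⟨_, _, .mk (F.hom a a') (α.app (.nil a')) (.nil _) rfl rfl rfl,
        .last (α.app (.nil a)) _ rfl rfl rfl, ?_⟩
      exact hl ▸ .refl _
    | cons K' q =>
      obtain ⟨t₀, t₀', h₁, h₂, h₃⟩ := evalRow_nil (.cons K' q) trivial ρ a a'
      have e : ∀ a,  evalRow (CellRow.cons (p := .nil C) rfl α ρ : EnrRow _ F H (.cons K (.cons K' q))) (.nil a)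
        = .cons rfl (α.app (.nil a)) (evalRow ρ (.nil a)) := fun _ => rfl
      have e' := e a'
      generalize evalRow ρ (.nil a') = v at h₁ e'
      cases h₁ with
      | mk _ z s h₁₂ h₁ h₂' =>
      have hA := LRow.mk (F.hom a a') (α.app (.nil a')) (.cons h₁ z s) rfl rfl rfl
      refine ⟨_, _, e'.symm.subst (motive := fun x => LRow _ x _) hA,
        .cons (α.app (.nil a)) h₂ rfl rfl, ?_⟩
      refine .trans ?_ (.cons _ _ h₃)
      refine .trans ?_ (.symm (.slide rfl h₁₂ h₂' h₁ rfl rfl (α.app (.nil a)) _ z s))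
      exact Eq.subst (motive := fun x => Equi (ChainRow.cons _ x _) _) hl.symm (.refl _)

end ChainRow
namespace VirtualDoubleCategory

theorem paste_eq_cast {V : Type u} [VirtualDoubleCategory.{z, w, v} V]
    {X X' Y Y' Y₁ Y₁' Z Z' : V} {p : HPath X X'} {q : HPath Y Y'} {q₁ : HPath Y₁ Y₁'} {K : Pro Z Z'}
    {f : X ⟶ Y} {g : X' ⟶ Y'} {f' : Y ⟶ Z} {g' : Y' ⟶ Z'} {f₁ : X ⟶ Y₁} {g₁ : X' ⟶ Y₁'}
    {f₁' : Y₁ ⟶ Z} {g₁' : Y₁' ⟶ Z'} {k k' : X ⟶ Z} {l l' : X' ⟶ Z'} {ρ : Row p f g q}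
    {α : Cell q f' g' K} {σ : Row p f₁ g₁ q₁} {β : Cell q₁ f₁' g₁' K} {h₁ : f ≫ f' = k}
    {h₂ : g ≫ g' = l} {h₃ : f₁ ≫ f₁' = k} {h₄ : g₁ ≫ g₁' = l}
    (h : paste ρ α h₁ h₂ = paste σ β h₃ h₄) (hk : k = k') (hl : l = l') :
    paste ρ α (h₁.trans hk) (h₂.trans hl) = paste σ β (h₃.trans hk) (h₄.trans hl) := by
  subst hk hl
  exact h

end VirtualDoubleCategory

namespace ChainRow

theorem IsPre.cons_nil {C D D' : EnrCat.{t} E} {X X' : E} {J : EnrProfunctor C D}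
    {p : ProfPath D D'} {a : C.Obj} {b : D.Obj} {d : D'.Obj} {o o' : HPath X X'}
    {f' : X ⟶ C.ext a} {g' : X ⟶ D.ext b} {k' : X' ⟶ D'.ext d}
    {h : o = (ProPath.nil X).append o} {h' : o' = (ProPath.nil X).append o'}
    {y : Cell (.nil X) f' g' (J.obj a b)} {ρ : Row o (𝟙 X) (𝟙 X') o'}
    {s : ChainRow o' p b d g' k'} {t : ChainRow o p b d g' k'}
    (hs : IsPre ρ s t) : IsPre ρ (.cons h' y s) (ChainRow.cons h y t) := by
  obtain ⟨hs⟩ := hs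
  have := IsPaste.cons₀ (α := y) (hp := h') (ho := h) (Category.id_comp _) (Category.id_comp _) hs
  rw [show paste (.nil (𝟙 X)) y (Category.id_comp _) (Category.id_comp _) = y from ids_paste y]
    at this
  exact .mk this

theorem evalRow_lact : ∀ {C₁ D₁ : EnrCat.{t} E} (q : ProfPath C₁ D₁) {C C₀ D : EnrCat.{t} E}
    {J : EnrProfunctor C C₀} {p : ProfPath C₀ D} {F : C ⟶ C₁} {G : D ⟶ D₁}
    (ρ : EnrRow (.cons J p) F G q) (a a' : C.Obj) {d : C₀.Obj} {b : D.Obj} (c : Chain p d b),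
    ∃ t t' : ChainRow (.cons (C.hom a a') (.cons (J.obj a' d) c.path)) q (F.obj a) (G.obj b)
        (F.arr a) (G.arr b),
      IsPre (cons (by rfl) (J.lact a a' d) (ids c)).row (evalRow ρ (.cons a c)) t ∧
        LRow (F.hom a a') (evalRow ρ (.cons a' c)) t' ∧ Equi t t'
  | _, _, .nil _, _, _, _, _, _, _, _, ρ, _, _, _, _, _ => nomatch ρ
  | _, _, .cons K q, C, C₀, D, J, p, F, H, ρ, a, a', d, b, c => by
    cases ρ with
    | @cons _ _ _ _ _ _ p₁ r _ _ G _ _ _ h α ρ =>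
    cases p₁ with
    | nil =>
      change ProPath.cons J p = r at h
      subst h
      have hl := α.left a a'
      obtain ⟨t₀, t₀', h₁, h₂, h₃⟩ := evalRow_lact q ρ a a' c
      have e : ∀ a, evalRow (CellRow.cons (p := .nil C) rfl α ρ : EnrRow _ F H (.cons K q))
          (.cons a c) = .cons rfl (α.app (.nil a)) (evalRow ρ (.cons a c)) := fun _ => rfl
      have e' := e a'
      generalize evalRow ρ (.cons a' c) = v at h₂ e'
      cases h₂ with
      | mk _ z s h₁₂ h₂ h₂' =>
      have hA := LRow.mk (F.hom a a') (α.app (.nil a')) (.cons h₂ z s) rfl rfl rfl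
      refine ⟨.cons (by rfl) (α.app (.nil a)) t₀, _, .cons_nil h₁, e'.symm.subst (motive := fun x => LRow _ x _) hA, ?_⟩
      refine .trans (.cons _ _ h₃) ?_
      refine .trans (.slide rfl h₁₂ h₂' h₂ rfl rfl (α.app (.nil a)) _ z s) ?_
      exact Eq.subst (motive := fun x => Equi (ChainRow.cons _ x _) _) hl (.refl _)
    | cons J' p₁ =>
      cases h
      obtain ⟨m, c₁, c₂, rfl⟩ := Chain.exists_append p₁ c
      have hc := Chain.path_append c₁ c₂
      have hc' := congrArg (ProPath.cons (J.obj a' d)) hc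
      have hc'' := congrArg (ProPath.cons (C.hom a a')) hc'
      have e : (ChainRow.cons (by rfl) (J.lact a a' d) (.ids c₁)).append hc'' (.ids c₂) =
            ChainRow.cons (by rfl) (J.lact a a' d) (.ids (c₁.append c₂)) :=
          (ChainRow.cons_append _ _ hc rfl _ _ _).trans
            (congrArg (ChainRow.cons (by rfl) (J.lact a a' d)) (ChainRow.ids_append c₁ c₂))
      have h := IsPre.evalRow_cons (s₁ := ChainRow.cons (by rfl) (J.lact a a' d) (.ids c₁)) (s₂ := .ids c₂) (F := F) (α := α) (.ids (evalRow ρ c₂)) hc''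
      have hl := paste_eq_cast (α.left a a' c₁) (Category.id_comp _) (Category.id_comp _)
      have e' := evalRow_append_cons α ρ (.cons (J := J) a' c₁) c₂
      have hA := LRow.mk (F.hom a a') (α.app (.cons a' c₁)) (evalRow ρ c₂) rfl hc' hc''
      rw [e] at h
      exact ⟨_, _, h, e'.symm.subst (motive := fun x => LRow (q := .cons K q) _ x _) hA,
        Eq.subst (motive := fun x => Equi (ChainRow.cons _ x _) _) hl.symm (.refl _)⟩

end ChainRow
namespace ChainRow

theorem IsPre.append_nil {C D C₁ D₁ D₁' : EnrCat.{t} E} {p : ProfPath C D} {F : C ⟶ C₁}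
    {G : D ⟶ D₁} {K : EnrProfunctor C₁ D₁} {q : ProfPath D₁ D₁'} {a : C.Obj} {b : D.Obj}
    {d : D₁'.Obj} {o : HPath (C.ext a) (D.ext b)} {k : D.ext b ⟶ D₁'.ext d}
    (s : ChainRow o p a b (𝟙 _) (𝟙 _)) (α : ChainFamily p F G K)
    (v : ChainRow (.nil (D.ext b)) q (G.obj b) d (G.arr b) k)
    (h : s.chain.path = s.chain.path.append (.nil _)) (h' : o = o.append (.nil _)) :
    IsPre s.row (.cons h (α s.chain) v) (ChainRow.cons h'
      (paste s.row (α s.chain) (Category.id_comp _) (Category.id_comp _)) v) := by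
  have := CellRow.Paste.cons (paste := paste (V := E)) h' h (Category.id_comp _)
    (Category.id_comp _) s.row (α s.chain) (IsPaste.id_left v.row)
  have e : s.row.append h' h (idRow (.nil (D.ext b))) = s.row := append_nil_right _ _ _
  rw [e] at this
  exact .mk this

theorem evalRow_ract : ∀ {C D C₁ D₁ : EnrCat.{t} E} {p : ProfPath C D} {F : C ⟶ C₁}
    {G : D ⟶ D₁} {q : ProfPath C₁ D₁} (ρ : EnrRow p F G q) {a : C.Obj} {b : D.Obj}
    (c : Chain p a b) (b' : D.Obj) {s} (_ : RightAction c b' s),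
    ∃ t t' : ChainRow (c.path.append (.cons (D.hom b b') (.nil _))) q (F.obj a) (G.obj b')
        (F.arr a) (G.arr b'),
      IsPre s.row (evalRow ρ s.chain) t ∧ RRow (evalRow ρ c) (G.hom b b') t' ∧ Equi t t'
  | _, _, _, _, _, _, _, _, .nil _, _, _, _, _, _, h => nomatch h
  | C, D, C₁, D₁, _, F, H, _, .cons (p := p) (r := r) (g := G) (K := K) (q := q) h₀ α ρ, a, b, c, b', s, h => by
    cases r with
    | cons J r =>
      subst h₀
      obtain ⟨m, c₁, c₂, rfl⟩ := Chain.exists_append p c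
      obtain ⟨s₂, ho, h₂, rfl⟩ := RightAction.exists_append p (q := .cons J r) trivial c₁ c₂ h
      obtain ⟨u, u', i₁, i₂, i₃⟩ := evalRow_ract ρ c₂ b' h₂
      have hp := IsPre.evalRow_cons (s₁ := .ids c₁) (F := F) (α := α) i₁ ho
      rw [paste_ids_app α.app c₁] at hp
      have e := evalRow_append_cons α ρ c₁ c₂
      have hR := RRow.cons (α.app c₁) i₂ (Chain.path_append c₁ c₂) ho
      exact ⟨_, _, hp, e.symm.subst (motive := fun x => RRow (q := .cons K q) x _ _) hR,
        .cons _ _ i₃⟩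
    | nil =>
      obtain rfl := (ProPath.append_nil p).symm.trans h₀.symm
      have e : ∀ {b} (c : Chain p a b), evalRow (CellRow.cons h₀ α ρ : EnrRow _ F H (.cons K q)) c
          = .cons (ProPath.append_nil _).symm (α.app c) (evalRow ρ (.nil b)) := fun c =>
        evalRow_cons h₀ α ρ c c (.nil _) (Chain.append_nil_heq c).symm _
      have hr := paste_eq_cast (α.right c b' s h) (Category.id_comp _) (Category.id_comp _)
      have hP := IsPre.append_nil s α.app (evalRow ρ (.nil b')) (ProPath.append_nil _).symm
        (ProPath.append_nil _).symm
      rw [← e] at hP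
      rw [e c]
      cases q with
      | nil =>
        cases ρ with
        | nil =>
        refine ⟨_, _, hP, .last (α.app c) _ rfl _ (ProPath.append_nil _).symm, ?_⟩
        exact Eq.subst (motive := fun x => Equi (ChainRow.cons _ x _) _) hr.symm (.refl _)
      | cons K' q =>
        obtain ⟨t₀, t₀', h₁, h₂, h₃⟩ := evalRow_nil (.cons K' q) trivial ρ b b'
        refine ⟨_, _, hP, .cons (α.app c) h₂ _ rfl, ?_⟩
        refine .trans ?_ (.cons _ _ h₃)
        generalize evalRow ρ (.nil b') = v at h₁
        cases h₁ with
        | mk _ z s h₁₂ h₁ h₂' =>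
        refine .trans ?_ (.symm (.slide rfl h₁₂ h₂' h₁ rfl (ProPath.append_nil _).symm (α.app c) _ z s))
        exact Eq.subst (motive := fun x => Equi (ChainRow.cons _ x _) _) hr.symm (.refl _)

end ChainRow
namespace ChainRow

theorem evalRow_inner : ∀ {C D C₁ D₁ : EnrCat.{t} E} {p : ProfPath C D} {F : C ⟶ C₁}
    {G : D ⟶ D₁} {q : ProfPath C₁ D₁} (ρ : EnrRow p F G q) {a : C.Obj} {b : D.Obj}
    {o : HPath (C.ext a) (D.ext b)} {s s' : ChainRow o p a b (𝟙 _) (𝟙 _)} (_ : InnerActions o s s'),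
    ∃ t t' : ChainRow o q (F.obj a) (G.obj b) (F.arr a) (G.arr b),
      IsPre s.row (evalRow ρ s.chain) t ∧ IsPre s'.row (evalRow ρ s'.chain) t' ∧ Equi t t'
  | _, _, _, _, _, _, _, _, .nil _, _, _, _, _, _, h => nomatch h
  | C, D, C₁, D₁, _, F, H, _, .cons (p := p) (r := r) (g := G) (K := K) (q := q) h₀ α ρ,
      a, b, o, s, s', h => by
    subst h₀
    have hs := InnerActions.split p h
    clear h
    cases hs with
    | left h c ho =>
      have h₁ := fun s => IsPre.evalRow_cons (s₁ := s) (s₂ := .ids c) (F := F) (α := α)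
        (.ids (evalRow ρ c)) ho
      have e := paste_eq_cast (α.inner _ _ _ h) (Category.id_comp _) (Category.id_comp _)
      exact ⟨_, _, h₁ _, h₁ _, Eq.subst (motive := fun x => Equi (ChainRow.cons _ x _) _) e.symm (.refl _)⟩
    | right c h ho =>
      obtain ⟨u, u', i₁, i₂, i₃⟩ := evalRow_inner ρ h
      have h₁ := IsPre.evalRow_cons (s₁ := .ids c) (F := F) (α := α) i₁ ho
      have h₂ := IsPre.evalRow_cons (s₁ := .ids c) (F := F) (α := α) i₂ ho
      exact ⟨_, _, h₁, h₂, .cons _ _ i₃⟩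
    | mid c₁ c h ho ho' =>
      rename_i D₂ J d d' e r s₁
      obtain ⟨u, u', i₁, i₂, i₃⟩ := evalRow_lact _ ρ d d' c
      have h₁ := IsPre.evalRow_cons (s₁ := .ids c₁)
        (s₂ := .cons (by rfl) (J.lact d d' e) (.ids c)) (F := F) (α := α) i₁ ho
      rw [paste_ids_app α.app c₁] at h₁
      have h₂ := IsPre.evalRow_cons (s₁ := s₁) (s₂ := .ids (.cons (J := J) d' c)) (F := F)
        (α := α) (.ids (evalRow ρ (.cons d' c))) ho'
      have hr := paste_eq_cast (α.right c₁ d' s₁ h) (Category.id_comp _) (Category.id_comp _)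
      refine ⟨_, _, h₁, h₂, ?_⟩
      refine .trans (.cons _ _ i₃) ?_
      generalize evalRow ρ (.cons d' c) = v at i₂
      cases i₂ with
      | mk _ z s h₁₂ h₁ h₂' =>
      refine .trans (.slide rfl h₁₂ h₂' h₁ ho ho' (α.app c₁) _ z s) ?_
      exact Eq.subst (motive := fun x => Equi (ChainRow.cons _ x _) _) hr (.refl _)

end ChainRow
namespace EnrMorphism

variable {C D C₁ D₁ C₂ D₂ : EnrCat.{t} E}

theorem pasteApp_left : ∀ {C D C₁ D₁ C₂ D₂ : EnrCat.{t} E} {p : ProfPath C D}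
    {q : ProfPath C₁ D₁} {F : C ⟶ C₁} {G : D ⟶ D₁} {F' : C₁ ⟶ C₂} {G' : D₁ ⟶ D₂}
    {K : EnrProfunctor C₂ D₂} (ρ : EnrRow p F G q) (β : EnrMorphism q F' G' K),
    LeftLaw p (F ≫ F') (G ≫ G') K (pasteApp ρ β)
  | C, _, C₁, _, C₂, D₂, .nil _, .nil _, F, _, F', G', K, .nil _, β => fun a a' => by
      have hl := congrArg (fun x => paste (.single (F.hom a a')) x
        (f'' := F.arr a ≫ F'.arr _) (g'' := F.arr a' ≫ G'.arr _) rfl rfl)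
        (β.left (F.obj a) (F.obj a'))
      refine Eq.trans ?_ (hl.trans ?_)
      · exact (paste_paste (.cons₁ rfl rfl (.single (.nil (F.arr a')) _ rfl rfl))).symm
      · exact paste_paste (.cons₀ rfl rfl (.single (.single (F.hom a a')) _ rfl rfl))
  | C, _, C₁, D₁, C₂, D₂, .nil _, .cons J q, F, G, F', G', K, ρ, β => fun a a' => by
      obtain ⟨t, t', h₁, h₂, h₃⟩ := ChainRow.evalRow_nil (.cons J q) trivial ρ a a'
      exact (h₁.paste_eq β rfl).symm.trans ((h₃.paste_eq β rfl rfl).trans (h₂.paste_eq β rfl))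
  | C, _, C₁, D₁, C₂, D₂, .cons J p, q, F, G, F', G', K, ρ, β => fun a a' {d b} c => by
      obtain ⟨t, t', h₁, h₂, h₃⟩ := ChainRow.evalRow_lact q ρ a a' c
      have h₁ := h₁.paste_eq β.app rfl rfl rfl rfl (by simp) (by simp)
      have h₂ := paste_eq_cast (h₂.paste_eq β rfl) (Category.id_comp _).symm (Category.id_comp _).symm
      exact h₁.trans ((h₃.paste_eq β _ _).trans h₂)

/-- The composite of a row of morphisms with a morphism. -/
def pasteCell {p : ProfPath C D} {q : ProfPath C₁ D₁} {F : C ⟶ C₁} {G : D ⟶ D₁} {F' : C₁ ⟶ C₂}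
    {G' : D₁ ⟶ D₂} {K : EnrProfunctor C₂ D₂} (ρ : EnrRow p F G q) (β : EnrMorphism q F' G' K) :
    EnrMorphism p (F ≫ F') (G ≫ G') K where
  app := pasteApp ρ β
  inner o s s' h := by
    obtain ⟨t, t', h₁, h₂, h₃⟩ := ChainRow.evalRow_inner ρ h
    exact (h₁.paste_eq β.app rfl rfl rfl rfl (by simp) (by simp)).trans
      ((h₃.paste_eq β _ _).trans (h₂.paste_eq β.app rfl rfl rfl rfl (by simp) (by simp)).symm)
  left := pasteApp_left ρ β
  right c b' s h := by
    obtain ⟨t, t', h₁, h₂, h₃⟩ := ChainRow.evalRow_ract ρ c b' h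
    have h₁ := h₁.paste_eq β.app rfl rfl rfl rfl (by simp) (by simp)
    have h₂ := paste_eq_cast (h₂.paste_eq β rfl) (Category.id_comp _).symm (Category.id_comp _).symm
    exact h₁.trans ((h₃.paste_eq β _ _).trans h₂)

end EnrMorphism
namespace VirtualDoubleCategory

theorem heq_ids_paste {V : Type u} [VirtualDoubleCategory.{z, w, v} V] {X X' Y Y' : V}
    {p : HPath X X'} {K : Pro Y Y'} {f f' : X ⟶ Y} {g g' : X' ⟶ Y'} (α : Cell p f g K)
    (hf : 𝟙 _ ≫ f = f') (hg : 𝟙 _ ≫ g = g') : HEq (paste (idRow p) α hf hg) α := by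
  obtain rfl := (Category.id_comp f).symm.trans hf
  obtain rfl := (Category.id_comp g).symm.trans hg
  exact heq_of_eq (ids_paste α)

theorem heq_pair_ids {V : Type u} [VirtualDoubleCategory.{z, w, v} V] {X X' X'' Y Y' : V}
    {J : Pro X X'} {J' : Pro X' X''} {K : Pro Y Y'} {f f' : X ⟶ Y} {g g' : X'' ⟶ Y'}
    (α : Cell (.cons J (.cons J' (.nil X''))) f g K) (hf : 𝟙 _ ≫ f = f') (hg : 𝟙 _ ≫ g = g') :
    HEq (paste (.pair (cellId J) (cellId J')) α hf hg) α :=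
  heq_ids_paste α hf hg

end VirtualDoubleCategory

namespace EnrMorphism

variable {C D C₁ D₁ C₂ D₂ : EnrCat.{t} E}

/-- The components of an identity morphism. -/
def idApp (J : EnrProfunctor C D) : ChainFamily (.cons J (.nil D)) (𝟙 C) (𝟙 D) J
  | a, _, .cons _ (.nil b) => cellId (J.obj a b)

/-- The identity morphism of a profunctor. -/
def idCell (J : EnrProfunctor C D) : EnrMorphism (.cons J (.nil D)) (𝟙 C) (𝟙 D) J where
  app := idApp J
  inner o s s' h := by
    cases h with
    | cons _ h => cases h
  left := fun a a' {d b} c => by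
    cases c
    exact eq_of_heq ((heq_paste_id (J.lact a a' d) _ _).trans
      (heq_pair_ids (J.lact a a' d) rfl rfl).symm)
  right c b' s h := by
    cases h with
    | cons _ h => cases h
    | last =>
      rename_i a b
      exact eq_of_heq ((heq_paste_id (J.ract a b b') _ _).trans
        (heq_pair_ids (J.ract a b b') rfl rfl).symm)

/-- Transport of a morphism along equations between functors. -/
def cast {p : ProfPath C D} {F F' : C ⟶ C₁} {G G' : D ⟶ D₁} {K : EnrProfunctor C₁ D₁}
    (hF : F = F') (hG : G = G') (α : EnrMorphism p F G K) : EnrMorphism p F' G' K := by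
  subst hF hG
  exact α

theorem cast_app {p : ProfPath C D} {F F' : C ⟶ C₁} {G G' : D ⟶ D₁} {K : EnrProfunctor C₁ D₁}
    (hF : F = F') (hG : G = G') (α : EnrMorphism p F G K) {a : C.Obj} {b : D.Obj}
    (c : Chain p a b) : HEq ((α.cast hF hG).app c) (α.app c) := by
  subst hF hG
  rfl

theorem eq_of_app {p : ProfPath C D} {F : C ⟶ C₁} {G : D ⟶ D₁} {K : EnrProfunctor C₁ D₁}
    {α β : EnrMorphism p F G K}
    (h : ∀ {a : C.Obj} {b : D.Obj} (c : Chain p a b), HEq (α.app c) (β.app c)) : α = β :=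
  EnrMorphism.ext (funext fun _ => funext fun _ => funext fun c => eq_of_heq (h c))

theorem evalRow_ids : ∀ {C D : EnrCat.{t} E} {p : ProfPath C D} {a : C.Obj} {b : D.Obj}
    (c : Chain p a b),
    evalRow (CellRow.ids (C := fun _ _ _ _ => EnrMorphism (E := E)) (fun _ _ => idCell) p) c = .ids c
  | _, _, _, _, _, .nil a => rfl
  | _, _, _, _, _, .cons (J := J) (p := p) a (b := b) c =>
      (evalRow_cons (p := .cons J (.nil _)) rfl (idCell J) _ (.cons (J := J) a c)
        (.cons (J := J) a (.nil b)) c HEq.rfl rfl).trans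
      (congrArg (ChainRow.cons (by rfl) (cellId (J.obj a b))) (evalRow_ids c))

theorem evalRow_single {p : ProfPath C D} {F : C ⟶ C₁} {G : D ⟶ D₁} {K : EnrProfunctor C₁ D₁}
    (α : EnrMorphism p F G K) {a : C.Obj} {b : D.Obj} (c : Chain p a b) :
    evalRow (.single α : EnrRow p F G _) c =
      .cons (ProPath.append_nil _).symm (α.app c) (.nil (G.arr b)) :=
  evalRow_cons _ α _ c c (.nil b) (Chain.append_nil_heq c).symm _

theorem evalRow_append {D' D₁' : EnrCat.{t} E} {o : ProfPath C D} {p : ProfPath C₁ D₁} {F : C ⟶ C₁}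
    {G : D ⟶ D₁} {H : D' ⟶ D₁'} (γ : EnrRow o F G p) {o' : ProfPath D D'} {p' : ProfPath D₁ D₁'}
    (ρ : EnrRow o' G H p') {a : C.Obj} {b : D.Obj} {d : D'.Obj} (c₁ : Chain o a b)
    (c₂ : Chain o' b d) :
    evalRow (γ.append rfl rfl ρ : EnrRow (o.append o') F H (p.append p')) (c₁.append c₂) =
      (evalRow γ c₁).append (Chain.path_append c₁ c₂) (evalRow ρ c₂) := by
  induction γ with
  | nil F => cases c₁; rfl
  | @cons _ _ _ _ _ _ p₁ r s F' G' H' K q h α γ ih =>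
    subst h
    obtain ⟨m, d₁, d₂, rfl⟩ := Chain.exists_append _ c₁
    have hp := ProPath.append_assoc p₁ r o'
    have hx : ((d₁.append d₂).append c₂).path = d₁.path.append (d₂.append c₂).path := by
      rw [Chain.path_append, Chain.path_append, Chain.path_append, ProPath.append_assoc]
    have e := evalRow_cons hp α (γ.append rfl rfl ρ) _ d₁ (d₂.append c₂)
      (Chain.append_assoc_heq d₁ d₂ c₂) hx
    refine e.trans ?_
    rw [ih, ChainRow.evalRow_append_cons]
    exact (ChainRow.cons_append _ _ _ _ _ _ _).symm

/-- The composite of a row of morphisms with a morphism. -/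
def vpaste ⦃C D C₁ D₁ C₂ D₂ : EnrCat.{t} E⦄ ⦃p : ProfPath C D⦄ ⦃q : ProfPath C₁ D₁⦄
    ⦃K : EnrProfunctor C₂ D₂⦄ ⦃F : C ⟶ C₁⦄ ⦃G : D ⟶ D₁⦄ ⦃F' : C₁ ⟶ C₂⦄ ⦃G' : D₁ ⟶ D₂⦄
    ⦃F'' : C ⟶ C₂⦄ ⦃G'' : D ⟶ D₂⦄ (ρ : EnrRow p F G q) (β : EnrMorphism q F' G' K)
    (hF : F ≫ F' = F'') (hG : G ≫ G' = G'') : EnrMorphism p F'' G'' K :=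
  (pasteCell ρ β).cast hF hG

theorem vpaste_app {p : ProfPath C D} {q : ProfPath C₁ D₁} {K : EnrProfunctor C₂ D₂} {F : C ⟶ C₁}
    {G : D ⟶ D₁} {F' : C₁ ⟶ C₂} {G' : D₁ ⟶ D₂} {F'' : C ⟶ C₂} {G'' : D ⟶ D₂}
    (ρ : EnrRow p F G q) (β : EnrMorphism q F' G' K) (hF : F ≫ F' = F'') (hG : G ≫ G' = G'')
    {a : C.Obj} {b : D.Obj} (c : Chain p a b) :
    HEq ((vpaste ρ β hF hG).app c) ((evalRow ρ c).app β.app) :=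
  cast_app hF hG (pasteCell ρ β) c

/-- Transport of a row along equations between functors. -/
def castRow {p : ProfPath C D} {q : ProfPath C₁ D₁} {F F' : C ⟶ C₁} {G G' : D ⟶ D₁}
    (hF : F = F') (hG : G = G') (α : EnrRow p F G q) : EnrRow p F' G' q := by
  subst hF hG
  exact α

theorem paste_right {o : ProfPath C D} {p : ProfPath C₁ D₁}
    {q : ProfPath C₂ D₂} {F : C ⟶ C₁} {G : D ⟶ D₁} {F' : C₁ ⟶ C₂} {G' : D₁ ⟶ D₂} {F'' : C ⟶ C₂}
    {G'' : D ⟶ D₂} {ρ : EnrRow o F G p} {σ : EnrRow p F' G' q} {τ : EnrRow o F'' G'' q}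
    (h : CellRow.Paste vpaste ρ σ τ) : G'' = G ≫ G' := by
  induction h with
  | nil hf => exact hf.symm
  | cons ho hp hf hg γ α h ih => exact ih

theorem paste_left {o : ProfPath C D} {p : ProfPath C₁ D₁}
    {q : ProfPath C₂ D₂} {F : C ⟶ C₁} {G : D ⟶ D₁} {F' : C₁ ⟶ C₂} {G' : D₁ ⟶ D₂} {F'' : C ⟶ C₂}
    {G'' : D ⟶ D₂} {ρ : EnrRow o F G p} {σ : EnrRow p F' G' q} {τ : EnrRow o F'' G'' q}
    (h : CellRow.Paste vpaste ρ σ τ) : F'' = F ≫ F' := by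
  cases h with
  | nil hf => exact hf.symm
  | cons ho hp hf hg γ α h => exact hf.symm

theorem evalRow_paste {o : ProfPath C D} {p : ProfPath C₁ D₁}
    {q : ProfPath C₂ D₂} {F : C ⟶ C₁} {G : D ⟶ D₁} {F' : C₁ ⟶ C₂} {G' : D₁ ⟶ D₂} {F'' : C ⟶ C₂}
    {G'' : D ⟶ D₂} {ρ : EnrRow o F G p} {σ : EnrRow p F' G' q} {τ : EnrRow o F'' G'' q}
    (h : CellRow.Paste vpaste ρ σ τ) (hF : F'' = F ≫ F') (hG : G'' = G ≫ G') {a : C.Obj}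
    {b : D.Obj} (c : Chain o a b) :
    ChainRow.IsPre (evalRow ρ c).row (evalRow σ (evalRow ρ c).chain)
      (evalRow (castRow hF hG τ) c) := by
  induction h with
  | nil hf =>
    subst hf
    cases c
    exact .mk (.nil rfl)
  | @cons _ _ _ _ _ _ _ _ _ o o' _ p p' _ K q f g k f' g' k' _ _ _ ho hp hf hg γ α ρ σ τ h ih =>
    subst ho hp hf hg hG
    obtain ⟨m, c₁, c₂, rfl⟩ := Chain.exists_append _ c
    have h := ih rfl rfl c₂
    have e₁ := evalRow_append γ ρ c₁ c₂
    have e₂ := ChainRow.evalRow_append_cons α σ (evalRow γ c₁).chain (evalRow ρ c₂).chain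
    have e₃ := ChainRow.evalRow_append_cons (vpaste γ α rfl rfl) τ c₁ c₂
    rw [e₁]
    refine e₂.symm.subst (motive := fun x => ChainRow.IsPre _ x _) ?_
    refine e₃.symm.subst (motive := fun x => ChainRow.IsPre (p := .cons K q) _ _ x) ?_
    change ChainRow.IsPre _ _ (evalRow τ c₂) at h
    generalize evalRow τ c₂ = v at h
    obtain ⟨h⟩ := h
    exact .mk (.cons (Chain.path_append c₁ c₂) (Chain.path_append _ _) rfl rfl
      (evalRow γ c₁).row (α.app (evalRow γ c₁).chain) h)

end EnrMorphism

open EnrMorphism in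
/-- The virtual double category of categories enriched in `E`. -/
instance : VirtualDoubleCategory (EnrCat.{t} E) where
  Pro := EnrProfunctor
  Cell := fun _ _ _ _ => EnrMorphism
  cellId := fun _ _ => idCell
  paste := vpaste
  ids_paste β := eq_of_app fun c => by
    refine (vpaste_app _ β _ _ c).trans ?_
    have h := congrArg (fun s : ChainRow _ _ _ _ _ _ => s.app β.app) (evalRow_ids c)
    exact (heq_of_eq h).trans (heq_ids_paste _ _ _)
  paste_id α := eq_of_app fun c => by
    refine (vpaste_app _ (idCell _) _ _ c).trans ?_
    have h := congrArg (fun s : ChainRow _ _ _ _ _ _ => s.app (idCell _).app) (evalRow_single α c)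
    exact (heq_of_eq h).trans (heq_paste_id _ _ _)
  paste_assoc {X X' Y Y' Z Z' W W' o p q K f g f' g' f'' g'' k l k' l' k'' l'' ρ σ τ} β h
      h₁ h₂ h₃ h₄ h₅ h₆ := by
    obtain rfl := paste_left h
    obtain rfl := paste_right h
    subst h₁ h₂ h₃ h₄
    refine eq_of_app fun c => ?_
    refine (vpaste_app _ _ _ _ c).trans (HEq.trans ?_ (vpaste_app _ _ _ _ c).symm)
    have h := (evalRow_paste h rfl rfl c).paste_eq β.app (k' := (f ≫ f' ≫ k).arr _)
      (l' := (g ≫ g' ≫ l).arr _) rfl rfl rfl rfl (Category.assoc _ _ _) (Category.assoc _ _ _)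
    exact (heq_of_eq h).trans (heq_paste _ _ _ _ _ _)

end Enriched
namespace VirtualDoubleCategory

section Hor

variable {V : Type u} [VirtualDoubleCategory.{z, w, v} V]

/-- The proarrows from `X` to `Y`, as the objects of a category. -/
structure Hor (X Y : V) where
  pro : Pro X Y

/-- The category of proarrows from `X` to `Y`: the morphisms are the cells with one proarrow as
domain and with identities as vertical arrows. -/
instance (X Y : V) : Category (Hor X Y) where
  Hom J K := Cell (.cons J.pro (.nil Y)) (𝟙 X) (𝟙 Y) K.pro
  id J := cellId J.pro
  comp α β := paste (.single α) β (Category.id_comp _) (Category.id_comp _)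
  id_comp α := ids_paste α
  comp_id α := paste_id α
  assoc α β γ := (paste_single _ _ _ _ _).symm

end Hor

end VirtualDoubleCategory

/-- A functor of virtual double categories. -/
structure VDFunctor (V : Type*) [VirtualDoubleCategory V] (W : Type*) [VirtualDoubleCategory W]
    extends V ⥤ W where
  proMap : ∀ ⦃X Y : V⦄, Pro X Y → Pro (obj X) (obj Y)
  cellMap : ∀ ⦃X X' Y Y' : V⦄ ⦃p : HPath X X'⦄ ⦃f : X ⟶ Y⦄ ⦃g : X' ⟶ Y'⦄ ⦃K : Pro Y Y'⦄,
    Cell p f g K → Cell (p.map obj proMap) (map f) (map g) (proMap K)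
  cellMap_id : ∀ {X Y : V} (J : Pro X Y),
    castCell (map_id X) (map_id Y) (cellMap (cellId J)) = cellId (proMap J)
  cellMap_paste : ∀ {X X' Y Y' Z Z' : V} {p : HPath X X'} {q : HPath Y Y'} {K : Pro Z Z'}
    {f : X ⟶ Y} {g : X' ⟶ Y'} {f' : Y ⟶ Z} {g' : Y' ⟶ Z'} {f'' : X ⟶ Z} {g'' : X' ⟶ Z'}
    (ρ : Row p f g q) (β : Cell q f' g' K) (hf : f ≫ f' = f'') (hg : g ≫ g' = g''),
    cellMap (paste ρ β hf hg) = paste (ρ.map toFunctor proMap cellMap) (cellMap β)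
      ((map_comp f f').symm.trans (congrArg map hf)) ((map_comp g g').symm.trans (congrArg map hg))

namespace VDFunctor

variable {V : Type*} [VirtualDoubleCategory V] {W : Type*} [VirtualDoubleCategory W]
  (Φ : VDFunctor V W)

/-- The image of a cell between identities. -/
def globMap {X Y : V} {p : HPath X Y} {J : Pro X Y} (μ : Cell p (𝟙 X) (𝟙 Y) J) :
    Cell (p.map Φ.obj Φ.proMap) (𝟙 (Φ.obj X)) (𝟙 (Φ.obj Y)) (Φ.proMap J) :=
  castCell (Φ.map_id X) (Φ.map_id Y) (Φ.cellMap μ)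

/-- The functor induced on categories of proarrows. -/
def hor (X Y : V) : Hor X Y ⥤ Hor (Φ.obj X) (Φ.obj Y) where
  obj J := ⟨Φ.proMap J.pro⟩
  map α := Φ.globMap α
  map_id J := Φ.cellMap_id J.pro
  map_comp {J K L} α β := by
    have h := Φ.cellMap_paste (.single α) β (Category.id_comp _) (Category.id_comp _)
    have key : ∀ (f : Φ.obj X ⟶ Φ.obj X) (g : Φ.obj Y ⟶ Φ.obj Y) (hf : f = 𝟙 _) (hg : g = 𝟙 _)
        (hf' : f ≫ f = f) (hg' : g ≫ g = g)
        (a : Cell (.cons (Φ.proMap J.pro) (.nil _)) f g (Φ.proMap K.pro))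
        (b : Cell (.cons (Φ.proMap K.pro) (.nil _)) f g (Φ.proMap L.pro)),
        castCell hf hg (paste (.single a) b hf' hg') = paste (.single (castCell hf hg a))
          (castCell hf hg b) (Category.id_comp _) (Category.id_comp _) := by
      intro f g hf hg
      subst hf hg
      exact fun _ _ _ _ => rfl
    exact (congrArg (castCell (Φ.map_id X) (Φ.map_id Y)) h).trans (key _ _ _ _ _ _ _ _)

end VDFunctor

namespace VirtualDoubleCategory

section Units

variable {V : Type u} [VirtualDoubleCategory.{z, w, v} V] {X X' Y Y' Z Z' W W' : V}

theorem IsCartesian.existsUnique {J : Pro X X'} {f : X ⟶ Y} {g : X' ⟶ Y'} {K : Pro Y Y'}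
    {χ : Cell (.cons J (.nil X')) f g K} (hχ : IsCartesian χ) {p : HPath W W'} (h : W ⟶ X)
    (k : W' ⟶ X') {f' : W ⟶ Y} {g' : W' ⟶ Y'} (hf : h ≫ f = f') (hg : k ≫ g = g')
    (α : Cell p f' g' K) : ∃! β : Cell p h k J, paste (.single β) χ hf hg = α := by
  subst hf hg
  exact hχ p h k α

variable [IsVirtualEquipment V]

/-- A unit of `A`. -/
noncomputable def unit (A : V) : Pro A A :=
  (IsVirtualEquipment.exists_unit A).choose

/-- The cell exhibiting `unit A` as the composite of the empty string. -/
noncomputable def unitCell (A : V) : Cell (.nil A) (𝟙 A) (𝟙 A) (unit A) :=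
  (IsVirtualEquipment.exists_unit A).choose_spec.choose

theorem unitCell_isComposite (A : V) : IsComposite (unitCell A) :=
  (IsVirtualEquipment.exists_unit A).choose_spec.choose_spec

/-- The restriction `K(f, g)`. -/
noncomputable def res (f : X ⟶ Y) (g : X' ⟶ Y') (K : Pro Y Y') : Pro X X' :=
  (IsVirtualEquipment.exists_restriction f g K).choose

/-- The cartesian cell from `K(f, g)` to `K`. -/
noncomputable def resCell (f : X ⟶ Y) (g : X' ⟶ Y') (K : Pro Y Y') :
    Cell (.cons (res f g K) (.nil X')) f g K :=
  (IsVirtualEquipment.exists_restriction f g K).choose_spec.choose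

theorem resCell_isCartesian (f : X ⟶ Y) (g : X' ⟶ Y') (K : Pro Y Y') :
    IsCartesian (resCell f g K) :=
  (IsVirtualEquipment.exists_restriction f g K).choose_spec.choose_spec

/-- The factorization of a cell through the cartesian cell of a restriction. -/
noncomputable def resLift {f : X ⟶ Y} {g : X' ⟶ Y'} {K : Pro Y Y'} {p : HPath W W'} {h : W ⟶ X}
    {k : W' ⟶ X'} {f' : W ⟶ Y} {g' : W' ⟶ Y'} (α : Cell p f' g' K) (hf : h ≫ f = f')
    (hg : k ≫ g = g') : Cell p h k (res f g K) :=
  (IsCartesian.existsUnique (resCell_isCartesian f g K) h k hf hg α).choose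

theorem resLift_paste {f : X ⟶ Y} {g : X' ⟶ Y'} {K : Pro Y Y'} {p : HPath W W'} {h : W ⟶ X}
    {k : W' ⟶ X'} {f' : W ⟶ Y} {g' : W' ⟶ Y'} (α : Cell p f' g' K) (hf : h ≫ f = f')
    (hg : k ≫ g = g') : paste (.single (resLift α hf hg)) (resCell f g K) hf hg = α :=
  (IsCartesian.existsUnique (resCell_isCartesian f g K) h k hf hg α).choose_spec.1

theorem res_ext {f : X ⟶ Y} {g : X' ⟶ Y'} {K : Pro Y Y'} {p : HPath W W'} {h : W ⟶ X}
    {k : W' ⟶ X'} {f' : W ⟶ Y} {g' : W' ⟶ Y'} {β β' : Cell p h k (res f g K)} (hf : h ≫ f = f')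
    (hg : k ≫ g = g') (e : paste (.single β) (resCell f g K) hf hg =
      paste (.single β') (resCell f g K) hf hg) : β = β' :=
  (IsCartesian.existsUnique (resCell_isCartesian f g K) h k hf hg _).unique e rfl

/-- The cell obtained from `α` by inserting a unit in its domain. -/
noncomputable def unitLift {A : V} {f : Z ⟶ Y} {g : W ⟶ Y'} {K : Pro Y Y'} (k : HPath Z A)
    (q : HPath A W) (α : Cell (k.append q) f g K) : Cell (k.append (.cons (unit A) q)) f g K :=
  (unitCell_isComposite A k q f g K α).choose

theorem paste_unitLift {A : V} {f : Z ⟶ Y} {g : W ⟶ Y'} {K : Pro Y Y'} (k : HPath Z A)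
    (q : HPath A W) (α : Cell (k.append q) f g K) :
    paste (whisker (unitCell A) k q) (unitLift k q α) (Category.id_comp f) (Category.id_comp g) =
      α :=
  (unitCell_isComposite A k q f g K α).choose_spec.1

theorem unit_ext {A : V} {f : Z ⟶ Y} {g : W ⟶ Y'} {K : Pro Y Y'} (k : HPath Z A)
    (q : HPath A W) {α α' : Cell (k.append (.cons (unit A) q)) f g K}
    (h : paste (whisker (unitCell A) k q) α (Category.id_comp f) (Category.id_comp g) =
      paste (whisker (unitCell A) k q) α' (Category.id_comp f) (Category.id_comp g)) : α = α' :=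
  (unitCell_isComposite A k q f g K _).unique h rfl

/-- The cell `U, J ⟶ J`. -/
noncomputable def lam (J : Pro X Y) :
    Cell (.cons (unit X) (.cons J (.nil Y))) (𝟙 X) (𝟙 Y) J :=
  unitLift (.nil X) (.cons J (.nil Y)) (cellId J)

/-- The cell `J, U ⟶ J`. -/
noncomputable def rho (J : Pro X Y) :
    Cell (.cons J (.cons (unit Y) (.nil Y))) (𝟙 X) (𝟙 Y) J :=
  unitLift (.cons J (.nil Y)) (.nil Y) (cellId J)

/-- The cell `U ⟶ U` over an arrow `f`. -/
noncomputable def unitMap (f : X ⟶ Y) : Cell (.cons (unit X) (.nil X)) f f (unit Y) :=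
  unitLift (.nil X) (.nil X) (paste (.nil f) (unitCell Y) (Category.comp_id f) (Category.comp_id f))

/-- A row with a unit inserted in front. -/
noncomputable abbrev etaLeft (p : HPath X Y) : Row p (𝟙 X) (𝟙 Y) (.cons (unit X) p) :=
  .cons (by rfl) (unitCell X) (idRow p)

theorem unit_ext_left {p : HPath X X'} {f : X ⟶ Y} {g : X' ⟶ Y'} {K : Pro Y Y'}
    {α α' : Cell (.cons (unit X) p) f g K}
    (h : paste (etaLeft p) α (Category.id_comp f) (Category.id_comp g) =
      paste (etaLeft p) α' (Category.id_comp f) (Category.id_comp g)) : α = α' :=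
  unit_ext (.nil X) p h

/-- A row with a unit inserted at the end. -/
noncomputable def etaRight : ∀ {X Y : V} (p : HPath X Y),
    Row p (𝟙 X) (𝟙 Y) (p.append (.cons (unit Y) (.nil Y)))
  | _, Y, .nil _ => .cons (by rfl) (unitCell Y) (.nil (𝟙 Y))
  | _, _, .cons J p => .cons (by rfl) (cellId J) (etaRight p)

theorem whisker_heq_etaRight : ∀ {X Y : V} (p : HPath X Y),
    HEq (whisker (unitCell Y) p (.nil Y)) (etaRight p)
  | _, _, .nil _ => HEq.rfl
  | X, Y, .cons (Y := Y₁) J p => by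
      have h := whisker_heq_etaRight p
      have key : ∀ (p' : HPath Y₁ Y) (hp : p' = p)
          (ρ : Row p' (𝟙 Y₁) (𝟙 Y) (p.append (.cons (unit Y) (.nil Y)))) (_ : HEq ρ (etaRight p)),
          HEq (CellRow.cons (C := Cell (V := V)) (p := .cons J (.nil _)) (s := .cons J p')
            (K := J) (by rfl) (cellId J) ρ) (etaRight (.cons J p)) := by
        intro p' hp ρ h
        subst hp
        obtain rfl := eq_of_heq h
        rfl
      exact key _ (ProPath.append_nil p) _ h

theorem unit_ext_right {p : HPath X X'} {f : X ⟶ Y} {g : X' ⟶ Y'} {K : Pro Y Y'}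
    {α α' : Cell (p.append (.cons (unit X') (.nil X'))) f g K}
    (h : paste (etaRight p) α (Category.id_comp f) (Category.id_comp g) =
      paste (etaRight p) α' (Category.id_comp f) (Category.id_comp g)) : α = α' := by
  refine unit_ext p (.nil X') ?_
  have key : ∀ (p' : HPath X X') (hp : p' = p)
      (ρ : Row p' (𝟙 X) (𝟙 X') (p.append (.cons (unit X') (.nil X')))) (_ : HEq ρ (etaRight p)),
      paste ρ α (Category.id_comp f) (Category.id_comp g) =
        paste ρ α' (Category.id_comp f) (Category.id_comp g) := by
    intro p' hp ρ h
    subst hp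
    obtain rfl := eq_of_heq h
    assumption
  exact key _ (ProPath.append_nil p) _ (whisker_heq_etaRight p)

theorem eta_lam (J : Pro X Y) :
    paste (.pair (unitCell X) (cellId J)) (lam J) (Category.comp_id _) (Category.comp_id _) =
      cellId J :=
  paste_unitLift (.nil X) (.cons J (.nil Y)) (cellId J)

theorem eta_rho (J : Pro X Y) :
    paste (.pair (cellId J) (unitCell Y)) (rho J) (Category.comp_id _) (Category.comp_id _) =
      cellId J :=
  paste_unitLift (.cons J (.nil Y)) (.nil Y) (cellId J)

theorem eta_unitMap (f : X ⟶ Y) :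
    paste (.single (unitCell X)) (unitMap f) (Category.id_comp _) (Category.id_comp _) =
      paste (.nil f) (unitCell Y) (Category.comp_id f) (Category.comp_id f) :=
  paste_unitLift (.nil X) (.nil X) _

end Units

end VirtualDoubleCategory

namespace VirtualDoubleCategory

section UnitCalculus

variable {V : Type u} [VirtualDoubleCategory.{z, w, v} V]
  {X X' Y Y' Z Z' W W' : V}

theorem pasteAssoc {o : HPath X X'} {p : HPath Y Y'} {q : HPath Z Z'} {K : Pro W W'}
    {f : X ⟶ Y} {g : X' ⟶ Y'} {f' : Y ⟶ Z} {g' : Y' ⟶ Z'} {f'' : X ⟶ Z} {g'' : X' ⟶ Z'}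
    {k : Z ⟶ W} {l : Z' ⟶ W'} {k' : Y ⟶ W} {l' : Y' ⟶ W'} {k'' : X ⟶ W} {l'' : X' ⟶ W'}
    {ρ : Row o f g p} {σ : Row p f' g' q} {τ : Row o f'' g'' q} (h : IsPaste ρ σ τ)
    (β : Cell q k l K) (h₁ : f' ≫ k = k') (h₂ : g' ≫ l = l') (h₃ : f ≫ k' = k'')
    (h₄ : g ≫ l' = l'') (h₅ : f'' ≫ k = k'' := by simp) (h₆ : g'' ≫ l = l'' := by simp) :
    paste ρ (paste σ β h₁ h₂) h₃ h₄ = paste τ β h₅ h₆ :=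
  paste_assoc β h h₁ h₂ h₃ h₄ h₅ h₆

theorem nil_id_paste {K : Pro Y Y'} {f : X ⟶ Y} {g : X ⟶ Y'} (α : Cell (.nil X) f g K) :
    paste (.nil (𝟙 X)) α (Category.id_comp f) (Category.id_comp g) = α :=
  ids_paste α

variable [IsVirtualEquipment V]

theorem unit_lam {p : HPath X X'} {f : X ⟶ Y} {g : X' ⟶ Y'} {J : Pro Y Y'} (α : Cell p f g J) :
    paste (.cons (by rfl) (paste (.nil f) (unitCell Y) (Category.comp_id f) (Category.comp_id f))
      (.single α)) (lam J) (Category.comp_id f) (Category.comp_id g) = α := by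
  have h := pasteAssoc (IsPaste.cons₀ (α := unitCell Y) (hp := rfl) (ho := rfl) (Category.comp_id f)
    (Category.comp_id f) (.id_right (.single α))) (β := lam J) (h₁ := Category.comp_id _)
    (h₂ := Category.comp_id _) (h₃ := Category.comp_id _) (h₄ := Category.comp_id _)
  refine h.symm.trans ?_
  refine Eq.trans ?_ (paste_id α)
  congr 1
  exact eta_lam J

theorem unit_rho {p : HPath X X'} {f : X ⟶ Y} {g : X' ⟶ Y'} {J : Pro Y Y'} (α : Cell p f g J) :
    paste (.cons (ProPath.append_nil p).symm α (.single (paste (.nil g) (unitCell Y')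
      (Category.comp_id g) (Category.comp_id g)))) (rho J) (Category.comp_id f)
      (Category.comp_id g) = α := by
  have h := pasteAssoc (IsPaste.cons_id (α := α) (ho := (ProPath.append_nil p).symm) (hp := rfl)
    (.single (.nil g) (unitCell Y') (Category.comp_id _) (Category.comp_id _)))
    (β := rho J) (h₁ := Category.comp_id _) (h₂ := Category.comp_id _)
    (h₃ := Category.comp_id _) (h₄ := Category.comp_id _)
  refine h.symm.trans ?_
  refine Eq.trans ?_ (paste_id α)
  congr 1
  exact eta_rho J

theorem eta_left_rho (A : V) :
    paste (.pair (unitCell A) (cellId (unit A))) (rho (unit A)) (Category.comp_id _)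
      (Category.comp_id _) = cellId (unit A) := by
  refine unit_ext_left ?_
  have e : etaLeft (.nil A) = .single (unitCell A) := rfl
  rw [e, paste_id]
  have h₁ := pasteAssoc (ρ := .single (unitCell A)) (IsPaste.cons₀ (α := unitCell A) (hp := rfl) (ho := rfl)
    (Category.comp_id (𝟙 A)) (Category.comp_id _) (.id_right (.single (unitCell A))))
    (β := rho (unit A)) (h₁ := Category.comp_id _) (h₂ := Category.comp_id _)
    (h₃ := Category.comp_id _) (h₄ := Category.comp_id _)
  refine h₁.trans ?_
  have h₂ := unit_rho (unitCell A)
  rw [nil_id_paste] at h₂ ⊢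
  exact h₂

theorem lam_unit (A : V) : lam (unit A) = rho (unit A) :=
  unit_ext_left ((eta_lam (unit A)).trans (eta_left_rho A).symm)

theorem lam_lam (J : Pro X Y) :
    paste (.pair (lam (unit X)) (cellId J)) (lam J) (Category.comp_id _) (Category.comp_id _) =
      paste (.pair (cellId (unit X)) (lam J)) (lam J) (Category.comp_id _) (Category.comp_id _) := by
  refine unit_ext_left ?_
  have h₁ := pasteAssoc (IsPaste.cons₂ (α₀ := unitCell X) (α := cellId (unit X)) (β := lam (unit X))
    (ho₂ := rfl) (ho := rfl) (ho' := rfl) (hp := rfl) (Category.comp_id _) (Category.comp_id _)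
    (.single (.single (cellId J)) (cellId J) (Category.comp_id _) (Category.comp_id _)))
    (β := lam J) (h₁ := Category.comp_id _) (h₂ := Category.comp_id _)
    (h₃ := Category.comp_id _) (h₄ := Category.comp_id _)
  have h₂ := pasteAssoc (IsPaste.cons_id (α := unitCell X) (ho := rfl) (hp := rfl)
    (.single (.pair (cellId (unit X)) (cellId J)) (lam J) (Category.comp_id _) (Category.comp_id _)))
    (β := lam J) (h₁ := Category.comp_id _) (h₂ := Category.comp_id _)
    (h₃ := Category.comp_id _) (h₄ := Category.comp_id _)
  refine h₁.trans (Eq.trans ?_ h₂.symm)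
  have h₃ := eta_lam (unit X)
  have h₄ : paste (.pair (cellId (unit X)) (cellId J)) (lam J) (Category.comp_id _)
    (Category.comp_id _) = lam J := ids_paste _
  have h₅ := unit_lam (lam J)
  rw [nil_id_paste] at h₅
  rw [h₄, h₃, paste_id]
  exact h₄.trans h₅.symm

theorem lam_rho (J : Pro X Y) :
    paste (.pair (lam J) (cellId (unit Y))) (rho J) (Category.comp_id _) (Category.comp_id _) =
      paste (.pair (cellId (unit X)) (rho J)) (lam J) (Category.comp_id _) (Category.comp_id _) := by
  refine unit_ext_left ?_
  have h₁ := pasteAssoc (IsPaste.cons₂ (α₀ := unitCell X) (α := cellId J) (β := lam J)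
    (ho₂ := rfl) (ho := rfl) (ho' := rfl) (hp := rfl) (Category.comp_id _) (Category.comp_id _)
    (.single (.single (cellId (unit Y))) (cellId (unit Y)) (Category.comp_id _) (Category.comp_id _)))
    (β := rho J) (h₁ := Category.comp_id _) (h₂ := Category.comp_id _)
    (h₃ := Category.comp_id _) (h₄ := Category.comp_id _)
  have h₂ := pasteAssoc (IsPaste.cons_id (α := unitCell X) (ho := rfl) (hp := rfl)
    (.single (.pair (cellId J) (cellId (unit Y))) (rho J) (Category.comp_id _) (Category.comp_id _)))
    (β := lam J) (h₁ := Category.comp_id _) (h₂ := Category.comp_id _)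
    (h₃ := Category.comp_id _) (h₄ := Category.comp_id _)
  refine h₁.trans (Eq.trans ?_ h₂.symm)
  have h₃ := eta_lam J
  have h₄ : paste (.pair (cellId J) (cellId (unit Y))) (rho J) (Category.comp_id _)
    (Category.comp_id _) = rho J := ids_paste _
  have h₅ := unit_lam (rho J)
  rw [nil_id_paste] at h₅
  rw [h₄, h₃, paste_id]
  exact h₄.trans h₅.symm

theorem rho_rho (J : Pro X Y) :
    paste (.pair (rho J) (cellId (unit Y))) (rho J) (Category.comp_id _) (Category.comp_id _) =
      paste (.pair (cellId J) (lam (unit Y))) (rho J) (Category.comp_id _) (Category.comp_id _) := by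
  rw [lam_unit]
  refine unit_ext_right (p := .cons J (.cons (unit Y) (.nil Y))) ?_
  have h₁ := pasteAssoc (IsPaste.cons₂ (α₀ := cellId J) (α := cellId (unit Y)) (β := rho J)
    (ho₂ := rfl) (ho := rfl) (ho' := rfl) (hp := rfl) (Category.comp_id _) (Category.comp_id _)
    (.single (.single (unitCell Y)) (cellId (unit Y)) (Category.comp_id _) (Category.comp_id _)))
    (β := rho J) (h₁ := Category.comp_id _) (h₂ := Category.comp_id _)
    (h₃ := Category.comp_id _) (h₄ := Category.comp_id _)
  have h₂ := pasteAssoc (IsPaste.cons_id (α := cellId J) (ho := rfl) (hp := rfl)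
    (.single (.pair (cellId (unit Y)) (unitCell Y)) (rho (unit Y)) (Category.comp_id _) (Category.comp_id _)))
    (β := rho J) (h₁ := Category.comp_id _) (h₂ := Category.comp_id _)
    (h₃ := Category.comp_id _) (h₄ := Category.comp_id _)
  refine h₁.trans (Eq.trans ?_ h₂.symm)
  have h₃ := eta_rho (unit Y)
  have h₄ : paste (.pair (cellId J) (cellId (unit Y))) (rho J) (Category.comp_id _)
    (Category.comp_id _) = rho J := ids_paste _
  have h₅ := unit_rho (rho J)
  rw [nil_id_paste] at h₅
  rw [h₄, h₃, paste_id]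
  exact h₅.trans h₄.symm

theorem unitMap_lam (f : X ⟶ Y) :
    paste (.single (lam (unit X))) (unitMap f) (Category.id_comp _) (Category.id_comp _) =
      paste (.pair (unitMap f) (unitMap f)) (lam (unit Y)) (Category.comp_id _)
        (Category.comp_id _) := by
  refine unit_ext_left ?_
  have h₁ := pasteAssoc (IsPaste.single (.pair (unitCell X) (cellId (unit X))) (lam (unit X))
    (Category.comp_id _) (Category.comp_id _))
    (β := unitMap f) (h₁ := Category.id_comp _) (h₂ := Category.id_comp _)
    (h₃ := Category.id_comp _) (h₄ := Category.id_comp _)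
  have h₂ := pasteAssoc (IsPaste.cons₁ (α := unitCell X) (β := unitMap f) (ho := rfl) (hp := rfl)
    (Category.id_comp f) (Category.id_comp f)
    (.single (.single (cellId (unit X))) (unitMap f) (Category.id_comp _) (Category.id_comp _)))
    (β := lam (unit Y)) (h₁ := Category.comp_id _) (h₂ := Category.comp_id _)
    (h₃ := Category.id_comp _) (h₄ := Category.id_comp _)
  refine h₁.trans (Eq.trans ?_ h₂.symm)
  have h₃ := eta_lam (unit X)
  have h₄ : paste (.single (cellId (unit X))) (unitMap f) (Category.id_comp _)
    (Category.id_comp _) = unitMap f := ids_paste _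
  have h₅ := unit_lam (unitMap f)
  rw [h₃, h₄, eta_unitMap]
  exact h₄.trans h₅.symm

theorem lam_paste {J : Pro X Z} {p : HPath Z X'} {f : X ⟶ Y} {g : X' ⟶ Y'} {K : Pro Y Y'}
    (α : Cell (.cons J p) f g K) :
    paste (.cons (by rfl) (lam J) (idRow p)) α (Category.id_comp f) (Category.id_comp g) =
      paste (.cons (by rfl) (unitMap f) (.single α)) (lam K) (Category.comp_id f)
        (Category.comp_id g) := by
  refine unit_ext_left ?_
  have h₁ := pasteAssoc (IsPaste.cons₂ (α₀ := unitCell X) (α := cellId J) (β := lam J)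
    (ho₂ := rfl) (ho := rfl) (ho' := rfl) (hp := rfl) (Category.comp_id _) (Category.comp_id _)
    (.id_right (idRow p)))
    (β := α) (h₁ := Category.id_comp _) (h₂ := Category.id_comp _)
    (h₃ := Category.id_comp _) (h₄ := Category.id_comp _)
  have h₂ := pasteAssoc (IsPaste.cons₁ (α := unitCell X) (β := unitMap f) (ho := rfl) (hp := rfl)
    (Category.id_comp f) (Category.id_comp f)
    (.single (idRow (.cons J p)) α (Category.id_comp _) (Category.id_comp _)))
    (β := lam K) (h₁ := Category.comp_id _) (h₂ := Category.comp_id _)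
    (h₃ := Category.id_comp _) (h₄ := Category.id_comp _)
  refine h₁.trans (Eq.trans ?_ h₂.symm)
  rw [eta_lam, eta_unitMap, ids_paste]
  exact (ids_paste α).trans (unit_lam α).symm

theorem unitMap_nat {f : X ⟶ Y} {g : X ⟶ Y'} {K : Pro Y Y'} (α : Cell (.nil X) f g K) :
    paste (.pair (unitMap f) α) (lam K) (Category.comp_id f) (Category.comp_id g) =
      paste (.pair α (unitMap g)) (rho K) (Category.comp_id f) (Category.comp_id g) := by
  refine unit_ext_left ?_
  have h₁ := pasteAssoc (IsPaste.cons₁ (α := unitCell X) (β := unitMap f) (ho := rfl) (hp := rfl)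
    (Category.id_comp f) (Category.id_comp f)
    (.single (.nil (𝟙 X)) α (Category.id_comp _) (Category.id_comp _)))
    (β := lam K) (h₁ := Category.comp_id _) (h₂ := Category.comp_id _)
    (h₃ := Category.id_comp _) (h₄ := Category.id_comp _)
  have h₂ := pasteAssoc (IsPaste.cons₀ (α := α) (hp := rfl) (ho := rfl)
    (Category.id_comp f) (Category.id_comp g)
    (.single (.single (unitCell X)) (unitMap g) (Category.id_comp _) (Category.id_comp _)))
    (β := rho K) (h₁ := Category.comp_id _) (h₂ := Category.comp_id _)
    (h₃ := Category.id_comp _) (h₄ := Category.id_comp _)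
  refine h₁.trans (Eq.trans ?_ h₂.symm)
  rw [eta_unitMap, eta_unitMap, nil_id_paste]
  exact (unit_lam α).trans (unit_rho α).symm

theorem etaRight_eq : ∀ {X Y : V} (p : HPath X Y),
    etaRight p = (idRow p).append (ProPath.append_nil p).symm rfl (.single (unitCell Y))
  | _, _, .nil _ => rfl
  | _, _, .cons J p => by
      have h := append_cons (o'' := .cons J p) rfl (ProPath.append_nil _).symm (by rfl) rfl
        (ProPath.append_nil p).symm rfl (cellId J) (idRow p) (.single (unitCell _))
      refine Eq.trans ?_ h.symm
      rw [← etaRight_eq p]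
      rfl

theorem rho_paste {p : HPath X X'} {f : X ⟶ Y} {g : X' ⟶ Y'} {K : Pro Y Y'} (α : Cell p f g K)
    {ρ : Row (p.append (.cons (unit X') (.nil X'))) (𝟙 X) (𝟙 X') p}
    (h : IsPaste (etaRight p) ρ (idRow p)) :
    paste ρ α (Category.id_comp f) (Category.id_comp g) =
      paste (.pair α (unitMap g)) (rho K) (Category.comp_id f) (Category.comp_id g) := by
  refine unit_ext_right ?_
  have h₁ := paste_paste h (β := α) (h₁ := Category.id_comp f) (h₂ := Category.id_comp g)
    (h₃ := Category.id_comp _) (h₄ := Category.id_comp _)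
  have h₂ := pasteAssoc (CellRow.Paste.cons (ProPath.append_nil p).symm rfl (Category.id_comp f)
    (Category.id_comp g) (idRow p) α
    (IsPaste.single (.single (unitCell X')) (unitMap g) (Category.id_comp g) (Category.id_comp g)))
    (β := rho K) (h₁ := Category.comp_id _) (h₂ := Category.comp_id _)
    (h₃ := Category.id_comp _) (h₄ := Category.id_comp _)
  refine h₁.trans (Eq.trans ?_ (etaRight_eq p ▸ h₂.symm))
  rw [eta_unitMap, ids_paste]
  exact (unit_rho α).symm

end UnitCalculus

end VirtualDoubleCategory

namespace VirtualDoubleCategory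

section Rep

variable {V : Type u} [VirtualDoubleCategory.{z, w, v} V] [IsVirtualEquipment V]
  {X X' Y Y' Z Z' W W' : V}

theorem unitMap_id (X : V) : unitMap (𝟙 X) = cellId (unit X) := by
  refine unit_ext_left (p := .nil X) ?_
  refine (paste_eq_cast (eta_unitMap (𝟙 X)) rfl rfl).trans ?_
  rw [nil_id_paste]
  exact (paste_id _).symm

theorem unitMap_comp (f : X ⟶ Y) (g : Y ⟶ Z) {h : X ⟶ Z} (e : f ≫ g = h) :
    unitMap h = paste (.single (unitMap f)) (unitMap g) e e := by
  refine unit_ext_left (p := .nil X) ?_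
  have h₁ := pasteAssoc (IsPaste.single (.single (unitCell X)) (unitMap f) (Category.id_comp _)
    (Category.id_comp _)) (unitMap g) (k' := h) (l' := h) e e (Category.id_comp _)
    (Category.id_comp _) e e
  have h₂ := pasteAssoc (IsPaste.single (.nil f) (unitCell Y) (Category.comp_id _)
    (Category.comp_id _)) (unitMap g) (k' := g) (l' := g) (k'' := h) (l'' := h) (Category.id_comp _)
    (Category.id_comp _) e e e e
  have h₃ := pasteAssoc (.nil e) (unitCell Z) (k' := g) (l' := g) (k'' := h) (l'' := h)
    (Category.comp_id _) (Category.comp_id _) e e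
  refine (eta_unitMap h).trans (Eq.trans ?_ h₁.symm)
  rw [eta_unitMap]
  refine Eq.trans ?_ h₂
  rw [eta_unitMap]
  exact h₃.symm

theorem lift_paste {f : X ⟶ Y} {g : X' ⟶ Y'} {K : Pro Y Y'} {p : HPath W W'} {q : HPath Z Z'}
    {h : W ⟶ X} {k : W' ⟶ X'} {f' : W ⟶ Y} {g' : W' ⟶ Y'} {m : Z ⟶ W} {n : Z' ⟶ W'} {m' : Z ⟶ X}
    {n' : Z' ⟶ X'} {m'' : Z ⟶ Y} {n'' : Z' ⟶ Y'} (ρ : Row q m n p) (α : Cell p f' g' K)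
    (hf : h ≫ f = f') (hg : k ≫ g = g') (hm : m ≫ h = m') (hn : n ≫ k = n') (hm' : m' ≫ f = m'')
    (hn' : n' ≫ g = n'') (hm'' : m ≫ f' = m'') (hn'' : n ≫ g' = n'') :
    paste (.single (paste ρ (resLift α hf hg) hm hn)) (resCell f g K) hm' hn' =
      paste ρ α hm'' hn'' := by
  have h₁ := paste_assoc (resCell f g K) (IsPaste.single ρ (resLift α hf hg) hm hn) hf hg hm'' hn''
    hm' hn'
  rw [resLift_paste] at h₁
  exact h₁.symm

/-- The elements of `A`: the arrows with codomain `A`. -/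
structure RepObj (A : V) : Type (max u v) where
  dom : V
  arr : dom ⟶ A

variable {A B : V}

/-- The unit of `|A|`. -/
noncomputable def repOne (x : RepObj A) :
    Cell (.nil x.dom) (𝟙 _) (𝟙 _) (res x.arr x.arr (unit A)) :=
  resLift (paste (.nil x.arr) (unitCell A) (Category.comp_id _) (Category.comp_id _))
    (Category.id_comp _) (Category.id_comp _)

/-- The left action on `|J|`. -/
noncomputable def repLact (J : Pro A B) (x x' : RepObj A) (y : RepObj B) :
    Cell (.cons (res x.arr x'.arr (unit A)) (.cons (res x'.arr y.arr J) (.nil _))) (𝟙 _) (𝟙 _)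
      (res x.arr y.arr J) :=
  resLift (paste (.pair (resCell x.arr x'.arr (unit A)) (resCell x'.arr y.arr J)) (lam J)
    (Category.comp_id _) (Category.comp_id _)) (Category.id_comp _) (Category.id_comp _)

/-- The right action on `|J|`. -/
noncomputable def repRact (J : Pro A B) (x : RepObj A) (y y' : RepObj B) :
    Cell (.cons (res x.arr y.arr J) (.cons (res y.arr y'.arr (unit B)) (.nil _))) (𝟙 _) (𝟙 _)
      (res x.arr y'.arr J) :=
  resLift (paste (.pair (resCell x.arr y.arr J) (resCell y.arr y'.arr (unit B))) (rho J)
    (Category.comp_id _) (Category.comp_id _)) (Category.id_comp _) (Category.id_comp _)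

theorem repLact_unit (x x' y : RepObj A) : repLact (unit A) x x' y = repRact (unit A) x x' y := by
  rw [repLact, repRact, lam_unit]

theorem rep_one_lact (J : Pro A B) (x : RepObj A) (y : RepObj B) :
    paste (.pair (repOne x) (cellId (res x.arr y.arr J))) (repLact J x x y)
      (Category.comp_id _) (Category.comp_id _) = cellId (res x.arr y.arr J) := by
  refine res_ext (Category.id_comp _) (Category.id_comp _) ?_
  refine (lift_paste _ _ _ _ _ _ _ _ (Category.id_comp _) (Category.id_comp _)).trans ?_
  refine (pasteAssoc (IsPaste.cons₁ (Category.id_comp _) (Category.id_comp _) (hp := rfl)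
    (.single (.single (cellId _)) _ (Category.id_comp _) (Category.id_comp _))) _ _ _ _ _).trans ?_
  rw [repOne, resLift_paste]
  refine (unit_lam _)

theorem rep_ract_one (J : Pro A B) (x : RepObj A) (y : RepObj B) :
    paste (.pair (cellId (res x.arr y.arr J)) (repOne y)) (repRact J x y y)
      (Category.comp_id _) (Category.comp_id _) = cellId (res x.arr y.arr J) := by
  refine res_ext (Category.id_comp _) (Category.id_comp _) ?_
  refine (lift_paste _ _ _ _ _ _ _ _ (Category.id_comp _) (Category.id_comp _)).trans ?_
  refine (pasteAssoc (IsPaste.cons₁ (Category.id_comp _) (Category.id_comp _) (hp := rfl)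
    (.single (.single (repOne y)) _ (Category.id_comp _) (Category.id_comp _))) _ _ _ _ _).trans ?_
  rw [repOne, resLift_paste]
  exact unit_rho _

/-- Both sides of an associativity law for actions on restrictions. -/
theorem rep_assoc {X₀ X₁ X₂ X₃ A₀ A₁ A₂ A₃ : V} {f₀ : X₀ ⟶ A₀} {f₁ : X₁ ⟶ A₁} {f₂ : X₂ ⟶ A₂}
    {f₃ : X₃ ⟶ A₃} {J₁ : Pro A₀ A₁} {J₂ : Pro A₁ A₂} {J₃ : Pro A₂ A₃} {K : Pro A₀ A₂}
    {L : Pro A₁ A₃} {M : Pro A₀ A₃}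
    {a : Cell (.cons J₁ (.cons J₂ (.nil _))) (𝟙 _) (𝟙 _) K}
    {b : Cell (.cons K (.cons J₃ (.nil _))) (𝟙 _) (𝟙 _) M}
    {c : Cell (.cons J₂ (.cons J₃ (.nil _))) (𝟙 _) (𝟙 _) L}
    {d : Cell (.cons J₁ (.cons L (.nil _))) (𝟙 _) (𝟙 _) M}
    (h : paste (.pair a (cellId J₃)) b (Category.comp_id _) (Category.comp_id _) =
      paste (.pair (cellId J₁) c) d (Category.comp_id _) (Category.comp_id _)) :
    paste (.pair (resLift (paste (.pair (resCell f₀ f₁ J₁) (resCell f₁ f₂ J₂)) a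
          (Category.comp_id _) (Category.comp_id _)) (Category.id_comp _) (Category.id_comp _))
        (cellId (res f₂ f₃ J₃)))
      (resLift (paste (.pair (resCell f₀ f₂ K) (resCell f₂ f₃ J₃)) b
          (Category.comp_id _) (Category.comp_id _)) (Category.id_comp _) (Category.id_comp _))
      (Category.comp_id _) (Category.comp_id _) =
    paste (.pair (cellId (res f₀ f₁ J₁))
        (resLift (paste (.pair (resCell f₁ f₂ J₂) (resCell f₂ f₃ J₃)) c
          (Category.comp_id _) (Category.comp_id _)) (Category.id_comp _) (Category.id_comp _)))
      (resLift (paste (.pair (resCell f₀ f₁ J₁) (resCell f₁ f₃ L)) d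
          (Category.comp_id _) (Category.comp_id _)) (Category.id_comp _) (Category.id_comp _))
      (Category.comp_id _) (Category.comp_id _) := by
  refine res_ext (Category.id_comp _) (Category.id_comp _) ?_
  refine (lift_paste _ _ _ _ _ _ _ _ (Category.id_comp _) (Category.id_comp _)).trans
    (Eq.trans ?_ (lift_paste _ _ _ _ _ _ _ _ (Category.id_comp _) (Category.id_comp _)).symm)
  have e : ∀ {X X' Y Y' : V} (f : X ⟶ Y) (g : X' ⟶ Y') (J : Pro Y Y'),
      paste (.single (cellId _)) (resCell f g J) (Category.id_comp _) (Category.id_comp _) =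
        resCell f g J := fun _ _ _ => ids_paste _
  have h₁ := pasteAssoc (ρ := .pair (resLift (paste (.pair (resCell f₀ f₁ J₁) (resCell f₁ f₂ J₂)) a
      (Category.comp_id _) (Category.comp_id _)) (Category.id_comp _) (Category.id_comp _))
      (cellId (res f₂ f₃ J₃)))
    (IsPaste.cons₁ (β := resCell f₀ f₂ K) (Category.id_comp _) (Category.id_comp _) (hp := rfl)
    (.single (.single (cellId _)) (resCell f₂ f₃ J₃) (Category.id_comp _) (Category.id_comp _)))
    b (Category.comp_id _) (Category.comp_id _) (Category.id_comp _) (Category.id_comp _)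
  have h₂ := pasteAssoc (IsPaste.cons₁ (α := cellId _) (β := resCell f₀ f₁ J₁) (ho := rfl) (hp := rfl)
    (Category.id_comp _) (Category.id_comp _) (.single (.single
    (resLift (paste (.pair (resCell f₁ f₂ J₂) (resCell f₂ f₃ J₃)) c
      (Category.comp_id _) (Category.comp_id _)) (Category.id_comp _) (Category.id_comp _)))
      (resCell f₁ f₃ L) (Category.id_comp _) (Category.id_comp _)))
    d (Category.comp_id _) (Category.comp_id _) (Category.id_comp _) (Category.id_comp _)
  rw [resLift_paste, e] at h₁ h₂
  have h₃ := pasteAssoc (IsPaste.cons₂ (α₀ := resCell f₀ f₁ J₁) (α := resCell f₁ f₂ J₂) (β := a)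
    (ho₂ := rfl) (ho := rfl) (ho' := rfl) (hp := rfl) (Category.comp_id _) (Category.comp_id _)
    (.single (.single (resCell f₂ f₃ J₃)) (cellId J₃) (Category.comp_id _) (Category.comp_id _)))
    b (Category.comp_id _) (Category.comp_id _) (Category.comp_id _) (Category.comp_id _)
  have h₄ := pasteAssoc (IsPaste.cons_id (α := resCell f₀ f₁ J₁) (ho := rfl) (hp := rfl)
    (.single (.pair (resCell f₁ f₂ J₂) (resCell f₂ f₃ J₃)) c (Category.comp_id _)
      (Category.comp_id _)))
    d (Category.comp_id _) (Category.comp_id _) (Category.comp_id _) (Category.comp_id _)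
  rw [paste_id] at h₃
  refine h₁.trans (h₃.symm.trans (Eq.trans ?_ (h₄.trans h₂.symm)))
  exact congrArg (fun z => paste _ z (Category.comp_id _) (Category.comp_id _)) h

/-- The action of `|f|` on homs. -/
noncomputable def repHom (f : A ⟶ B) (x y : RepObj A) :
    Cell (.cons (res x.arr y.arr (unit A)) (.nil _)) (𝟙 _) (𝟙 _)
      (res (x.arr ≫ f) (y.arr ≫ f) (unit B)) :=
  resLift (paste (.single (resCell x.arr y.arr (unit A))) (unitMap f) rfl rfl)
    (Category.id_comp _) (Category.id_comp _)

theorem repHom_one (f : A ⟶ B) (x : RepObj A) :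
    paste (.single (repOne x)) (repHom f x x) (Category.id_comp _) (Category.id_comp _) =
      paste (.nil (𝟙 x.dom)) (repOne ⟨x.dom, x.arr ≫ f⟩) (Category.comp_id _)
        (Category.comp_id _) := by
  refine res_ext (Category.id_comp _) (Category.id_comp _) ?_
  refine (lift_paste _ _ _ _ _ _ _ _ (Category.id_comp _) (Category.id_comp _)).trans
    (Eq.trans ?_ (lift_paste (.nil (𝟙 x.dom)) _ _ _ _ _ _ _ (Category.id_comp _)
      (Category.id_comp _)).symm)
  rw [nil_id_paste]
  have h₁ := pasteAssoc (IsPaste.single (.single (repOne x)) (resCell x.arr x.arr (unit A))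
    (Category.id_comp _) (Category.id_comp _)) (unitMap f) rfl rfl (Category.id_comp _)
    (Category.id_comp _) rfl rfl
  rw [repOne, resLift_paste] at h₁
  have h₂ := pasteAssoc (IsPaste.single (.nil x.arr) (unitCell A)
    (Category.comp_id _) (Category.comp_id _)) (unitMap f) (Category.id_comp _)
    (Category.id_comp _) rfl rfl rfl rfl
  rw [eta_unitMap] at h₂
  exact h₁.trans (h₂.symm.trans (pasteAssoc (.nil rfl) (unitCell B) _ _ _ _))

theorem repHom_mul (f : A ⟶ B) (x y y' : RepObj A) :
    paste (.single (repLact (unit A) x y y')) (repHom f x y') (Category.id_comp _)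
      (Category.id_comp _) =
    paste (.pair (repHom f x y) (repHom f y y')) (repLact (unit B) ⟨x.dom, x.arr ≫ f⟩
      ⟨y.dom, y.arr ≫ f⟩ ⟨y'.dom, y'.arr ≫ f⟩) (Category.comp_id _) (Category.comp_id _) := by
  refine res_ext (Category.id_comp _) (Category.id_comp _) ?_
  refine (lift_paste _ _ _ _ _ _ _ _ (Category.id_comp _) (Category.id_comp _)).trans
    (Eq.trans ?_ (lift_paste _ _ _ _ _ _ _ _ (Category.id_comp _) (Category.id_comp _)).symm)
  have h₁ := pasteAssoc (IsPaste.single (.single (repLact (unit A) x y y'))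
    (resCell x.arr y'.arr (unit A)) (Category.id_comp _) (Category.id_comp _)) (unitMap f) rfl rfl
    (Category.id_comp _) (Category.id_comp _) rfl rfl
  have h₂ := pasteAssoc (IsPaste.cons₁ (α := repHom f x y) (ho := rfl) (hp := rfl)
    (β := resCell (x.arr ≫ f) (y.arr ≫ f) (unit B)) (Category.id_comp _) (Category.id_comp _)
    (.single (.single (repHom f y y')) (resCell (y.arr ≫ f) (y'.arr ≫ f) (unit B))
      (Category.id_comp _) (Category.id_comp _)))
    (lam (unit B)) (Category.comp_id _) (Category.comp_id _) (Category.id_comp _)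
    (Category.id_comp _) (Category.comp_id _) (Category.comp_id _)
  rw [repLact, resLift_paste] at h₁
  rw [repHom, repHom, resLift_paste, resLift_paste] at h₂
  have h₃ := pasteAssoc (IsPaste.single (.pair (resCell x.arr y.arr (unit A))
    (resCell y.arr y'.arr (unit A))) (lam (unit A)) (Category.comp_id _) (Category.comp_id _))
    (unitMap f) (Category.id_comp _) (Category.id_comp _) rfl rfl rfl rfl
  have h₄ := pasteAssoc (IsPaste.cons₁ (α := resCell x.arr y.arr (unit A)) (ho := rfl) (hp := rfl)
    (β := unitMap f) rfl rfl (.single (.single (resCell y.arr y'.arr (unit A))) (unitMap f)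
    rfl rfl)) (lam (unit B)) (Category.comp_id _) (Category.comp_id _) rfl rfl
    (Category.comp_id _) (Category.comp_id _)
  refine h₁.trans (h₃.symm.trans (Eq.trans ?_ (h₄.trans h₂.symm)))
  exact congrArg (fun z => paste _ z rfl rfl) (unitMap_lam f)

end Rep

end VirtualDoubleCategory

section Embedding

variable {E : Type u} [VirtualDoubleCategory.{z, w, v} E] [IsVirtualEquipment E]

/-- The enriched category `|A|`: its objects are the arrows with codomain `A`, an arrow having its
domain as extent, and `|A|(x, y)` is the restriction of the unit of `A` along `x` and `y`. -/
noncomputable def repCat (A : E) : EnrCat.{max u v} E where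
  Obj := RepObj A
  ext x := x.dom
  hom x y := res x.arr y.arr (unit A)
  one := repOne
  mul := repLact (unit A)
  one_mul := rep_one_lact (unit A)
  mul_one x y := by
    rw [repLact_unit]
    exact rep_ract_one (unit A) x y
  mul_assoc := fun x₀ x₁ x₂ x₃ =>
    rep_assoc (f₀ := RepObj.arr x₀) (f₁ := RepObj.arr x₁) (f₂ := RepObj.arr x₂)
      (f₃ := RepObj.arr x₃) (lam_lam (unit A))

/-- The profunctor `|J|`, with `|J|(x, y)` the restriction of `J` along `x` and `y`. -/
noncomputable def repPro {A B : E} (J : Pro A B) : EnrProfunctor (repCat A) (repCat B) where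
  obj x y := res x.arr y.arr J
  lact := repLact J
  ract := repRact J
  one_lact := rep_one_lact J
  ract_one := rep_ract_one J
  mul_lact := fun x₀ x₁ x₂ x₃ =>
    rep_assoc (f₀ := RepObj.arr x₀) (f₁ := RepObj.arr x₁) (f₂ := RepObj.arr x₂)
      (f₃ := RepObj.arr x₃) (lam_lam J)
  ract_mul := fun x₀ x₁ x₂ x₃ =>
    rep_assoc (f₀ := RepObj.arr x₀) (f₁ := RepObj.arr x₁) (f₂ := RepObj.arr x₂)
      (f₃ := RepObj.arr x₃) (rho_rho J)
  lact_ract := fun x₀ x₁ x₂ x₃ =>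
    rep_assoc (f₀ := RepObj.arr x₀) (f₁ := RepObj.arr x₁) (f₂ := RepObj.arr x₂)
      (f₃ := RepObj.arr x₃) (lam_rho J)

/-- The functor `|f|`, which sends an arrow to its composite with `f`. -/
noncomputable def repFun {A B : E} (f : A ⟶ B) : repCat A ⟶ repCat B where
  obj x := ⟨x.dom, x.arr ≫ f⟩
  arr x := 𝟙 x.dom
  hom := repHom f
  map_one := repHom_one f
  map_mul := repHom_mul f

end Embedding

namespace VirtualDoubleCategory

section UnitPair

variable {V : Type u} [VirtualDoubleCategory.{z, w, v} V]
  {X X' X'' Y Y' Y'' Z Z' Z'' W W' : V}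

theorem IsPaste.consEq {o : HPath X X'} {o' : HPath X' X''} {o'' : HPath X X''} {J : Pro Y Y'}
    {p' : HPath Y' Y''} {q : HPath Z' Z''} {K : Pro Z Z'}
    {f : X ⟶ Y} {g : X' ⟶ Y'} {k : X'' ⟶ Y''} {f' : Y ⟶ Z} {g' : Y' ⟶ Z'} {k' : Y'' ⟶ Z''}
    {f'' : X ⟶ Z} {g'' : X' ⟶ Z'} {k'' : X'' ⟶ Z''} {α : Cell o f g J}
    {ρ : Row o' g k p'} {β : Cell (.cons J (.nil Y')) f' g' K} {σ : Row p' g' k' q}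
    {τ : Row o' g'' k'' q} (hf : f ≫ f' = f'') (hg : g ≫ g' = g'')
    {ho : o'' = o.append o'} {hp : ProPath.cons J p' = (ProPath.cons J (.nil Y')).append p'}
    {γ : Cell o f'' g'' K} (e : paste (.single α) β hf hg = γ)
    (h : IsPaste ρ σ τ) :
    IsPaste (.cons ho α ρ) (.cons hp β σ) (.cons ho γ τ) :=
  e ▸ .cons₁ hf hg h

variable [IsVirtualEquipment V]

/-- Two rows which both cancel the insertion of a unit in the middle of a string. -/
inductive UnitPair : ∀ {X Y : V} {p o : HPath X Y}, Row o (𝟙 X) (𝟙 Y) p →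
    Row o (𝟙 X) (𝟙 Y) p → Prop
  | mk {X Y A : V} (k : HPath X A) (q : HPath A Y)
      {i i' : Row (k.append (.cons (unit A) q)) (𝟙 X) (𝟙 Y) (k.append q)}
      (h : IsPaste (whisker (unitCell A) k q) i (idRow _))
      (h' : IsPaste (whisker (unitCell A) k q) i' (idRow _)) : UnitPair i i'

theorem UnitPair.cons (L : Pro Z X) {p o : HPath X Y} {i i' : Row o (𝟙 X) (𝟙 Y) p}
    (h : UnitPair i i') : UnitPair (p := .cons L p) (o := .cons L o)
      (.cons (by rfl) (cellId L) i) (.cons (by rfl) (cellId L) i') := by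
  cases h with
  | mk k q h h' => exact .mk (.cons L k) q (.cons_id h) (.cons_id h')

theorem UnitPair.paste_eq {p o : HPath X Y} {i i' : Row o (𝟙 X) (𝟙 Y) p} (h : UnitPair i i')
    {f : X ⟶ Z} {g : Y ⟶ W} {K : Pro Z W} (α : Cell p f g K) :
    paste i α (Category.id_comp _) (Category.id_comp _) =
      paste i' α (Category.id_comp _) (Category.id_comp _) := by
  cases h with
  | mk k q h h' =>
    refine unit_ext k q ?_
    exact (pasteAssoc h α (Category.id_comp _) (Category.id_comp _) (Category.id_comp _)
      (Category.id_comp _)).trans (pasteAssoc h' α (Category.id_comp _) (Category.id_comp _)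
      (Category.id_comp _) (Category.id_comp _)).symm

theorem UnitPair.here (J : Pro X Y) (J' : Pro Y Z) (p : HPath Z W) :
    UnitPair (p := .cons J (.cons J' p)) (o := .cons J (.cons (unit Y) (.cons J' p)))
      (.cons (by rfl) (cellId J) (.cons (by rfl) (lam J') (idRow p)))
      (.cons (by rfl) (rho J) (.cons (by rfl) (cellId J') (idRow p))) := by
  refine .mk (.cons J (.nil Y)) (.cons J' p) ?_ ?_
  · have h := IsPaste.cons₂ (α₀ := unitCell Y) (α := cellId J') (β := lam J')
      (ho₂ := rfl) (ho := rfl) (ho' := rfl) (hp := rfl) (Category.comp_id _) (Category.comp_id _)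
      (.id_right (idRow p))
    have e := eta_lam J'
    rw [e] at h
    exact .cons_id h
  · have h := IsPaste.cons₂ (α₀ := cellId J) (α := unitCell Y) (β := rho J)
      (ho₂ := rfl) (ho := rfl) (ho' := rfl) (hp := rfl) (Category.comp_id _) (Category.comp_id _)
      (.id_right (idRow (.cons J' p)))
    have e := eta_rho J
    rw [e] at h
    exact h

end UnitPair

end VirtualDoubleCategory

section Chains

variable {E : Type u} [VirtualDoubleCategory.{z, w, v} E]

/-- Case distinction for lists of objects over an empty string. -/
def Chain.elimNil {C : EnrCat.{t} E} {motive : ∀ {a b : C.Obj}, Chain (.nil C) a b → Sort*}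
    (h : ∀ a : C.Obj, motive (.nil a)) : ∀ {a b : C.Obj} (c : Chain (.nil C) a b), motive c
  | _, _, .nil a => h a

/-- Case distinction for lists of objects over a nonempty string. -/
def Chain.elimCons {C D D' : EnrCat.{t} E} {J : EnrProfunctor C D} {p : ProfPath D D'} {a : C.Obj}
    {d : D'.Obj} {motive : Chain (.cons J p) a d → Sort*}
    (h : ∀ {b : D.Obj} (c : Chain p b d), motive (.cons a c)) : ∀ c, motive c
  | .cons _ c => h c

theorem Chain.exists_cons {C D D' : EnrCat.{t} E} {J : EnrProfunctor C D}
    {p : ProfPath D D'} {a : C.Obj} {d : D'.Obj} (c : Chain (.cons J p) a d) :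
    ∃ (b : D.Obj) (c' : Chain p b d), c = .cons a c' := by
  cases c
  exact ⟨_, _, rfl⟩

theorem Chain.cons_heq {C D D' : EnrCat.{t} E} {J : EnrProfunctor C D} {p p' : ProfPath D D'}
    (hp : p = p') (a : C.Obj) {b : D.Obj} {d : D'.Obj} {c : Chain p b d} {c' : Chain p' b d}
    (h : HEq c c') : HEq (Chain.cons (J := J) a c) (Chain.cons (J := J) a c') := by
  subst hp
  obtain rfl := eq_of_heq h
  rfl

theorem RepObj.mk_congr {A : E} {X : E} {f g : X ⟶ A} (h : f = g) : RepObj.mk X f = ⟨X, g⟩ := by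
  rw [h]

end Chains

section Embedding

variable {E : Type u} [VirtualDoubleCategory.{z, w, v} E] [IsVirtualEquipment E]

/-- The string `|J₁|, …, |Jₖ|`. -/
noncomputable abbrev repPath {A B : E} (p : HPath A B) : ProfPath (repCat A) (repCat B) :=
  p.map repCat (fun _ _ J => repPro J)

/-- The row of cartesian cells from `|J₁|(x₀, x₁), …, |Jₖ|(xₖ₋₁, xₖ)` to `J₁, …, Jₖ`. -/
noncomputable def cartRow : ∀ {A B : E} (p : HPath A B) {x : (repCat A).Obj} {y : (repCat B).Obj}
    (c : Chain (repPath p) x y), Row c.path (RepObj.arr x) (RepObj.arr y) p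
  | _, _, .nil A, x, y, c =>
      @Chain.elimNil E _ (repCat A)
        (fun {x y} c => Row c.path (RepObj.arr x) (RepObj.arr y) (.nil A))
        (fun x => .nil (RepObj.arr x)) x y c
  | _, _, .cons J p, x, y, c =>
      Chain.elimCons (J := repPro J) (p := repPath p)
        (motive := fun c => Row c.path (RepObj.arr x) (RepObj.arr y) (.cons J p))
        (fun {b} c => .cons (by rfl) (resCell (RepObj.arr x) (RepObj.arr b) J) (cartRow p c)) c

/-- The components of `|α|`. -/
noncomputable def repApp {A B A' B' : E} {p : HPath A B} {f : A ⟶ A'} {g : B ⟶ B'} {K : Pro A' B'}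
    (α : Cell p f g K) : ChainFamily (repPath p) (repFun f) (repFun g) (repPro K) :=
  fun _ _ c => resLift (paste (cartRow p c) α rfl rfl) (Category.id_comp _) (Category.id_comp _)

theorem resCell_repLact {A B : E} (J : Pro A B) (x x' : RepObj A) (y : RepObj B) :
    paste (.single (repLact J x x' y)) (resCell x.arr y.arr J) (Category.id_comp _)
      (Category.id_comp _) = paste (.pair (resCell x.arr x'.arr (unit A)) (resCell x'.arr y.arr J))
        (lam J) (Category.comp_id _) (Category.comp_id _) :=
  resLift_paste _ _ _

theorem resCell_repRact {A B : E} (J : Pro A B) (x : RepObj A) (y y' : RepObj B) :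
    paste (.single (repRact J x y y')) (resCell x.arr y'.arr J) (Category.id_comp _)
      (Category.id_comp _) = paste (.pair (resCell x.arr y.arr J) (resCell y.arr y'.arr (unit B)))
        (rho J) (Category.comp_id _) (Category.comp_id _) :=
  resLift_paste _ _ _

theorem resCell_id {X X' Y Y' : E} (f : X ⟶ Y) (g : X' ⟶ Y') (J : Pro Y Y') :
    paste (.single (cellId _)) (resCell f g J) (Category.id_comp _) (Category.id_comp _) =
      resCell f g J :=
  ids_paste _

theorem rep_inner : ∀ {A B : E} (p : HPath A B) {x : (repCat A).Obj} {y : (repCat B).Obj}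
    {o : HPath x.dom y.dom} {s s' : ChainRow o (repPath p) x y (𝟙 _) (𝟙 _)}
    (_ : InnerActions (p := repPath p) o s s'),
    ∃ (q : HPath A B) (m : Row o x.arr y.arr q) (i i' : Row q (𝟙 A) (𝟙 B) p)
      (t t' : Row o x.arr y.arr p), UnitPair i i' ∧ IsPaste s.row (cartRow p s.chain) t ∧
        IsPaste s'.row (cartRow p s'.chain) t' ∧ IsPaste m i t ∧ IsPaste m i' t'
  | _, _, .nil A, _, _, _, _, _, h => nomatch h
  | _, _, .cons J (.nil _), _, _, _, _, _, h => by
      change InnerActions (p := .cons (repPro J) (.nil _)) _ _ _ at h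
      cases h with
      | cons _ h => cases h
  | A, B, .cons J (.cons J' p), x, y, o, s, s', h => by
      refine InnerActions.elim (J := repPro J) (J₁ := repPro J') (p := repPath p)
        (motive := fun o s s' => ∃ (q : HPath A B) (m : Row o x.arr y.arr q)
          (i i' : Row q (𝟙 A) (𝟙 B) (.cons J (.cons J' p)))
          (t t' : Row o x.arr y.arr (.cons J (.cons J' p))), UnitPair i i' ∧
          IsPaste s.row (cartRow (.cons J (.cons J' p)) s.chain) t ∧
          IsPaste s'.row (cartRow (.cons J (.cons J' p)) s'.chain) t' ∧ IsPaste m i t ∧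
          IsPaste m i' t') ?_ ?_ h
      · intro d d' e c
        have e₁ := resCell_repLact J' d d' e
        have e₂ := resCell_repRact J x d d'
        have e₃ := resCell_id (RepObj.arr x) (RepObj.arr d) J
        have e₄ := resCell_id (RepObj.arr d') (RepObj.arr e) J'
        refine ⟨_, .cons (by rfl) (resCell (RepObj.arr x) (RepObj.arr d) J) (.cons (by rfl)
          (resCell (RepObj.arr d) (RepObj.arr d') (unit _)) (.cons (by rfl)
          (resCell (RepObj.arr d') (RepObj.arr e) J') (cartRow p c))), _, _, _, _, .here J J' p,
          .consEq _ _ e₃ (.consEq _ _ e₁ (.id_left _)),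
          .consEq _ _ e₂ (.consEq _ _ e₄ (.id_left _)), ?_, ?_⟩
        · exact .cons_id (.cons₂ _ _ (.id_right _))
        · exact .cons₂ _ _ (.cons_id (.id_right _))
      · intro d o s s' h
        obtain ⟨q, m, i, i', t, t', h₁, h₂, h₃, h₄, h₅⟩ := rep_inner (.cons J' p) h
        have e₃ := resCell_id (RepObj.arr x) (RepObj.arr d) J
        exact ⟨.cons J q, .cons (by rfl) (resCell (RepObj.arr x) (RepObj.arr d) J) m, _, _, _, _,
          .cons J h₁, .consEq _ _ e₃ h₂, .consEq _ _ e₃ h₃, .cons_id h₄, .cons_id h₅⟩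

end Embedding

namespace VirtualDoubleCategory

theorem paste_two {V : Type u} [VirtualDoubleCategory.{z, w, v} V] {X X' X'' Y Y' Y'' Z Z' Z'' W W'' : V}
    {o : HPath X X'} {o' : HPath X' X''} {o'' : HPath X X''} {J : Pro Y Y'}
    {J' : Pro Y' Y''} {K : Pro Z Z'} {K' : Pro Z' Z''} {L : Pro W W''} {f : X ⟶ Y} {g : X' ⟶ Y'}
    {h : X'' ⟶ Y''} {f' : Y ⟶ Z} {g' : Y' ⟶ Z'} {h' : Y'' ⟶ Z''} {f'' : X ⟶ Z} {g'' : X' ⟶ Z'}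
    {h'' : X'' ⟶ Z''} {k : Z ⟶ W} {l : Z'' ⟶ W''} {k' : Y ⟶ W} {l' : Y'' ⟶ W''} {k'' : X ⟶ W}
    {l'' : X'' ⟶ W''} {α : Cell o f g J} {α' : Cell o' g h J'}
    {β : Cell (.cons J (.nil Y')) f' g' K} {β' : Cell (.cons J' (.nil Y'')) g' h' K'}
    {γ : Cell o f'' g'' K} {γ' : Cell o' g'' h'' K'}
    {hf : f ≫ f' = f''} {hg : g ≫ g' = g''} {hh : h ≫ h' = h''}
    (e : paste (.single α) β hf hg = γ) (e' : paste (.single α') β' hg hh = γ')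
    (ho : o'' = o.append o') (δ : Cell (.cons K (.cons K' (.nil Z''))) k l L)
    (h₁ : f' ≫ k = k') (h₂ : h' ≫ l = l') (h₃ : f ≫ k' = k'') (h₄ : h ≫ l' = l'')
    (h₅ : f'' ≫ k = k'') (h₆ : h'' ≫ l = l'') :
    paste (.cons ho α (.single α')) (paste (.pair β β') δ h₁ h₂) h₃ h₄ =
      paste (.cons ho γ (.single γ')) δ h₅ h₆ := by
  subst e e'
  exact paste_assoc δ (IsPaste.cons₁ hf hg (IsPaste.cons₁ hg hh (.nil hh))) h₁ h₂ h₃ h₄ h₅ h₆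

end VirtualDoubleCategory

section Embedding

variable {E : Type u} [VirtualDoubleCategory.{z, w, v} E] [IsVirtualEquipment E]

theorem resCell_repHom {A B : E} (f : A ⟶ B) (x y : RepObj A) :
    paste (.single (repHom f x y)) (resCell (x.arr ≫ f) (y.arr ≫ f) (unit B)) (Category.id_comp _)
      (Category.id_comp _) =
    paste (.single (resCell x.arr y.arr (unit A))) (unitMap f) rfl rfl :=
  resLift_paste _ _ _

theorem resCell_repApp {A B A' B' : E} {p : HPath A B} {f : A ⟶ A'} {g : B ⟶ B'} {K : Pro A' B'}
    (α : Cell p f g K) {x : (repCat A).Obj} {y : (repCat B).Obj} (c : Chain (repPath p) x y) :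
    paste (.single (repApp α c)) (resCell (RepObj.arr x ≫ f) (RepObj.arr y ≫ g) K)
      (Category.id_comp _) (Category.id_comp _) = paste (cartRow p c) α rfl rfl :=
  resLift_paste _ _ _

/-- The composite of a member of the family `repApp α` with a row and a cartesian cell. -/
theorem app_repApp {A B A' B' X X' : E} {p : HPath A B} {f : A ⟶ A'} {g : B ⟶ B'} {K : Pro A' B'}
    (α : Cell p f g K) {x : (repCat A).Obj} {y : (repCat B).Obj} {o : HPath X X'}
    {h : X ⟶ (repCat A).ext x} {k : X' ⟶ (repCat B).ext y} (s : ChainRow o (repPath p) x y h k)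
    {h' : X ⟶ A} {k' : X' ⟶ B} {t : Row o h' k' p} (ht : IsPaste s.row (cartRow p s.chain) t)
    {l : X ⟶ A'} {m : X' ⟶ B'}
    (e : (h ≫ 𝟙 _) ≫ RepObj.arr x ≫ f = l) (e' : (k ≫ 𝟙 _) ≫ RepObj.arr y ≫ g = m)
    (e₁ : h' ≫ f = l) (e₁' : k' ≫ g = m) :
    paste (.single (s.app (repApp α))) (resCell (RepObj.arr x ≫ f) (RepObj.arr y ≫ g) K) e e' =
      paste t α e₁ e₁' := by
  have h₁ := ht.left
  have h₂ := ht.right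
  subst h₁ h₂ e₁ e₁'
  refine (lift_paste s.row _ _ _ _ _ _ _ (Category.assoc _ _ _).symm (Category.assoc _ _ _).symm).trans ?_
  exact pasteAssoc ht α _ _ _ _ rfl rfl

theorem repApp_left : ∀ {A B A' B' : E} {p : HPath A B} {f : A ⟶ A'} {g : B ⟶ B'} {K : Pro A' B'}
    (α : Cell p f g K), LeftLaw (repPath p) (repFun f) (repFun g) (repPro K) (repApp α)
  | A, _, A', B', .nil _, f, g, K, α => fun x x' => by
      refine res_ext (f := RepObj.arr x ≫ f) (g := RepObj.arr x' ≫ g) (Category.id_comp _) (Category.id_comp _) ?_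
      refine (lift_paste _ _ _ _ _ _ _ _ (Category.id_comp _) (Category.id_comp _)).trans
        (Eq.trans ?_ (lift_paste _ _ _ _ _ _ _ _ (Category.id_comp _) (Category.id_comp _)).symm)
      have h₁ := paste_two (resCell_repHom f x x') (resCell_repApp α (.nil x')) (by rfl) (lam K)
        (Category.comp_id _) (Category.comp_id _) (Category.id_comp _)
        (Category.id_comp _) (Category.comp_id _) (Category.comp_id _)
      have h₂ := paste_two (resCell_repApp α (.nil x)) (resCell_repHom g x x') (by rfl) (rho K)
        (Category.comp_id _) (Category.comp_id _) (Category.id_comp _)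
        (Category.id_comp _) (Category.comp_id _) (Category.comp_id _)
      have h₃ := pasteAssoc (IsPaste.cons₁ (α := resCell x.arr x'.arr (unit A)) (ho := rfl)
        (hp := rfl) (β := unitMap f) rfl rfl (.single (.nil x'.arr) α rfl rfl)) (lam K)
        (Category.comp_id _) (Category.comp_id _) rfl rfl (Category.comp_id _) (Category.comp_id _)
      have h₄ := pasteAssoc (IsPaste.cons₀ (α := α) (ho := rfl)
        (hp := rfl) rfl rfl (.single (.single (resCell x.arr x'.arr (unit A))) (unitMap g) rfl rfl))
        (rho K)
        (Category.comp_id _) (Category.comp_id _) rfl rfl (Category.comp_id _) (Category.comp_id _)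
      refine h₁.trans (h₃.symm.trans (Eq.trans ?_ (h₄.trans h₂.symm)))
      exact congrArg (fun z => paste _ z rfl rfl) (unitMap_nat α)
  | A, B, A', B', .cons J p, f, g, K, α => fun x x' {b y} c => by
      refine res_ext (f := RepObj.arr x ≫ f) (g := RepObj.arr y ≫ g) (f' := RepObj.arr x ≫ f)
        (g' := RepObj.arr y ≫ g) ((congrArg (· ≫ _) (Category.comp_id _)).trans (Category.id_comp _))
        ((congrArg (· ≫ _) (Category.comp_id _)).trans (Category.id_comp _)) ?_
      refine (app_repApp α _ (.consEq _ _ (resCell_repLact J x x' b) (.id_left _)) _ _ rfl rfl).trans ?_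
      refine Eq.trans ?_ (lift_paste _ _ _ _ _ _ _ _ (Category.id_comp _) (Category.id_comp _)).symm
      have h₁ := paste_two (resCell_repHom f x x') (resCell_repApp α (.cons (J := repPro J) x' c))
        (by rfl) (lam K)
        (Category.comp_id _) (Category.comp_id _) (Category.id_comp _)
        (Category.id_comp _) (Category.comp_id _) (Category.comp_id _)
      refine Eq.trans ?_ h₁.symm
      have h₂ := pasteAssoc (IsPaste.cons₁ (α := resCell x.arr x'.arr (unit A)) (ho := rfl)
        (hp := rfl) (β := unitMap f) rfl rfl (.single (cartRow (.cons J p) (.cons (J := repPro J) x' c)) α rfl rfl)) (lam K)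
        (Category.comp_id _) (Category.comp_id _) rfl rfl (Category.comp_id _) (Category.comp_id _)
      refine Eq.trans ?_ h₂
      have h₃ := pasteAssoc (IsPaste.cons₂ (α₀ := resCell x.arr x'.arr (unit A)) (α := resCell x'.arr (RepObj.arr b) J) (ho₂ := rfl) (ho := rfl)
        (ho' := rfl)
        (hp := rfl) (β := lam J) (Category.comp_id _) (Category.comp_id _) (.id_right (cartRow p c))) α
        (Category.id_comp _) (Category.id_comp _) rfl rfl rfl rfl
      refine h₃.symm.trans ?_
      exact congrArg (fun z => paste _ z rfl rfl) (lam_paste α)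

theorem rep_right : ∀ {A B : E} (p : HPath A B) {x : (repCat A).Obj} {y : (repCat B).Obj}
    (c : Chain (repPath p) x y) (y' : (repCat B).Obj) {s} (_ : RightAction c y' s),
    ∃ (t : Row (c.path.append (.cons ((repCat B).hom y y') (.nil _))) x.arr y'.arr p)
      (ρ : Row (p.append (.cons (unit B) (.nil B))) (𝟙 A) (𝟙 B) p),
      IsPaste s.row (cartRow p s.chain) t ∧
        IsPaste ((cartRow p c).append rfl rfl (.single (resCell y.arr y'.arr (unit B)))) ρ t ∧
        IsPaste (etaRight p) ρ (idRow p)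
  | _, _, .nil _, _, _, _, _, _, h => nomatch h
  | A, B, .cons J (.nil _), x, y, c, y', s, h => by
      change RightAction (p := .cons (repPro J) (.nil _)) _ _ _ at h
      cases h with
      | cons _ h => nomatch h
      | last =>
        refine ⟨_, .single (rho J), .consEq _ _ (resCell_repRact J x y y') (.nil (Category.id_comp _)),
          .cons₂ (Category.comp_id _) (Category.comp_id _) (.nil (Category.comp_id _)), ?_⟩
        have h := IsPaste.single (.pair (cellId J) (unitCell B)) (rho J) (Category.comp_id _)
          (Category.comp_id _)
        rw [eta_rho] at h
        exact h
  | A, B, .cons J (.cons J' p), x, y, c, y', s, h => by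
      obtain ⟨b, c, rfl⟩ := Chain.exists_cons (J := repPro J) (p := repPath (.cons J' p)) c
      obtain ⟨s', h', rfl⟩ := RightAction.cons_inv (p := repPath (.cons J' p)) trivial h
      obtain ⟨t, ρ, h₁, h₂, h₃⟩ := rep_right (.cons J' p) c y' h'
      exact ⟨_, .cons (by rfl) (cellId J) ρ, .consEq _ _ (resCell_id x.arr (RepObj.arr b) J) h₁,
        .cons_id h₂, .cons_id h₃⟩

/-- The morphism of profunctors `|α|`. -/
noncomputable def repCell {A B A' B' : E} {p : HPath A B} {f : A ⟶ A'} {g : B ⟶ B'} {K : Pro A' B'}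
    (α : Cell p f g K) : EnrMorphism (repPath p) (repFun f) (repFun g) (repPro K) where
  app := repApp α
  inner {x y} o s s' h := by
    obtain ⟨q, m, i, i', t, t', h₁, h₂, h₃, h₄, h₅⟩ := rep_inner p h
    have e : ∀ {X Y : E} (f : X ⟶ Y), (𝟙 _ ≫ 𝟙 _) ≫ f = f := fun f => by simp
    refine res_ext (f := RepObj.arr x ≫ f) (g := RepObj.arr y ≫ g) (f' := RepObj.arr x ≫ f)
      (g' := RepObj.arr y ≫ g) (e _) (e _) ?_
    refine (app_repApp α _ h₂ _ _ rfl rfl).trans (Eq.trans ?_ (app_repApp α _ h₃ _ _ rfl rfl).symm)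
    have k₁ := pasteAssoc h₄ α (Category.id_comp _) (Category.id_comp _) rfl rfl rfl rfl
    have k₂ := pasteAssoc h₅ α (Category.id_comp _) (Category.id_comp _) rfl rfl rfl rfl
    rw [h₁.paste_eq] at k₁
    exact k₁.symm.trans k₂
  left := repApp_left α
  right {x y} c y' s h := by
    obtain ⟨t, ρ, h₁, h₂, h₃⟩ := rep_right p c y' h
    have e : ∀ {X Y : E} (f : X ⟶ Y), (𝟙 _ ≫ 𝟙 _) ≫ f = f := fun f => by simp
    refine res_ext (f := RepObj.arr x ≫ f) (g := RepObj.arr y' ≫ g) (f' := RepObj.arr x ≫ f)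
      (g' := RepObj.arr y' ≫ g) (e _) (e _) ?_
    refine (app_repApp α _ h₁ _ _ rfl rfl).trans ?_
    have k₁ := pasteAssoc h₂ α (Category.id_comp _) (Category.id_comp _) rfl rfl rfl rfl
    refine k₁.symm.trans ?_
    rw [rho_paste α h₃]
    refine Eq.trans ?_ (lift_paste _ _ _ _ _ _ _ _ (Category.id_comp _) (Category.id_comp _)).symm
    have k₂ := paste_two (resCell_repApp α c) (resCell_repHom g y y')
      rfl (rho K)
      (Category.comp_id _) (Category.comp_id _) (Category.id_comp _)
      (Category.id_comp _) (Category.comp_id _) (Category.comp_id _)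
    refine Eq.trans ?_ k₂.symm
    exact pasteAssoc (.cons rfl rfl rfl rfl (cartRow p c) α
      (IsPaste.single (.single (resCell y.arr y'.arr (unit B))) (unitMap g) rfl rfl)) _ _ _ _ _ _ _

end Embedding

namespace VirtualDoubleCategory

section Lift

variable {V : Type u} [VirtualDoubleCategory.{z, w, v} V] [IsVirtualEquipment V]
  {X X' Y Y' W W' : V}

theorem eq_resLift {f : X ⟶ Y} {g : X' ⟶ Y'} {K : Pro Y Y'} {p : HPath W W'} {h : W ⟶ X}
    {k : W' ⟶ X'} {f' : W ⟶ Y} {g' : W' ⟶ Y'} {β : Cell p h k (res f g K)} {α : Cell p f' g' K}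
    {hf : h ≫ f = f'} {hg : k ≫ g = g'} (e : paste (.single β) (resCell f g K) hf hg = α) :
    β = resLift α hf hg :=
  res_ext hf hg (e.trans (resLift_paste α hf hg).symm)

theorem resLift_congr {f₁ f₂ : X ⟶ Y} {g₁ g₂ : X' ⟶ Y'} {K : Pro Y Y'} {p : HPath W W'}
    {h₁ h₂ : W ⟶ X} {k₁ k₂ : W' ⟶ X'} {f₁' f₂' : W ⟶ Y} {g₁' g₂' : W' ⟶ Y'}
    {α₁ : Cell p f₁' g₁' K} {α₂ : Cell p f₂' g₂' K} {hf₁ : h₁ ≫ f₁ = f₁'} {hg₁ : k₁ ≫ g₁ = g₁'}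
    {hf₂ : h₂ ≫ f₂ = f₂'} {hg₂ : k₂ ≫ g₂ = g₂'} (hf : f₁ = f₂) (hg : g₁ = g₂) (hh : h₁ = h₂)
    (hk : k₁ = k₂) (h : HEq α₁ α₂) : HEq (resLift α₁ hf₁ hg₁) (resLift α₂ hf₂ hg₂) := by
  subst hf hg hh hk hf₁ hg₁ hf₂ hg₂
  rw [eq_of_heq h]

theorem cellId_eq_resLift (f : X ⟶ Y) (g : X' ⟶ Y') (K : Pro Y Y') :
    cellId (res f g K) = resLift (resCell f g K) (Category.id_comp f) (Category.id_comp g) :=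
  eq_resLift (ids_paste _)

end Lift

end VirtualDoubleCategory

section Chains

variable {E : Type u} [VirtualDoubleCategory.{z, w, v} E]

theorem castCell_app {C D C' D' : EnrCat.{t} E} {p : ProfPath C D} {F F' : C ⟶ C'} {G G' : D ⟶ D'}
    {K : EnrProfunctor C' D'} (hF : F = F') (hG : G = G') (α : EnrMorphism p F G K) {a : C.Obj}
    {b : D.Obj} (c : Chain p a b) :
    HEq (EnrMorphism.app (castCell (V := EnrCat.{t} E) hF hG α) c) (α.app c) := by
  subst hF hG
  rfl

end Chains

section Embedding

variable {E : Type u} [VirtualDoubleCategory.{z, w, v} E] [IsVirtualEquipment E]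

theorem repFun_id (A : E) : repFun (𝟙 A) = 𝟙 (repCat A) := by
  refine EnrFunctor.ext_heq (fun x => RepObj.mk_congr (Category.comp_id (RepObj.arr x))) (fun x => HEq.rfl) fun x y => ?_
  have e : HEq (repHom (𝟙 A) x y) (cellId (res (RepObj.arr x) (RepObj.arr y) (unit A))) := by
    rw [cellId_eq_resLift]
    refine resLift_congr (Category.comp_id _) (Category.comp_id _) rfl rfl ?_
    rw [unitMap_id]
    exact heq_paste_id _ _ _
  exact e

theorem repHom_comp {A B C : E} (f : A ⟶ B) (g : B ⟶ C) (x y : RepObj A) :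
    HEq (repHom (f ≫ g) x y) (paste (.single (repHom f x y))
      (repHom g ⟨x.dom, x.arr ≫ f⟩ ⟨y.dom, y.arr ≫ f⟩) rfl rfl) := by
  have h := lift_paste (.single (repHom f x y)) (paste (.single (resCell (x.arr ≫ f) (y.arr ≫ f)
    (unit B))) (unitMap g) rfl rfl) (Category.id_comp _) (Category.id_comp _) rfl rfl
    (m'' := (x.arr ≫ f) ≫ g) (n'' := (y.arr ≫ f) ≫ g) (by simp) (by simp) (by simp) (by simp)
  have h₁ := pasteAssoc (IsPaste.single (.single (repHom f x y))
    (resCell (x.arr ≫ f) (y.arr ≫ f) (unit B)) (Category.id_comp _) (Category.id_comp _))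
    (unitMap g) rfl rfl (k'' := (x.arr ≫ f) ≫ g) (l'' := (y.arr ≫ f) ≫ g) (by simp) (by simp)
    rfl rfl
  have h₂ := pasteAssoc (IsPaste.single (.single (resCell x.arr y.arr (unit A))) (unitMap f) rfl
    rfl) (unitMap g) rfl rfl (Category.assoc _ _ _).symm (Category.assoc _ _ _).symm rfl rfl
  rw [resCell_repHom, ← h₂, ← unitMap_comp f g rfl] at h₁
  have e := eq_resLift h
  rw [h₁] at e
  refine HEq.trans ?_ (heq_of_eq e.symm)
  exact resLift_congr (Category.assoc _ _ _).symm (Category.assoc _ _ _).symm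
    (Category.comp_id _).symm (Category.comp_id _).symm (heq_paste _ _ _ _ _ _)

theorem repFun_comp {A B C : E} (f : A ⟶ B) (g : B ⟶ C) :
    repFun (f ≫ g) = repFun f ≫ repFun g :=
  EnrFunctor.ext_heq (fun x => RepObj.mk_congr (Category.assoc (RepObj.arr x) _ _).symm)
    (fun _ => heq_of_eq (Category.comp_id _).symm) (repHom_comp f g)

variable (E) in
/-- The embedding on objects and arrows. -/
noncomputable def repFunctor : E ⥤ EnrCat.{max u v} E where
  obj := repCat
  map := repFun
  map_id := repFun_id
  map_comp := repFun_comp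

theorem rep_split : ∀ {A B C : E} (p : HPath A B) (r : HPath B C) {x : (repCat A).Obj}
    {y : (repCat C).Obj} (c : Chain (repPath (p.append r)) x y),
    ∃ (m : (repCat B).Obj) (c₁ : Chain (repPath p) x m) (c₂ : Chain (repPath r) m y)
      (_ : HEq c (c₁.append c₂)) (ho : c.path = c₁.path.append c₂.path),
      cartRow (p.append r) c = (cartRow p c₁).append ho rfl (cartRow r c₂)
  | _, _, _, .nil _, r, x, y, c => ⟨x, .nil x, c, HEq.rfl, rfl, rfl⟩
  | _, _, _, .cons J p, r, x, y, c => by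
      obtain ⟨b, c, rfl⟩ := Chain.exists_cons (J := repPro J) (p := repPath (p.append r)) c
      obtain ⟨m, c₁, c₂, h₁, ho, h₂⟩ := rep_split p r c
      have hp : repPath (p.append r) = (repPath p).append (repPath r) := ProPath.map_append _ _ _ _
      refine ⟨m, .cons (J := repPro J) x c₁, c₂, Chain.cons_heq hp x h₁, congrArg (ProPath.cons _) ho, ?_⟩
      have h₃ := append_cons (p'' := p.append r) (by rfl) (congrArg (ProPath.cons _) ho) (by rfl) (by rfl) ho rfl
        (resCell x.arr (RepObj.arr b) J) (cartRow p c₁) (cartRow r c₂)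
      refine Eq.trans ?_ h₃.symm
      rw [← h₂]
      rfl

theorem rep_evalRow {A B A' B' : E} {p : HPath A B} {q : HPath A' B'} {f : A ⟶ A'} {g : B ⟶ B'}
    (ρ : Row p f g q) {x : (repCat A).Obj} {y : (repCat B).Obj} (c : Chain (repPath p) x y) :
    ∃ t : Row c.path (RepObj.arr x ≫ f) (RepObj.arr y ≫ g) q,
      IsPaste (evalRow (ρ.map (C' := fun _ _ _ _ => EnrMorphism) (repFunctor E)
          (fun _ _ J => repPro J) (fun _ _ _ _ _ _ _ _ => repCell)) c).row
        (cartRow q (evalRow (ρ.map (C' := fun _ _ _ _ => EnrMorphism) (repFunctor E)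
          (fun _ _ J => repPro J) (fun _ _ _ _ _ _ _ _ => repCell)) c).chain) t ∧
      IsPaste (cartRow p c) ρ t := by
  induction ρ with
  | nil f =>
    cases c
    exact ⟨_, .nil (Category.id_comp _), .nil rfl⟩
  | @cons _ _ _ _ _ _ p r s f g k K q h α ρ ih =>
    subst h
    obtain ⟨m, c₁, c₂, h₁, ho, h₂⟩ := rep_split p r c
    obtain ⟨t, h₃, h₄⟩ := ih c₂
    have e := evalRow_cons (ProPath.map_append _ _ p r) (repCell α) (ρ.map (C' := fun _ _ _ _ => EnrMorphism)
      (repFunctor E) (fun _ _ J => repPro J) (fun _ _ _ _ _ _ _ _ => repCell)) c c₁ c₂ h₁ ho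
    refine ⟨.cons ho (paste (cartRow p c₁) α rfl rfl) t, ?_, ?_⟩
    · exact e.symm.subst (motive := fun u => IsPaste u.row (cartRow (.cons K q) u.chain) _)
        (IsPaste.consEq _ _ (resCell_repApp α c₁) h₃)
    · rw [h₂]
      exact .cons ho rfl rfl rfl (cartRow p c₁) α h₄

theorem repCell_id {A B : E} (J : Pro A B) :
    castCell (V := EnrCat.{max u v} E) (repFun_id A) (repFun_id B) (repCell (cellId J)) =
      EnrMorphism.idCell (repPro J) :=
  EnrMorphism.eq_of_app fun {x y} c => by
    refine (castCell_app _ _ _ c).trans ?_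
    obtain ⟨_, c, rfl⟩ := Chain.exists_cons (J := repPro J) c
    cases c
    have e : HEq (resLift (paste (.single (resCell (RepObj.arr x) (RepObj.arr y) J)) (cellId J) rfl rfl)
        (Category.id_comp _) (Category.id_comp _))
        (cellId (res (RepObj.arr x) (RepObj.arr y) J)) := by
      rw [cellId_eq_resLift]
      exact resLift_congr (Category.comp_id _) (Category.comp_id _) rfl rfl (heq_paste_id _ _ _)
    exact e

theorem repCell_paste {X X' Y Y' Z Z' : E} {p : HPath X X'} {q : HPath Y Y'} {K : Pro Z Z'}
    {f : X ⟶ Y} {g : X' ⟶ Y'} {f' : Y ⟶ Z} {g' : Y' ⟶ Z'} {f'' : X ⟶ Z} {g'' : X' ⟶ Z'}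
    (ρ : Row p f g q) (β : Cell q f' g' K) (hf : f ≫ f' = f'') (hg : g ≫ g' = g'') :
    repCell (paste ρ β hf hg) = EnrMorphism.vpaste (ρ.map (C' := fun _ _ _ _ => EnrMorphism)
      (repFunctor E) (fun _ _ J => repPro J) (fun _ _ _ _ _ _ _ _ => repCell)) (repCell β)
      ((repFun_comp f f').symm.trans (congrArg repFun hf))
      ((repFun_comp g g').symm.trans (congrArg repFun hg)) :=
  EnrMorphism.eq_of_app fun {x y} c => by
    subst hf hg
    refine HEq.trans ?_ (EnrMorphism.vpaste_app _ _ _ _ c).symm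
    obtain ⟨t, h₁, h₂⟩ := rep_evalRow ρ c
    have e₀ : ∀ {X Y : E} (f : X ⟶ Y), (𝟙 _ ≫ 𝟙 _) ≫ f = f := fun f => by simp
    have e := app_repApp β _ h₁ (l := (RepObj.arr x ≫ f) ≫ f') (m := (RepObj.arr y ≫ g) ≫ g')
      (e₀ _) (e₀ _) rfl rfl
    refine HEq.trans ?_ (heq_of_eq (eq_resLift e).symm)
    refine resLift_congr (Category.assoc _ _ _).symm (Category.assoc _ _ _).symm
      (Category.comp_id _).symm (Category.comp_id _).symm ?_
    have h := pasteAssoc h₂ β rfl rfl (Category.assoc _ _ _).symm (Category.assoc _ _ _).symm rfl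
      rfl
    exact (heq_paste _ _ _ _ _ _).trans (heq_of_eq h)

variable (E) in
/-- The canonical embedding `|·|` of a virtual equipment into the virtual double category of
categories enriched in it. -/
noncomputable def canonicalEmbedding : VDFunctor E (EnrCat.{max u v} E) where
  toFunctor := repFunctor E
  proMap := fun _ _ J => repPro J
  cellMap := fun _ _ _ _ _ _ _ _ α => repCell α
  cellMap_id := repCell_id
  cellMap_paste := repCell_paste

end Embedding

namespace EnrFunctor

variable {E : Type u} [VirtualDoubleCategory.{z, w, v} E] {C D : EnrCat.{t} E}

/-- An isomorphism between functors `F G : C ⟶ D`: natural transformations `F ⟶ G` and `G ⟶ F`,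
that is morphisms from the empty string to `D(-, -)` over `F` and `G` and over `G` and `F`, whose
composites in either order have the components of an identity natural transformation. -/
structure NatIso (F G : C ⟶ D) where
  hom : EnrMorphism (.nil C) F G D.homProfunctor
  inv : EnrMorphism (.nil C) G F D.homProfunctor
  hom_inv : ∀ a : C.Obj,
    (paste (.pair (hom.app (.nil a)) (inv.app (.nil a))) (D.mul (F.obj a) (G.obj a) (F.obj a))
      (Category.comp_id _) (Category.comp_id _) :
      Cell (.nil (C.ext a)) (F.arr a) (F.arr a) (D.hom (F.obj a) (F.obj a))) =
    paste (.nil (F.arr a)) (D.one (F.obj a)) (Category.comp_id _) (Category.comp_id _)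
  inv_hom : ∀ a : C.Obj,
    (paste (.pair (inv.app (.nil a)) (hom.app (.nil a))) (D.mul (G.obj a) (F.obj a) (G.obj a))
      (Category.comp_id _) (Category.comp_id _) :
      Cell (.nil (C.ext a)) (G.arr a) (G.arr a) (D.hom (G.obj a) (G.obj a))) =
    paste (.nil (G.arr a)) (D.one (G.obj a)) (Category.comp_id _) (Category.comp_id _)

end EnrFunctor

section Evaluation

variable {E : Type u} [VirtualDoubleCategory.{z, w, v} E] [IsVirtualEquipment E]

/-- The identity of `A`, as an object of `|A|`. -/
noncomputable def repId (A : E) : (repCat A).Obj := RepObj.mk A (𝟙 A)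

/-- The list `id_A, id_B` of objects. -/
noncomputable abbrev idChain {A B : E} (J : EnrProfunctor (repCat A) (repCat B)) :
    Chain (.cons J (.nil (repCat B))) (repId A) (repId B) :=
  .cons (J := J) (repId A) (.nil (C := repCat B) (repId B))

/-- The functor `J ↦ J(id_A, id_B)` from profunctors `|A| ⟶ |B|` to proarrows `A ⟶ B`. -/
noncomputable def evalHor (A B : E) : Hor (repCat A) (repCat B) ⥤ Hor A B where
  obj J := ⟨EnrProfunctor.obj J.pro (repId A) (repId B)⟩
  map {J _} φ := EnrMorphism.app φ (idChain J.pro)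
  map_id J := rfl
  map_comp {J K L} φ ψ := by
    have h := EnrMorphism.vpaste_app (.single φ) ψ (Category.id_comp _) (Category.id_comp _)
      (idChain J.pro)
    have e := congrArg (fun s : ChainRow _ _ _ _ _ _ => s.app ψ.app)
      (EnrMorphism.evalRow_single φ (idChain J.pro))
    refine eq_of_heq (h.trans ((heq_of_eq e).trans ?_))
    exact heq_paste _ _ _ _ _ _

end Evaluation

/-! The whole argument rests on one notion. A row of cells with identity outer sides is a cover
(`IsCover`) if composing with it, inside any longer string, is a bijection on cells. A cell is a
composite exactly when the row consisting of it alone is a cover. Covers are stable under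
whiskering, and they satisfy two-out-of-three: if two of a pair of rows and their vertical composite
are covers, so is the third. Most steps exhibit a commutative square of rows of which three sides
are known to be covers.

That the enriched categories form a virtual equipment is proved for categories of any kind.
Restrictions are computed object by object: `K(F, G)(a, b)` is the restriction of `K(Fa, Gb)` along
the arrows of `F` and `G`, and its actions are forced by the universal property of the cartesian
cells. The unit of `C` is its hom profunctor. Inserting it next to a profunctor `J` is inverse to
the action on `J`, because every morphism out of a string equalizes the two actions of each interior
category. When there is no neighbouring profunctor, a morphism `α` out of the empty string is
extended by the formula `F(a, a') · α(a')`.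

For composites of nonempty strings, `J(a, b)` should be the colimit of the strings `J₁(a, c₁), …,
Jₖ(cₖ₋₁, b)` over the interior objects, modulo the interior actions. `IsDense` expresses this by
cells out of longer strings, and `IsDense.isComposite` shows that it suffices: the extension of a
morphism is defined one list of objects at a time, and its equivariance is tested against the
components of `μ`, which are jointly injective.

What is special about `|A|` is that the object `id_A` is a center (`EnrCat.Center`): every object
`x` is a restriction of it along the arrow `x`, and its endomorphisms form a unit. If `e` is a
center of `C`, the action `C(x, e), K(e, b) ⟶ K(x, b)` is a composite in `E` (`lact_isComposite`,
and `ract_isComposite` on the other side), so profunctors are controlled by their values at centers.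
A cell between the values at the centers extends to a morphism (`exists_extension`). A morphism out
of `|J₁|, …, |Jₖ|` is determined by its component at the identities (`ext_idsChain`). The colimit
defining density collapses to the single term with identities in the interior (`isDense_of_glob`).

Cartesian cells with identity sides are invertible, so at the identities the string `|J₁|, …, |Jₖ|`
is `J₁, …, Jₖ` up to a cover. The four properties follow. The component of `|μ|` at the identities
is `μ` up to invertible cells, so `|μ|` is dense and hence a composite; for the empty string `μ` is
compared with the chosen unit. A cell and its image determine each other through the component at
the identities. A functor `G` is isomorphic to `|f|` for the arrow `f` represented by the object
`G(id_A)`, since an inverse pair of cells at the center extends to an inverse pair of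
transformations. Finally, morphisms `|J| ⟶ L` correspond to cells `J(id, id) ⟶ L(id, id)`, hence to
cells `J ⟶ L(id, id)`, which is the adjunction. -/

namespace VirtualDoubleCategory

/-! ### Calculus of rows: concatenation, whiskering and covers -/

section RowCalculus

variable {V : Type u} [VirtualDoubleCategory.{z, w, v} V]
  {X X' X'' X₃ Y Y' Y'' Y₃ Z Z' Z'' W W' : V}

/-- `ProPath.append` is associative only up to a propositional equality, so the strings of all
partial concatenations are free variables tied by equations. The law then applies to any bracketing
without transporting rows. -/
theorem row_append_assoc {o₁ : HPath X X'} {o₂ : HPath X' X''} {o₃ : HPath X'' X₃}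
    {p₁ : HPath Y Y'} {p₂ : HPath Y' Y''} {p₃ : HPath Y'' Y₃} {f : X ⟶ Y} {g : X' ⟶ Y'}
    {h : X'' ⟶ Y''} {k : X₃ ⟶ Y₃} (ρ₁ : Row o₁ f g p₁) (ρ₂ : Row o₂ g h p₂) (ρ₃ : Row o₃ h k p₃)
    {o₁₂ : HPath X X''} {p₁₂ : HPath Y Y''} {o₂₃ : HPath X' X₃} {p₂₃ : HPath Y' Y₃}
    {o : HPath X X₃} {p : HPath Y Y₃}
    (ho₁₂ : o₁₂ = o₁.append o₂) (hp₁₂ : p₁₂ = p₁.append p₂) (ho₂₃ : o₂₃ = o₂.append o₃)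
    (hp₂₃ : p₂₃ = p₂.append p₃) (ho : o = o₁₂.append o₃) (hp : p = p₁₂.append p₃)
    (ho' : o = o₁.append o₂₃) (hp' : p = p₁.append p₂₃) :
    (ρ₁.append ho₁₂ hp₁₂ ρ₂).append ho hp ρ₃ = ρ₁.append ho' hp' (ρ₂.append ho₂₃ hp₂₃ ρ₃) := by
  induction ρ₁ with
  | nil f =>
    change o₁₂ = o₂ at ho₁₂
    change p₁₂ = p₂ at hp₁₂
    subst ho₁₂ hp₁₂ ho₂₃ hp₂₃ ho hp
    rfl
  | @cons _ _ _ _ _ _ _ r s f g k K q h α ρ ih =>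
    subst hp₁₂ ho₂₃ hp₂₃ h ho₁₂ ho hp
    have e₁ := append_cons rfl rfl rfl (ProPath.append_assoc _ _ _) rfl rfl α ρ ρ₂
    refine (congrArg (CellRow.append (by rfl) (by rfl) · ρ₃) e₁).trans ?_
    have e₂ := append_cons (ProPath.append_assoc _ _ _) rfl (by rfl)
      ((congrArg (ProPath.append · o₃) (ProPath.append_assoc _ _ _)).trans
        (ProPath.append_assoc _ _ _)) rfl rfl α (ρ.append rfl rfl ρ₂) ρ₃
    refine e₂.trans ?_
    rw [ih ρ₂ rfl rfl rfl rfl rfl rfl (ProPath.append_assoc _ _ _) (ProPath.append_assoc _ _ _)]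
    exact (append_cons _ _ _ _ _ _ _ _ _).symm

/-- The interchange law: vertical composition of rows is computed block by block, so it respects
horizontal concatenation. It lets computations on different parts of a string be carried out
independently. -/
theorem IsPaste.append {o₁ : HPath X X'} {o₂ : HPath X' X''} {p₁ : HPath Y Y'} {p₂ : HPath Y' Y''}
    {q₁ : HPath Z Z'} {q₂ : HPath Z' Z''} {o : HPath X X''} {p : HPath Y Y''} {q : HPath Z Z''}
    {f : X ⟶ Y} {g : X' ⟶ Y'} {h : X'' ⟶ Y''} {f' : Y ⟶ Z} {g' : Y' ⟶ Z'} {h' : Y'' ⟶ Z''}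
    {f'' : X ⟶ Z} {g'' : X' ⟶ Z'} {h'' : X'' ⟶ Z''}
    {ρ₁ : Row o₁ f g p₁} {σ₁ : Row p₁ f' g' q₁} {τ₁ : Row o₁ f'' g'' q₁}
    {ρ₂ : Row o₂ g h p₂} {σ₂ : Row p₂ g' h' q₂} {τ₂ : Row o₂ g'' h'' q₂}
    (h₁ : IsPaste ρ₁ σ₁ τ₁) (h₂ : IsPaste ρ₂ σ₂ τ₂) (ho : o = o₁.append o₂) (hp : p = p₁.append p₂)
    (hq : q = q₁.append q₂) :
    IsPaste (ρ₁.append ho hp ρ₂) (σ₁.append hp hq σ₂) (τ₁.append ho hq τ₂) := by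
  induction h₁ with
  | nil hf =>
    change o = o₂ at ho
    change p = p₂ at hp
    change q = q₂ at hq
    subst ho hp hq
    exact h₂
  | @cons _ _ _ _ _ _ _ _ _ a a' a'' b b' b'' K c _ _ _ _ _ _ _ _ _ ha hb hf hg γ α ρ σ τ h ih =>
    subst hq ha hb ho hp
    have := ih h₂ rfl rfl rfl
    have e₁ := row_append_assoc γ ρ ρ₂ rfl rfl rfl rfl rfl rfl (ProPath.append_assoc _ _ _)
      (ProPath.append_assoc _ _ _)
    have e₂ := append_cons rfl rfl (by rfl) (ProPath.append_assoc _ _ _) rfl rfl α σ σ₂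
    have e₃ := append_cons rfl rfl (by rfl) (ProPath.append_assoc _ _ _) rfl rfl
      (paste γ α hf hg) τ τ₂
    rw [e₁]
    refine e₂.symm.subst (motive := fun x => IsPaste _ x _) ?_
    refine e₃.symm.subst (motive := fun x => IsPaste _ _ x) ?_
    exact .cons _ _ _ _ _ _ this

/-- The row `id, …, id, ρ, id, …, id`. -/
def whiskerRow {o p : HPath X Y} (k : HPath Z X) (ρ : Row o (𝟙 X) (𝟙 Y) p) (q : HPath Y W)
    {s t : HPath Z W} (hs : s = k.append (o.append q)) (ht : t = k.append (p.append q)) :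
    Row s (𝟙 Z) (𝟙 W) t :=
  (idRow k).append hs ht (ρ.append rfl rfl (idRow q))

/-- The definition of composites uses `whisker`, which recurses on the left string. Written as a
concatenation, it becomes accessible to the interchange law. -/
theorem whisker_eq : ∀ {X Y : V} {p : HPath X Y} {J : Pro X Y} (μ : Cell p (𝟙 X) (𝟙 Y) J)
    {Z W : V} (k : HPath Z X) (q : HPath Y W),
    whisker μ k q = whiskerRow k (.single μ) q rfl rfl
  | _, _, _, _, μ, _, _, .nil _, q =>
      (append_cons (ProPath.append_nil _).symm rfl (by rfl) rfl rfl rfl μ (.nil _) (idRow q)).symm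
  | _, _, p, J, μ, _, _, .cons L k, q => by
      have e := append_cons (o := .cons L k) (p := k) (o'' := (ProPath.cons L k).append (p.append q))
        (p'' := k.append (.cons J q)) rfl rfl (by rfl) (by rfl)
        rfl rfl (cellId L) (idRow k) ((CellRow.single μ).append rfl rfl (idRow q))
      refine Eq.trans ?_ e.symm
      exact congrArg (CellRow.cons (by rfl) (cellId L)) (whisker_eq μ k q)

/-- Whiskering twice is whiskering once by longer strings. This is why being a cover, a condition on
all whiskerings at once, is stable under whiskering. -/
theorem whiskerRow_whiskerRow {o p : HPath X Y} (k : HPath Z X) (ρ : Row o (𝟙 X) (𝟙 Y) p)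
    (q : HPath Y W) {s t : HPath Z W} (hs : s = k.append (o.append q))
    (ht : t = k.append (p.append q)) (k' : HPath Z' Z) (q' : HPath W W') {s' t' : HPath Z' W'}
    (hs' : s' = k'.append (s.append q')) (ht' : t' = k'.append (t.append q'))
    (hs'' : s' = (k'.append k).append (o.append (q.append q')) := by
      subst hs hs'; simp only [ProPath.append_assoc])
    (ht'' : t' = (k'.append k).append (p.append (q.append q')) := by
      subst ht ht'; simp only [ProPath.append_assoc]) :
    whiskerRow k' (whiskerRow k ρ q hs ht) q' hs' ht' =
      whiskerRow (k'.append k) ρ (q.append q') hs'' ht'' := by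
  subst hs ht hs' ht'
  have a := fun {X Y Z W : V} (p : HPath X Y) (q : HPath Y Z) (r : HPath Z W) =>
    ProPath.append_assoc p q r
  unfold whiskerRow
  rw [row_append_assoc (idRow k) (ρ.append rfl rfl (idRow q)) (idRow q') rfl rfl rfl rfl rfl rfl
    (a _ _ _) (a _ _ _),
    row_append_assoc ρ (idRow q) (idRow q') rfl rfl rfl rfl rfl rfl (a _ _ _) (a _ _ _),
    ← idRow_append q q', idRow_append k' k]
  have e := row_append_assoc (idRow k') (idRow k) (ρ.append rfl rfl (idRow (q.append q'))) rfl rfl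
    rfl rfl hs'' ht'' (hs''.trans (a _ _ _)) (ht''.trans (a _ _ _))
  refine Eq.trans ?_ e.symm
  have key : ∀ {m n : HPath X W'} {m' n' : HPath Z W'} {s t : HPath Z' W'}
      (hm : m = o.append (q.append q')) (hn : n = p.append (q.append q')) (hm' : m' = k.append m)
      (hn' : n' = k.append n) (hs : s = k'.append m') (ht : t = k'.append n')
      (hs' : s = k'.append (k.append (o.append (q.append q'))))
      (ht' : t = k'.append (k.append (p.append (q.append q')))),
      (idRow k').append hs ht ((idRow k).append hm' hn' (ρ.append hm hn (idRow (q.append q')))) =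
        (idRow k').append hs' ht' ((idRow k).append rfl rfl
          (ρ.append rfl rfl (idRow (q.append q')))) := by
    intro m n m' n' s t hm hn hm' hn' hs ht hs' ht'
    subst hm hn hm' hn'
    rfl
  exact key (a _ _ _) (a _ _ _) (a _ _ _) (a _ _ _) rfl rfl _ _

/-- An identity cell at the head of a row can be absorbed into the left context. Hence prefixing an
identity preserves covers. -/
theorem whiskerRow_cons {o p : HPath X Y} (k : HPath Z Z') (L : Pro Z' X)
    (ρ : Row o (𝟙 X) (𝟙 Y) p) (q : HPath Y W) {s t : HPath Z W}
    (hs : s = k.append ((ProPath.cons L o).append q))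
    (ht : t = k.append ((ProPath.cons L p).append q))
    (hs' : s = (k.append (.cons L (.nil _))).append (o.append q))
    (ht' : t = (k.append (.cons L (.nil _))).append (p.append q)) :
    whiskerRow k (.cons (by rfl) (cellId L) ρ : Row (.cons L o) _ _ (.cons L p)) q hs ht =
      whiskerRow (k.append (.cons L (.nil _))) ρ q hs' ht' := by
  subst hs ht
  unfold whiskerRow
  have e' := row_append_assoc (idRow k) (idRow (.cons L (.nil _)))
    (ρ.append rfl rfl (idRow q)) rfl rfl rfl rfl hs' ht' rfl rfl
  rw [idRow_append]
  refine Eq.trans ?_ e'.symm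
  have e := append_cons (by rfl) rfl (by rfl) (by rfl) rfl rfl (cellId L) ρ (idRow q)
  exact congrArg (CellRow.append rfl rfl (idRow k)) e

theorem whiskerRow_nil_left {o p : HPath X Y} (ρ : Row o (𝟙 X) (𝟙 Y) p) (q : HPath Y W)
    {s t : HPath X W} (hs : s = o.append q) (ht : t = p.append q) :
    whiskerRow (.nil X) ρ q hs ht = ρ.append hs ht (idRow q) := by
  subst hs ht
  rfl

theorem whiskerRow_nil_nil {o p : HPath X Y} (ρ : Row o (𝟙 X) (𝟙 Y) p)
    (hs : o = (ProPath.nil X).append (o.append (.nil Y)))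
    (ht : p = (ProPath.nil X).append (p.append (.nil Y))) :
    whiskerRow (.nil X) ρ (.nil Y) hs ht = ρ :=
  (whiskerRow_nil_left ρ (.nil Y) hs ht).trans (append_nil_right ρ hs ht)

theorem whiskerRow_append_right {o p : HPath X Y} (ρ : Row o (𝟙 X) (𝟙 Y) p) (k : HPath Z X)
    (q : HPath Y W) {m n : HPath X W} {s t : HPath Z W} (hm : m = o.append q) (hn : n = p.append q)
    (hs : s = k.append m) (ht : t = k.append n) (hs' : s = k.append (o.append q))
    (ht' : t = k.append (p.append q)) :
    (idRow k).append hs ht (ρ.append hm hn (idRow q)) = whiskerRow k ρ q hs' ht' := by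
  subst hm hn
  rfl

theorem whiskerRow_id (k : HPath Z X) (o : HPath X Y) (q : HPath Y W) {s : HPath Z W}
    (hs : s = k.append (o.append q)) : whiskerRow k (idRow o) q hs hs = idRow s := by
  subst hs
  rw [idRow_append, idRow_append]
  rfl

theorem IsPaste.whisker {o p r : HPath X Y} {ρ : Row o (𝟙 X) (𝟙 Y) p} {σ : Row p (𝟙 X) (𝟙 Y) r}
    {τ : Row o (𝟙 X) (𝟙 Y) r} (h : IsPaste ρ σ τ) (k : HPath Z X) (q : HPath Y W)
    {s s' s'' : HPath Z W} (hs : s = k.append (o.append q)) (hs' : s' = k.append (p.append q))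
    (hs'' : s'' = k.append (r.append q)) :
    IsPaste (whiskerRow k ρ q hs hs') (whiskerRow k σ q hs' hs'') (whiskerRow k τ q hs hs'') :=
  (IsPaste.id_left (idRow k)).append (h.append (IsPaste.id_left (idRow q)) rfl rfl rfl) hs hs' hs''

/-- Precomposition with the row `σ` is bijective. -/
structure Bijects {s t : HPath X Y} (σ : Row s (𝟙 X) (𝟙 Y) t) : Prop where
  existsUnique : ∀ {Y₀ Y₁ : V} (f : X ⟶ Y₀) (g : Y ⟶ Y₁) (K : Pro Y₀ Y₁) (α : Cell s f g K),
    ∃! β : Cell t f g K, paste σ β (Category.id_comp f) (Category.id_comp g) = α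

/-- Precomposition with the row `σ`, placed inside any longer row of identities, is bijective. -/
structure IsCover {o p : HPath X Y} (ρ : Row o (𝟙 X) (𝟙 Y) p) : Prop where
  whiskerRow_bijects : ∀ {Z W : V} (k : HPath Z X) (q : HPath Y W) {s t : HPath Z W}
    (hs : s = k.append (o.append q)) (ht : t = k.append (p.append q)),
    Bijects (whiskerRow k ρ q hs ht)

/-- The universal property of a composite already quantifies over all contexts, so composites are
the covers with one cell. This lemma and its converse make the cancellation laws of covers available
for composites. -/
theorem IsCover.isComposite {p : HPath X Y} {J : Pro X Y} {μ : Cell p (𝟙 X) (𝟙 Y) J}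
    (h : IsCover (.single μ)) : IsComposite μ := by
  intro Z W Y₀ Y₁ k q f g K α
  rw [whisker_eq]
  exact (h.whiskerRow_bijects k q rfl rfl).existsUnique f g K α

theorem IsComposite.isCover {p : HPath X Y} {J : Pro X Y} {μ : Cell p (𝟙 X) (𝟙 Y) J}
    (h : IsComposite μ) : IsCover (.single μ) := by
  refine ⟨fun k q s t hs ht => ⟨fun f g K α => ?_⟩⟩
  subst hs ht
  have := h k q f g K α
  rw [whisker_eq] at this
  exact this

theorem IsCover.bijects {o p : HPath X Y} {ρ : Row o (𝟙 X) (𝟙 Y) p} (h : IsCover ρ) :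
    Bijects ρ := by
  have := h.whiskerRow_bijects (.nil X) (.nil Y) (ProPath.append_nil o).symm (ProPath.append_nil p).symm
  exact (whiskerRow_nil_nil ρ _ _) ▸ this

theorem Bijects.ext {s t : HPath X Y} {σ : Row s (𝟙 X) (𝟙 Y) t} (h : Bijects σ) {f : X ⟶ Z}
    {g : Y ⟶ W} {K : Pro Z W} {β β' : Cell t f g K}
    (e : paste σ β (Category.id_comp f) (Category.id_comp g) =
      paste σ β' (Category.id_comp f) (Category.id_comp g)) : β = β' :=
  (h.existsUnique f g K _).unique e rfl

/-- Precomposition with a vertical composite of rows is the composite of the two precompositions.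
This lemma and the next ones are therefore instances of two-out-of-three for bijections. -/
theorem Bijects.comp {s t r : HPath X Y} {σ : Row s (𝟙 X) (𝟙 Y) t} {τ : Row t (𝟙 X) (𝟙 Y) r}
    {υ : Row s (𝟙 X) (𝟙 Y) r} (h : IsPaste σ τ υ) (hσ : Bijects σ) (hτ : Bijects τ) :
    Bijects υ := by
  refine ⟨fun f g K α => ?_⟩
  obtain ⟨β, hβ, hβ'⟩ := hσ.existsUnique f g K α
  obtain ⟨γ, hγ, hγ'⟩ := hτ.existsUnique f g K β
  have e := fun γ' : Cell r f g K => pasteAssoc h γ' (Category.id_comp f) (Category.id_comp g)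
    (Category.id_comp f) (Category.id_comp g)
  refine ⟨γ, (e γ).symm.trans (by rw [hγ, hβ]), fun γ' h' => hγ' _ (hβ' _ ((e γ').trans h'))⟩

theorem Bijects.cancel {s t r : HPath X Y} {σ : Row s (𝟙 X) (𝟙 Y) t} {τ : Row t (𝟙 X) (𝟙 Y) r}
    {υ : Row s (𝟙 X) (𝟙 Y) r} (h : IsPaste σ τ υ) (hσ : Bijects σ) (hυ : Bijects υ) :
    Bijects τ := by
  refine ⟨fun f g K α => ?_⟩
  have e := fun γ' : Cell r f g K => pasteAssoc h γ' (Category.id_comp f) (Category.id_comp g)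
    (Category.id_comp f) (Category.id_comp g)
  obtain ⟨γ, hγ, hγ'⟩ := hυ.existsUnique f g K (paste σ α (Category.id_comp f) (Category.id_comp g))
  refine ⟨γ, hσ.ext ((e γ).trans hγ), fun γ' h' => hγ' _ ((e γ').symm.trans ?_)⟩
  rw [h']

theorem IsCover.comp {o p r : HPath X Y} {ρ : Row o (𝟙 X) (𝟙 Y) p} {σ : Row p (𝟙 X) (𝟙 Y) r}
    {τ : Row o (𝟙 X) (𝟙 Y) r} (h : IsPaste ρ σ τ) (hρ : IsCover ρ) (hσ : IsCover σ) :
    IsCover τ := by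
  refine ⟨fun k q s t hs ht => ?_⟩
  exact .comp (h.whisker k q hs rfl ht) (hρ.whiskerRow_bijects k q hs rfl)
    (hσ.whiskerRow_bijects k q rfl ht)

/-- The usual way of recognizing a composite below: in a square of rows, the upper side and the
composite of the other two sides are covers, so the remaining lower side is one. -/
theorem IsCover.cancel {o p r : HPath X Y} {ρ : Row o (𝟙 X) (𝟙 Y) p} {σ : Row p (𝟙 X) (𝟙 Y) r}
    {τ : Row o (𝟙 X) (𝟙 Y) r} (h : IsPaste ρ σ τ) (hρ : IsCover ρ) (hτ : IsCover τ) :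
    IsCover σ := by
  refine ⟨fun k q s t hs ht => ?_⟩
  exact .cancel (h.whisker k q rfl hs ht) (hρ.whiskerRow_bijects k q rfl hs)
    (hτ.whiskerRow_bijects k q rfl ht)

theorem IsCover.whisker {o p : HPath X Y} {ρ : Row o (𝟙 X) (𝟙 Y) p} (h : IsCover ρ)
    (k : HPath Z X) (q : HPath Y W) {s t : HPath Z W} (hs : s = k.append (o.append q))
    (ht : t = k.append (p.append q)) : IsCover (whiskerRow k ρ q hs ht) := by
  refine ⟨fun k' q' s' t' hs' ht' => ?_⟩
  rw [whiskerRow_whiskerRow (hs := hs) (ht := ht) (hs' := hs') (ht' := ht')]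
  exact h.whiskerRow_bijects _ _ _ _

theorem IsCover.cons {o p : HPath X Y} {ρ : Row o (𝟙 X) (𝟙 Y) p} (h : IsCover ρ) (L : Pro Z X) :
    IsCover (.cons (by rfl) (cellId L) ρ : Row (.cons L o) _ _ (.cons L p)) := by
  refine ⟨fun k' q' s' t' hs' ht' => ?_⟩
  rw [whiskerRow_cons (hs' := hs'.trans (ProPath.append_assoc k' (.cons L (.nil _)) _).symm)
    (ht' := ht'.trans (ProPath.append_assoc k' (.cons L (.nil _)) _).symm)]
  exact h.whiskerRow_bijects _ _ _ _

theorem IsCover.append {o p : HPath X Y} {ρ : Row o (𝟙 X) (𝟙 Y) p} (h : IsCover ρ)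
    (q : HPath Y Z) {s t : HPath X Z} (hs : s = o.append q) (ht : t = p.append q) :
    IsCover (ρ.append hs ht (idRow q)) := by
  have := h.whisker (.nil X) q (s := s) (t := t) hs ht
  exact (whiskerRow_nil_left ρ q hs ht) ▸ this

/-- A composite followed by the identities of a string. -/
theorem IsCover.consIds {o : HPath X Y} {J : Pro X Y} {μ : Cell o (𝟙 X) (𝟙 Y) J}
    (h : IsComposite μ) (q : HPath Y Z) {s : HPath X Z} (hs : s = o.append q) :
    IsCover (.cons hs μ (idRow q)) := by
  have := h.isCover.append q hs (t := .cons J q) (by rfl)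
  have e := append_cons (ProPath.append_nil o).symm hs (by rfl) hs (by rfl) (by rfl) μ (.nil (𝟙 Y))
    (idRow q)
  exact e ▸ this

/-- A row with an inverse up to precomposition bijects. -/
theorem Bijects.of_inverse {s t : HPath X Y} {σ : Row s (𝟙 X) (𝟙 Y) t} {τ : Row t (𝟙 X) (𝟙 Y) s}
    (h : IsPaste τ σ (idRow t)) {υ : Row s (𝟙 X) (𝟙 Y) s} (h' : IsPaste σ τ υ)
    (hυ : ∀ {Y₀ Y₁ : V} (f : X ⟶ Y₀) (g : Y ⟶ Y₁) (K : Pro Y₀ Y₁) (α : Cell s f g K),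
      paste υ α (Category.id_comp f) (Category.id_comp g) = α) : Bijects σ := by
  refine ⟨fun f g K α => ⟨paste τ α (Category.id_comp f) (Category.id_comp g), ?_, fun β hβ => ?_⟩⟩
  · exact (pasteAssoc h' α (Category.id_comp f) (Category.id_comp g) (Category.id_comp f)
      (Category.id_comp g)).trans (hυ f g K α)
  · rw [← hβ]
    exact ((pasteAssoc h β (Category.id_comp f) (Category.id_comp g) (Category.id_comp f)
      (Category.id_comp g)).trans (ids_paste β)).symm

end RowCalculus

end VirtualDoubleCategory

/-! ### Rows inverse to each other up to composition -/

namespace VirtualDoubleCategory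

variable {V : Type u} [VirtualDoubleCategory.{z, w, v} V] {X Y : V}

section Eq

variable {X' X'' Y' Y'' Z Z' Z'' : V}

/-- These variants of the pasting rules take the composite cell `γ` as a variable together with an
equation. The resulting row can then be stated with the simplified cell, for instance an identity.
-/
theorem IsPaste.cons₀Eq {o : HPath X' X''} {p : HPath Y' Y''} {q : HPath Z' Z''} {K : Pro Z Z'}
    {f : X' ⟶ Y'} {k : X'' ⟶ Y''} {f' : Y' ⟶ Z} {g' : Y' ⟶ Z'} {k' : Y'' ⟶ Z''}
    {f'' : X' ⟶ Z} {g'' : X' ⟶ Z'} {k'' : X'' ⟶ Z''} {ρ : Row o f k p} {σ : Row p g' k' q}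
    {τ : Row o g'' k'' q} {α : Cell (.nil Y') f' g' K} (hf : f ≫ f' = f'') (hg : f ≫ g' = g'')
    {hp : p = (ProPath.nil Y').append p} {ho : o = (ProPath.nil X').append o}
    {γ : Cell (.nil X') f'' g'' K} (e : paste (.nil f) α hf hg = γ) (h : IsPaste ρ σ τ) :
    IsPaste ρ (.cons hp α σ) (.cons ho γ τ) :=
  e ▸ .cons₀ hf hg h

theorem IsPaste.cons₂Eq {X₀ Y₀ : V} {o₀ : HPath X₀ X} {o₁ : HPath X X'} {o' : HPath X' X''}
    {o₂ : HPath X X''} {o'' : HPath X₀ X''} {J₀ : Pro Y₀ Y} {J : Pro Y Y'}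
    {p' : HPath Y' Y''} {q : HPath Z' Z''} {K : Pro Z Z'} {e : X₀ ⟶ Y₀}
    {f : X ⟶ Y} {g : X' ⟶ Y'} {k : X'' ⟶ Y''} {f' : Y₀ ⟶ Z} {g' : Y' ⟶ Z'} {k' : Y'' ⟶ Z''}
    {f'' : X₀ ⟶ Z} {g'' : X' ⟶ Z'} {k'' : X'' ⟶ Z''} {α₀ : Cell o₀ e f J₀} {α : Cell o₁ f g J}
    {ρ : Row o' g k p'} {β : Cell (.cons J₀ (.cons J (.nil Y'))) f' g' K} {σ : Row p' g' k' q}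
    {τ : Row o' g'' k'' q} (hf : e ≫ f' = f'') (hg : g ≫ g' = g'')
    {ho₂ : o₂ = o₁.append o'} {ho : o'' = o₀.append o₂}
    {hp : ProPath.cons J₀ (ProPath.cons J p') =
      (ProPath.cons J₀ (ProPath.cons J (.nil Y'))).append p'}
    {ho' : o'' = (o₀.append o₁).append o'} {γ : Cell (o₀.append o₁) f'' g'' K}
    (e : paste (.pair α₀ α) β hf hg = γ) (h : IsPaste ρ σ τ) :
    IsPaste (.cons ho α₀ (.cons ho₂ α ρ)) (.cons hp β σ) (.cons ho' γ τ) :=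
  e ▸ .cons₂ hf hg h

theorem IsPaste.singleEq {o : HPath X X'} {p : HPath Y Y'} {K : Pro Z Z'} {f : X ⟶ Y} {g : X' ⟶ Y'}
    {f' : Y ⟶ Z} {g' : Y' ⟶ Z'} {f'' : X ⟶ Z} {g'' : X' ⟶ Z'} {ρ : Row o f g p}
    {α : Cell p f' g' K} (hf : f ≫ f' = f'') (hg : g ≫ g' = g'') {γ : Cell o f'' g'' K}
    (e : paste ρ α hf hg = γ) : IsPaste ρ (.single α) (.single γ) :=
  e ▸ .single ρ α hf hg

end Eq

/-- A row with an inverse up to precomposition is a cover. -/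
theorem IsCover.of_inverse {s t : HPath X Y} {σ : Row s (𝟙 X) (𝟙 Y) t} {τ : Row t (𝟙 X) (𝟙 Y) s}
    (h : IsPaste τ σ (idRow t)) {υ : Row s (𝟙 X) (𝟙 Y) s} (h' : IsPaste σ τ υ)
    (hυ : ∀ {Z W Y₀ Y₁ : V} (k : HPath Z X) (q : HPath Y W) {s' : HPath Z W}
      (hs : s' = k.append (s.append q)) (f : Z ⟶ Y₀) (g : W ⟶ Y₁) (K : Pro Y₀ Y₁)
      (α : Cell s' f g K), paste (whiskerRow k υ q hs hs) α (Category.id_comp f)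
        (Category.id_comp g) = α) : IsCover σ := by
  refine ⟨fun k q s' t' hs ht => ?_⟩
  refine .of_inverse ?_ (h'.whisker k q hs ht hs) (hυ k q hs)
  have := h.whisker k q ht hs ht
  rwa [whiskerRow_id] at this

/-- Rows which cancel the same cover agree after composition with any cell. -/
theorem IsCover.paste_eq {s t : HPath X Y} {j : Row s (𝟙 X) (𝟙 Y) t} (hj : IsCover j)
    {i i' : Row t (𝟙 X) (𝟙 Y) s} (h : IsPaste j i (idRow s)) (h' : IsPaste j i' (idRow s))
    {Z W Y₀ Y₁ : V} (k : HPath Z X) (q : HPath Y W) {s' t' : HPath Z W}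
    (hs : s' = k.append (s.append q)) (ht : t' = k.append (t.append q)) {f : Z ⟶ Y₀} {g : W ⟶ Y₁}
    {K : Pro Y₀ Y₁} (α : Cell s' f g K) :
    paste (whiskerRow k i q ht hs) α (Category.id_comp f) (Category.id_comp g) =
      paste (whiskerRow k i' q ht hs) α (Category.id_comp f) (Category.id_comp g) := by
  have e := fun {i : Row t (𝟙 X) (𝟙 Y) s} (h : IsPaste j i (idRow s)) =>
    pasteAssoc (h.whisker k q hs ht hs) α (Category.id_comp f) (Category.id_comp g)
      (Category.id_comp f) (Category.id_comp g) (Category.id_comp f) (Category.id_comp g)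
  -- Composition with the whiskering of `j` is injective, and it turns both sides into the composite
  -- of `α` with an identity row.
  exact (hj.whiskerRow_bijects k q hs ht).ext ((e h).trans (by rw [e h', whiskerRow_id]))

end VirtualDoubleCategory

/-! ### Enriched categories with a center -/

section Centers

variable {E : Type u} [VirtualDoubleCategory.{z, w, v} E]

/-- An object of an enriched category of which every object is a restriction along an arrow, and
whose endomorphisms are a unit. -/
structure EnrCat.Center (C : EnrCat.{t} E) where
  pt : C.Obj
  arr : ∀ x : C.Obj, C.ext x ⟶ C.ext pt
  toPt : ∀ x : C.Obj, Cell (.nil (C.ext x)) (𝟙 _) (arr x) (C.hom x pt)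
  ofPt : ∀ x : C.Obj, Cell (.nil (C.ext x)) (arr x) (𝟙 _) (C.hom pt x)
  mul_eq : ∀ x : C.Obj, (paste (.pair (toPt x) (ofPt x)) (C.mul x pt x) (Category.comp_id _)
    (Category.comp_id _) : Cell (.nil (C.ext x)) (𝟙 _) (𝟙 _) (C.hom x x)) = C.one x
  one_isComposite : IsComposite (C.one pt)

namespace EnrCat.Center

variable {C D : EnrCat.{t} E} (z : C.Center)

section Left

variable (K : EnrProfunctor C D) (x : C.Obj) (b : D.Obj)

/-- The cell `K(x, b) ⟶ K(e, b)`. -/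
def pullLeft : Cell (.cons (K.obj x b) (.nil _)) (z.arr x) (𝟙 _) (K.obj z.pt b) :=
  paste (.cons (by rfl) (z.ofPt x) (.single (cellId (K.obj x b)))) (K.lact z.pt x b)
    (Category.comp_id _) (Category.comp_id _)

/-- The row from `K(x, b)` to `C(x, e), K(e, b)`. -/
def leftRow : Row (.cons (K.obj x b) (.nil _)) (𝟙 _) (𝟙 _)
    (.cons (C.hom x z.pt) (.cons (K.obj z.pt b) (.nil _))) :=
  .cons (by rfl) (z.toPt x) (.single (z.pullLeft K x b))

/-- Associativity turns the successive actions of `ofPt` and `toPt` on `K(x, b)` into the action of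
their product, which is the unit of `x` by `mul_eq` and acts trivially. -/
theorem leftRow_lact : paste (z.leftRow K x b) (K.lact x z.pt b) (Category.comp_id _)
    (Category.comp_id _) = cellId (K.obj x b) := by
  have h₁ := pasteAssoc (IsPaste.cons_id (α := z.toPt x) (ho := rfl) (hp := rfl)
    (.single (.cons (by rfl) (z.ofPt x) (.single (cellId (K.obj x b)))) (K.lact z.pt x b)
      (Category.comp_id _) (Category.comp_id _))) (K.lact x z.pt b) (Category.comp_id _)
      (Category.comp_id _) (Category.comp_id _) (Category.comp_id _) (Category.comp_id _)
      (Category.comp_id _)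
  have h₂ := pasteAssoc (IsPaste.cons₂Eq (ho₂ := rfl) (ho := rfl) (ho' := rfl) (hp := rfl) (Category.comp_id _)
    (Category.comp_id _) (z.mul_eq x) (.singleEq (Category.comp_id _) (Category.comp_id _)
      (paste_id (cellId (K.obj x b))))) (K.lact x x b) (Category.comp_id _)
      (Category.comp_id _) (Category.comp_id _) (Category.comp_id _) (Category.comp_id _)
      (Category.comp_id _)
  refine h₁.symm.trans (Eq.trans ?_ (h₂.trans (K.one_lact x b)))
  exact congrArg (fun y => paste _ y (Category.comp_id _) (Category.comp_id _))
    (K.mul_lact x z.pt x b).symm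

/-- By associativity, acting with `ofPt x` after the action of `C(x, e)` is the same as first
multiplying it into `C(x, e)`, which lands in `C(e, e)`. The composite of the action with its
candidate inverse is thereby expressed through `C(e, e)`. -/
theorem lact_pullLeft : paste (.single (K.lact x z.pt b)) (z.pullLeft K x b) (Category.id_comp _)
    (Category.id_comp _) = paste (.cons (by rfl) (z.pullLeft C.homProfunctor x z.pt)
      (.single (cellId (K.obj z.pt b)))) (K.lact z.pt z.pt b) (Category.comp_id _)
      (Category.comp_id _) := by
  have h₁ := pasteAssoc (IsPaste.cons₀ (α := z.ofPt x) (hp := rfl) (ho := rfl)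
    (Category.id_comp _) (Category.id_comp _) (IsPaste.single (.single (K.lact x z.pt b))
      (cellId (K.obj x b)) (Category.comp_id _) (Category.comp_id _))) (K.lact z.pt x b)
    (Category.comp_id _) (Category.comp_id _) (Category.id_comp _) (Category.id_comp _)
    (Category.comp_id _) (Category.comp_id _)
  have h₂ := pasteAssoc (ρ := .cons (by rfl) (z.ofPt x) (idRow _)) (IsPaste.cons_id
    (α := z.ofPt x) (ho := rfl) (hp := rfl)
    (.single (.pair (cellId (C.hom x z.pt)) (cellId (K.obj z.pt b))) (K.lact x z.pt b)
      (Category.id_comp _) (Category.id_comp _))) (K.lact z.pt x b) (Category.comp_id _)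
      (Category.comp_id _) (Category.comp_id _) (Category.comp_id _) (Category.comp_id _)
      (Category.comp_id _)
  have h₃ := pasteAssoc (IsPaste.cons₂ (α₀ := z.ofPt x) (α := cellId (C.hom x z.pt))
    (β := C.mul z.pt x z.pt)
    (ho₂ := rfl) (ho := rfl) (ho' := rfl) (hp := rfl) (Category.comp_id _) (Category.comp_id _)
    (.single (.single (cellId (K.obj z.pt b))) (cellId (K.obj z.pt b)) (Category.comp_id _)
      (Category.comp_id _))) (K.lact z.pt z.pt b) (Category.comp_id _)
      (Category.comp_id _) (Category.comp_id _) (Category.comp_id _) (Category.comp_id _)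
      (Category.comp_id _)
  have e : paste (.pair (cellId (C.hom x z.pt)) (cellId (K.obj z.pt b))) (K.lact x z.pt b)
      (Category.id_comp _) (Category.id_comp _) = K.lact x z.pt b := ids_paste _
  rw [paste_id, nil_id_paste] at h₁
  rw [e] at h₂
  rw [paste_id] at h₃
  refine h₁.trans (h₂.symm.trans (Eq.trans ?_ h₃))
  exact congrArg (fun y => paste _ y (Category.comp_id _) (Category.comp_id _))
    (K.mul_lact z.pt x z.pt b).symm

/-- One composite of the action with `leftRow` is the identity. The other one replaces an element of
`C(x, e)` by `toPt x` together with an element of `C(e, e)` acting on `K(e, b)`. Since `C(e, e)` is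
a unit, that element may act on `C(x, e)` from the right instead, and then `leftRow_lact` for the
hom profunctor gives back the original string. The product of `ofPt x` and `toPt x` in the order
that lands in `C(e, e)` never has to be computed. -/
theorem lact_isComposite : IsComposite (K.lact x z.pt b) := by
  apply IsCover.isComposite
  have h := IsPaste.singleEq (Category.comp_id _) (Category.comp_id _) (z.leftRow_lact K x b)
  have h' : IsPaste (.single (K.lact x z.pt b)) (z.leftRow K x b) _ :=
    IsPaste.cons₀Eq (hp := rfl) (ho := rfl) (Category.id_comp _) (Category.id_comp _)
      (nil_id_paste _) (.singleEq (Category.id_comp _) (Category.id_comp _) (z.lact_pullLeft K x b))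
  refine IsCover.of_inverse h h' fun k q s' hs f g L α => ?_
  -- In `hm` and `hm'` the same row into `C(x, e), C(e, e), K(e, b)` is followed by the action of
  -- `C(e, e)` on its right and on its left neighbour. The second outcome is the identity row.
  have hm : IsPaste (CellRow.cons (p := .nil _) (by rfl) (z.toPt x) (.cons (p := .cons _ (.nil _))
      (by rfl) (z.pullLeft C.homProfunctor x z.pt) (.single (cellId (K.obj z.pt b)))))
      (.pair (cellId (C.hom x z.pt)) (K.lact z.pt z.pt b)) _ :=
    IsPaste.cons_id (ho := rfl) (hp := rfl) (.single _ _ (Category.comp_id _) (Category.comp_id _))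
  have hm' : IsPaste (CellRow.cons (p := .nil _) (by rfl) (z.toPt x) (.cons (p := .cons _ (.nil _))
      (by rfl) (z.pullLeft C.homProfunctor x z.pt) (.single (cellId (K.obj z.pt b)))))
      (.pair (C.mul x z.pt z.pt) (cellId (K.obj z.pt b))) (idRow _) :=
    IsPaste.cons₂Eq (ho₂ := rfl) (ho := rfl) (ho' := rfl) (hp := rfl) (Category.comp_id _)
      (Category.comp_id _) (z.leftRow_lact C.homProfunctor x z.pt) (.singleEq (Category.comp_id _)
      (Category.comp_id _) (paste_id (cellId (K.obj z.pt b))))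
  -- Inserting the unit of `e` between `C(x, e)` and `K(e, b)` is a cover, and both actions of `C(e,
  -- e)` cancel it. Hence they agree after composition with any cell, which is all that
  -- `IsCover.of_inverse` asks for.
  have hj := (IsCover.consIds z.one_isComposite (.cons (K.obj z.pt b) (.nil _)) (by rfl)).cons
    (C.hom x z.pt)
  have hi : IsPaste (CellRow.cons (by rfl) (cellId (C.hom x z.pt)) (.cons (p := .nil _) (by rfl)
      (C.one z.pt) (idRow (.cons (K.obj z.pt b) (.nil _)))))
      (.pair (cellId (C.hom x z.pt)) (K.lact z.pt z.pt b)) (idRow _) :=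
    IsPaste.cons_id (hp := rfl) (.singleEq (Category.comp_id _) (Category.comp_id _)
      (K.one_lact z.pt b))
  have hi' : IsPaste (CellRow.cons (by rfl) (cellId (C.hom x z.pt)) (.cons (p := .nil _) (by rfl)
      (C.one z.pt) (idRow (.cons (K.obj z.pt b) (.nil _)))))
      (.pair (C.mul x z.pt z.pt) (cellId (K.obj z.pt b))) (idRow _) :=
    IsPaste.cons₂Eq (hp := rfl) (ho' := rfl) (Category.comp_id _)
      (Category.comp_id _) (C.mul_one x z.pt) (.id_right (idRow (.cons (K.obj z.pt b) (.nil _))))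
  have key := hj.paste_eq hi hi' k q hs rfl α
  have k₁ := pasteAssoc (hm.whisker k q hs rfl hs) α (Category.id_comp f) (Category.id_comp g)
    (Category.id_comp f) (Category.id_comp g) (Category.id_comp f) (Category.id_comp g)
  have k₂ := pasteAssoc (hm'.whisker k q hs rfl hs) α (Category.id_comp f) (Category.id_comp g)
    (Category.id_comp f) (Category.id_comp g) (Category.id_comp f) (Category.id_comp g)
  refine k₁.symm.trans ((congrArg (fun y => paste _ y (Category.id_comp _) (Category.id_comp _))
    key).trans (k₂.trans ?_))
  have e₃ := whiskerRow_id k (.cons (C.hom x z.pt) (.cons (K.obj z.pt b) (.nil _))) q hs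
  exact (congrArg (fun y => paste y α (Category.id_comp _) (Category.id_comp _)) e₃).trans
    (ids_paste α)

end Left

section Right

variable (K : EnrProfunctor D C) (b : D.Obj) (x : C.Obj)

/-- The cell `K(b, x) ⟶ K(b, e)`. -/
def pullRight : Cell (.cons (K.obj b x) (.nil _)) (𝟙 _) (z.arr x) (K.obj b z.pt) :=
  paste (.pair (cellId (K.obj b x)) (z.toPt x)) (K.ract b x z.pt)
    (Category.comp_id _) (Category.comp_id _)

/-- The row from `K(b, x)` to `K(b, e), C(e, x)`. -/
def rightRow : Row (.cons (K.obj b x) (.nil _)) (𝟙 _) (𝟙 _)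
    (.cons (K.obj b z.pt) (.cons (C.hom z.pt x) (.nil _))) :=
  .cons (by rfl) (z.pullRight K b x) (.single (z.ofPt x))

theorem rightRow_ract : paste (z.rightRow K b x) (K.ract b z.pt x) (Category.comp_id _)
    (Category.comp_id _) = cellId (K.obj b x) := by
  have h₁ := pasteAssoc (ρ := .cons (by rfl) (cellId (K.obj b x)) (.cons (p := .nil _) (by rfl)
      (z.toPt x) (.single (z.ofPt x)))) (IsPaste.cons₂ (β := K.ract b x z.pt)
      (ho' := rfl) (hp := rfl) (Category.comp_id _)
    (Category.comp_id _) (.singleEq (ρ := .single (z.ofPt x)) (Category.comp_id _)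
      (Category.comp_id _) (paste_id (z.ofPt x)))) (K.ract b z.pt x) (Category.comp_id _)
      (Category.comp_id _) (Category.comp_id _) (Category.comp_id _) (Category.comp_id _)
      (Category.comp_id _)
  have h₂ := pasteAssoc (ρ := .cons (by rfl) (cellId (K.obj b x)) (.cons (p := .nil _) (by rfl)
      (z.toPt x) (.single (z.ofPt x)))) (IsPaste.cons_id
    (hp := rfl) (.singleEq (Category.comp_id _) (Category.comp_id _)
      (z.mul_eq x))) (K.ract b x x) (Category.comp_id _)
      (Category.comp_id _) (Category.comp_id _) (Category.comp_id _) (Category.comp_id _)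
      (Category.comp_id _)
  refine h₁.symm.trans (Eq.trans ?_ (h₂.trans (K.ract_one b x)))
  exact congrArg (fun y => paste _ y (Category.comp_id _) (Category.comp_id _))
    (K.ract_mul b x z.pt x)

theorem ract_pullRight : paste (.single (K.ract b z.pt x)) (z.pullRight K b x)
    (Category.id_comp _) (Category.id_comp _) = paste (.pair (cellId (K.obj b z.pt))
      (z.pullRight C.homProfunctor z.pt x)) (K.ract b z.pt z.pt) (Category.comp_id _)
      (Category.comp_id _) := by
  have h₁ := pasteAssoc (IsPaste.cons_id (α := K.ract b z.pt x)
    (ho := (ProPath.append_nil _).symm) (hp := rfl)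
    (IsPaste.singleEq (ρ := .nil (𝟙 _)) (Category.id_comp _) (Category.id_comp _)
      (nil_id_paste (z.toPt x)))) (K.ract b x z.pt)
    (Category.comp_id _) (Category.comp_id _) (Category.id_comp _) (Category.id_comp _)
    (Category.comp_id _) (Category.comp_id _)
  have h₂ := pasteAssoc (ρ := .cons (by rfl) (cellId (K.obj b z.pt)) (.cons (by rfl)
      (cellId (C.hom z.pt x)) (.single (z.toPt x)))) (IsPaste.cons₂Eq (γ := K.ract b z.pt x)
      (ho' := rfl) (hp := rfl) (Category.comp_id _)
    (Category.comp_id _) (ids_paste (K.ract b z.pt x)) (.singleEq (ρ := .single (z.toPt x))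
      (Category.comp_id _) (Category.comp_id _) (paste_id (z.toPt x)))) (K.ract b x z.pt)
      (Category.comp_id _) (Category.comp_id _) (Category.comp_id _) (Category.comp_id _)
      (Category.comp_id _) (Category.comp_id _)
  have h₃ := pasteAssoc (ρ := .cons (by rfl) (cellId (K.obj b z.pt)) (.cons (by rfl)
      (cellId (C.hom z.pt x)) (.single (z.toPt x)))) (IsPaste.cons_id (hp := rfl)
    (.single (.pair (cellId (C.hom z.pt x)) (z.toPt x)) (C.mul z.pt x z.pt)
      (Category.comp_id _) (Category.comp_id _))) (K.ract b z.pt z.pt) (Category.comp_id _)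
      (Category.comp_id _) (Category.comp_id _) (Category.comp_id _) (Category.comp_id _)
      (Category.comp_id _)
  refine h₁.trans (h₂.symm.trans (Eq.trans ?_ h₃))
  exact congrArg (fun y => paste _ y (Category.comp_id _) (Category.comp_id _))
    (K.ract_mul b z.pt x z.pt)

/-- The mirror image of `lact_isComposite`: here `C(e, e)` is moved from its left neighbour `K(b,
e)` to its right neighbour `C(e, x)`. -/
theorem ract_isComposite : IsComposite (K.ract b z.pt x) := by
  apply IsCover.isComposite
  have h := IsPaste.singleEq (Category.comp_id _) (Category.comp_id _) (z.rightRow_ract K b x)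
  have h' : IsPaste (.single (K.ract b z.pt x)) (z.rightRow K b x) _ :=
    IsPaste.cons₁ (hp := rfl) (ho := rfl) (Category.id_comp _) (Category.id_comp _)
      (.singleEq (ρ := .nil (𝟙 _)) (Category.id_comp _) (Category.id_comp _)
        (nil_id_paste (z.ofPt x)))
  rw [z.ract_pullRight] at h'
  refine IsCover.of_inverse h h' fun k q s' hs f g L α => ?_
  have hm : IsPaste (CellRow.cons (by rfl) (cellId (K.obj b z.pt)) (.cons
      (by rfl) (z.pullRight C.homProfunctor z.pt x) (.single (z.ofPt x))))
      (.pair (K.ract b z.pt z.pt) (cellId (C.hom z.pt x))) _ :=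
    IsPaste.cons₂ (α₀ := cellId (K.obj b z.pt)) (α := z.pullRight C.homProfunctor z.pt x)
      (β := K.ract b z.pt z.pt) (ho₂ := rfl) (ho := rfl) (ho' := rfl) (hp := rfl)
      (Category.comp_id _) (Category.comp_id _)
      (.singleEq (ρ := .single (z.ofPt x)) (Category.comp_id _) (Category.comp_id _)
        (paste_id (z.ofPt x)))
  have hm' : IsPaste (CellRow.cons (by rfl) (cellId (K.obj b z.pt)) (.cons
      (by rfl) (z.pullRight C.homProfunctor z.pt x) (.single (z.ofPt x))))
      (.pair (cellId (K.obj b z.pt)) (C.mul z.pt z.pt x)) (idRow _) :=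
    IsPaste.cons_id (hp := rfl)
      (.singleEq (Category.comp_id _) (Category.comp_id _) (z.rightRow_ract C.homProfunctor z.pt x))
  have hj := (IsCover.consIds z.one_isComposite (.cons (C.hom z.pt x) (.nil _)) (by rfl)).cons
    (K.obj b z.pt)
  have hi : IsPaste (CellRow.cons (by rfl) (cellId (K.obj b z.pt)) (.cons (p := .nil _) (by rfl)
      (C.one z.pt) (idRow (.cons (C.hom z.pt x) (.nil _)))))
      (.pair (K.ract b z.pt z.pt) (cellId (C.hom z.pt x))) (idRow _) :=
    IsPaste.cons₂Eq (hp := rfl) (ho' := rfl) (Category.comp_id _)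
      (Category.comp_id _) (K.ract_one b z.pt) (.id_right (idRow (.cons (C.hom z.pt x) (.nil _))))
  have hi' : IsPaste (CellRow.cons (by rfl) (cellId (K.obj b z.pt)) (.cons (p := .nil _) (by rfl)
      (C.one z.pt) (idRow (.cons (C.hom z.pt x) (.nil _)))))
      (.pair (cellId (K.obj b z.pt)) (C.mul z.pt z.pt x)) (idRow _) :=
    IsPaste.cons_id (hp := rfl) (.singleEq (Category.comp_id _) (Category.comp_id _)
      (C.one_mul z.pt x))
  have key := hj.paste_eq hi hi' k q hs rfl α
  have k₁ := pasteAssoc (hm.whisker k q hs rfl hs) α (Category.id_comp f) (Category.id_comp g)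
    (Category.id_comp f) (Category.id_comp g) (Category.id_comp f) (Category.id_comp g)
  have k₂ := pasteAssoc (hm'.whisker k q hs rfl hs) α (Category.id_comp f) (Category.id_comp g)
    (Category.id_comp f) (Category.id_comp g) (Category.id_comp f) (Category.id_comp g)
  refine k₁.symm.trans ((congrArg (fun y => paste _ y (Category.id_comp _) (Category.id_comp _))
    key).trans (k₂.trans ?_))
  have e₃ := whiskerRow_id k (.cons (K.obj b z.pt) (.cons (C.hom z.pt x) (.nil _))) q hs
  exact (congrArg (fun y => paste y α (Category.id_comp _) (Category.id_comp _)) e₃).trans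
    (ids_paste α)

end Right

end EnrCat.Center

end Centers

/-! ### Interior and right actions in concatenated strings -/

section Density

variable {E : Type u} [VirtualDoubleCategory.{z, w, v} E]

/-- Together with its mirror below, this places an interior action of a piece inside a longer
string, where the compatibility of a morphism out of the whole string can be used. -/
theorem InnerActions.append_left {C D D' : EnrCat.{t} E} {p : ProfPath C D} {q : ProfPath D D'}
    {a : C.Obj} {b : D.Obj} {d : D'.Obj} (c : Chain p a b) {o : HPath (D.ext b) (D'.ext d)}
    {s s' : ChainRow o q b d (𝟙 _) (𝟙 _)} (h : InnerActions o s s')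
    {o' : HPath (C.ext a) (D'.ext d)} (ho : o' = c.path.append o) :
    InnerActions o' ((ChainRow.ids c).append ho s) ((ChainRow.ids c).append ho s') := by
  induction c with
  | nil a =>
    change o' = o at ho
    subst ho
    exact h
  | @cons C D D' J p a b d c ih =>
    subst ho
    rename_i s s' _
    have e := ChainRow.idCons_append (a := a) (J := J) (.ids c) s (rfl : _ = c.path.append o) rfl
    have e' := ChainRow.idCons_append (a := a) (J := J) (.ids c) s' (rfl : _ = c.path.append o) rfl
    exact e.symm ▸ e'.symm ▸ InnerActions.cons (J := J) a (ih h rfl)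

theorem InnerActions.append_right {C D D' : EnrCat.{t} E} {p : ProfPath C D} {q : ProfPath D D'}
    {a : C.Obj} {b : D.Obj} {d : D'.Obj} {o : HPath (C.ext a) (D.ext b)}
    {s s' : ChainRow o p a b (𝟙 _) (𝟙 _)} (h : InnerActions o s s') (c : Chain q b d)
    {o' : HPath (C.ext a) (D'.ext d)} (ho : o' = o.append c.path) :
    InnerActions o' (s.append ho (ChainRow.ids c)) (s'.append ho (ChainRow.ids c)) := by
  induction h with
  | here a d d' c₁ =>
    rename_i J J₁ p e b
    have hc := Chain.path_append c₁ c
    have h₁ := congrArg (ProPath.cons (J₁.obj d' e)) hc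
    have h₂ := congrArg (ProPath.cons (EnrCat.hom _ d d')) h₁
    have h₃ := congrArg (ProPath.cons (J.obj a d)) h₂
    obtain rfl := ho.trans h₃.symm
    have e₁ : (ChainRow.cons (by rfl) (J₁.lact d d' e) (.ids c₁)).append h₂ (.ids c) =
        ChainRow.cons (by rfl) (J₁.lact d d' e) (.ids (c₁.append c)) :=
      (ChainRow.cons_append _ _ hc rfl _ _ _).trans
        (congrArg (ChainRow.cons (by rfl) (J₁.lact d d' e)) (ChainRow.ids_append c₁ c))
    have e₂ : (ChainRow.cons (by rfl) (cellId (J.obj a d))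
        (ChainRow.cons (by rfl) (J₁.lact d d' e) (.ids c₁))).append h₃ (.ids c) =
          ChainRow.cons (by rfl) (cellId (J.obj a d))
            (ChainRow.cons (by rfl) (J₁.lact d d' e) (.ids (c₁.append c))) :=
      (ChainRow.idCons_append _ _ h₂ _).trans
        (congrArg (ChainRow.cons (by rfl) (cellId (J.obj a d))) e₁)
    have e₃ : (ChainRow.cons (by rfl) (J.ract a d d')
        (ChainRow.cons (by rfl) (cellId (J₁.obj d' e)) (.ids c₁))).append h₃ (.ids c) =
          ChainRow.cons (by rfl) (J.ract a d d')
            (ChainRow.cons (by rfl) (cellId (J₁.obj d' e)) (.ids (c₁.append c))) :=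
      (ChainRow.cons_append _ _ h₁ rfl _ _ _).trans
        (congrArg (ChainRow.cons (by rfl) (J.ract a d d')) ((ChainRow.idCons_append _ _ hc _).trans
        (congrArg (ChainRow.cons (by rfl) (cellId (J₁.obj d' e))) (ChainRow.ids_append c₁ c))))
    exact e₂.symm ▸ e₃.symm ▸ InnerActions.here (J := J) (J' := J₁) (p := p.append q) a d d'
      (c₁.append c)
  | @cons _ _ _ J p a d b o s s' h ih =>
    subst ho
    have e := fun s => ChainRow.idCons_append (a := a) (J := J) (p := p) s (.ids c)
      (rfl : _ = o.append c.path) rfl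
    exact (e s).symm ▸ (e s').symm ▸ InnerActions.cons (J := J) a (ih c rfl)

/-- An empty string has no last profunctor to act on. This is one of the places where a dense
morphism must come out of a nonempty string. -/
theorem RightAction.nonempty : ∀ {C D : EnrCat.{t} E} {p : ProfPath C D} (_ : p.IsCons) {a : C.Obj}
    {b : D.Obj} (c : Chain p a b) (b' : D.Obj), ∃ s, RightAction c b' s
  | _, _, .nil _, hp, _, _, _, _ => hp.elim
  | _, _, .cons _ (.nil _), _, _, _, .cons a (.nil b), b' => ⟨_, .last a b b'⟩
  | _, _, .cons _ (.cons J p), _, _, _, .cons a c, b' =>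
      have ⟨_, h⟩ := RightAction.nonempty (show (ProPath.cons J p).IsCons from trivial) c b'
      ⟨_, .cons a h⟩

/-- The string `p.append (.nil D)` is equal to `p` only propositionally, so actions on the last
profunctor of `p` have to be carried over. -/
theorem RightAction.append_nil {C D : EnrCat.{t} E} {p : ProfPath C D} {a : C.Obj}
    {b b' : D.Obj} {c : Chain p a b} {s} (h : RightAction c b' s) (ho) :
    RightAction (c.append (.nil b)) b' (s.append ho (.ids (.nil b'))) := by
  induction h with
  | last a b b' => exact .last a b b'
  | @cons _ _ _ J p a d b c b' s h ih =>
    have hp : (c.append (.nil b)).path.append (.cons (EnrCat.hom _ b b') (.nil _)) =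
        (c.path.append (.cons (EnrCat.hom _ b b') (.nil _))).append (.nil _) := by
      rw [Chain.path_append, ProPath.append_nil]
      congr 1
      exact ProPath.append_nil _
    have e := ChainRow.idCons_append (a := a) (J := J) (p := p) s (.ids (.nil b')) hp ho
    exact e.symm ▸ RightAction.cons (J := J) a (ih hp)

/-- The right action on a string is prefixed by identities. -/
theorem RightAction.append : ∀ {C D D' : EnrCat.{t} E} {p : ProfPath C D}
    {q : ProfPath D D'} {a : C.Obj} {b : D.Obj} {d d' : D'.Obj}
    (c₁ : Chain p a b) {c₂ : Chain q b d} {s₂} (_ : RightAction c₂ d' s₂) (ho),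
    RightAction (c₁.append c₂) d' ((ChainRow.ids c₁).append ho s₂)
  | _, _, _, _, _, _, _, _, _, .nil _, c₂, s₂, h, ho => h
  | _, _, _, .cons J p, q, _, _, _, d', .cons a c₁, c₂, s₂, h, ho => by
      have ho' : (c₁.append c₂).path.append (.cons (EnrCat.hom _ _ d') (.nil _)) =
          c₁.path.append (c₂.path.append (.cons (EnrCat.hom _ _ d') (.nil _))) := by
        rw [Chain.path_append, ProPath.append_assoc]
      have e := ChainRow.idCons_append (a := a) (J := J) (.ids c₁) s₂ ho' ho
      exact e.symm ▸ RightAction.cons a (RightAction.append c₁ h ho')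

/-- The interior action at the junction of two strings. -/
theorem RightAction.innerActions {C D D' D'' : EnrCat.{t} E} {p : ProfPath C D}
    {J : EnrProfunctor D D'} {q : ProfPath D' D''} {a : C.Obj} {d d' : D.Obj} {e : D'.Obj}
    {b : D''.Obj} {c₁ : Chain p a d} (c : Chain q e b) {s} (h : RightAction c₁ d' s)
    {o : HPath (C.ext a) (D''.ext b)}
    (ho : o = c₁.path.append (.cons (D.hom d d') (.cons (J.obj d' e) c.path)))
    (ho' : o = (c₁.path.append (.cons (D.hom d d') (.nil _))).append (.cons (J.obj d' e) c.path)) :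
    InnerActions o ((ChainRow.ids c₁).append ho (.cons (by rfl) (J.lact d d' e) (.ids c)))
      (s.append ho' (.ids (.cons (J := J) d' c))) := by
  induction h with
  | last a d d' =>
    subst ho
    exact .here a d d' c
  | @cons _ _ _ J₀ p a m d c₁ d' s h ih =>
    subst ho
    have hm : c₁.path.append (.cons (EnrCat.hom _ d d') (.cons (J.obj d' e) c.path)) =
      (c₁.path.append (.cons (EnrCat.hom _ d d') (.nil _))).append (.cons (J.obj d' e) c.path) := by
        rw [ProPath.append_assoc]; rfl
    have e₁ := ChainRow.idCons_append (a := a) (J := J₀) (.ids c₁)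
      (.cons (by rfl) (J.lact d d' e) (.ids c))
      (rfl : _ = c₁.path.append (.cons (EnrCat.hom _ d d') (.cons (J.obj d' e) c.path))) rfl
    have e₂ := ChainRow.idCons_append (a := a) (J := J₀) (p := p) s (.ids (.cons (J := J) d' c)) hm ho'
    exact e₁.symm ▸ e₂.symm ▸ InnerActions.cons (J := J₀) a (ih rfl hm)

/-! ### Interchange of whiskering with rows of actions -/

namespace VirtualDoubleCategory

section Interchange

variable {X Y Z W : E}

/-- If `s` after `ρ` equals `ν` after `σ`, the same holds in the middle of a string while unrelated
rows `S₁` and `S₃` act on the two ends. In the application `ρ` and `ν` come from components of a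
dense morphism `μ`, `s` is an identity or an action on its codomain, and `σ` is the corresponding
row on its domain. -/
theorem whisker_interchange {o₁ k : HPath Z X} {o₂ o₂' m : HPath X Y} {J : Pro X Y}
    {o₃ q : HPath Y W} (S₁ : Row o₁ (𝟙 _) (𝟙 _) k) (S₃ : Row o₃ (𝟙 _) (𝟙 _) q)
    {ρ : Row o₂' (𝟙 _) (𝟙 _) o₂} {s : Cell o₂ (𝟙 _) (𝟙 _) J} {σ : Row o₂' (𝟙 _) (𝟙 _) m}
    {ν : Cell m (𝟙 _) (𝟙 _) J} (e : paste ρ s (Category.comp_id _) (Category.comp_id _) =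
      paste σ ν (Category.comp_id _) (Category.comp_id _)) {Y₀ Y₁ : E} {f : Z ⟶ Y₀} {g : W ⟶ Y₁}
    {K : Pro Y₀ Y₁} {l l' l'' t t' u v : HPath _ _} (hl : l = o₁.append (o₂'.append o₃))
    (hl' : l' = o₁.append (o₂.append o₃)) (hu : u = o₂.append o₃) (hl'' : l' = o₁.append u)
    (ht : t = k.append (.cons J q)) (hv : v = o₂'.append o₃) (hl₁ : l = o₁.append v)
    (hw : l'' = m.append q) (ht' : t' = k.append l'') (ht'' : t' = k.append (m.append q))
    (ψ : Cell t f g K) :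
    paste (whiskerRow o₁ ρ o₃ hl hl') (paste (S₁.append hl'' ht (.cons hu s S₃)) ψ
      (Category.id_comp _) (Category.id_comp _)) (Category.id_comp _) (Category.id_comp _) =
    paste (S₁.append hl₁ ht' (σ.append hv hw S₃)) (paste (whiskerRow k (.single ν) q ht'' ht) ψ
      (Category.id_comp _) (Category.id_comp _)) (Category.id_comp _) (Category.id_comp _) := by
  subst hu hl' hv hl₁ hw ht' ht
  have h₁ := (IsPaste.id_left S₁).append ((IsPaste.singleEq (Category.comp_id _)
    (Category.comp_id _) e).append (IsPaste.id_left S₃) rfl rfl rfl) rfl rfl rfl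
  have h₂ := (IsPaste.id_right S₁).append ((IsPaste.single σ ν (Category.comp_id _)
    (Category.comp_id _)).append (IsPaste.id_right S₃) rfl rfl rfl) rfl rfl rfl
  have a₁ := append_cons (ProPath.append_nil o₂).symm (by rfl) (by rfl) rfl rfl rfl s (.nil (𝟙 _)) S₃
  refine (congrArg (fun S => paste (whiskerRow o₁ ρ o₃ hl rfl) (paste (S₁.append hl'' rfl S) ψ
    (Category.id_comp _) (Category.id_comp _)) (Category.id_comp _) (Category.id_comp _))
    a₁.symm).trans ?_
  exact (pasteAssoc h₁ ψ _ _ _ _ (Category.id_comp _) (Category.id_comp _)).trans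
    (pasteAssoc h₂ ψ _ _ _ _ (Category.id_comp _) (Category.id_comp _)).symm

theorem whiskerRow_cons_left {X₀ : E} {o p : HPath X Y} (L : Pro X₀ Z) (k : HPath Z X)
    (ρ : Row o (𝟙 X) (𝟙 Y) p) (q : HPath Y W) {s t : HPath Z W} (hs : s = k.append (o.append q))
    (ht : t = k.append (p.append q)) (hs' : ProPath.cons L s = (ProPath.cons L k).append (o.append q))
    (ht' : ProPath.cons L t = (ProPath.cons L k).append (p.append q)) :
    whiskerRow (.cons L k) ρ q hs' ht' = .cons (by rfl) (cellId L) (whiskerRow k ρ q hs ht) := by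
  subst hs ht
  exact append_cons ..

theorem whiskerRow_append_last {W' : E} {o p : HPath X Y} (k : HPath Z X)
    (ρ : Row o (𝟙 X) (𝟙 Y) p) (q : HPath Y W) (L : HPath W W')
    {s t : HPath Z W} (hs : s = k.append (o.append q))
    (ht : t = k.append (p.append q)) {s' t' : HPath Z W'}
    (hs' : s' = k.append (o.append (q.append L)))
    (ht' : t' = k.append (p.append (q.append L)))
    (hs'' : s' = s.append L) (ht'' : t' = t.append L) :
    whiskerRow k ρ (q.append L) hs' ht' =
      (whiskerRow k ρ q hs ht).append hs'' ht'' (idRow L) :=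
  (whiskerRow_whiskerRow k ρ q hs ht (.nil Z) L hs'' ht'' hs' ht').symm.trans
    (whiskerRow_nil_left _ L hs'' ht'')

/-- The counterpart of `whiskerRow_cons` on the right: identity cells that follow `ν` are absorbed
into the right context. -/
theorem whiskerRow_consIds {W' : E} {m : HPath X Y} {J : Pro X Y} (ν : Cell m (𝟙 X) (𝟙 Y) J)
    (k : HPath Z X) (L : HPath Y W) (q : HPath W W') {s t : HPath Z W'}
    (hs : s = k.append ((m.append L).append q)) (ht : t = k.append ((ProPath.cons J L).append q))
    (hs' : s = k.append (m.append (L.append q))) (ht' : t = k.append (.cons J (L.append q))) :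
    whiskerRow k (.cons rfl ν (idRow L)) q hs ht =
      whiskerRow k (.single ν) (L.append q) hs' ht' := by
  subst ht
  have hm := ProPath.append_assoc m L q
  have e₁ : (CellRow.cons rfl ν (idRow L) : Row (m.append L) _ _ (.cons J L)).append rfl rfl
      (idRow q) = .cons hm ν (idRow (L.append q)) :=
    (append_cons rfl rfl (by rfl) hm rfl rfl ν (idRow L) (idRow q)).trans
      (congrArg (CellRow.cons hm ν) (idRow_append L q).symm)
  have e₂ : (CellRow.single ν).append rfl rfl (idRow (L.append q)) =
      .cons rfl ν (idRow (L.append q)) :=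
    append_cons (ProPath.append_nil m).symm rfl (by rfl) rfl rfl rfl ν (.nil (𝟙 Y)) _
  refine (congrArg (CellRow.append hs rfl (idRow k)) e₁).trans ?_
  refine Eq.trans ?_ (congrArg (CellRow.append hs' rfl (idRow k)) e₂).symm
  have key : ∀ {v : HPath X W'} (h : v = m.append (L.append q)) (h' : s = k.append v),
      (idRow k).append h' rfl (CellRow.cons h ν (idRow (L.append q))) =
        (idRow k).append hs' rfl (CellRow.cons rfl ν (idRow (L.append q))) := by
    intro v h h'
    subst h
    rfl
  exact key hm hs

/-- Whiskering commutes with a left action. -/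
theorem whiskerRow_paste_pair_left {X₀ : E} {o p : HPath X Y} (L : Pro X₀ Z) (k : HPath Z X)
    (ρ : Row o (𝟙 X) (𝟙 Y) p) (q : HPath Y W) {s t : HPath Z W} (hs : s = k.append (o.append q))
    (ht : t = k.append (p.append q)) (hs' : ProPath.cons L s = (ProPath.cons L k).append (o.append q))
    (ht' : ProPath.cons L t = (ProPath.cons L k).append (p.append q)) {Y₀ Y₁ Y₂ : E}
    {f : X₀ ⟶ Y₀} {g : Z ⟶ Y₁} {h : W ⟶ Y₂} {K₀ : Pro Y₀ Y₁} {K₁ : Pro Y₁ Y₂} {K : Pro Y₀ Y₂}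
    (x : Cell (.cons L (.nil Z)) f g K₀) (ψ : Cell t g h K₁)
    (χ : Cell (.cons K₀ (.cons K₁ (.nil Y₂))) (𝟙 _) (𝟙 _) K) :
    paste (whiskerRow (.cons L k) ρ q hs' ht') (paste (.pair x ψ) χ (Category.comp_id _)
      (Category.comp_id _)) (Category.id_comp _) (Category.id_comp _) =
    paste (.pair x (paste (whiskerRow k ρ q hs ht) ψ (Category.id_comp _) (Category.id_comp _))) χ
      (Category.comp_id _) (Category.comp_id _) := by
  rw [whiskerRow_cons_left L k ρ q hs ht]
  refine pasteAssoc ?_ χ _ _ _ _ _ _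
  have := CellRow.Paste.cons (paste := paste (V := E)) (o'' := .cons L s) (p'' := .cons L t)
    (by rfl) (by rfl) (Category.id_comp _) (Category.id_comp _)
    (idRow (.cons L (.nil Z))) x (IsPaste.single (whiskerRow k ρ q hs ht) ψ (Category.id_comp _)
      (Category.id_comp _))
  rw [ids_paste] at this
  exact this

/-- Whiskering commutes with a right action. -/
theorem whiskerRow_paste_pair_right {W' : E} {o p : HPath X Y} (L : Pro W W') (k : HPath Z X)
    (ρ : Row o (𝟙 X) (𝟙 Y) p) (q : HPath Y W) {s t : HPath Z W} (hs : s = k.append (o.append q))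
    (ht : t = k.append (p.append q)) {s' : HPath Z W'}
    (hs' : s' = k.append (o.append (q.append (.cons L (.nil _)))))
    (ht' : t.append (.cons L (.nil _)) = k.append (p.append (q.append (.cons L (.nil _)))))
    (hs'' : s' = s.append (.cons L (.nil _))) {Y₀ Y₁ Y₂ : E}
    {f : Z ⟶ Y₀} {g : W ⟶ Y₁} {h : W' ⟶ Y₂} {K₀ : Pro Y₀ Y₁} {K₁ : Pro Y₁ Y₂} {K : Pro Y₀ Y₂}
    (ψ : Cell t f g K₀) (x : Cell (.cons L (.nil W')) g h K₁)
    (χ : Cell (.cons K₀ (.cons K₁ (.nil Y₂))) (𝟙 _) (𝟙 _) K) :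
    paste (whiskerRow k ρ (q.append (.cons L (.nil _))) hs' ht') (paste (.pair ψ x) χ
      (Category.comp_id _) (Category.comp_id _)) (Category.id_comp _) (Category.id_comp _) =
    paste (.cons hs'' (paste (whiskerRow k ρ q hs ht) ψ (Category.id_comp _) (Category.id_comp _))
      (.single x)) χ (Category.comp_id _) (Category.comp_id _) := by
  rw [whiskerRow_append_last k ρ q (.cons L (.nil _)) hs ht hs' ht' hs'' rfl]
  exact pasteAssoc (.cons hs'' rfl (Category.id_comp _) (Category.id_comp _) _ ψ
    (IsPaste.id_left (.single x))) χ _ _ _ _ _ _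

end Interchange

end VirtualDoubleCategory

namespace EnrMorphism

variable {B C D D' : EnrCat.{t} E} {P : ProfPath C D} {J : EnrProfunctor C D}

/-- The components of a morphism over identities. -/
def glob (μ : EnrMorphism P (𝟙 C) (𝟙 D) J) {a : C.Obj} {b : D.Obj} (c : Chain P a b) :
    Cell c.path (𝟙 _) (𝟙 _) (J.obj a b) := μ.app c

/-- At a list of objects cut into three pieces, whiskering `μ` amounts to whiskering its component
at the middle piece. This reduces universal properties of enriched morphisms to statements about
cells of `E`. -/
theorem evalRow_whisker (μ : EnrMorphism P (𝟙 C) (𝟙 D) J) {k : ProfPath B C} {q : ProfPath D D'}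
    {x : B.Obj} {a : C.Obj} {b : D.Obj} {y : D'.Obj} (c₁ : Chain k x a) (c : Chain P a b)
    (c₂ : Chain q b y) (hs : (c₁.append (c.append c₂)).path = c₁.path.append (c.path.append c₂.path))
    (ht : (c₁.append (.cons (J := J) a c₂)).path = c₁.path.append (.cons (J.obj a b) c₂.path)) :
    evalRow (VirtualDoubleCategory.whisker (V := EnrCat.{t} E) μ k q) (c₁.append (c.append c₂)) =
      ⟨c₁.append (.cons a c₂), whiskerRow c₁.path (.single (μ.glob c)) c₂.path hs ht⟩ := by
  have e₀ := whisker_eq (V := EnrCat.{t} E) μ k q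
  refine (congrArg (fun ρ => evalRow ρ (c₁.append (c.append c₂))) e₀).trans ?_
  have e₁ := evalRow_append (idRow (V := EnrCat.{t} E) k)
    ((CellRow.single μ).append rfl rfl (idRow (V := EnrCat.{t} E) q)) c₁ (c.append c₂)
  have e₂ := evalRow_append (CellRow.single μ) (idRow (V := EnrCat.{t} E) q) c c₂
  have e₃ := evalRow_single μ c
  refine e₁.trans ?_
  refine (congrArg (fun s => (evalRow (idRow (V := EnrCat.{t} E) k) c₁).append
    (Chain.path_append _ _) s) (e₂.trans (congrArg (fun s => s.append (Chain.path_append _ _)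
      (evalRow (idRow (V := EnrCat.{t} E) q) c₂)) e₃))).trans ?_
  refine (congrArg₂ (fun s s' => s.append (Chain.path_append c₁ (c.append c₂))
    ((ChainRow.cons (ProPath.append_nil _).symm (μ.app c) (.nil ((𝟙 D : D ⟶ D).arr b))).append
    (Chain.path_append c c₂) s')) (evalRow_ids c₁) (evalRow_ids c₂)).trans ?_
  exact congrArg (ChainRow.mk (c₁.append (.cons a c₂))) (whiskerRow_append_right (.single (μ.glob c))
    c₁.path c₂.path (Chain.path_append c c₂) (by rfl) _ _ _ _)

end EnrMorphism

end Density

/-! ### Dense morphisms and extension of families along them -/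

section Density

variable {E : Type u} [VirtualDoubleCategory.{z, w, v} E]

namespace EnrMorphism

variable {B C D D' : EnrCat.{t} E} {P : ProfPath C D} {J : EnrProfunctor C D}

/-- A family of cells, out of the strings `k, P(a, …, b), q`, which is compatible with the interior
actions. -/
structure InnerCompat {Z W Y₀ Y₁ : E} {a : C.Obj} {b : D.Obj} (k : HPath Z (C.ext a))
    (q : HPath (D.ext b) W) {f : Z ⟶ Y₀} {g : W ⟶ Y₁} {K : Pro Y₀ Y₁} {O : Chain P a b → HPath Z W}
    (hO : ∀ c, O c = k.append (c.path.append q)) (φ : ∀ c, Cell (O c) f g K) : Prop where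
  inner : ∀ {o : HPath (C.ext a) (D.ext b)} {s s' : ChainRow o P a b (𝟙 _) (𝟙 _)},
    InnerActions o s s' → ∀ {o' : HPath Z W} (h : o' = k.append (o.append q)),
      paste (whiskerRow k s.row q h (hO s.chain)) (φ s.chain) (Category.id_comp _)
        (Category.id_comp _) =
      paste (whiskerRow k s'.row q h (hO s'.chain)) (φ s'.chain) (Category.id_comp _)
        (Category.id_comp _)

/-- The components of `μ` exhibit each `J(a, b)` as the colimit of the `P(a, …, b)`. -/
structure IsDense (μ : EnrMorphism P (𝟙 C) (𝟙 D) J) : Prop where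
  ext : ∀ {Z W Y₀ Y₁ : E} {a : C.Obj} {b : D.Obj} (k : HPath Z (C.ext a))
    (q : HPath (D.ext b) W) {f : Z ⟶ Y₀} {g : W ⟶ Y₁} {K : Pro Y₀ Y₁} {o : HPath Z W}
    (ho : o = k.append (.cons (J.obj a b) q)) {ψ ψ' : Cell o f g K},
    (∀ (c : Chain P a b) {O : HPath Z W} (hO : O = k.append (c.path.append q)),
      paste (whiskerRow k (.single (μ.glob c)) q hO ho) ψ (Category.id_comp _)
        (Category.id_comp _) =
      paste (whiskerRow k (.single (μ.glob c)) q hO ho) ψ' (Category.id_comp _)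
        (Category.id_comp _)) → ψ = ψ'
  exists_lift : ∀ {Z W Y₀ Y₁ : E} {a : C.Obj} {b : D.Obj} (k : HPath Z (C.ext a))
    (q : HPath (D.ext b) W) {f : Z ⟶ Y₀} {g : W ⟶ Y₁} {K : Pro Y₀ Y₁} {o : HPath Z W}
    (ho : o = k.append (.cons (J.obj a b) q)) {O : Chain P a b → HPath Z W}
    (hO : ∀ c, O c = k.append (c.path.append q)) (φ : ∀ c, Cell (O c) f g K),
    InnerCompat k q hO φ → ∃ ψ : Cell o f g K, ∀ c,
      paste (whiskerRow k (.single (μ.glob c)) q (hO c) ho) ψ (Category.id_comp _)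
        (Category.id_comp _) = φ c

theorem inner_eq {C' D₁ : EnrCat.{t} E} {p : ProfPath C D} {F : C ⟶ C'} {G : D ⟶ D₁}
    {K : EnrProfunctor C' D₁} (α : EnrMorphism p F G K) {a : C.Obj} {b : D.Obj}
    {o : HPath (C.ext a) (D.ext b)} {s s' : ChainRow o p a b (𝟙 _) (𝟙 _)}
    (h : InnerActions o s s') :
    paste s.row (α.app s.chain) (Category.id_comp _) (Category.id_comp _) =
      paste s'.row (α.app s'.chain) (Category.id_comp _) (Category.id_comp _) :=
  paste_eq_cast (α.inner _ _ _ h) (Category.id_comp _) (Category.id_comp _)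

variable {C' D₁ : EnrCat.{t} E} {μ : EnrMorphism P (𝟙 C) (𝟙 D) J} {k : ProfPath B C}
  {q : ProfPath D D'} {F : B ⟶ C'} {G : D' ⟶ D₁} {K : EnrProfunctor C' D₁}
  {α : EnrMorphism (k.append (P.append q)) F G K} {β : ChainFamily (k.append (.cons J q)) F G K}

/-- The family `β` composed with the whiskering of `μ` is `α`. -/
structure Extends (μ : EnrMorphism P (𝟙 C) (𝟙 D) J) (k : ProfPath B C) (q : ProfPath D D')
    (α : EnrMorphism (k.append (P.append q)) F G K)
    (β : ChainFamily (k.append (.cons J q)) F G K) : Prop where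
  eq : ∀ {x : B.Obj} {a : C.Obj} {b : D.Obj} {y : D'.Obj} (c₁ : Chain k x a) (c : Chain P a b)
    (c₂ : Chain q b y) (hs : (c₁.append (c.append c₂)).path = c₁.path.append (c.path.append c₂.path))
    (ht : (c₁.append (.cons (J := J) a c₂)).path = c₁.path.append (.cons (J.obj a b) c₂.path)),
    paste (whiskerRow c₁.path (.single (μ.glob c)) c₂.path hs ht) (β (c₁.append (.cons a c₂)))
      (Category.id_comp _) (Category.id_comp _) = α.app (c₁.append (c.append c₂))

namespace Extends

/-- The tool for testing `β`. If `s` after `ρ` is a row on `P` followed by `μ`, then `β` evaluated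
on a row containing `s` becomes, after composition with `ρ`, the value of `α` on a row over `k, P,
q`. Laws for `β`, composed with components of `μ`, thus become laws for `α`. -/
theorem paste_eq (h : Extends μ k q α β) {x : B.Obj} {a : C.Obj} {b : D.Obj} {y : D'.Obj}
    {o₁ : HPath (B.ext x) (C.ext a)} {o₂ o₂' : HPath (C.ext a) (D.ext b)}
    {o₃ : HPath (D.ext b) (D'.ext y)} (S₁ : ChainRow o₁ k x a (𝟙 _) (𝟙 _))
    (S₂ : ChainRow o₂' P a b (𝟙 _) (𝟙 _)) (S₃ : ChainRow o₃ q b y (𝟙 _) (𝟙 _))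
    {ρ : Row o₂' (𝟙 _) (𝟙 _) o₂} {s : Cell o₂ (𝟙 _) (𝟙 _) (J.obj a b)}
    (e : paste ρ s (Category.comp_id _) (Category.comp_id _) =
      paste S₂.row (μ.glob S₂.chain) (Category.comp_id _) (Category.comp_id _))
    {l l' u v : HPath _ _} (hl : l = o₁.append (o₂'.append o₃))
    (hl' : l' = o₁.append (o₂.append o₃)) (hu : u = o₂.append o₃) (hl'' : l' = o₁.append u)
    (hv : v = o₂'.append o₃) (hl₁ : l = o₁.append v) :
    paste (whiskerRow o₁ ρ o₃ hl hl') (paste (S₁.append hl'' (.cons hu s S₃)).row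
      (β (S₁.append hl'' (.cons hu s S₃)).chain) (Category.id_comp _) (Category.id_comp _))
      (Category.id_comp _) (Category.id_comp _) =
    paste (S₁.append hl₁ (S₂.append hv S₃)).row (α.app (S₁.append hl₁ (S₂.append hv S₃)).chain)
      (Category.id_comp _) (Category.id_comp _) := by
  have hc := Chain.path_append S₂.chain S₃.chain
  have hc' := Chain.path_append S₁.chain (S₂.chain.append S₃.chain)
  refine (whisker_interchange S₁.row S₃.row e hl hl' hu hl'' (Chain.path_append _ _) hv hl₁ hc
    hc' (hc'.trans (congrArg _ hc)) (β (S₁.append hl'' (.cons hu s S₃)).chain)).trans ?_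
  exact congrArg (fun x => paste _ x (Category.id_comp _) (Category.id_comp _))
    (h.eq S₁.chain S₂.chain S₃.chain _ _)

end Extends

/-- Some of the laws to be tested have a hom proarrow `L` next to `J(a, b)` in their domain. Joint
injectivity of the components of `μ` persists when `L` is kept fixed, since `L` can be counted as
part of the context. -/
theorem IsDense.ext_cons (hμ : IsDense μ) {Z W Y₀ Y₁ X : E} {a : C.Obj} {b : D.Obj} (k : HPath Z X)
    (L : Pro X (C.ext a)) (q : HPath (D.ext b) W) {f : Z ⟶ Y₀} {g : W ⟶ Y₁} {K : Pro Y₀ Y₁}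
    {o : HPath Z W} (ho : o = k.append ((ProPath.cons L (.cons (J.obj a b) (.nil _))).append q))
    {ψ ψ' : Cell o f g K} (h : ∀ (c : Chain P a b) {O : HPath Z W}
      (hO : O = k.append ((ProPath.cons L c.path).append q)),
      paste (whiskerRow k (.cons (by rfl) (cellId L) (.single (μ.glob c))) q hO ho) ψ
        (Category.id_comp _) (Category.id_comp _) =
      paste (whiskerRow k (.cons (by rfl) (cellId L) (.single (μ.glob c))) q hO ho) ψ'
        (Category.id_comp _) (Category.id_comp _)) : ψ = ψ' := by
  have a {X Y Z W : E} (p : HPath X Y) (q : HPath Y Z) (r : HPath Z W) := ProPath.append_assoc p q r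
  have ho' := ho.trans (a k (.cons L (.nil _)) (.cons (J.obj _ b) q)).symm
  refine hμ.ext (k.append (.cons L (.nil _))) q ho' fun c O hO => ?_
  have hO' := hO.trans (a k (.cons L (.nil _)) (c.path.append q))
  have e := whiskerRow_cons k L (.single (μ.glob c)) q hO' ho hO ho'
  exact e ▸ h c hO'

theorem IsDense.ext_append (hμ : IsDense μ) {Z W Y₀ Y₁ X : E} {a : C.Obj} {b : D.Obj}
    (k : HPath Z (C.ext a))
    (L : Pro (D.ext b) X) (q : HPath X W) {f : Z ⟶ Y₀} {g : W ⟶ Y₁} {K : Pro Y₀ Y₁}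
    {o : HPath Z W} (ho : o = k.append ((ProPath.cons (J.obj a b) (.cons L (.nil _))).append q))
    {ψ ψ' : Cell o f g K} (h : ∀ (c : Chain P a b) {O : HPath Z W}
      (hO : O = k.append ((c.path.append (.cons L (.nil _))).append q)),
      paste (whiskerRow k (.cons (by rfl) (μ.glob c) (.single (cellId L))) q hO ho) ψ
        (Category.id_comp _) (Category.id_comp _) =
      paste (whiskerRow k (.cons (by rfl) (μ.glob c) (.single (cellId L))) q hO ho) ψ'
        (Category.id_comp _) (Category.id_comp _)) : ψ = ψ' := by
  refine hμ.ext k (.cons L q) ho fun c O hO => ?_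
  have hO' : O = k.append ((c.path.append (.cons L (.nil _))).append q) := by
    rw [hO, ProPath.append_assoc]; rfl
  have e := whiskerRow_consIds (μ.glob c) k (.cons L (.nil _)) q hO' ho hO ho
  exact e ▸ h c hO'

end EnrMorphism

end Density

/-! ### Equivariance of the extended family -/

section Density

variable {E : Type u} [VirtualDoubleCategory.{z, w, v} E]

namespace EnrMorphism

variable {B C D D' : EnrCat.{t} E} {P : ProfPath C D} {J : EnrProfunctor C D}

section Glob

/-- The instance of the hypothesis of `Extends.paste_eq` that serves for actions not involving `J`.
-/
theorem glob_id (μ : EnrMorphism P (𝟙 C) (𝟙 D) J) {a : C.Obj} {b : D.Obj} (c : Chain P a b) :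
    paste (.single (μ.glob c)) (cellId _) (Category.comp_id _) (Category.comp_id _) =
      paste (ChainRow.ids c).row (μ.glob (ChainRow.ids c).chain) (Category.comp_id _)
        (Category.comp_id _) :=
  (paste_id (μ.glob c)).trans (ids_paste (μ.glob c)).symm

/-- Equivariance of `μ` in the form needed by `Extends.paste_eq`: an action on `J(a, b)` is induced
by an action on the first profunctor of its domain. This is why the string has to have a first
profunctor. -/
theorem glob_lact {C₁ : EnrCat.{t} E} {P₁ : EnrProfunctor C C₁} {P' : ProfPath C₁ D}
    (μ : EnrMorphism (.cons P₁ P') (𝟙 C) (𝟙 D) J) (a a' : C.Obj) {m : C₁.Obj} {b : D.Obj}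
    (c : Chain P' m b) :
    paste (.cons (p := .cons _ (.nil _)) (by rfl) (cellId (C.hom a a'))
      (.single (μ.glob (.cons a' c)))) (J.lact a a' b) (Category.comp_id _) (Category.comp_id _) =
    paste (ChainRow.cons (J := P₁) (by rfl) (P₁.lact a a' m) (.ids c)).row (μ.glob (.cons a c))
      (Category.comp_id _) (Category.comp_id _) :=
  (paste_eq_cast (μ.left a a' c) (Category.comp_id _) (Category.comp_id _)).symm

theorem glob_ract (μ : EnrMorphism P (𝟙 C) (𝟙 D) J) {a : C.Obj} {b b' : D.Obj} {c : Chain P a b}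
    {s} (h : RightAction c b' s) :
    paste (.cons (by rfl) (μ.glob c) (.single (cellId (D.hom b b')))) (J.ract a b b')
      (Category.comp_id _) (Category.comp_id _) =
    paste s.row (μ.glob s.chain) (Category.comp_id _) (Category.comp_id _) :=
  (paste_eq_cast (μ.right c b' s h) (Category.comp_id _) (Category.comp_id _)).symm

end Glob

variable {C' D₁ : EnrCat.{t} E} {μ : EnrMorphism P (𝟙 C) (𝟙 D) J} {k : ProfPath B C}
  {q : ProfPath D D'} {F : B ⟶ C'} {G : D' ⟶ D₁} {K : EnrProfunctor C' D₁}
  {α : EnrMorphism (k.append (P.append q)) F G K} {β : ChainFamily (k.append (.cons J q)) F G K}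

/-- Both sides are cells out of a string in which some `J(a, b)` occurs, so by density they may be
compared after composition with the components of `μ`. There they are values of `α` on two rows that
differ by an interior action in `k, P, q`. -/
theorem Extends.inner (h : Extends μ k q α β) (hμ : IsDense μ) (hP : P.IsCons) {x : B.Obj}
    {y : D'.Obj} {o : HPath (B.ext x) (D'.ext y)}
    {s s' : ChainRow o (k.append (.cons J q)) x y (𝟙 _) (𝟙 _)} (hi : InnerActions o s s') :
    paste s.row (β s.chain) (Category.id_comp _) (Category.id_comp _) =
      paste s'.row (β s'.chain) (Category.id_comp _) (Category.id_comp _) := by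
  have hs := InnerActions.split k hi
  clear hi
  cases hs with
  -- The action takes place inside `k` and leaves `J` untouched.
  | left hi c ho =>
    rename_i m o₁ s s'
    cases c with
    | @cons _ _ _ _ _ _ b _ c₂ =>
    refine hμ.ext o₁ c₂.path ho fun c O hO => ?_
    have hO' := hO.trans (congrArg o₁.append (Chain.path_append c c₂).symm)
    have hi' := hi.append_right (c.append c₂) hO'
    rw [← ChainRow.ids_append] at hi'
    have e := fun s => h.paste_eq s (.ids c) (.ids c₂) (μ.glob_id c) hO ho
      (by rfl) ho (Chain.path_append c c₂) hO'
    exact (e s).trans ((α.inner_eq hi').trans (e s').symm)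
  | right c₁ hi ho =>
    rename_i m o₂ s s'
    cases hi with
    -- The junction of `J` with the first profunctor of `q`. Right equivariance of `μ` moves the
    -- action on `J` to the last profunctor of `P`.
    | @here _ _ _ _ _ J' q _ d d' e b c₂ =>
      refine hμ.ext_append c₁.path (D.hom d d') (.cons (J'.obj d' e) c₂.path) ho fun c O hO => ?_
      obtain ⟨R, hR⟩ := RightAction.nonempty hP c d'
      have ha : O = c₁.path.append (c.path.append (.cons (D.hom d d') (.cons (J'.obj d' e) c₂.path))) :=
        hO.trans (congrArg _ (ProPath.append_assoc _ _ _))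
      have ha' := (ProPath.append_assoc c.path (.cons (D.hom d d') (.nil _))
        (.cons (J'.obj d' e) c₂.path)).symm
      have hi' := (hR.innerActions (J := J') c₂ rfl ha').append_left c₁ ha
      have e₁ := h.paste_eq (.ids c₁) (.ids c)
        (.cons (by rfl) (J'.lact d d' e) (.ids c₂)) (μ.glob_id c) ha ho (by rfl) ho rfl ha
      have e₂ := h.paste_eq (.ids c₁) R
        (.cons (by rfl) (cellId (J'.obj d' e)) (.ids c₂)) (μ.glob_ract hR) hO ho (by rfl) ho
        ha' ha
      have e₃ := whiskerRow_consIds (μ.glob c) c₁.path (.cons (D.hom d d') (.nil _))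
        (.cons (J'.obj d' e) c₂.path) hO ho ha ho
      refine Eq.trans ?_ (e₁.trans ((α.inner_eq hi').trans e₂.symm))
      exact congrArg (fun x => paste x _ (Category.id_comp _) (Category.id_comp _)) e₃
    -- The action takes place inside `q`.
    | @cons _ _ _ _ _ _ d _ o₃ s s' hi =>
      refine hμ.ext c₁.path o₃ ho fun c O hO => ?_
      have hi' := (hi.append_left c rfl).append_left c₁ hO
      have e := fun s => h.paste_eq (.ids c₁) (.ids c) s (μ.glob_id c) hO ho
        (by rfl) ho rfl hO
      exact (e s).trans ((α.inner_eq hi').trans (e s').symm)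
  -- The junction of `k` with `J`. Left equivariance of `μ` moves the action on `J` to the first
  -- profunctor of `P`.
  | mid c₁ c₂ hi ho ho' =>
    rename_i d d' b s
    cases P with
    | nil => exact hP.elim
    | @cons _ C₁ _ P₁ P =>
    refine hμ.ext_cons c₁.path (C.hom d d') c₂.path ho fun c O hO => ?_
    cases c with
    | @cons _ _ _ _ _ _ m _ c =>
    have hc := Chain.path_append c c₂
    have hc' : O = c₁.path.append (.cons (C.hom d d') (.cons (P₁.obj d' m) (c.append c₂).path)) :=
      hO.trans (congrArg (fun x => c₁.path.append (.cons _ (.cons _ x))) hc.symm)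
    have hc'' := hc'.trans (ProPath.append_assoc c₁.path (.cons (C.hom d d') (.nil _)) _).symm
    have hO' := hO.trans (ProPath.append_assoc c₁.path (.cons (C.hom d d') (.nil _))
      ((ProPath.cons (P₁.obj d' m) c.path).append c₂.path)).symm
    have hi' := hi.innerActions (J := P₁) (c.append c₂) hc' hc''
    have e₁ := h.paste_eq (.ids c₁) (.cons (by rfl) (P₁.lact d d' m) (.ids c)) (.ids c₂)
      (μ.glob_lact d d' c) hO ho (by rfl) ho
      (congrArg (fun x => ProPath.cons _ (ProPath.cons _ x)) hc) hc'
    have e₂ := h.paste_eq s (.ids (.cons (J := P₁) d' c)) (.ids c₂) (μ.glob_id _) hO' ho' (by rfl)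
      ho' (congrArg (fun x => ProPath.cons _ x) hc) hc''
    have e₃ := whiskerRow_cons c₁.path (C.hom d d') (.single (μ.glob (.cons d' c))) c₂.path hO ho
      hO' ho'
    have a₁ : (ChainRow.cons (by rfl) (P₁.lact d d' m) (.ids c)).append
        (congrArg (fun x => ProPath.cons _ (ProPath.cons _ x)) hc) (.ids c₂) =
          ChainRow.cons (J := P₁) (by rfl) (P₁.lact d d' m) (.ids (c.append c₂)) :=
      (ChainRow.cons_append _ _ hc rfl _ _ _).trans
        (congrArg (ChainRow.cons (by rfl) (P₁.lact d d' m)) (ChainRow.ids_append c c₂))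
    have a₂ : _ = ChainRow.ids (.cons (J := P₁) d' (c.append c₂)) :=
      ChainRow.ids_append (.cons (J := P₁) d' c) c₂
    replace hi' := Eq.subst (motive := fun S => InnerActions O _ (s.append hc'' S)) a₂.symm
      (Eq.subst (motive := fun S => InnerActions O ((ChainRow.ids c₁).append hc' S) _) a₁.symm hi')
    refine e₁.trans ((α.inner_eq hi').trans (e₂.symm.trans ?_))
    exact congrArg (fun x => paste x _ (Category.id_comp _) (Category.id_comp _)) e₃.symm

/-- The type of a row depends on the list of objects on which it lands, so the two can only be
replaced simultaneously. -/
theorem _root_.ChainRow.paste_congr {C D C' D₁ : EnrCat.{t} E} {X X' : E} {p : ProfPath C D}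
    {F : C ⟶ C'} {G : D ⟶ D₁}
    {K : EnrProfunctor C' D₁} (α : ChainFamily p F G K) {o : HPath X X'} {a : C.Obj} {b : D.Obj}
    {f : X ⟶ C.ext a} {g : X' ⟶ D.ext b} {s s' : ChainRow o p a b f g} (e : s = s')
    {k : X ⟶ C'.ext (F.obj a)} {l : X' ⟶ D₁.ext (G.obj b)} (h₁ : f ≫ F.arr a = k)
    (h₂ : g ≫ G.arr b = l) :
    paste s.row (α s.chain) h₁ h₂ = paste s'.row (α s'.chain) h₁ h₂ := by
  subst e
  rfl

/-- As for `Extends.inner`, the sides are compared after composition with the components of `μ`,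
where the claim becomes the left law of `α`. -/
theorem Extends.left (h : Extends μ k q α β) (hμ : IsDense μ) (hP : P.IsCons) :
    LeftLaw (k.append (.cons J q)) F G K β := by
  cases k with
  -- Here the category acts on `J` itself. Because `P` is nonempty, `α.left` is the law about acting
  -- on the first profunctor of `P` and not the naturality condition of the empty string.
  | nil =>
    cases P with
    | nil => exact hP.elim
    | @cons _ C₁ _ P₁ P =>
    intro a a' b y c₂
    refine paste_eq_cast (h₁ := Category.id_comp _) (h₂ := Category.id_comp _)
      (h₃ := Category.comp_id _) (h₄ := Category.comp_id _) ?_ (Category.id_comp _).symm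
      (Category.id_comp _).symm
    refine hμ.ext (.cons (B.hom a a') (.nil _)) c₂.path (by rfl) fun c O hO => ?_
    cases c with
    | @cons _ _ _ _ _ _ m _ c =>
    have hc := Chain.path_append c c₂
    have hc' := congrArg (fun x => ProPath.cons (P₁.obj a' m) x) hc
    have hc'' := congrArg (fun x => ProPath.cons (B.hom a a') x) hc'
    obtain rfl := hO.trans hc''.symm
    have e₁ := h.paste_eq (.ids (.nil a)) (.cons (by rfl) (P₁.lact a a' m) (.ids c)) (.ids c₂)
      (μ.glob_lact a a' c) hc'' (by rfl) (by rfl) (by rfl) hc'' (by rfl)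
    have e₂ := whiskerRow_cons (.nil _) (B.hom a a') (.single (μ.glob (.cons a' c))) c₂.path
      hc'' (by rfl) (by exact hc'') (by rfl)
    have e₃ := paste_eq_cast (α.left a a' (c.append c₂)) (Category.id_comp _) (Category.id_comp _)
    have e₄ := h.eq (.nil a') (.cons a' c) c₂ hc' rfl
    have e₅ := whiskerRow_paste_pair_left (B.hom a a') (.nil _) (.single (μ.glob (.cons a' c)))
      c₂.path hc' (by rfl) hc'' (by rfl) (F.hom a a') (β (.cons a' c₂)) (K.lact _ _ _)
    have a₁ : (ChainRow.cons (by rfl) (P₁.lact a a' m) (.ids c)).append hc'' (.ids c₂) =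
          ChainRow.cons (J := P₁) (by rfl) (P₁.lact a a' m) (.ids (c.append c₂)) :=
      (ChainRow.cons_append _ _ hc rfl _ _ _).trans
        (congrArg (ChainRow.cons (by rfl) (P₁.lact a a' m)) (ChainRow.ids_append c c₂))
    refine (congrArg (fun x => paste x _ (Category.id_comp _) (Category.id_comp _)) e₂.symm).trans
      (e₁.trans ((ChainRow.paste_congr (p := .cons P₁ (P.append q)) α.app a₁ _ _).trans
      (e₃.trans (Eq.trans ?_ e₅.symm))))
    exact congrArg (fun x => paste (.pair (F.hom a a') x) (K.lact _ _ _) (Category.comp_id _)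
      (Category.comp_id _)) e₄.symm
  -- Here the category acts on the first profunctor of `k`, away from `J`.
  | @cons _ B₁ _ L k =>
    intro a a' d y c
    obtain ⟨m, c₁, c', rfl⟩ := Chain.exists_append k c
    cases c' with
    | @cons _ _ _ _ _ _ b _ c₂ =>
    refine paste_eq_cast (h₁ := Category.id_comp _) (h₂ := Category.id_comp _)
      (h₃ := Category.comp_id _) (h₄ := Category.comp_id _) ?_ (Category.id_comp _).symm
      (Category.id_comp _).symm
    have hk := Chain.path_append c₁ (.cons (J := J) m c₂)
    have hk' := congrArg (fun x => ProPath.cons (L.obj a' d) x) hk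
    have hk'' := congrArg (fun x => ProPath.cons (B.hom a a') x) hk'
    refine hμ.ext (.cons (B.hom a a') (.cons (L.obj a' d) c₁.path)) c₂.path hk'' fun c O hO => ?_
    have hc := (Chain.path_append c₁ (c.append c₂)).trans
      (congrArg c₁.path.append (Chain.path_append c c₂))
    have hc' := congrArg (fun x => ProPath.cons (L.obj a' d) x) hc
    have hc'' := congrArg (fun x => ProPath.cons (B.hom a a') x) hc'
    obtain rfl := hO.trans hc''.symm
    have hd := congrArg (fun x => ProPath.cons (B.hom a a') (ProPath.cons (L.obj a' d) x))
      (Chain.path_append c₁ (c.append c₂))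
    have e₁ := h.paste_eq (.cons (J := L) (by rfl) (L.lact a a' d) (.ids c₁)) (.ids c) (.ids c₂)
      (μ.glob_id c) hc'' hk'' (by rfl) hk'' (Chain.path_append c c₂) hd
    have e₃ := paste_eq_cast (α.left a a' (c₁.append (c.append c₂))) (Category.id_comp _)
      (Category.id_comp _)
    have e₄ := h.eq (.cons a' c₁) c c₂ hc' hk'
    have e₅ := whiskerRow_paste_pair_left (B.hom a a') (.cons (L.obj a' d) c₁.path)
      (.single (μ.glob c)) c₂.path hc' hk' hc'' hk'' (F.hom a a')
      (β (.cons a' (c₁.append (.cons m c₂)))) (K.lact _ _ _)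
    have a₁ : (ChainRow.cons (by rfl) (L.lact a a' d) (.ids c₁)).append hk''
        (.ids (.cons (J := J) m c₂)) = ChainRow.cons (J := L) (by rfl) (L.lact a a' d)
          (.ids (c₁.append (.cons (J := J) m c₂))) :=
      (ChainRow.cons_append _ _ hk rfl _ _ _).trans
        (congrArg (ChainRow.cons (by rfl) (L.lact a a' d)) (ChainRow.ids_append c₁ _))
    have a₂ : (ChainRow.cons (by rfl) (L.lact a a' d) (.ids c₁)).append hd
        ((ChainRow.ids c).append (Chain.path_append c c₂) (.ids c₂)) =
          ChainRow.cons (J := L) (by rfl) (L.lact a a' d) (.ids (c₁.append (c.append c₂))) :=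
      (congrArg (ChainRow.append hd _) (ChainRow.ids_append c c₂)).trans
      ((ChainRow.cons_append _ _ (Chain.path_append c₁ (c.append c₂)) rfl _ _ _).trans
        (congrArg (ChainRow.cons (by rfl) (L.lact a a' d)) (ChainRow.ids_append c₁ _)))
    refine (congrArg (fun x => paste _ x (Category.id_comp _) (Category.id_comp _))
      (ChainRow.paste_congr (p := .cons L (k.append (.cons J q))) β a₁.symm _ _)).trans
      (e₁.trans ((ChainRow.paste_congr (p := .cons L (k.append (P.append q))) α.app a₂ _ _).trans
      (e₃.trans (Eq.trans ?_ e₅.symm))))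
    exact congrArg (fun x => paste (.pair (F.hom a a') x) (K.lact _ _ _) (Category.comp_id _)
      (Category.comp_id _)) e₄.symm

/-- Tested against the components of `μ`, this becomes the right law of `α`. -/
theorem Extends.right (h : Extends μ k q α β) (hμ : IsDense μ) (hP : P.IsCons) {x : B.Obj}
    {y : D'.Obj} (c : Chain (k.append (.cons J q)) x y) (y' : D'.Obj)
    (s : ChainRow (c.path.append (.cons (D'.hom y y') (.nil _))) (k.append (.cons J q)) x y'
      (𝟙 _) (𝟙 _)) (hs : RightAction c y' s) :
    paste s.row (β s.chain) (Category.id_comp _) (Category.id_comp _) =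
      paste (.pair (β c) (G.hom y y')) (K.ract (F.obj x) (G.obj y) (G.obj y'))
        (Category.comp_id _) (Category.comp_id _) := by
  obtain ⟨m, c₁, c', rfl⟩ := Chain.exists_append k c
  obtain ⟨s₂, ho, h₂, rfl⟩ := RightAction.exists_append k (q := .cons J q) trivial c₁ c' hs
  clear hs
  cases c' with
  | @cons _ _ _ _ _ _ b _ c₂ =>
  have hk := Chain.path_append c₁ (.cons (J := J) m c₂)
  refine hμ.ext c₁.path (c₂.path.append (.cons (D'.hom y y') (.nil _))) ho fun c O hO => ?_
  have hp := (Chain.path_append c₁ (c.append c₂)).trans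
    (congrArg c₁.path.append (Chain.path_append c c₂))
  obtain rfl : O = (c₁.append (c.append c₂)).path.append (.cons (D'.hom y y') (.nil _)) := by
    rw [hO, hp, ProPath.append_assoc, ProPath.append_assoc]
  have e₄ := h.eq c₁ c c₂ hp hk
  have e₅ := whiskerRow_paste_pair_right (D'.hom y y') c₁.path (.single (μ.glob c)) c₂.path hp hk hO
    ho rfl (β (c₁.append (.cons m c₂))) (G.hom y y') (K.ract _ _ _)
  refine Eq.trans ?_ ((congrArg (fun x => paste (.pair x (G.hom y y')) (K.ract _ _ _)
    (Category.comp_id _) (Category.comp_id _)) e₄.symm).trans e₅.symm)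
  cases q with
  -- The category acts on `J` itself, hence, by equivariance of `μ`, on the last profunctor of `P`.
  | nil =>
    cases c₂ with
    | nil =>
    cases h₂ with
    | cons _ h => nomatch h
    | last =>
    obtain ⟨R, hR⟩ := RightAction.nonempty hP c y'
    have hn : (c.append (.nil b)).path = c.path :=
      (Chain.path_append c (.nil b)).trans (ProPath.append_nil _)
    have hn' : (c.append (.nil b)).path.append (.cons (EnrCat.hom _ b y') (.nil _)) =
      (c.path.append (.cons (EnrCat.hom _ b y') (.nil _))).append (.nil _) :=
      (congrArg (fun x => ProPath.append x (.cons (EnrCat.hom _ b y') (.nil _))) hn).trans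
        (ProPath.append_nil _).symm
    have hq : (c₁.append (c.append (.nil b))).path.append (.cons (EnrCat.hom _ b y') (.nil _)) =
        c₁.path.append ((c.append (.nil b)).path.append (.cons (EnrCat.hom _ b y') (.nil _))) := by
      rw [Chain.path_append, ProPath.append_assoc]
    have hq' := hq.trans (congrArg c₁.path.append hn')
    have e₁ := h.paste_eq (.ids c₁) R (.ids (.nil y')) (μ.glob_ract hR) hq' ho (by rfl) ho hn' hq
    have e₂ := whiskerRow_consIds (μ.glob c) c₁.path (.cons (EnrCat.hom _ b y') (.nil _)) (.nil _) hq' ho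
      hO ho
    have e₃ := paste_eq_cast (α.right _ _ _ ((hR.append_nil hn').append c₁ hq))
      (Category.id_comp _) (Category.id_comp _)
    exact (congrArg (fun x => paste x _ (Category.id_comp _) (Category.id_comp _)) e₂.symm).trans
      (e₁.trans e₃)
  -- The action is on the last profunctor of `q`, so `J` is not involved.
  | cons L q =>
    obtain ⟨s₃, h₃, rfl⟩ := RightAction.cons_inv (show (ProPath.cons L q).IsCons from trivial) h₂
    have hv : (c.append c₂).path.append (.cons (D'.hom y y') (.nil _)) =
        c.path.append (c₂.path.append (.cons (D'.hom y y') (.nil _))) := by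
      rw [Chain.path_append, ProPath.append_assoc]
    have hq : (c₁.append (c.append c₂)).path.append (.cons (D'.hom y y') (.nil _)) =
        c₁.path.append ((c.append c₂).path.append (.cons (D'.hom y y') (.nil _))) := by
      rw [Chain.path_append, ProPath.append_assoc]
    have e₁ := h.paste_eq (.ids c₁) (.ids c) s₃ (μ.glob_id c) hO ho (by rfl) ho hv hq
    have e₃ := paste_eq_cast (α.right _ _ _ ((h₃.append c hv).append c₁ hq))
      (Category.id_comp _) (Category.id_comp _)
    exact e₁.trans e₃

end EnrMorphism

end Density

/-! ### Dense morphisms out of nonempty strings are composites -/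

section Density

variable {E : Type u} [VirtualDoubleCategory.{z, w, v} E]

/-- The object at the cut is part of what is determined, hence the dependent pairs. -/
theorem Chain.append_inj {C D D' : EnrCat.{t} E} {p : ProfPath C D} {q : ProfPath D D'} {a : C.Obj}
    {b b' : D.Obj} {d : D'.Obj} {c₁ : Chain p a b} {c₂ : Chain q b d} {c₁' : Chain p a b'}
    {c₂' : Chain q b' d} (h : c₁.append c₂ = c₁'.append c₂') :
    (⟨b, c₁, c₂⟩ : Σ b, Chain p a b × Chain q b d) = ⟨b', c₁', c₂'⟩ := by
  have e {b} (c₁ : Chain p a b) (c₂ : Chain q b d) :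
      (⟨(split₀ p (c₁.append c₂)).mid, (split₀ p (c₁.append c₂)).fst,
        (split₀ p (c₁.append c₂)).snd⟩ : Σ b, Chain p a b × Chain q b d) = ⟨b, c₁, c₂⟩ := by
    rw [split₀_append]
  rw [← e c₁ c₂, ← e c₁' c₂', h]

namespace EnrMorphism

variable {B C D D' : EnrCat.{t} E} {P : ProfPath C D} {J : EnrProfunctor C D}
  {C' D₁ : EnrCat.{t} E} {μ : EnrMorphism P (𝟙 C) (𝟙 D) J} {k : ProfPath B C}
  {q : ProfPath D D'} {F : B ⟶ C'} {G : D' ⟶ D₁} {K : EnrProfunctor C' D₁}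
  {α : EnrMorphism (k.append (P.append q)) F G K}

/-- Every list of objects over `k, P, q` is a concatenation of three lists. The equation in the
universal property of `μ` is therefore equivalent to equations between components in `E`. -/
theorem paste_whisker_iff (β : EnrMorphism (k.append (.cons J q)) F G K) :
    paste (V := EnrCat.{t} E) (VirtualDoubleCategory.whisker (V := EnrCat.{t} E) μ k q) β
      (Category.id_comp F) (Category.id_comp G) = α ↔ Extends μ k q α β.app := by
  have key {x : B.Obj} {a : C.Obj} {b : D.Obj} {y : D'.Obj} (c₁ : Chain k x a) (c : Chain P a b)
      (c₂ : Chain q b y)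
      (hs : (c₁.append (c.append c₂)).path = c₁.path.append (c.path.append c₂.path))
      (ht : (c₁.append (.cons (J := J) a c₂)).path = c₁.path.append (.cons (J.obj a b) c₂.path)) :
      (vpaste (VirtualDoubleCategory.whisker (V := EnrCat.{t} E) μ k q) β
        (Category.id_comp F) (Category.id_comp G)).app (c₁.append (c.append c₂)) =
      paste (whiskerRow c₁.path (.single (μ.glob c)) c₂.path hs ht)
        (β.app (c₁.append (.cons a c₂))) (Category.id_comp _) (Category.id_comp _) := by
    refine eq_of_heq ((vpaste_app _ _ _ _ _).trans ?_)
    have e := evalRow_whisker μ c₁ c c₂ hs ht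
    exact (heq_of_eq (congrArg (fun s : ChainRow _ _ _ _ _ _ => s.app β.app) e)).trans
      (heq_paste _ _ _ _ _ _)
  constructor
  · intro h
    refine ⟨fun c₁ c c₂ hs ht => (key c₁ c c₂ hs ht).symm.trans ?_⟩
    rw [← h]
    rfl
  · intro h
    refine EnrMorphism.ext (funext fun x => funext fun y => funext fun c => ?_)
    obtain ⟨a, c₁, c, rfl⟩ := Chain.exists_append k c
    obtain ⟨b, c, c₂, rfl⟩ := Chain.exists_append P c
    have hs := (Chain.path_append c₁ (c.append c₂)).trans
      (congrArg c₁.path.append (Chain.path_append c c₂))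
    exact (key c₁ c c₂ hs (Chain.path_append _ _)).trans (h.eq c₁ c c₂ hs _)

/-- For fixed outer lists, the values of `α` form a family over the lists through `P` that is
compatible with the interior actions, and density lifts it to a cell out of `J(a, b)` in its
context. -/
theorem IsDense.exists_extends (hμ : IsDense μ) (α : EnrMorphism (k.append (P.append q)) F G K) :
    ∃ β : ChainFamily (k.append (.cons J q)) F G K, Extends μ k q α β := by
  -- The decomposition of `c` enters as a variable with an equation, so that the chosen cell depends
  -- on `c` alone. Uniqueness of the decomposition, `Chain.append_inj`, makes this harmless.
  have key {x : B.Obj} {y : D'.Obj} (c : Chain (k.append (.cons J q)) x y) :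
      ∃ ψ : Cell c.path (F.arr x) (G.arr y) (K.obj (F.obj x) (G.obj y)),
        ∀ {a : C.Obj} {b : D.Obj} (c₁ : Chain k x a) (c' : Chain P a b) (c₂ : Chain q b y)
          (_ : c = c₁.append (.cons (J := J) a c₂))
          (hs : (c₁.append (c'.append c₂)).path = c₁.path.append (c'.path.append c₂.path))
          (ht : c.path = c₁.path.append (.cons (J.obj a b) c₂.path)),
        paste (whiskerRow c₁.path (.single (μ.glob c')) c₂.path hs ht) ψ
          (Category.id_comp _) (Category.id_comp _) = α.app (c₁.append (c'.append c₂)) := by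
    obtain ⟨a, c₁, c, rfl⟩ := Chain.exists_append k c
    cases c with
    | @cons _ _ _ _ _ _ b _ c₂ =>
    have hs (c' : Chain P a b) := (Chain.path_append c₁ (c'.append c₂)).trans
      (congrArg c₁.path.append (Chain.path_append c' c₂))
    obtain ⟨ψ, hψ⟩ := hμ.exists_lift c₁.path c₂.path
      (Chain.path_append c₁ (.cons (J := J) a c₂)) hs
      (fun c' => α.app (c₁.append (c'.append c₂))) ⟨fun {o s s'} h {o'} ho => by
        have e := α.inner_eq ((h.append_right c₂ rfl).append_left c₁ ho)
        have r (s : ChainRow o P a b (𝟙 _) (𝟙 _)) := whiskerRow_append_right s.row c₁.path c₂.path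
          rfl (Chain.path_append s.chain c₂) ho (Chain.path_append c₁ (s.chain.append c₂)) ho
          (hs s.chain)
        exact (congrArg (fun x => paste x _ (Category.id_comp _) (Category.id_comp _))
          (r s).symm).trans (e.trans (congrArg (fun x => paste x _ (Category.id_comp _)
            (Category.id_comp _)) (r s')))⟩
    refine ⟨ψ, fun {a' b'} c₁' c' c₂' h _ ht => ?_⟩
    cases Chain.append_inj (p := k) (q := .cons J q) h
    exact hψ c'
  choose β hβ using @key
  exact ⟨fun _ _ c => β c, ⟨fun c₁ c c₂ hs ht => hβ _ c₁ c c₂ rfl hs ht⟩⟩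

/-- A dense morphism out of a nonempty string is a composite. -/
theorem IsDense.isComposite (hμ : IsDense μ) (hP : P.IsCons) :
    IsComposite (V := EnrCat.{t} E) μ := by
  intro B D' C' D₁ k q F G K α
  obtain ⟨β, hβ⟩ := hμ.exists_extends α
  refine ⟨⟨β, fun o s s' h => paste_eq_cast (hβ.inner hμ hP h) (Category.id_comp _).symm
    (Category.id_comp _).symm, hβ.left hμ hP, fun c b' s h =>
      paste_eq_cast (hβ.right hμ hP c b' s h) (Category.id_comp _).symm
    (Category.id_comp _).symm⟩, (paste_whisker_iff _).2 hβ, fun β' h => ?_⟩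
  replace h := (paste_whisker_iff β').1 h
  refine EnrMorphism.ext (funext fun x => funext fun y => funext fun c => ?_)
  obtain ⟨a, c₁, c, rfl⟩ := Chain.exists_append k c
  cases c with
  | @cons _ _ _ _ _ _ b _ c₂ =>
  have ht := Chain.path_append c₁ (.cons (J := J) a c₂)
  -- Uniqueness: both extensions have the same composites with the components of `μ`.
  refine hμ.ext c₁.path c₂.path ht fun c O hO => ?_
  have hs := (Chain.path_append c₁ (c.append c₂)).trans
    (congrArg c₁.path.append (Chain.path_append c c₂))
  obtain rfl := hO.trans hs.symm
  exact (h.eq c₁ c c₂ hs ht).trans (hβ.eq c₁ c c₂ hs ht).symm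

end EnrMorphism

end Density

/-! ### Unitors and the insertion of units -/

namespace VirtualDoubleCategory

variable {V : Type u} [VirtualDoubleCategory.{z, w, v} V] {X Y : V}

/-- The remaining case of two-out-of-three. -/
theorem Bijects.cancel_right {s t r : HPath X Y} {σ : Row s (𝟙 X) (𝟙 Y) t}
    {τ : Row t (𝟙 X) (𝟙 Y) r} {υ : Row s (𝟙 X) (𝟙 Y) r} (h : IsPaste σ τ υ) (hτ : Bijects τ)
    (hυ : Bijects υ) : Bijects σ := by
  have e {Y₀ Y₁ : V} (f : X ⟶ Y₀) (g : Y ⟶ Y₁) (K : Pro Y₀ Y₁) (γ : Cell r f g K) :=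
    pasteAssoc h γ (Category.id_comp f) (Category.id_comp g) (Category.id_comp f)
      (Category.id_comp g) (Category.id_comp f) (Category.id_comp g)
  refine ⟨fun f g K α => ?_⟩
  obtain ⟨γ, hγ, -⟩ := hυ.existsUnique f g K α
  refine ⟨paste τ γ (Category.id_comp f) (Category.id_comp g), (e f g K γ).trans hγ, ?_⟩
  intro β hβ
  obtain ⟨γ', rfl, -⟩ := hτ.existsUnique f g K β
  rw [hυ.ext ((e f g K γ').symm.trans (hβ.trans hγ.symm))]

theorem IsCover.cancel_right {o p r : HPath X Y} {ρ : Row o (𝟙 X) (𝟙 Y) p}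
    {σ : Row p (𝟙 X) (𝟙 Y) r} {τ : Row o (𝟙 X) (𝟙 Y) r} (h : IsPaste ρ σ τ) (hσ : IsCover σ)
    (hτ : IsCover τ) : IsCover ρ :=
  ⟨fun k q _ _ hs ht => .cancel_right (h.whisker k q hs ht rfl)
    (hσ.whiskerRow_bijects k q ht rfl) (hτ.whiskerRow_bijects k q hs rfl)⟩

theorem IsCover.ids (p : HPath X Y) : IsCover (idRow p) := by
  refine ⟨fun k q s t hs ht => ?_⟩
  subst hs
  subst ht
  rw [whiskerRow_id]
  exact ⟨fun f g K α => ⟨α, ids_paste α, fun β hβ => (ids_paste β).symm.trans hβ⟩⟩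

/-- Let `j` be the insertion of `η` before `J`. Then `j` followed by `l` is the identity, while `l`
followed by `j` is the same as inserting `η` in front of `U, J` and applying `l` to the last two
proarrows. By `hs` one may apply `m` to the first two instead, which cancels `η`. So `l` is a cover,
and `j` is one by cancellation. The hypothesis `hs` asks for equality only after composition with
cells, because the two rows themselves differ. -/
theorem isCover_of_leftUnitor {U : Pro X X} {η : Cell (.nil X) (𝟙 X) (𝟙 X) U} {J : Pro X Y}
    {l : Cell (.cons U (.cons J (.nil Y))) (𝟙 X) (𝟙 Y) J}
    {m : Cell (.cons U (.cons U (.nil X))) (𝟙 X) (𝟙 X) U}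
    (hl : paste (.cons (by rfl) η (.single (cellId J))) l (Category.comp_id _)
      (Category.comp_id _) = cellId J)
    (hm : paste (.cons (by rfl) η (.single (cellId U))) m (Category.comp_id _)
      (Category.comp_id _) = cellId U)
    (hs : ∀ {Z W Y₀ Y₁ : V} (k : HPath Z X) (q : HPath Y W) {f : Z ⟶ Y₀} {g : W ⟶ Y₁}
      {K : Pro Y₀ Y₁} (ψ : Cell (k.append (.cons U (.cons J q))) f g K),
      paste (whiskerRow k (.cons (p := .cons U (.nil _)) (by rfl) (cellId U) (.single l)) q rfl
        rfl) ψ (Category.id_comp f) (Category.id_comp g) =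
      paste (whiskerRow k (.cons (p := .cons U (.cons U (.nil _))) (by rfl) m
        (.single (cellId J))) q rfl rfl) ψ (Category.id_comp f) (Category.id_comp g)) :
    IsCover (.cons (by rfl) η (.single (cellId J)) : Row (.cons J (.nil Y)) _ _ _) := by
  have h : IsPaste (.cons (by rfl) η (.single (cellId J))) (.single l) (idRow (.cons J (.nil Y))) :=
    IsPaste.singleEq (Category.comp_id _) (Category.comp_id _) hl
  have h' : IsPaste (.single l) (.cons (by rfl) η (.single (cellId J)))
      (.cons (p := .nil X) (by rfl) η (.single l)) :=
    IsPaste.cons₀Eq (Category.id_comp _) (Category.id_comp _) (nil_id_paste η)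
      (.id_right (.single l))
  have h₁ : IsPaste (.cons (p := .nil X) (by rfl) η (idRow (.cons U (.cons J (.nil Y)))))
      (.cons (p := .cons U (.nil _)) (by rfl) (cellId U) (.single l))
      (.cons (p := .nil X) (by rfl) η (.single l)) :=
    IsPaste.cons_id (.id_left (.single l))
  have h₂ : IsPaste (.cons (p := .nil X) (by rfl) η (idRow (.cons U (.cons J (.nil Y)))))
      (.cons (p := .cons U (.cons U (.nil _))) (by rfl) m (.single (cellId J)))
      (idRow (.cons U (.cons J (.nil Y)))) :=
    IsPaste.cons₂Eq (ho₂ := rfl) (Category.comp_id _) (Category.comp_id _) hm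
      (.id_left (.single (cellId J)))
  refine IsCover.cancel_right h (IsCover.of_inverse h h' fun k q s hs' f g K α => ?_) (.ids _)
  subst hs'
  refine (pasteAssoc (h₁.whisker k q rfl rfl rfl) α (Category.id_comp f) (Category.id_comp g)
    (Category.id_comp f) (Category.id_comp g)).symm.trans ?_
  refine (congrArg (fun x => paste _ x (Category.id_comp f) (Category.id_comp g)) (hs k q α)).trans ?_
  refine (pasteAssoc (h₂.whisker k q rfl rfl rfl) α (Category.id_comp f) (Category.id_comp g)
    (Category.id_comp f) (Category.id_comp g)).trans ?_
  rw [whiskerRow_id]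
  exact ids_paste α

/-- The mirror image, with `η` inserted after `J`. -/
theorem isCover_of_rightUnitor {U : Pro Y Y} {η : Cell (.nil Y) (𝟙 Y) (𝟙 Y) U} {J : Pro X Y}
    {r : Cell (.cons J (.cons U (.nil Y))) (𝟙 X) (𝟙 Y) J}
    {m : Cell (.cons U (.cons U (.nil Y))) (𝟙 Y) (𝟙 Y) U}
    (hr : paste (.cons (by rfl) (cellId J) (.single η)) r (Category.comp_id _)
      (Category.comp_id _) = cellId J)
    (hm : paste (.cons (by rfl) (cellId U) (.single η)) m (Category.comp_id _)
      (Category.comp_id _) = cellId U)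
    (hs : ∀ {Z W Y₀ Y₁ : V} (k : HPath Z X) (q : HPath Y W) {f : Z ⟶ Y₀} {g : W ⟶ Y₁}
      {K : Pro Y₀ Y₁} (ψ : Cell (k.append (.cons J (.cons U q))) f g K),
      paste (whiskerRow k (.cons (p := .cons J (.nil _)) (by rfl) (cellId J) (.single m)) q rfl
        rfl) ψ (Category.id_comp f) (Category.id_comp g) =
      paste (whiskerRow k (.cons (p := .cons J (.cons U (.nil _))) (by rfl) r
        (.single (cellId U))) q rfl rfl) ψ (Category.id_comp f) (Category.id_comp g)) :
    IsCover (.cons (by rfl) (cellId J) (.single η) : Row (.cons J (.nil Y)) _ _ _) := by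
  have h : IsPaste (.cons (by rfl) (cellId J) (.single η)) (.single r) (idRow (.cons J (.nil Y))) :=
    IsPaste.singleEq (Category.comp_id _) (Category.comp_id _) hr
  have h' : IsPaste (.single r) (.cons (by rfl) (cellId J) (.single η))
      (.cons (p := .cons J (.cons U (.nil _))) (by rfl) r (.single η)) :=
    IsPaste.cons_id (IsPaste.cons₀Eq (ρ := .nil (𝟙 Y)) (σ := .nil (𝟙 Y)) (Category.id_comp _)
      (Category.id_comp _) (nil_id_paste η) (.nil (Category.id_comp _)))
  have h₁ : IsPaste (.cons (p := .cons J (.nil _)) (by rfl) (cellId J)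
        (.cons (p := .cons U (.nil _)) (by rfl) (cellId U) (.single η)))
      (.cons (p := .cons J (.cons U (.nil _))) (by rfl) r (.single (cellId U)))
      (.cons (p := .cons J (.cons U (.nil _))) (by rfl) r (.single η)) := by
    refine IsPaste.cons₂Eq (ho₂ := rfl) (Category.comp_id _) (Category.comp_id _) (ids_paste r)
      (.id_right (.single η))
  have h₂ : IsPaste (.cons (p := .cons J (.nil _)) (by rfl) (cellId J)
        (.cons (p := .cons U (.nil _)) (by rfl) (cellId U) (.single η)))
      (.cons (p := .cons J (.nil _)) (by rfl) (cellId J) (.single m))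
      (idRow (.cons J (.cons U (.nil Y)))) :=
    IsPaste.cons_id (IsPaste.singleEq (Category.comp_id _) (Category.comp_id _) hm)
  refine IsCover.cancel_right h (IsCover.of_inverse h h' fun k q s hs' f g K α => ?_) (.ids _)
  subst hs'
  refine (pasteAssoc (h₁.whisker k q rfl rfl rfl) α (Category.id_comp f) (Category.id_comp g)
    (Category.id_comp f) (Category.id_comp g)).symm.trans ?_
  refine (congrArg (fun x => paste _ x (Category.id_comp f) (Category.id_comp g))
    (hs k q α).symm).trans ?_
  refine (pasteAssoc (h₂.whisker k q rfl rfl rfl) α (Category.id_comp f) (Category.id_comp g)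
    (Category.id_comp f) (Category.id_comp g)).trans ?_
  rw [whiskerRow_id]
  exact ids_paste α

end VirtualDoubleCategory

theorem ProPath.IsCons.exists_last {V : Type u} {H : V → V → Type w} : ∀ {X Y : V}
    {p : ProPath H X Y} (_ : p.IsCons), ∃ (Z : V) (q : ProPath H X Z) (L : H Z Y),
      p = q.append (.cons L (.nil Y))
  | _, _, .cons L (.nil _), _ => ⟨_, .nil _, L, rfl⟩
  | _, _, .cons L (.cons L' p), _ => by
    obtain ⟨Z, q, M, h⟩ := exists_last (p := .cons L' p) trivial
    exact ⟨Z, .cons L q, M, congrArg (ProPath.cons L) h⟩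

/-! ### Hom profunctors as units -/

section Units

variable {E : Type u} [VirtualDoubleCategory.{z, w, v} E]

namespace EnrMorphism

variable {B C D D' C' D₁ : EnrCat.{t} E}

theorem evalRow_whiskerRow {o p : ProfPath C D} {k : ProfPath B C} (ρ : EnrRow o (𝟙 C) (𝟙 D) p)
    {q : ProfPath D D'} {x : B.Obj} {a : C.Obj} {b : D.Obj} {y : D'.Obj} (c₁ : Chain k x a)
    (c : Chain o a b) (c₂ : Chain q b y) :
    evalRow (whiskerRow (V := EnrCat.{t} E) k ρ q rfl rfl) (c₁.append (c.append c₂)) =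
      (ChainRow.ids c₁).append (Chain.path_append _ _)
        ((evalRow ρ c).append (Chain.path_append _ _) (.ids c₂)) := by
  have e₁ := evalRow_append (idRow (V := EnrCat.{t} E) k)
    (ρ.append rfl rfl (idRow (V := EnrCat.{t} E) q)) c₁ (c.append c₂)
  have e₂ := evalRow_append ρ (idRow (V := EnrCat.{t} E) q) c c₂
  refine e₁.trans ((congrArg (fun s => (evalRow (idRow (V := EnrCat.{t} E) k) c₁).append
    (Chain.path_append _ _) s) e₂).trans ?_)
  exact congrArg₂ (fun s s' => s.append (Chain.path_append c₁ (c.append c₂))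
    ((evalRow ρ c).append (Chain.path_append c c₂) s')) (evalRow_ids c₁) (evalRow_ids c₂)

/-- The components of `lactMor`. -/
def lactApp (J : EnrProfunctor C D) :
    ChainFamily (.cons C.homProfunctor (.cons J (.nil D))) (𝟙 C) (𝟙 D) J
  | _, _, .cons a (.cons a' (.nil b)) => J.lact a a' b

/-- The left action of a category on a profunctor, as a morphism. -/
def lactMor (J : EnrProfunctor C D) :
    EnrMorphism (.cons C.homProfunctor (.cons J (.nil D))) (𝟙 C) (𝟙 D) J where
  app := lactApp J
  inner o s s' h := by
    cases h with
    | here a d d' c =>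
      cases c
      rename_i x y
      exact paste_eq_cast (J.mul_lact x d d' y).symm (Category.comp_id _).symm
        (Category.comp_id _).symm
    | cons _ h => cases h with | cons _ h => cases h
  left := fun a a' {d b} c => by
    cases c with
    | cons _ c =>
    cases c
    exact paste_eq_cast (J.mul_lact a a' d b) (Category.comp_id _).symm (Category.comp_id _).symm
  right c b' s h := by
    cases h with
    | cons a h =>
    cases h with
    | last =>
      rename_i x y z
      exact paste_eq_cast (J.lact_ract x z y b').symm (Category.comp_id _).symm (Category.comp_id _).symm
    | cons _ h => cases h

/-- The components of `ractMor`. -/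
def ractApp (J : EnrProfunctor C D) :
    ChainFamily (.cons J (.cons D.homProfunctor (.nil D))) (𝟙 C) (𝟙 D) J
  | _, _, .cons a (.cons b (.nil b')) => J.ract a b b'

/-- The right action of a category on a profunctor, as a morphism. -/
def ractMor (J : EnrProfunctor C D) :
    EnrMorphism (.cons J (.cons D.homProfunctor (.nil D))) (𝟙 C) (𝟙 D) J where
  app := ractApp J
  inner o s s' h := by
    cases h with
    | here a d d' c =>
      cases c
      rename_i x y
      exact paste_eq_cast (J.ract_mul x d d' y).symm (Category.comp_id _).symm
        (Category.comp_id _).symm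
    | cons _ h => cases h with | cons _ h => cases h
  left := fun a a' {d b} c => by
    cases c with
    | cons _ c =>
    cases c
    exact paste_eq_cast (J.lact_ract a a' d _) (Category.comp_id _).symm (Category.comp_id _).symm
  right c b' s h := by
    cases h with
    | cons a h =>
    cases h with
    | last =>
      rename_i x y z
      exact paste_eq_cast (J.ract_mul x z y b').symm (Category.comp_id _).symm (Category.comp_id _).symm
    | cons _ h => cases h

/-- The components of `oneMor`. -/
def oneApp (C : EnrCat.{t} E) : ChainFamily (.nil C) (𝟙 C) (𝟙 C) C.homProfunctor
  | _, _, .nil a => C.one a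

/-- The units of a category, as a morphism out of the empty string. -/
def oneMor (C : EnrCat.{t} E) : EnrMorphism (.nil C) (𝟙 C) (𝟙 C) C.homProfunctor where
  app := oneApp C
  inner o s s' h := by cases h
  left a a' := (C.mul_one a a').trans (C.one_mul a a').symm
  right c b' s h := by cases h

theorem one_lactMor (J : EnrProfunctor C D) : paste (V := EnrCat.{t} E)
    (.cons (by rfl) (oneMor C) (.single (idCell J))) (lactMor J) (Category.comp_id _)
    (Category.comp_id _) = idCell J := by
  refine eq_of_app fun c => (vpaste_app _ _ _ _ c).trans ?_
  cases c with
  | cons _ c =>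
  cases c
  rename_i a b
  exact (heq_paste _ _ _ _ _ _).trans (heq_of_eq (J.one_lact a b))

theorem one_ractMor (J : EnrProfunctor C D) : paste (V := EnrCat.{t} E)
    (.cons (by rfl) (idCell J) (.single (oneMor D))) (ractMor J) (Category.comp_id _)
    (Category.comp_id _) = idCell J := by
  refine eq_of_app fun c => (vpaste_app _ _ _ _ c).trans ?_
  cases c with
  | cons _ c =>
  cases c
  rename_i a b
  exact (heq_paste _ _ _ _ _ _).trans (heq_of_eq (J.ract_one a b))

/-- Both actions on the hom profunctor are the multiplication. Because of this, `paste_slide`, which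
compares a left action with a right one, provides the sliding hypothesis of the two unitor lemmas.
-/
theorem lactMor_homProfunctor (C : EnrCat.{t} E) :
    lactMor C.homProfunctor = ractMor C.homProfunctor := by
  refine eq_of_app fun c => ?_
  cases c with
  | cons a c =>
  cases c with
  | cons a c =>
  cases c
  rfl

/-- A morphism out of a string equalizes the two actions of each interior category. -/
theorem paste_slide {C₁ : EnrCat.{t} E} (J : EnrProfunctor C C₁) (J' : EnrProfunctor C₁ D)
    (k : ProfPath B C) (q : ProfPath D D') {F : B ⟶ C'} {G : D' ⟶ D₁} {K : EnrProfunctor C' D₁}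
    (ψ : EnrMorphism (k.append (.cons J (.cons J' q))) F G K) :
    paste (V := EnrCat.{t} E) (whiskerRow (V := EnrCat.{t} E) k
      (.cons (p := .cons J (.nil _)) (by rfl) (idCell J) (.single (lactMor J'))) q rfl rfl) ψ
      (Category.id_comp F) (Category.id_comp G) =
    paste (V := EnrCat.{t} E) (whiskerRow (V := EnrCat.{t} E) k
      (.cons (p := .cons J (.cons _ (.nil _))) (by rfl) (ractMor J) (.single (idCell J'))) q rfl
        rfl) ψ (Category.id_comp F) (Category.id_comp G) := by
  refine eq_of_app fun c => (vpaste_app _ _ _ _ c).trans (HEq.trans ?_ (vpaste_app _ _ _ _ c).symm)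
  obtain ⟨a, c₁, c, rfl⟩ := Chain.exists_append k c
  cases c with
  | @cons _ _ _ _ _ _ d _ c =>
  cases c with
  | @cons _ _ _ _ _ _ d' _ c =>
  cases c with
  | @cons _ _ _ _ _ _ e _ c =>
  have e₁ := evalRow_whiskerRow (k := k) (.cons (p := .cons J (.nil _)) (by rfl) (idCell J)
    (.single (lactMor J'))) (q := q) c₁
    (.cons (J := J) a (.cons (J := C₁.homProfunctor) d (.cons (J := J') d' (.nil e)))) c
  have e₂ := evalRow_whiskerRow (k := k) (.cons (p := .cons J (.cons _ (.nil _))) (by rfl)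
    (ractMor J) (.single (idCell J'))) (q := q) c₁
    (.cons (J := J) a (.cons (J := C₁.homProfunctor) d (.cons (J := J') d' (.nil e)))) c
  have h := ((InnerActions.here (J := J) (J' := J') a d d' (.nil e)).append_right c
    (o' := (Chain.append (.cons (J := J) a (.cons (J := C₁.homProfunctor) d (.cons (J := J') d'
      (.nil e)))) c).path) (Chain.path_append _ _)).append_left c₁ (Chain.path_append _ _)
  exact (heq_of_eq (congrArg (fun s : ChainRow _ _ _ _ _ _ => s.app ψ.app) e₁)).trans
    ((heq_of_eq (ψ.inner _ _ _ h)).trans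
    (heq_of_eq (congrArg (fun s : ChainRow _ _ _ _ _ _ => s.app ψ.app) e₂)).symm)

theorem one_isCover_left (J : EnrProfunctor C D) : IsCover (V := EnrCat.{t} E)
    (.cons (by rfl) (oneMor C) (.single (idCell J))) := by
  refine isCover_of_leftUnitor (V := EnrCat.{t} E) (one_lactMor J) (one_lactMor C.homProfunctor) ?_
  intro B D' C' D₁ k q F G K ψ
  rw [lactMor_homProfunctor C]
  exact paste_slide _ J k q ψ

theorem one_isCover_right (J : EnrProfunctor C D) : IsCover (V := EnrCat.{t} E)
    (.cons (by rfl) (idCell J) (.single (oneMor D))) := by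
  refine isCover_of_rightUnitor (V := EnrCat.{t} E) (one_ractMor J) (one_ractMor D.homProfunctor) ?_
  intro B D' C' D₁ k q F G K ψ
  rw [← lactMor_homProfunctor D]
  exact paste_slide J _ k q ψ

/-- The components of the extension of a morphism along the units. -/
def extendApp {F : C ⟶ C'} {G : C ⟶ D'} {K : EnrProfunctor C' D'}
    (α : EnrMorphism (.nil C) F G K) : ChainFamily (.cons C.homProfunctor (.nil C)) F G K
  | _, _, .cons a (.nil a') => paste (.pair (F.hom a a') (α.app (.nil a')))
      (K.lact (F.obj a) (F.obj a') (G.obj a')) (Category.comp_id _) (Category.comp_id _)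

/-- Both sides are the actions of `F(a, a')` and `F(a', b)` on the component of `α` at `b`, by
functoriality of `F` and associativity of the action on `K`. -/
theorem extendApp_mul {F : C ⟶ C'} {G : C ⟶ D'} {K : EnrProfunctor C' D'}
    (α : EnrMorphism (.nil C) F G K) (a a' b : C.Obj) :
    paste (.single (C.mul a a' b)) (extendApp α (.cons a (.nil b))) (Category.id_comp _)
      (Category.id_comp _) =
    paste (.pair (F.hom a a') (extendApp α (.cons a' (.nil b))))
      (K.lact (F.obj a) (F.obj a') (G.obj b)) (Category.comp_id _) (Category.comp_id _) := by
  have h₁ := pasteAssoc (IsPaste.consEq (ho := rfl) (hp := rfl) (Category.id_comp _)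
    (Category.id_comp _) (F.map_mul a a' b) (IsPaste.cons₀Eq (ρ := .nil (𝟙 _)) (σ := .nil (G.arr b)) (ho := rfl)
      (hp := rfl) (Category.id_comp _) (Category.id_comp _) (nil_id_paste (α.app (.nil b)))
      (.nil (Category.id_comp _)))) (K.lact (F.obj a) (F.obj b) (G.obj b)) (Category.comp_id _)
    (Category.comp_id _) (Category.id_comp _) (Category.id_comp _)
  have h₂ := pasteAssoc (IsPaste.cons₂ (α₀ := F.hom a a') (α := F.hom a' b)
    (β := C'.mul (F.obj a) (F.obj a') (F.obj b)) (ho₂ := rfl) (ho := rfl) (ho' := rfl) (hp := rfl)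
    (Category.comp_id _) (Category.comp_id _) (.id_right (.single (α.app (.nil b)))))
    (K.lact (F.obj a) (F.obj b) (G.obj b)) (Category.comp_id _) (Category.comp_id _)
    (Category.comp_id _) (Category.comp_id _)
  have h₃ := pasteAssoc (IsPaste.cons_id (α := F.hom a a') (ho := rfl) (hp := rfl)
    (IsPaste.single (.pair (F.hom a' b) (α.app (.nil b))) (K.lact (F.obj a') (F.obj b) (G.obj b))
    (Category.comp_id _) (Category.comp_id _))) (K.lact (F.obj a) (F.obj a') (G.obj b))
    (Category.comp_id _) (Category.comp_id _) (Category.comp_id _) (Category.comp_id _)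
  refine h₁.trans (h₂.symm.trans (Eq.trans ?_ h₃))
  exact congrArg (fun x => paste _ x (Category.comp_id _) (Category.comp_id _))
    (K.mul_lact (F.obj a) (F.obj a') (F.obj b) (G.obj b))

/-- The extension of a morphism out of an empty string along the units. -/
def extendOne {F : C ⟶ C'} {G : C ⟶ D'} {K : EnrProfunctor C' D'}
    (α : EnrMorphism (.nil C) F G K) : EnrMorphism (.cons C.homProfunctor (.nil C)) F G K where
  app := extendApp α
  inner o s s' h := by cases h with | cons _ h => cases h
  left := fun a a' {d b} c => by
    cases c
    exact paste_eq_cast (extendApp_mul α a a' d) (Category.id_comp _).symm (Category.id_comp _).symm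
  right c b' s h := by
    cases h with
    | cons _ h => cases h
    | last =>
      rename_i a b
      have h₁ := pasteAssoc (IsPaste.cons_id (α := F.hom a b) (ho := rfl) (hp := rfl)
        (IsPaste.single (.pair (α.app (.nil b)) (G.hom b b')) (K.ract (F.obj b) (G.obj b) (G.obj b'))
        (Category.comp_id _) (Category.comp_id _))) (K.lact (F.obj a) (F.obj b) (G.obj b'))
        (Category.comp_id _) (Category.comp_id _) (Category.comp_id _) (Category.comp_id _)
      have h₂ := pasteAssoc (IsPaste.cons₂ (α₀ := F.hom a b) (α := α.app (.nil b))
        (β := K.lact (F.obj a) (F.obj b) (G.obj b)) (ho₂ := rfl) (ho := rfl) (ho' := rfl)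
        (hp := rfl) (Category.comp_id _) (Category.comp_id _) (.id_right (.single (G.hom b b'))))
        (K.ract (F.obj a) (G.obj b) (G.obj b')) (Category.comp_id _) (Category.comp_id _)
        (Category.comp_id _) (Category.comp_id _)
      -- Naturality of `α` replaces the action of `F` on the left by the action of `G` on the right,
      -- and `lact_ract` then moves the latter outside.
      have h₃ := congrArg (fun x => paste (.pair (F.hom a b) x)
        (K.lact (F.obj a) (F.obj b) (G.obj b')) (Category.comp_id _) (Category.comp_id _))
        (α.left b b')
      have h₄ := congrArg (fun x => paste (.cons (by rfl) (F.hom a b) (.pair (α.app (.nil b))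
        (G.hom b b'))) x (Category.comp_id _) (Category.comp_id _))
        (K.lact_ract (F.obj a) (F.obj b) (G.obj b) (G.obj b')).symm
      exact paste_eq_cast ((extendApp_mul α a b b').trans (h₃.trans (h₁.symm.trans (h₄.trans h₂))))
        (Category.id_comp _).symm (Category.id_comp _).symm

/-- `F` preserves units, and units act trivially on `K`. -/
theorem one_pair {F : C ⟶ C'} {G : C ⟶ D'} {K : EnrProfunctor C' D'} (a : C.Obj)
    (x : Cell (.nil (C.ext a)) (F.arr a) (G.arr a) (K.obj (F.obj a) (G.obj a))) :
    paste (.single (C.one a)) (paste (.pair (F.hom a a) x) (K.lact (F.obj a) (F.obj a) (G.obj a))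
      (Category.comp_id _) (Category.comp_id _)) (Category.id_comp _) (Category.id_comp _) = x := by
  have h₁ := pasteAssoc (IsPaste.consEq (ho := rfl) (hp := rfl) (Category.id_comp _)
    (Category.id_comp _) (F.map_one a) (IsPaste.cons₀Eq (ρ := .nil (𝟙 _)) (σ := .nil (G.arr a))
      (ho := rfl) (hp := rfl) (Category.id_comp _) (Category.id_comp _) (nil_id_paste x)
      (.nil (Category.id_comp _)))) (K.lact (F.obj a) (F.obj a) (G.obj a)) (Category.comp_id _)
    (Category.comp_id _) (Category.id_comp _) (Category.id_comp _)
  have h₂ := pasteAssoc (IsPaste.cons₀ (α := C'.one (F.obj a)) (ho := rfl) (hp := rfl)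
    (Category.comp_id _) (Category.comp_id _) (.id_right (.single x)))
    (K.lact (F.obj a) (F.obj a) (G.obj a)) (Category.comp_id _)
    (Category.comp_id _) (Category.comp_id _) (Category.comp_id _)
  refine h₁.trans (h₂.symm.trans ?_)
  refine (congrArg (fun x => paste _ x (Category.comp_id _) (Category.comp_id _))
    (K.one_lact (F.obj a) (G.obj a))).trans ?_
  exact paste_id x

theorem one_app {F : C ⟶ C'} {G : C ⟶ D'} {K : EnrProfunctor C' D'}
    (β : EnrMorphism (.cons C.homProfunctor (.nil C)) F G K) (a : C.Obj) :
    HEq ((paste (V := EnrCat.{t} E) (.single (oneMor C)) β (Category.id_comp _)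
      (Category.id_comp _) : EnrMorphism (.nil C) F G K).app (.nil a))
    (paste (.single (C.one a)) (β.app (.cons a (.nil a))) (Category.id_comp _)
      (Category.id_comp _)) :=
  (vpaste_app _ _ _ _ _).trans (heq_paste _ _ _ _ _ _)

theorem paste_extendOne {F : C ⟶ C'} {G : C ⟶ D'} {K : EnrProfunctor C' D'}
    (α : EnrMorphism (.nil C) F G K) : paste (V := EnrCat.{t} E) (.single (oneMor C)) (extendOne α)
      (Category.id_comp _) (Category.id_comp _) = α := by
  refine eq_of_app fun c => ?_
  cases c
  rename_i a
  exact (one_app _ a).trans (heq_of_eq (one_pair a (α.app (.nil a))))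

/-- By the left law, `β` on a product of elements of `C(a, b)` and `C(b, b)` is `F(a, b)` acting on
the value of `β` at `(b, b)`. Taking the unit of `b` as the second factor recovers `β` at `(a, b)`
and shows that it is determined by `β` on units. -/
theorem eq_extendOne {F : C ⟶ C'} {G : C ⟶ D'} {K : EnrProfunctor C' D'}
    {α : EnrMorphism (.nil C) F G K} {β : EnrMorphism (.cons C.homProfunctor (.nil C)) F G K}
    (h : paste (V := EnrCat.{t} E) (.single (oneMor C)) β (Category.id_comp _)
      (Category.id_comp _) = α) : β = extendOne α := by
  subst h
  refine eq_of_app fun c => ?_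
  cases c with
  | cons a c =>
  cases c
  rename_i a b
  refine heq_of_eq ?_
  have h := paste_eq_cast (β.left a b (.nil b)) (Category.id_comp _) (Category.id_comp _)
  have h₁ := congrArg (fun x => paste (.cons (by rfl) (cellId (C.hom a b)) (.single (C.one b))) x
    (Category.id_comp _) (Category.id_comp _)) h
  have h₂ := pasteAssoc (IsPaste.singleEq (Category.comp_id _) (Category.comp_id _) (C.mul_one a b))
    (β.app (.cons a (.nil b))) (Category.id_comp _) (Category.id_comp _) (Category.id_comp _)
    (Category.id_comp _)
  have h₃ := pasteAssoc (IsPaste.consEq (ho := rfl) (hp := rfl) (Category.id_comp _)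
    (Category.id_comp _) (ids_paste (F.hom a b)) (IsPaste.singleEq (Category.id_comp _)
      (Category.id_comp _) (eq_of_heq (one_app β b)).symm)) (K.lact (F.obj a) (F.obj b) (G.obj b))
    (Category.comp_id _) (Category.comp_id _) (Category.id_comp _) (Category.id_comp _)
  exact (ids_paste _).symm.trans (h₂.symm.trans (h₁.trans h₃))

/-- If the place where the unit is inserted is adjacent to some profunctor, the insertion is a cover
by the unitors. Only the string with nothing else in it needs the explicit extension `extendOne`. -/
theorem oneMor_isComposite (C : EnrCat.{t} E) : IsComposite (V := EnrCat.{t} E) (oneMor C) := by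
  intro B D C' D' k q F G K α
  rw [VirtualDoubleCategory.whisker_eq]
  cases q with
  | @cons _ X _ J q =>
    have h := (one_isCover_left J).whiskerRow_bijects k q rfl rfl
    have e := whiskerRow_consIds (E := EnrCat.{t} E) (oneMor C) k (.cons J (.nil _)) q rfl rfl rfl rfl
    exact (e ▸ h).existsUnique F G K α
  | nil =>
    by_cases hk : k.IsCons
    -- The last profunctor `L` of the left string is split off, since the unit is inserted right
    -- after it.
    · obtain ⟨X, k, L, rfl⟩ := hk.exists_last
      have hs : ((k.append (.cons L (.nil _))).append (.nil _)) =
        k.append ((ProPath.cons L (.nil C)).append (.nil _)) := ProPath.append_assoc _ _ _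
      have ht : ((k.append (.cons L (.nil _))).append (.cons C.homProfunctor (.nil _))) =
        k.append ((ProPath.cons L (.cons C.homProfunctor (.nil C))).append (.nil _)) :=
          ProPath.append_assoc _ _ _
      have h := (one_isCover_right L).whiskerRow_bijects k (.nil C) hs ht
      have e := whiskerRow_cons (V := EnrCat.{t} E) k L (.single (oneMor C)) (.nil C) hs ht rfl rfl
      exact (e ▸ h).existsUnique F G K α
    · cases k with
      | cons => exact (hk trivial).elim
      | nil => exact ⟨extendOne α, paste_extendOne α, fun β h => eq_extendOne h⟩

end EnrMorphism

end Units

/-! ### Restrictions of profunctors -/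

section Restrictions

variable {E : Type u} [VirtualDoubleCategory.{z, w, v} E]

/-- Cells over an associativity law are associative after composition with the cell which they are
over. -/
theorem VirtualDoubleCategory.paste_assoc_of_over {X₀ X₁ X₂ X₃ A₀ A₁ A₂ A₃ : E} {f₀ : X₀ ⟶ A₀} {f₁ : X₁ ⟶ A₁} {f₂ : X₂ ⟶ A₂}
    {f₃ : X₃ ⟶ A₃} {J₁ : Pro A₀ A₁} {J₂ : Pro A₁ A₂} {J₃ : Pro A₂ A₃} {K : Pro A₀ A₂}
    {L : Pro A₁ A₃} {M : Pro A₀ A₃} {H₁ : Pro X₀ X₁} {H₂ : Pro X₁ X₂} {H₃ : Pro X₂ X₃}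
    {H₁₂ : Pro X₀ X₂} {H₂₃ : Pro X₁ X₃} {T : Pro X₀ X₃}
    {a : Cell (.cons J₁ (.cons J₂ (.nil _))) (𝟙 _) (𝟙 _) K}
    {b : Cell (.cons K (.cons J₃ (.nil _))) (𝟙 _) (𝟙 _) M}
    {c : Cell (.cons J₂ (.cons J₃ (.nil _))) (𝟙 _) (𝟙 _) L}
    {d : Cell (.cons J₁ (.cons L (.nil _))) (𝟙 _) (𝟙 _) M}
    (h : paste (.pair a (cellId J₃)) b (Category.comp_id _) (Category.comp_id _) =
      paste (.pair (cellId J₁) c) d (Category.comp_id _) (Category.comp_id _))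
    {x₁ : Cell (.cons H₁ (.nil _)) f₀ f₁ J₁} {x₂ : Cell (.cons H₂ (.nil _)) f₁ f₂ J₂}
    {x₃ : Cell (.cons H₃ (.nil _)) f₂ f₃ J₃} {x₁₂ : Cell (.cons H₁₂ (.nil _)) f₀ f₂ K}
    {x₂₃ : Cell (.cons H₂₃ (.nil _)) f₁ f₃ L} {x : Cell (.cons T (.nil _)) f₀ f₃ M}
    {u : Cell (.cons H₁ (.cons H₂ (.nil _))) (𝟙 _) (𝟙 _) H₁₂}
    {y : Cell (.cons H₁₂ (.cons H₃ (.nil _))) (𝟙 _) (𝟙 _) T}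
    {v : Cell (.cons H₂ (.cons H₃ (.nil _))) (𝟙 _) (𝟙 _) H₂₃}
    {w : Cell (.cons H₁ (.cons H₂₃ (.nil _))) (𝟙 _) (𝟙 _) T}
    (hu : paste (.single u) x₁₂ (Category.id_comp _) (Category.id_comp _) =
      paste (.pair x₁ x₂) a (Category.comp_id _) (Category.comp_id _))
    (hv : paste (.single v) x₂₃ (Category.id_comp _) (Category.id_comp _) =
      paste (.pair x₂ x₃) c (Category.comp_id _) (Category.comp_id _))
    (hy : paste (.single y) x (Category.id_comp _) (Category.id_comp _) =
      paste (.pair x₁₂ x₃) b (Category.comp_id _) (Category.comp_id _))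
    (hw : paste (.single w) x (Category.id_comp _) (Category.id_comp _) =
      paste (.pair x₁ x₂₃) d (Category.comp_id _) (Category.comp_id _)) :
    paste (.single (paste (.pair u (cellId H₃)) y (Category.comp_id _) (Category.comp_id _))) x
      (Category.id_comp _) (Category.id_comp _) =
    paste (.single (paste (.pair (cellId H₁) v) w (Category.comp_id _) (Category.comp_id _))) x
      (Category.id_comp _) (Category.id_comp _) := by
  -- The chain of equations descends to the target by `hy` and `hu`, changes the bracketing there by
  -- `h`, and returns by `hv` and `hw`.
  have e₁ := pasteAssoc (IsPaste.single (.pair u (cellId H₃)) y (Category.comp_id _)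
    (Category.comp_id _)) x (Category.id_comp _) (Category.id_comp _) (Category.id_comp _)
    (Category.id_comp _)
  have e₂ := congrArg (fun z => paste (.pair u (cellId H₃)) z (Category.id_comp _)
    (Category.id_comp _)) hy
  have e₃ := paste_two hu (ids_paste x₃) (by rfl) b (Category.comp_id _) (Category.comp_id _)
    (Category.id_comp _) (Category.id_comp _) (Category.comp_id _) (Category.comp_id _)
  have e₅ := pasteAssoc (IsPaste.cons₂ (α₀ := x₁) (α := x₂) (β := a) (ho₂ := rfl) (ho := rfl)
    (ho' := rfl) (hp := rfl) (Category.comp_id _) (Category.comp_id _) (.id_right (.single x₃))) b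
    (Category.comp_id _) (Category.comp_id _) (Category.comp_id _) (Category.comp_id _)
  have e₆ := congrArg (fun z => paste (.cons (by rfl) x₁ (.pair x₂ x₃)) z (Category.comp_id _)
    (Category.comp_id _)) h
  have e₇ := pasteAssoc (IsPaste.cons_id (α := x₁) (ho := rfl) (hp := rfl)
    (IsPaste.single (.pair x₂ x₃) c (Category.comp_id _) (Category.comp_id _))) d
    (Category.comp_id _) (Category.comp_id _) (Category.comp_id _) (Category.comp_id _)
  have e₈ := paste_two (ids_paste x₁) hv (by rfl) d (Category.comp_id _) (Category.comp_id _)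
    (Category.id_comp _) (Category.id_comp _) (Category.comp_id _) (Category.comp_id _)
  have e₉ := congrArg (fun z => paste (.pair (cellId H₁) v) z (Category.id_comp _)
    (Category.id_comp _)) hw
  have e₀ := pasteAssoc (IsPaste.single (.pair (cellId H₁) v) w (Category.comp_id _)
    (Category.comp_id _)) x (Category.id_comp _) (Category.id_comp _) (Category.id_comp _)
    (Category.id_comp _)
  exact e₁.symm.trans (e₂.trans (e₃.trans (e₅.symm.trans (e₆.trans (e₇.trans (e₈.symm.trans
    (e₉.symm.trans e₀)))))))

variable [IsVirtualEquipment E] {B B' C D C' D' : EnrCat.{t} E}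

namespace EnrProfunctor

variable (F : C ⟶ C') (G : D ⟶ D') (K : EnrProfunctor C' D')

/-- The cartesian cell of `K(Fa, Gb)`. -/
noncomputable abbrev resAt (a : C.Obj) (b : D.Obj) :
    Cell (.cons (res (F.arr a) (G.arr b) (K.obj (F.obj a) (G.obj b))) (.nil _)) (F.arr a) (G.arr b)
      (K.obj (F.obj a) (G.obj b)) :=
  resCell _ _ _

/-- The left action on a restriction. -/
noncomputable def resLact (a a' : C.Obj) (b : D.Obj) :
    Cell (.cons (C.hom a a') (.cons (res (F.arr a') (G.arr b) (K.obj (F.obj a') (G.obj b)))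
      (.nil _))) (𝟙 _) (𝟙 _) (res (F.arr a) (G.arr b) (K.obj (F.obj a) (G.obj b))) :=
  resLift (paste (.pair (F.hom a a') (resAt F G K a' b)) (K.lact (F.obj a) (F.obj a') (G.obj b))
    (Category.comp_id _) (Category.comp_id _)) (Category.id_comp _) (Category.id_comp _)

/-- The right action on a restriction. -/
noncomputable def resRact (a : C.Obj) (b b' : D.Obj) :
    Cell (.cons (res (F.arr a) (G.arr b) (K.obj (F.obj a) (G.obj b))) (.cons (D.hom b b')
      (.nil _))) (𝟙 _) (𝟙 _) (res (F.arr a) (G.arr b') (K.obj (F.obj a) (G.obj b'))) :=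
  resLift (paste (.pair (resAt F G K a b) (G.hom b b')) (K.ract (F.obj a) (G.obj b) (G.obj b'))
    (Category.comp_id _) (Category.comp_id _)) (Category.id_comp _) (Category.id_comp _)

theorem resLact_paste (a a' : C.Obj) (b : D.Obj) :
    paste (.single (resLact F G K a a' b)) (resAt F G K a b) (Category.id_comp _)
      (Category.id_comp _) =
    paste (.pair (F.hom a a') (resAt F G K a' b)) (K.lact (F.obj a) (F.obj a') (G.obj b))
      (Category.comp_id _) (Category.comp_id _) :=
  resLift_paste _ _ _

theorem resRact_paste (a : C.Obj) (b b' : D.Obj) :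
    paste (.single (resRact F G K a b b')) (resAt F G K a b') (Category.id_comp _)
      (Category.id_comp _) =
    paste (.pair (resAt F G K a b) (G.hom b b')) (K.ract (F.obj a) (G.obj b) (G.obj b'))
      (Category.comp_id _) (Category.comp_id _) :=
  resLift_paste _ _ _

/-- The restriction `K(F, G)`. -/
noncomputable def restrict : EnrProfunctor C D where
  obj a b := res (F.arr a) (G.arr b) (K.obj (F.obj a) (G.obj b))
  lact := resLact F G K
  ract := resRact F G K
  one_lact a b := by
    refine res_ext (Category.id_comp _) (Category.id_comp _) ?_
    refine (lift_paste _ _ _ _ _ _ _ _ (Category.id_comp _) (Category.id_comp _)).trans ?_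
    have e₁ := paste_two (F.map_one a) (ids_paste (resCell (F.arr a) (G.arr b)
      (K.obj (F.obj a) (G.obj b)))) (by rfl) (K.lact (F.obj a) (F.obj a) (G.obj b))
      (Category.comp_id _) (Category.comp_id _) (Category.id_comp _) (Category.id_comp _)
      (Category.comp_id _) (Category.comp_id _)
    have e₂ := pasteAssoc (IsPaste.cons₀ (α := C'.one (F.obj a)) (ho := rfl) (hp := rfl)
      (Category.comp_id _) (Category.comp_id _) (.id_right (.single (resCell (F.arr a) (G.arr b)
      (K.obj (F.obj a) (G.obj b))))))
      (K.lact (F.obj a) (F.obj a) (G.obj b)) (Category.comp_id _)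
      (Category.comp_id _) (Category.comp_id _) (Category.comp_id _)
    have e₃ := congrArg (fun x => paste (.single (resCell (F.arr a) (G.arr b)
      (K.obj (F.obj a) (G.obj b)))) x (Category.comp_id _) (Category.comp_id _))
      (K.one_lact (F.obj a) (G.obj b))
    exact e₁.trans (e₂.symm.trans (e₃.trans ((paste_id _).trans (ids_paste _).symm)))
  ract_one a b := by
    refine res_ext (Category.id_comp _) (Category.id_comp _) ?_
    refine (lift_paste _ _ _ _ _ _ _ _ (Category.id_comp _) (Category.id_comp _)).trans ?_
    have e₁ := paste_two (ids_paste (resCell (F.arr a) (G.arr b) (K.obj (F.obj a) (G.obj b))))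
      (G.map_one b) (by rfl) (K.ract (F.obj a) (G.obj b) (G.obj b))
      (Category.comp_id _) (Category.comp_id _) (Category.id_comp _) (Category.id_comp _)
      (Category.comp_id _) (Category.comp_id _)
    have e₂ := pasteAssoc (IsPaste.cons_id (α := resCell (F.arr a) (G.arr b)
      (K.obj (F.obj a) (G.obj b))) (ho := rfl) (hp := rfl) (IsPaste.cons₀ (α := D'.one (G.obj b))
      (ho := rfl) (hp := rfl) (Category.comp_id _) (Category.comp_id _) (.id_right (.nil _))))
      (K.ract (F.obj a) (G.obj b) (G.obj b)) (Category.comp_id _)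
      (Category.comp_id _) (Category.comp_id _) (Category.comp_id _)
    have e₃ := congrArg (fun x => paste (.single (resCell (F.arr a) (G.arr b)
      (K.obj (F.obj a) (G.obj b)))) x (Category.comp_id _) (Category.comp_id _))
      (K.ract_one (F.obj a) (G.obj b))
    exact e₁.trans (e₂.symm.trans (e₃.trans ((paste_id _).trans (ids_paste _).symm)))
  -- The three associativity laws hold after composition with the cartesian cells, because the
  -- actions on the restriction lie over those on `K` and because `F` and `G` preserve composition.
  mul_lact a a' a'' b := res_ext (Category.id_comp _) (Category.id_comp _)
    (paste_assoc_of_over (K.mul_lact _ _ _ _) (F.map_mul a a' a'') (resLact_paste F G K a' a'' b)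
      (resLact_paste F G K a a'' b) (resLact_paste F G K a a' b))
  ract_mul a b b' b'' := res_ext (Category.id_comp _) (Category.id_comp _)
    (paste_assoc_of_over (K.ract_mul _ _ _ _) (resRact_paste F G K a b b') (G.map_mul b b' b'')
      (resRact_paste F G K a b' b'') (resRact_paste F G K a b b''))
  lact_ract a a' b b' := res_ext (Category.id_comp _) (Category.id_comp _)
    (paste_assoc_of_over (K.lact_ract _ _ _ _) (resLact_paste F G K a a' b)
      (resRact_paste F G K a' b b') (resRact_paste F G K a b b') (resLact_paste F G K a a' b'))

end EnrProfunctor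

namespace EnrMorphism

variable {F : C ⟶ C'} {G : D ⟶ D'} {K : EnrProfunctor C' D'}

variable (F G K) in
/-- The components of `restrictCell`. -/
noncomputable def restrictApp :
    ChainFamily (.cons (K.restrict F G) (.nil D)) F G K
  | _, _, .cons a (.nil b) => K.resAt F G a b

variable (F G K) in
/-- The cartesian morphism of a restriction. -/
noncomputable def restrictCell : EnrMorphism (.cons (K.restrict F G) (.nil D)) F G K where
  app := restrictApp F G K
  inner o s s' h := by cases h with | cons _ h => cases h
  left := fun a a' {d b} c => by
    cases c
    exact paste_eq_cast (K.resLact_paste F G a a' d) (Category.id_comp _).symm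
      (Category.id_comp _).symm
  right c b' s h := by
    cases h with
    | cons _ h => cases h
    | last =>
      rename_i a b
      exact paste_eq_cast (K.resRact_paste F G a b b') (Category.id_comp _).symm
        (Category.id_comp _).symm

/-- The components of the factorization of a morphism through a restriction. -/
noncomputable def liftApp {p : ProfPath B B'} {h : B ⟶ C} {k : B' ⟶ D}
    (α : EnrMorphism p (h ≫ F) (k ≫ G) K) : ChainFamily p h k (K.restrict F G) :=
  fun a b c => (resLift (α.app c) rfl rfl :
    Cell c.path (h.arr a) (k.arr b) (res _ _ (K.obj (F.obj (h.obj a)) (G.obj (k.obj b)))))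

/-- Cells into a restriction are compared after composition with the cartesian cell. This lemma and
the next two show that the sides of the laws for `liftApp` become there the sides of the laws for
`α`. -/
theorem app_liftApp {p : ProfPath B B'} {h : B ⟶ C} {k : B' ⟶ D}
    (α : EnrMorphism p (h ≫ F) (k ≫ G) K) {X X' : E} {o : HPath X X'} {a : B.Obj} {b : B'.Obj}
    {f : X ⟶ B.ext a} {g : X' ⟶ B'.ext b} (s : ChainRow o p a b f g) :
    paste (.single (s.app (liftApp α))) (K.resAt F G (h.obj a) (k.obj b)) (Category.assoc _ _ _)
      (Category.assoc _ _ _) = s.app α.app :=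
  lift_paste _ _ _ _ _ _ _ _ _ _

theorem left_liftApp {p : ProfPath B B'} {h : B ⟶ C} {k : B' ⟶ D}
    (α : EnrMorphism p (h ≫ F) (k ≫ G) K) (a a' : B.Obj) {b : B'.Obj} (c : Chain p a' b)
    {f : B.ext a ⟶ C.ext (h.obj a)} {g : B'.ext b ⟶ D.ext (k.obj b)} {f' g'}
    (h₁ : h.arr a ≫ 𝟙 _ = f) (h₂ : k.arr b ≫ 𝟙 _ = g) (h₃ : f ≫ F.arr _ = f')
    (h₄ : g ≫ G.arr _ = g') (h₅ : (h.arr a ≫ F.arr _) ≫ 𝟙 _ = f')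
    (h₆ : (k.arr b ≫ G.arr _) ≫ 𝟙 _ = g') :
    paste (.single (paste (.pair (h.hom a a') (liftApp α c)) ((K.restrict F G).lact (h.obj a)
      (h.obj a') (k.obj b)) h₁ h₂)) (K.resAt F G (h.obj a) (k.obj b)) h₃ h₄ =
    paste (.pair ((h ≫ F).hom a a') (α.app c)) (K.lact _ _ _) h₅ h₆ := by
  subst h₁ h₂ h₃ h₄
  refine (lift_paste _ _ _ _ _ _ _ _ ?_ ?_).trans ?_
  · simp
  · simp
  exact paste_two rfl (resLift_paste (α.app c) rfl rfl) (by rfl) (K.lact _ _ _) _ _ _ _ _ _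

theorem right_liftApp {p : ProfPath B B'} {h : B ⟶ C} {k : B' ⟶ D}
    (α : EnrMorphism p (h ≫ F) (k ≫ G) K) {a : B.Obj} (b b' : B'.Obj) (c : Chain p a b)
    {f : B.ext a ⟶ C.ext (h.obj a)} {g : B'.ext b' ⟶ D.ext (k.obj b')} {f' g'}
    (h₁ : h.arr a ≫ 𝟙 _ = f) (h₂ : k.arr b' ≫ 𝟙 _ = g) (h₃ : f ≫ F.arr _ = f')
    (h₄ : g ≫ G.arr _ = g') (h₅ : (h.arr a ≫ F.arr _) ≫ 𝟙 _ = f')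
    (h₆ : (k.arr b' ≫ G.arr _) ≫ 𝟙 _ = g') :
    paste (.single (paste (.pair (liftApp α c) (k.hom b b')) ((K.restrict F G).ract (h.obj a)
      (k.obj b) (k.obj b')) h₁ h₂)) (K.resAt F G (h.obj a) (k.obj b')) h₃ h₄ =
    paste (.pair (α.app c) ((k ≫ G).hom b b')) (K.ract _ _ _) h₅ h₆ := by
  subst h₁ h₂ h₃ h₄
  refine (lift_paste _ _ _ _ _ _ _ _ ?_ ?_).trans ?_
  · simp
  · simp
  exact paste_two (resLift_paste (α.app c) rfl rfl) rfl (by rfl) (K.ract _ _ _) _ _ _ _ _ _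

theorem leftLaw_liftApp : ∀ {B B' : EnrCat.{t} E} {p : ProfPath B B'} {h : B ⟶ C} {k : B' ⟶ D}
    (α : EnrMorphism p (h ≫ F) (k ≫ G) K), LeftLaw p h k (K.restrict F G) (liftApp α)
  -- For the empty string the left law is naturality, one side of which is a right action.
  | _, _, .nil _, _, _, α => fun a a' => res_ext rfl rfl
      ((left_liftApp α a a' (.nil a') _ _ _ _ _ _).trans ((α.left a a').trans
        (right_liftApp α a a' (.nil a) _ _ _ _ _ _).symm))
  | _, _, .cons _ _, _, _, α => fun a a' {_ _} c => res_ext (Category.assoc _ _ _)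
      (Category.assoc _ _ _) ((app_liftApp α _).trans ((α.left a a' c).trans
        (left_liftApp α a a' (.cons a' c) _ _ _ _ _ _).symm))

/-- The factorization of a morphism through a restriction. -/
noncomputable def liftMor {p : ProfPath B B'} {h : B ⟶ C} {k : B' ⟶ D}
    (α : EnrMorphism p (h ≫ F) (k ≫ G) K) : EnrMorphism p h k (K.restrict F G) where
  app := liftApp α
  inner o s s' hs := res_ext (Category.assoc _ _ _) (Category.assoc _ _ _)
    ((app_liftApp α s).trans ((α.inner o s s' hs).trans (app_liftApp α s').symm))
  left := leftLaw_liftApp α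
  right {_ b} c b' s hs := res_ext (Category.assoc _ _ _)
      (Category.assoc _ _ _) ((app_liftApp α s).trans ((α.right c b' s hs).trans
      (right_liftApp α b b' c _ _ _ _ _ _).symm))

theorem paste_restrictCell_app {p : ProfPath B B'} {h : B ⟶ C} {k : B' ⟶ D}
    (β : EnrMorphism p h k (K.restrict F G)) {a : B.Obj} {b : B'.Obj} (c : Chain p a b) :
    (vpaste (.single β) (restrictCell F G K) rfl rfl).app c =
      paste (.single (β.app c)) (K.resAt F G (h.obj a) (k.obj b)) rfl rfl := by
  have e := evalRow_single β c
  refine eq_of_heq ((vpaste_app _ _ _ _ c).trans ?_)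
  exact heq_of_eq (congrArg (fun s : ChainRow _ _ _ _ _ _ => s.app (restrictApp F G K)) e)

theorem restrictCell_isCartesian : IsCartesian (V := EnrCat.{t} E) (restrictCell F G K) := by
  intro B B' p h k α
  refine ⟨liftMor α, eq_of_app fun c => heq_of_eq ((paste_restrictCell_app _ c).trans
    (resLift_paste _ _ _)), fun β hβ => ?_⟩
  subst hβ
  refine eq_of_app fun c => heq_of_eq (res_ext rfl rfl ?_)
  exact (paste_restrictCell_app β c).symm.trans (resLift_paste _ _ _).symm

end EnrMorphism

instance EnrCat.isVirtualEquipment : IsVirtualEquipment (EnrCat.{t} E) where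
  exists_unit C := ⟨C.homProfunctor, EnrMorphism.oneMor C, EnrMorphism.oneMor_isComposite C⟩
  exists_restriction F G K := ⟨K.restrict F G, EnrMorphism.restrictCell F G K,
    EnrMorphism.restrictCell_isCartesian⟩

end Restrictions

/-! ### Cancelling composites in equivariance squares -/

namespace VirtualDoubleCategory

section Assoc

variable {V : Type u} [VirtualDoubleCategory.{z, w, v} V] {X₀ X₁ X₂ X₃ : V}
  {A A' : Pro X₀ X₁} {B B' : Pro X₁ X₂} {C C' : Pro X₂ X₃} {P P' : Pro X₀ X₂} {Q Q' : Pro X₁ X₃}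
  {T T' : Pro X₀ X₃}
  {p : Cell (.cons A (.cons B (.nil _))) (𝟙 _) (𝟙 _) P}
  {q : Cell (.cons B (.cons C (.nil _))) (𝟙 _) (𝟙 _) Q}
  {r : Cell (.cons P (.cons C (.nil _))) (𝟙 _) (𝟙 _) T}
  {s : Cell (.cons A (.cons Q (.nil _))) (𝟙 _) (𝟙 _) T}
  {p' : Cell (.cons A' (.cons B' (.nil _))) (𝟙 _) (𝟙 _) P'}
  {q' : Cell (.cons B' (.cons C' (.nil _))) (𝟙 _) (𝟙 _) Q'}
  {r' : Cell (.cons P' (.cons C' (.nil _))) (𝟙 _) (𝟙 _) T'}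
  {s' : Cell (.cons A' (.cons Q' (.nil _))) (𝟙 _) (𝟙 _) T'}
  {a : Cell (.cons A (.nil _)) (𝟙 _) (𝟙 _) A'} {b : Cell (.cons B (.nil _)) (𝟙 _) (𝟙 _) B'}
  {c : Cell (.cons C (.nil _)) (𝟙 _) (𝟙 _) C'} {x : Cell (.cons P (.nil _)) (𝟙 _) (𝟙 _) P'}
  {y : Cell (.cons Q (.nil _)) (𝟙 _) (𝟙 _) Q'} {t : Cell (.cons T (.nil _)) (𝟙 _) (𝟙 _) T'}

/-- `x` and `a, b` commute with the multiplications `p` and `p'`. -/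
def Commutes₂ (p : Cell (.cons A (.cons B (.nil _))) (𝟙 _) (𝟙 _) P)
    (p' : Cell (.cons A' (.cons B' (.nil _))) (𝟙 _) (𝟙 _) P')
    (a : Cell (.cons A (.nil _)) (𝟙 _) (𝟙 _) A') (b : Cell (.cons B (.nil _)) (𝟙 _) (𝟙 _) B')
    (x : Cell (.cons P (.nil _)) (𝟙 _) (𝟙 _) P') : Prop :=
  paste (.single p) x (Category.id_comp _) (Category.id_comp _) =
    paste (.pair a b) p' (Category.comp_id _) (Category.comp_id _)

theorem paste_pair_assoc
    (h : paste (.pair p (cellId C)) r (Category.comp_id _) (Category.comp_id _) =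
      paste (.pair (cellId A) q) s (Category.comp_id _) (Category.comp_id _)) :
    paste (.pair p (cellId C)) (paste (.single r) t (Category.id_comp _) (Category.id_comp _))
      (Category.id_comp _) (Category.id_comp _) =
    paste (.pair (cellId A) q) (paste (.single s) t (Category.id_comp _) (Category.id_comp _))
      (Category.id_comp _) (Category.id_comp _) := by
  have e₁ := pasteAssoc (IsPaste.single (.pair p (cellId C)) r (Category.comp_id _)
    (Category.comp_id _)) t (Category.id_comp _) (Category.id_comp _) (Category.id_comp _)
    (Category.id_comp _) (Category.id_comp _) (Category.id_comp _)
  have e₂ := pasteAssoc (IsPaste.single (.pair (cellId A) q) s (Category.comp_id _)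
    (Category.comp_id _)) t (Category.id_comp _) (Category.id_comp _) (Category.id_comp _)
    (Category.id_comp _) (Category.id_comp _) (Category.id_comp _)
  exact e₁.trans ((congrArg (fun z => paste (.single z) t (Category.id_comp _)
    (Category.id_comp _)) h).trans e₂.symm)

/-- Both sides are `a`, `b`, `c` followed by one of the two bracketings of the multiplications of
the target, so associativity of the target identifies them. -/
theorem Commutes₂.paste_eq (hx : Commutes₂ p p' a b x) (hy : Commutes₂ q q' b c y)
    (h : paste (.pair p' (cellId C')) r' (Category.comp_id _) (Category.comp_id _) =
      paste (.pair (cellId A') q') s' (Category.comp_id _) (Category.comp_id _)) :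
    paste (.pair p (cellId C)) (paste (.pair x c) r' (Category.comp_id _) (Category.comp_id _))
      (Category.id_comp _) (Category.id_comp _) =
    paste (.pair (cellId A) q) (paste (.pair a y) s' (Category.comp_id _) (Category.comp_id _))
      (Category.id_comp _) (Category.id_comp _) := by
  have e₁ := paste_two hx (ids_paste c) (by rfl) r' (Category.comp_id _) (Category.comp_id _)
    (Category.id_comp _) (Category.id_comp _) (Category.comp_id _) (Category.comp_id _)
  have e₂ := pasteAssoc (IsPaste.cons₂ (α₀ := a) (α := b) (β := p') (ho₂ := rfl) (ho := rfl)
    (ho' := rfl) (hp := rfl) (Category.comp_id _) (Category.comp_id _) (.id_right (.single c))) r'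
    (Category.comp_id _) (Category.comp_id _) (Category.comp_id _) (Category.comp_id _)
  have e₃ := congrArg (fun z => paste (.cons (by rfl) a (.pair b c)) z (Category.comp_id _)
    (Category.comp_id _)) h
  have e₄ := pasteAssoc (IsPaste.cons_id (α := a) (ho := rfl) (hp := rfl)
    (IsPaste.single (.pair b c) q' (Category.comp_id _) (Category.comp_id _))) s'
    (Category.comp_id _) (Category.comp_id _) (Category.comp_id _) (Category.comp_id _)
  have e₅ := paste_two (ids_paste a) hy (by rfl) s' (Category.comp_id _) (Category.comp_id _)
    (Category.id_comp _) (Category.id_comp _) (Category.comp_id _) (Category.comp_id _)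
  exact e₁.trans (e₂.symm.trans (e₃.trans (e₄.trans e₅.symm)))

/-- The square for `r` may be tested after `p`, which next to the identity of `C` is a cover.
Associativity in the source and in the target then reduces it to the square for `s`. -/
theorem Commutes₂.of_left (hp : IsComposite p) (hx : Commutes₂ p p' a b x)
    (hy : Commutes₂ q q' b c y) (ht : Commutes₂ s s' a y t)
    (h : paste (.pair p (cellId C)) r (Category.comp_id _) (Category.comp_id _) =
      paste (.pair (cellId A) q) s (Category.comp_id _) (Category.comp_id _))
    (h' : paste (.pair p' (cellId C')) r' (Category.comp_id _) (Category.comp_id _) =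
      paste (.pair (cellId A') q') s' (Category.comp_id _) (Category.comp_id _)) :
    Commutes₂ r r' x c t := by
  have hc : IsCover (.pair p (cellId C)) := IsCover.consIds hp (.cons C (.nil _)) rfl
  refine hc.bijects.ext ((paste_pair_assoc h).trans (Eq.trans ?_ (hx.paste_eq hy h').symm))
  exact congrArg (fun z => paste _ z (Category.id_comp _) (Category.id_comp _)) ht

/-- The mirror image: the square for `s` is tested after `q` and reduces to the one for `r`. -/
theorem Commutes₂.of_right (hq : IsComposite q) (hx : Commutes₂ p p' a b x)
    (hy : Commutes₂ q q' b c y) (ht : Commutes₂ r r' x c t)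
    (h : paste (.pair p (cellId C)) r (Category.comp_id _) (Category.comp_id _) =
      paste (.pair (cellId A) q) s (Category.comp_id _) (Category.comp_id _))
    (h' : paste (.pair p' (cellId C')) r' (Category.comp_id _) (Category.comp_id _) =
      paste (.pair (cellId A') q') s' (Category.comp_id _) (Category.comp_id _)) :
    Commutes₂ s s' a y t := by
  have hc : IsCover (.pair (cellId A) q) := hq.isCover.cons A
  refine hc.bijects.ext ((paste_pair_assoc h).symm.trans (Eq.trans ?_ (hx.paste_eq hy h')))
  exact congrArg (fun z => paste _ z (Category.id_comp _) (Category.id_comp _)) ht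

theorem Commutes₂.id (p : Cell (.cons A (.cons B (.nil _))) (𝟙 _) (𝟙 _) P) :
    Commutes₂ p p (cellId A) (cellId B) (cellId P) :=
  (paste_id p).trans (ids_paste p).symm

end Assoc

end VirtualDoubleCategory

/-! ### Extension of cells from the centers -/

section Extension

variable {E : Type u} [VirtualDoubleCategory.{z, w, v} E] {C D : EnrCat.{t} E}

namespace EnrMorphism

variable {J K : EnrProfunctor C D}

/-- The components of `ofCommutes`. -/
def ofCommutesApp (φ : ∀ a b, Cell (.cons (J.obj a b) (.nil _)) (𝟙 _) (𝟙 _) (K.obj a b)) :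
    ChainFamily (.cons J (.nil D)) (𝟙 C) (𝟙 D) K
  | _, _, .cons a (.nil b) => φ a b

/-- A morphism between profunctors from its components. -/
def ofCommutes (φ : ∀ a b, Cell (.cons (J.obj a b) (.nil _)) (𝟙 _) (𝟙 _) (K.obj a b))
    (hl : ∀ a a' b, Commutes₂ (J.lact a a' b) (K.lact a a' b) (cellId _) (φ a' b) (φ a b))
    (hr : ∀ a b b', Commutes₂ (J.ract a b b') (K.ract a b b') (φ a b) (cellId _) (φ a b')) :
    EnrMorphism (.cons J (.nil D)) (𝟙 C) (𝟙 D) K where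
  app := ofCommutesApp φ
  inner o s s' h := by cases h with | cons _ h => cases h
  left := fun a a' {d b} c => by
    cases c
    exact paste_eq_cast (hl a a' d) (Category.id_comp _).symm (Category.id_comp _).symm
  right c b' s h := by
    cases h with
    | cons _ h => cases h
    | last =>
      rename_i a b
      exact paste_eq_cast (hr a b b') (Category.id_comp _).symm (Category.id_comp _).symm

end EnrMorphism

namespace EnrCat.Center

/-- A cell between the values at the centers is spread out in two stages, first over the objects of
`D` and then over those of `C`. At each stage the extension is forced by equivariance, because the
actions involving a center are composites. All remaining equivariances follow from associativity by
cancelling such composites. -/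
theorem exists_extension (y : C.Center) (z : D.Center) (J K : EnrProfunctor C D)
    (θ : Cell (.cons (J.obj y.pt z.pt) (.nil _)) (𝟙 _) (𝟙 _) (K.obj y.pt z.pt)) :
    ∃ φ : EnrMorphism (.cons J (.nil D)) (𝟙 C) (𝟙 D) K,
      φ.glob (.cons (J := J) y.pt (.nil z.pt)) = θ := by
  -- This gives `ψ b : J(y, b) ⟶ K(y, b)`, determined by compatibility with the right action of
  -- `D(z, b)` on the values at the centers.
  have hr (b : D.Obj) := (IsComposite.isCover (z.ract_isComposite J y.pt b)).bijects.existsUnique (𝟙 _) (𝟙 _) _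
    (paste (.pair θ (cellId (D.hom z.pt b))) (K.ract y.pt z.pt b) (Category.comp_id _)
      (Category.comp_id _))
  choose ψ hψ hψ' using hr
  -- This gives `φ a b : J(a, b) ⟶ K(a, b)`, determined by compatibility of `φ a b` and `ψ b` with
  -- the left action of `C(a, y)`.
  have hl (a : C.Obj) (b : D.Obj) := (IsComposite.isCover (y.lact_isComposite J a b)).bijects.existsUnique
    (𝟙 _) (𝟙 _) _ (paste (.pair (cellId (C.hom a y.pt)) (ψ b)) (K.lact a y.pt b)
      (Category.comp_id _) (Category.comp_id _))
  choose φ hφ hφ' using hl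
  have h₁ (b : D.Obj) : Commutes₂ (J.ract y.pt z.pt b) (K.ract y.pt z.pt b) θ (cellId _) (ψ b) :=
    hψ b
  have h₂ (a : C.Obj) (b : D.Obj) : Commutes₂ (J.lact a y.pt b) (K.lact a y.pt b) (cellId _) (ψ b)
    (φ a b) := hφ a b
  -- The defining squares `h₁` and `h₂` concern actions that involve a center. In `h₃`, `h₄` and
  -- `h₅` they are spread to all actions.
  have h₃ (b b' : D.Obj) : Commutes₂ (J.ract y.pt b b') (K.ract y.pt b b') (ψ b) (cellId _)
      (ψ b') :=
    (h₁ b).of_left (z.ract_isComposite J y.pt b) (.id _) (h₁ b') (J.ract_mul _ _ _ _)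
      (K.ract_mul _ _ _ _)
  have h₄ (a : C.Obj) (b b' : D.Obj) : Commutes₂ (J.ract a b b') (K.ract a b b') (φ a b) (cellId _)
      (φ a b') :=
    (h₂ a b).of_left (y.lact_isComposite J a b) (h₃ b b') (h₂ a b') (J.lact_ract _ _ _ _)
      (K.lact_ract _ _ _ _)
  have h₅ (a a' : C.Obj) (b : D.Obj) : Commutes₂ (J.lact a a' b) (K.lact a a' b) (cellId _)
      (φ a' b) (φ a b) :=
    Commutes₂.of_right (y.lact_isComposite J a' b) (.id _) (h₂ a' b) (h₂ a b) (J.mul_lact _ _ _ _)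
      (K.mul_lact _ _ _ _)
  -- At the center the extension gives back the original cell: the unit of `y`, inserted into the
  -- square `h₂`, is cancelled by both actions. The same argument with the unit of `z` gives `h₇`.
  have h₆ (b : D.Obj) : φ y.pt b = ψ b := by
    have e₁ := pasteAssoc (IsPaste.singleEq (Category.comp_id _) (Category.comp_id _)
      (J.one_lact y.pt b)) (φ y.pt b) (Category.id_comp _) (Category.id_comp _)
      (Category.id_comp _) (Category.id_comp _) (Category.id_comp _) (Category.id_comp _)
    have e₂ := congrArg (fun x => paste (.pair (C.one y.pt) (cellId (J.obj y.pt b))) x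
      (Category.id_comp _) (Category.id_comp _)) (h₂ y.pt b)
    have e₃ := paste_two (paste_id (C.one y.pt)) (ids_paste (ψ b)) (by rfl) (K.lact y.pt y.pt b)
      (Category.id_comp _) (Category.id_comp _) (Category.id_comp _) (Category.id_comp _)
      (Category.id_comp _) (Category.id_comp _)
    have e₄ := pasteAssoc (IsPaste.cons₀Eq (ho := rfl) (hp := rfl) (Category.id_comp _)
      (Category.id_comp _) (nil_id_paste (C.one y.pt)) (.id_right (.single (ψ b))))
      (K.lact y.pt y.pt b) (Category.id_comp _) (Category.id_comp _) (Category.id_comp _)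
      (Category.id_comp _) (Category.id_comp _) (Category.id_comp _)
    have e₅ := congrArg (fun x => paste (.single (ψ b)) x (Category.id_comp _)
      (Category.id_comp _)) (K.one_lact y.pt b)
    exact (ids_paste _).symm.trans (e₁.symm.trans (e₂.trans (e₃.trans (e₄.symm.trans (e₅.trans
      (paste_id _))))))
  have h₇ : ψ z.pt = θ := by
    have e₁ := pasteAssoc (IsPaste.singleEq (Category.comp_id _) (Category.comp_id _)
      (J.ract_one y.pt z.pt)) (ψ z.pt) (Category.id_comp _) (Category.id_comp _)
      (Category.id_comp _) (Category.id_comp _) (Category.id_comp _) (Category.id_comp _)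
    have e₂ := congrArg (fun x => paste (.pair (cellId (J.obj y.pt z.pt)) (D.one z.pt)) x
      (Category.id_comp _) (Category.id_comp _)) (h₁ z.pt)
    have e₃ := paste_two (ids_paste θ) (paste_id (D.one z.pt)) (by rfl) (K.ract y.pt z.pt z.pt)
      (Category.id_comp _) (Category.id_comp _) (Category.id_comp _) (Category.id_comp _)
      (Category.id_comp _) (Category.id_comp _)
    have e₄ := pasteAssoc (IsPaste.cons_id (α := θ) (ho := rfl) (hp := rfl)
      (IsPaste.singleEq (ρ := .nil (𝟙 _)) (Category.id_comp _) (Category.id_comp _)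
      (nil_id_paste (D.one z.pt)))) (K.ract y.pt z.pt z.pt) (Category.id_comp _)
      (Category.id_comp _) (Category.id_comp _) (Category.id_comp _) (Category.id_comp _)
      (Category.id_comp _)
    have e₅ := congrArg (fun x => paste (.single θ) x (Category.id_comp _)
      (Category.id_comp _)) (K.ract_one y.pt z.pt)
    exact (ids_paste _).symm.trans (e₁.symm.trans (e₂.trans (e₃.trans (e₄.symm.trans (e₅.trans
      (paste_id _))))))
  exact ⟨.ofCommutes φ h₅ h₄, (h₆ z.pt).trans h₇⟩

end EnrCat.Center

end Extension

/-! ### Cartesian cells with identity sides -/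

namespace VirtualDoubleCategory

variable {V : Type u} [VirtualDoubleCategory.{z, w, v} V] {X Y Z : V}

/-- When the sides are identities, factoring the identity of `K` through `χ` produces a two-sided
inverse of `χ`, and an invertible cell is a composite. -/
theorem IsCartesian.isComposite {J K : Pro X Y} {χ : Cell (.cons J (.nil Y)) (𝟙 X) (𝟙 Y) K}
    (h : IsCartesian χ) : IsComposite χ := by
  obtain ⟨ι, hι, -⟩ := h.existsUnique (𝟙 X) (𝟙 Y) (Category.id_comp _) (Category.id_comp _)
    (cellId K)
  have e : paste (.single χ) ι (Category.id_comp _) (Category.id_comp _) = cellId J := by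
    refine (h.existsUnique (𝟙 X) (𝟙 Y) (Category.id_comp _) (Category.id_comp _) χ).unique ?_
      (ids_paste χ)
    have := pasteAssoc (IsPaste.single (.single χ) ι (Category.id_comp _) (Category.id_comp _)) χ
      (Category.id_comp _) (Category.id_comp _) (Category.id_comp _) (Category.id_comp _)
      (Category.id_comp _) (Category.id_comp _)
    refine this.symm.trans ((congrArg (fun x => paste (.single χ) x (Category.id_comp _)
      (Category.id_comp _)) hι).trans (paste_id χ))
  apply IsCover.isComposite
  refine IsCover.of_inverse (τ := .single ι) (υ := idRow (.cons J (.nil Y)))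
    (IsPaste.singleEq (Category.id_comp _) (Category.id_comp _) hι)
    (IsPaste.singleEq (Category.id_comp _) (Category.id_comp _) e) ?_
  intro Z W Y₀ Y₁ k q s hs f g K α
  rw [whiskerRow_id]
  exact ids_paste α

/-- A composite followed by a cover. -/
theorem IsCover.consCover {J K : Pro X Y} {μ : Cell (.cons J (.nil Y)) (𝟙 X) (𝟙 Y) K}
    (h : IsComposite μ) {p q : HPath Y Z} {ρ : Row p (𝟙 Y) (𝟙 Z) q} (hρ : IsCover ρ) :
    IsCover (.cons (by rfl) μ ρ : Row (.cons J p) _ _ (.cons K q)) :=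
  .comp (.cons_id (.id_left ρ)) (.consIds h p rfl) (hρ.cons K)

end VirtualDoubleCategory

/-! ### The center of a representable category and lists of identities -/

section Representable

variable {E : Type u} [VirtualDoubleCategory.{z, w, v} E] [IsVirtualEquipment E]

/-- The identity of `A` is a center of `|A|`. -/
noncomputable def repCenter (A : E) : (repCat A).Center where
  pt := repId A
  arr x := RepObj.arr x
  toPt x := (resLift (paste (.nil (RepObj.arr x)) (unitCell A) (Category.comp_id _)
    (Category.comp_id _)) (Category.id_comp _) (Category.comp_id _) :
      Cell _ _ _ (res (RepObj.arr x) (𝟙 A) (unit A)))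
  ofPt x := (resLift (paste (.nil (RepObj.arr x)) (unitCell A) (Category.comp_id _)
    (Category.comp_id _)) (Category.comp_id _) (Category.id_comp _) :
      Cell _ _ _ (res (𝟙 A) (RepObj.arr x) (unit A)))
  mul_eq x := by
    -- Over the cartesian cells `toPt` and `ofPt` both become the unit of `A` pulled back along `x`,
    -- and the product of two units is a unit.
    refine res_ext (f := RepObj.arr x) (g := RepObj.arr x) (Category.id_comp _)
      (Category.id_comp _) ?_
    refine (lift_paste _ _ _ _ _ _ _ _ (Category.id_comp _) (Category.id_comp _)).trans ?_
    refine (paste_two (resLift_paste _ _ _) (resLift_paste _ _ _) (by rfl) (lam (unit A))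
      (Category.comp_id _) (Category.comp_id _) (Category.id_comp _) (Category.id_comp _)
      (Category.comp_id _) (Category.comp_id _)).trans ?_
    exact (unit_lam _).trans (resLift_paste _ _ _).symm
  one_isComposite := by
    -- At `id_A`, the unit of `|A|` followed by an invertible cartesian cell is the chosen unit of
    -- `A`. Cancelling the cartesian cell shows that it is a composite.
    have h := IsPaste.singleEq (ρ := .single (repOne (repId A))) (Category.id_comp _)
      (Category.id_comp _) ((resLift_paste _ _ _).trans (nil_id_paste (unitCell A)))
    apply IsCover.isComposite
    exact IsCover.cancel_right h
      (IsComposite.isCover (IsCartesian.isComposite (resCell_isCartesian (𝟙 A) (𝟙 A) _)))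
      (IsComposite.isCover (unitCell_isComposite A))

/-- The list of objects which are all identities. -/
noncomputable def idsChain : ∀ {A B : E} (p : HPath A B), Chain (repPath p) (repId A) (repId B)
  | _, _, .nil A => .nil (C := repCat A) (repId A)
  | A, _, .cons J p => .cons (J := repPro J) (repId A) (idsChain p)

/-- At the identities the cartesian cells have identity sides, hence each of them is a composite.
This row is the link between a string and its image under the embedding. -/
theorem cartRow_isCover : ∀ {A B : E} (p : HPath A B), IsCover (cartRow p (idsChain p))
  | _, _, .nil A => .ids (.nil A)
  | _, _, .cons J p =>
    .consCover (IsCartesian.isComposite (resCell_isCartesian (𝟙 _) (𝟙 _) J)) (cartRow_isCover p)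

/-- The list of objects, the interior ones being identities. -/
noncomputable def innerChain : ∀ {A A' B : E} (J : Pro A A') (p : HPath A' B) (x : (repCat A).Obj)
    (y : (repCat B).Obj), Chain (repPath (.cons J p)) x y
  | _, A', _, J, .nil _, x, y => .cons (J := repPro J) x (.nil (C := repCat A') y)
  | _, A', _, J, .cons J' p, x, y => .cons (J := repPro J) x (innerChain J' p (repId A') y)

theorem innerChain_repId : ∀ {A A' B : E} (J : Pro A A') (p : HPath A' B),
    innerChain J p (repId A) (repId B) = idsChain (.cons J p)
  | _, _, _, _, .nil _ => rfl
  | _, _, _, J, .cons J' p =>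
    congrArg (Chain.cons (J := repPro J) (repId _)) (innerChain_repId J' p)

/-- The lists of objects with identities in the interior only differ in the first entry. -/
theorem exists_innerChain : ∀ {A A' B : E} (J : Pro A A') (p : HPath A' B) (y : (repCat B).Obj),
    ∃ (d : (repCat A').Obj) (c : Chain (repPath p) d y), ∀ x : (repCat A).Obj,
      innerChain J p x y = .cons (J := repPro J) x c
  | _, _, _, _, .nil _, y => ⟨y, .nil y, fun _ => rfl⟩
  | _, _, _, _, .cons J' p, y => ⟨_, innerChain J' p (repId _) y, fun _ => rfl⟩

/-- The action of `|B|(id_B, y)` changes the last object from `id_B` to `y`, and it is a cover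
because `id_B` is a center. Statements about lists that end in `id_B` are transported along it. -/
theorem exists_rightAction : ∀ {A A' B : E} (J : Pro A A') (p : HPath A' B) (x : (repCat A).Obj)
    (y : (repCat B).Obj), ∃ r : Row ((innerChain J p x (repId B)).path.append
      (.cons ((repCat B).hom (repId B) y) (.nil _))) (𝟙 _) (𝟙 _) (innerChain J p x y).path,
      RightAction (innerChain J p x (repId B)) y ⟨innerChain J p x y, r⟩ ∧ IsCover r
  | _, A', _, J, .nil _, x, y => ⟨_, RightAction.last (J := repPro J) x (repId A') y,
      IsComposite.isCover ((repCenter A').ract_isComposite (repPro J) x y)⟩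
  | _, A', _, J, .cons J' p, x, y => by
    obtain ⟨r, h, hr⟩ := exists_rightAction J' p (repId A') y
    exact ⟨_, RightAction.cons (J := repPro J) x h, hr.cons _⟩

/-- Families which are compatible with the inner actions agree if they agree on the identities. -/
theorem EnrMorphism.InnerCompat.eq_of_innerChain : ∀ {A' B : E} (p : HPath A' B) {A : E}
    (J : Pro A A') {Z W Y₀ Y₁ : E} {x : (repCat A).Obj} {y : (repCat B).Obj}
    {k : HPath Z ((repCat A).ext x)}
    {q : HPath ((repCat B).ext y) W} {f : Z ⟶ Y₀} {g : W ⟶ Y₁} {K : Pro Y₀ Y₁}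
    {O : Chain (repPath (.cons J p)) x y → HPath Z W}
    {hO : ∀ c, O c = k.append (c.path.append q)} {φ φ' : ∀ c, Cell (O c) f g K}
    (_ : EnrMorphism.InnerCompat k q hO φ) (_ : EnrMorphism.InnerCompat k q hO φ')
    (_ : φ (innerChain J p x y) = φ' (innerChain J p x y)) (c), φ c = φ' c
  | A', _, .nil _, A, J, _, _, _, _, x, y, k, q, _, _, _, _, _, _, _, hφ, hφ', e, c => by
    obtain ⟨b, c, rfl⟩ := Chain.exists_cons (J := repPro J) c
    cases c
    exact e
  | A', B, .cons J' p, A, J, Z, W, _, _, x, y, k, q, f, g, L, O, hO, φ, φ', hφ, hφ', e, c => by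
    obtain ⟨b, c, rfl⟩ := Chain.exists_cons (J := repPro J) c
    obtain ⟨d, c₀, hc₀⟩ := exists_innerChain J' p y
    have hk : ∀ {o : HPath ((repCat A').ext b) ((repCat B).ext y)} {l : HPath Z W},
        l = (k.append (.cons ((repPro J).obj x b) (.nil _))).append (o.append q) →
          l = k.append ((ProPath.cons ((repPro J).obj x b) o).append q) := fun h =>
      h.trans (ProPath.append_assoc k _ _)
    have hk' : ∀ {o : HPath ((repCat A').ext b) ((repCat B).ext y)} {l : HPath Z W},
        l = k.append ((ProPath.cons ((repPro J).obj x b) o).append q) →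
          l = (k.append (.cons ((repPro J).obj x b) (.nil _))).append (o.append q) := fun {o _} h =>
      h.trans (ProPath.append_assoc k (.cons ((repPro J).obj x b) (.nil _)) (o.append q)).symm
    -- With the first proarrow moved into the context, the families are indexed by the lists over a
    -- shorter string and remain compatible. By induction it is enough that they agree where all
    -- interior objects after `b` are identities.
    have compat : ∀ {φ : ∀ c, Cell (O c) f g L}, EnrMorphism.InnerCompat k q hO φ →
        EnrMorphism.InnerCompat (P := repPath (.cons J' p)) (k.append (.cons ((repPro J).obj x b) (.nil _))) q
          (O := fun c => O (.cons (J := repPro J) x c))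
          (fun c => hk' (hO (.cons (J := repPro J) x c)))
          (fun c => φ (.cons (J := repPro J) x c)) := by
      intro φ h
      constructor
      intro o s s' hs l hl
      have e := h.inner (InnerActions.cons (J := repPro J) x hs) (hk hl)
      have e₁ := whiskerRow_cons k ((repPro J).obj x b) s.row q (hk hl)
        (hO (.cons (J := repPro J) x s.chain)) hl (hk' (hO (.cons (J := repPro J) x s.chain)))
      have e₂ := whiskerRow_cons k ((repPro J).obj x b) s'.row q (hk hl)
        (hO (.cons (J := repPro J) x s'.chain)) hl (hk' (hO (.cons (J := repPro J) x s'.chain)))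
      refine (congrArg (fun r => paste r _ (Category.id_comp _) (Category.id_comp _)) e₁).symm.trans
        (e.trans (congrArg (fun r => paste r _ (Category.id_comp _) (Category.id_comp _)) e₂))
    refine EnrMorphism.InnerCompat.eq_of_innerChain p J' (compat hφ) (compat hφ') ?_ c
    have hb := hc₀ b
    have hb' := hc₀ (repId A')
    have e : φ (.cons (J := repPro J) x (innerChain J' p (repId A') y)) =
      φ' (.cons (J := repPro J) x (innerChain J' p (repId A') y)) := e
    rw [hb'] at e
    rw [hb]
    -- It remains to replace `b` by the identity of `A'`. The action of `|A'|(b, id)` on `J'(id, d)`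
    -- is a cover, and by compatibility the value at `b` after it equals the value at the identity
    -- after the action on `J`.
    have cov := IsCover.cons (IsCover.consIds ((repCenter A').lact_isComposite (repPro J') b d)
      c₀.path (by rfl)) ((repPro J).obj x b)
    have act := InnerActions.here (J := repPro J) (J' := repPro J') x b (repId A') c₀
    refine (cov.whiskerRow_bijects k q rfl (hO _)).ext ?_
    exact (hφ.inner act rfl).trans ((congrArg (fun z => paste _ z (Category.id_comp _) (Category.id_comp _)) e).trans
      (hφ'.inner act rfl).symm)

end Representable

/-! ### Density of morphisms out of representable strings -/

section Representable

variable {E : Type u} [VirtualDoubleCategory.{z, w, v} E] [IsVirtualEquipment E]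

namespace EnrMorphism

variable {A A' B : E} {J : Pro A A'} {p : HPath A' B} {K : EnrProfunctor (repCat A) (repCat B)}
  (μ : EnrMorphism (repPath (.cons J p)) (𝟙 (repCat A)) (𝟙 (repCat B)) K)

/-- Left equivariance of `μ` is a square relating its components at `id_A` and at `x`. The other
three sides are covers: the component at `id_A` by hypothesis, the two actions because `id_A` is a
center. -/
theorem isComposite_glob_left (h : IsComposite (μ.glob (idsChain (.cons J p)))) (x : (repCat A).Obj) :
    IsComposite (μ.glob (innerChain J p x (repId B))) := by
  obtain ⟨d, c, hc⟩ := exists_innerChain J p (repId B)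
  rw [← innerChain_repId, hc] at h
  rw [hc]
  have e := EnrMorphism.glob_lact (P₁ := repPro J) (P' := repPath p) μ x (repId A) c
  have h₁ := IsPaste.singleEq (Category.comp_id _) (Category.comp_id _) e.symm
  have h₂ := IsPaste.single (CellRow.cons (p := .cons _ (.nil _)) (by rfl)
    (cellId ((repCat A).hom x (repId A))) (.single (μ.glob (.cons (J := repPro J) (repId A) c))))
    (K.lact x (repId A) (repId B)) (Category.comp_id _) (Category.comp_id _)
  apply IsCover.isComposite
  exact .cancel h₁ (.consIds ((repCenter A).lact_isComposite (repPro J) x d) c.path (by rfl))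
    (.comp h₂ ((IsComposite.isCover h).cons _)
      (IsComposite.isCover ((repCenter A).lact_isComposite K x (repId B))))

/-- The corresponding square for the right action replaces the last object `id_B` by `y`. -/
theorem isComposite_glob_innerChain (h : IsComposite (μ.glob (idsChain (.cons J p))))
    (x : (repCat A).Obj) (y : (repCat B).Obj) : IsComposite (μ.glob (innerChain J p x y)) := by
  have h : IsComposite (μ.glob (innerChain J p x (repId B))) := isComposite_glob_left μ h x
  obtain ⟨r, hr, hr'⟩ := exists_rightAction J p x y
  have e := EnrMorphism.glob_ract μ hr
  have h₁ := IsPaste.singleEq (Category.comp_id _) (Category.comp_id _) e.symm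
  have h₂ := IsPaste.single (CellRow.cons (by rfl) (μ.glob (innerChain J p x (repId B)))
    (.single (cellId ((repCat B).hom (repId B) y)))) (K.ract x (repId B) y) (Category.comp_id _)
    (Category.comp_id _)
  apply IsCover.isComposite
  exact .cancel h₁ hr' (.comp h₂ (.consIds h (.cons ((repCat B).hom (repId B) y) (.nil _)) (by rfl))
      (IsComposite.isCover ((repCenter B).ract_isComposite K x y)))

/-- `μ` itself equalizes the interior actions, so every cell out of `K(a, b)` in its context induces
a compatible family. -/
theorem InnerCompat.of_paste {Z W Y₀ Y₁ : E} {a : (repCat A).Obj} {b : (repCat B).Obj}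
    (k : HPath Z ((repCat A).ext a)) (q : HPath ((repCat B).ext b) W) {f : Z ⟶ Y₀} {g : W ⟶ Y₁}
    {L : Pro Y₀ Y₁} {o : HPath Z W} (ho : o = k.append (.cons (K.obj a b) q))
    {O : Chain (repPath (.cons J p)) a b → HPath Z W} (hO : ∀ c, O c = k.append (c.path.append q))
    (ψ : Cell o f g L) : InnerCompat k q hO (fun c =>
      paste (whiskerRow k (.single (μ.glob c)) q (hO c) ho) ψ (Category.id_comp _)
        (Category.id_comp _)) := by
  constructor
  intro l s s' hs o' ho'
  have h₁ := IsPaste.single s.row (μ.glob s.chain) (Category.comp_id _) (Category.comp_id _)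
  have h₂ := IsPaste.singleEq (Category.comp_id _) (Category.comp_id _)
    ((paste_eq_cast (μ.inner _ _ _ hs) (Category.comp_id _) (Category.comp_id _)).symm : paste s'.row (μ.glob s'.chain) (Category.comp_id _) (Category.comp_id _) =
      paste s.row (μ.glob s.chain) (Category.comp_id _) (Category.comp_id _))
  exact (pasteAssoc (h₁.whisker k q ho' (hO _) ho) ψ _ _ _ _ (Category.id_comp _)
    (Category.id_comp _)).trans (pasteAssoc (h₂.whisker k q ho' (hO _) ho) ψ _ _ _ _
    (Category.id_comp _) (Category.id_comp _)).symm

/-- The colimit over all lists of objects collapses to the one with identities in the interior: a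
compatible family is determined by its value there, and the component of `μ` there is a composite.
-/
theorem isDense_of_glob (h : IsComposite (μ.glob (idsChain (.cons J p)))) : IsDense μ where
  ext {Z W Y₀ Y₁ a b} k q f g L o ho ψ ψ' e :=
    ((IsComposite.isCover (isComposite_glob_innerChain μ h a b)).whiskerRow_bijects k q rfl
      ho).ext (e (innerChain J p a b) rfl)
  exists_lift {Z W Y₀ Y₁ a b} k q f g L o ho O hO φ hφ := by
    obtain ⟨ψ, hψ, -⟩ := ((IsComposite.isCover (isComposite_glob_innerChain μ h a
      b)).whiskerRow_bijects k q (hO _) ho).existsUnique f g L (φ _)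
    exact ⟨ψ, fun c => (InnerCompat.of_paste μ k q ho hO ψ).eq_of_innerChain p J hφ hψ c⟩

theorem isComposite_of_glob (h : IsComposite (μ.glob (idsChain (.cons J p)))) :
    IsComposite (V := EnrCat.{max u v} E) μ :=
  (isDense_of_glob μ h).isComposite trivial

end EnrMorphism

end Representable

/-! ### Morphisms determined by their value at a center -/

section Evaluation

variable {E : Type u} [VirtualDoubleCategory.{z, w, v} E]

namespace EnrMorphism

variable {C D C₁ C' D' : EnrCat.{t} E} {J : EnrProfunctor C C₁} {F : C ⟶ C'} {G : D ⟶ D'}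
  {K : EnrProfunctor C' D'}

/-- The left action of `C(a, e)`, with `e` the center, is a cover. By the left law, the component at
`a` composed with this cover is expressed through the component at the center. -/
theorem app_cons_eq (y : C.Center) {p : ProfPath C₁ D} {α β : EnrMorphism (.cons J p) F G K}
    {d : C₁.Obj} {b : D.Obj} {c : Chain p d b} (h : α.app (.cons y.pt c) = β.app (.cons y.pt c))
    (a : C.Obj) : α.app (.cons a c) = β.app (.cons a c) := by
  refine (IsCover.consIds (y.lact_isComposite J a d) c.path (by rfl)).bijects.ext ?_
  have e (α : EnrMorphism (.cons J p) F G K) :=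
    paste_eq_cast (α.left a y.pt c) (Category.id_comp _) (Category.id_comp _)
  exact (e α).trans ((congrArg (fun x => paste (.pair (F.hom a y.pt) x)
    (K.lact (F.obj a) (F.obj y.pt) (G.obj b)) (Category.comp_id _) (Category.comp_id _)) h).trans
    (e β).symm)

theorem app_eq_of_rightAction {p : ProfPath C D} {α β : EnrMorphism p F G K} {a : C.Obj}
    {b b' : D.Obj} {c : Chain p a b} {s : ChainRow _ p a b' (𝟙 _) (𝟙 _)} (hs : RightAction c b' s)
    (hs' : IsCover s.row) (h : α.app c = β.app c) : α.app s.chain = β.app s.chain := by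
  refine hs'.bijects.ext ?_
  have e (α : EnrMorphism p F G K) :=
    paste_eq_cast (α.right c b' s hs) (Category.id_comp _) (Category.id_comp _)
  exact (e α).trans ((congrArg (fun x => paste (.pair x (G.hom b b'))
    (K.ract (F.obj a) (G.obj b) (G.obj b')) (Category.comp_id _) (Category.comp_id _)) h).trans
    (e β).symm)

theorem ext_center (y : C.Center) (z : D.Center) {J : EnrProfunctor C D}
    {α β : EnrMorphism (.cons J (.nil D)) F G K}
    (h : α.app (.cons y.pt (.nil z.pt)) = β.app (.cons y.pt (.nil z.pt))) : α = β := by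
  refine eq_of_app fun c => heq_of_eq ?_
  cases c with
  | cons a c =>
  cases c
  rename_i a b
  exact app_eq_of_rightAction (RightAction.last (J := J) a z.pt b)
    (IsComposite.isCover (z.ract_isComposite J a b)) (app_cons_eq y h a)

/-- An empty string has no profunctor to act on, so the morphisms are first extended along the unit,
where the previous lemma applies. -/
theorem ext_center_nil (y : C.Center) {G : C ⟶ D'} {α β : EnrMorphism (.nil C) F G K}
    (h : α.app (.nil y.pt) = β.app (.nil y.pt)) : α = β := by
  have e : extendOne α = extendOne β := ext_center y y
    (congrArg (fun x => paste (.pair (F.hom y.pt y.pt) x)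
      (K.lact (F.obj y.pt) (F.obj y.pt) (G.obj y.pt)) (Category.comp_id _) (Category.comp_id _)) h)
  rw [← paste_extendOne α, ← paste_extendOne β, e]

/-- The interior law of a morphism restated with empty contexts, the form in which
`InnerCompat.eq_of_innerChain` applies to it. -/
theorem innerCompat_app {p : ProfPath C D} (α : EnrMorphism p F G K) (a : C.Obj) (b : D.Obj) :
    InnerCompat (P := p) (.nil _) (.nil _) (O := fun c : Chain p a b => c.path)
      (fun c => (ProPath.append_nil c.path).symm) (fun c => α.app c) := by
  constructor
  intro o s s' hs o' ho'
  obtain rfl : o' = o := ho'.trans (ProPath.append_nil o)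
  have e (s : ChainRow o' p a b (𝟙 _) (𝟙 _)) := whiskerRow_nil_nil s.row ho'
    (ProPath.append_nil s.chain.path).symm
  have e' (s : ChainRow o' p a b (𝟙 _) (𝟙 _)) := congrArg (fun r => paste r (α.app s.chain)
    (Category.id_comp _) (Category.id_comp _)) (e s)
  exact (e' s).trans ((α.inner_eq hs).trans (e' s').symm)

variable [IsVirtualEquipment E]

/-- A morphism out of a representable string is determined by its component at the identities. -/
theorem ext_idsChain : ∀ {A B : E} {p : HPath A B} {C' D' : EnrCat.{max u v} E} {F : repCat A ⟶ C'}
    {G : repCat B ⟶ D'} {K : EnrProfunctor C' D'} {α β : EnrMorphism (repPath p) F G K},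
    α.app (idsChain p) = β.app (idsChain p) → α = β
  | A, _, .nil _, _, _, _, _, _, _, _, h => ext_center_nil (repCenter A) h
  | A, B, .cons J p, _, _, _, _, _, α, β, h => by
    refine eq_of_app fun {x y} c => heq_of_eq ?_
    -- This makes the interior objects identities. The first object is then treated by `app_cons_eq`
    -- and the last one by `app_eq_of_rightAction`.
    refine (innerCompat_app α x y).eq_of_innerChain p J (innerCompat_app β x y) ?_ c
    obtain ⟨d, c, hc⟩ := exists_innerChain J p (repId B)
    obtain ⟨r, hr, hr'⟩ := exists_rightAction J p x y
    rw [← innerChain_repId, hc] at h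
    have h := app_cons_eq (J := repPro J) (p := repPath p) (repCenter A) h x
    refine app_eq_of_rightAction hr hr' ?_
    rw [hc]
    exact h

end EnrMorphism

end Evaluation

/-! ### Transport along equal proarrows and arrows -/

namespace VirtualDoubleCategory

section Congr

variable {V : Type u} [VirtualDoubleCategory.{z, w, v} V] {X X' Y Y' : V}

theorem IsComposite.of_heq {p : HPath X Y} {J J' : Pro X Y} {μ : Cell p (𝟙 X) (𝟙 Y) J}
    {μ' : Cell p (𝟙 X) (𝟙 Y) J'} (h : IsComposite μ) (hJ : J = J') (e : HEq μ μ') :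
    IsComposite μ' := by
  subst hJ
  obtain rfl := eq_of_heq e
  exact h

theorem heq_paste_resCell [IsVirtualEquipment V] {A B : V} {p : HPath X X'} {f f' : X ⟶ A}
    {g g' : X' ⟶ B} (hf : f = f') (hg : g = g') {K : Pro A B}
    {α : Cell p (𝟙 X) (𝟙 X') (res f g K)} {α' : Cell p (𝟙 X) (𝟙 X') (res f' g' K)} (h : HEq α α') :
    HEq (paste (.single α) (resCell f g K) (Category.id_comp _) (Category.id_comp _))
      (paste (.single α') (resCell f' g' K) (Category.id_comp _) (Category.id_comp _)) := by
  subst hf hg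
  obtain rfl := eq_of_heq h
  rfl

end Congr

end VirtualDoubleCategory

theorem VDFunctor.globMap_paste {V : Type*} [VirtualDoubleCategory V] {W : Type*}
    [VirtualDoubleCategory W] (Φ : VDFunctor V W) {X Y : V} {p : HPath X Y} {J K : Pro X Y}
    (α : Cell p (𝟙 X) (𝟙 Y) J) (β : Cell (.cons J (.nil Y)) (𝟙 X) (𝟙 Y) K) :
    Φ.globMap (paste (.single α) β (Category.id_comp _) (Category.id_comp _)) =
      paste (.single (Φ.globMap α)) (Φ.globMap β) (Category.id_comp _) (Category.id_comp _) := by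
  have h := Φ.cellMap_paste (.single α) β (Category.id_comp _) (Category.id_comp _)
  -- A functor preserves identity arrows only up to a propositional equality, so their images are
  -- generalized to variables before substituting.
  have key : ∀ (f : Φ.obj X ⟶ Φ.obj X) (g : Φ.obj Y ⟶ Φ.obj Y) (hf : f = 𝟙 _) (hg : g = 𝟙 _)
      (hf' : f ≫ f = f) (hg' : g ≫ g = g) (a : Cell (p.map Φ.obj Φ.proMap) f g (Φ.proMap J))
      (b : Cell (.cons (Φ.proMap J) (.nil _)) f g (Φ.proMap K)),
      castCell hf hg (paste (.single a) b hf' hg') = paste (.single (castCell hf hg a))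
        (castCell hf hg b) (Category.id_comp _) (Category.id_comp _) := by
    intro f g hf hg
    subst hf hg
    exact fun _ _ _ _ => rfl
  exact (congrArg (castCell (Φ.map_id X) (Φ.map_id Y)) h).trans (key _ _ _ _ _ _ _ _)

/-! ### Preservation of composites and full faithfulness on 2-cells -/

section Embedding

variable {E : Type u} [VirtualDoubleCategory.{z, w, v} E]

theorem EnrMorphism.heq_of_app {C D C' D' : EnrCat.{t} E} {p : ProfPath C D} {F : C ⟶ C'}
    {G : D ⟶ D'} {K K' : EnrProfunctor C' D'} (hK : K = K') {α : EnrMorphism p F G K}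
    {β : EnrMorphism p F G K'}
    (h : ∀ {a : C.Obj} {b : D.Obj} (c : Chain p a b), HEq (α.app c) (β.app c)) : HEq α β := by
  subst hK
  exact heq_of_eq (eq_of_app h)

variable [IsVirtualEquipment E]

/-- This is an equality and not only an isomorphism: just the right actions are defined differently,
by `rho` and by `lam`, and these coincide on a unit. -/
theorem repPro_unit (A : E) : repPro (unit A) = (repCat A).homProfunctor := by
  unfold repPro EnrCat.homProfunctor
  congr 1
  funext x y y'
  exact (repLact_unit x y y').symm

/-- Composition with the cartesian cell removes the transport along `|𝟙| = 𝟙` hidden in `globMap`,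
leaving only cells of `E` with plain sides. -/
theorem resCell_globMap {A B : E} {p : HPath A B} {J : Pro A B} (μ : Cell p (𝟙 A) (𝟙 B) J)
    {x : (repCat A).Obj} {y : (repCat B).Obj} (c : Chain (repPath p) x y) :
    paste (.single (EnrMorphism.app ((canonicalEmbedding E).globMap μ) c))
      (resCell (RepObj.arr x) (RepObj.arr y) J) (Category.id_comp _) (Category.id_comp _) =
    paste (cartRow p c) μ (Category.comp_id _) (Category.comp_id _) :=
  eq_of_heq ((heq_paste_resCell (Category.comp_id _).symm (Category.comp_id _).symm
    (castCell_app (repFun_id A) (repFun_id B) (repCell μ) c)).trans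
    ((heq_of_eq (resCell_repApp μ c)).trans (heq_paste _ _ _ _ _ _)))

/-- At the identities, the component of `|μ|` followed by an invertible cell is a cover followed by
`μ`. So this component is a composite, and the criterion for representable strings applies. -/
theorem globMap_isComposite_cons {A A' B : E} {J : Pro A A'} {p : HPath A' B} {K : Pro A B}
    {μ : Cell (.cons J p) (𝟙 A) (𝟙 B) K} (h : IsComposite μ) :
    IsComposite ((canonicalEmbedding E).globMap μ) := by
  refine EnrMorphism.isComposite_of_glob (J := J) (p := p) (K := repPro K) _ ?_
  apply IsCover.isComposite
  have h₁ := IsPaste.singleEq (Category.id_comp _) (Category.id_comp _)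
    (resCell_globMap μ (idsChain (.cons J p)))
  have h₂ := IsPaste.single (cartRow (.cons J p) (idsChain (.cons J p))) μ (Category.comp_id _)
    (Category.comp_id _)
  exact .cancel_right h₁
    (IsComposite.isCover (IsCartesian.isComposite (resCell_isCartesian (𝟙 A) (𝟙 B) K)))
    (.comp h₂ (cartRow_isCover _) (IsComposite.isCover h))

/-- Component by component, the image of the chosen unit is the unit of the category `|A|`, which is
already known to be a composite. -/
theorem globMap_unitCell_isComposite (A : E) :
    IsComposite ((canonicalEmbedding E).globMap (unitCell A)) := by
  refine IsComposite.of_heq (EnrMorphism.oneMor_isComposite (repCat A)) (repPro_unit A).symm ?_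
  refine EnrMorphism.heq_of_app (repPro_unit A).symm fun c => HEq.symm ?_
  cases c
  rename_i x
  exact (castCell_app (repFun_id A) (repFun_id A) (repCell (unitCell A)) (.nil x)).trans
    (resLift_congr (Category.comp_id _) (Category.comp_id _) rfl rfl (heq_paste _ _ _ _ _ _))

/-- For the empty string, `μ` differs from the chosen unit by a cell `ι` between proarrows. By
cancellation `ι` is a composite, its image is one by the nonempty case, and that image can be
cancelled from the image of the chosen unit. -/
theorem globMap_isComposite {A B : E} {p : HPath A B} {J : Pro A B} {μ : Cell p (𝟙 A) (𝟙 B) J}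
    (h : IsComposite μ) : IsComposite ((canonicalEmbedding E).globMap μ) := by
  cases p with
  | cons => exact globMap_isComposite_cons h
  | nil =>
    obtain ⟨ι, hι, -⟩ := (IsComposite.isCover h).bijects.existsUnique (𝟙 _) (𝟙 _) _ (unitCell A)
    have h₁ := IsPaste.singleEq (Category.comp_id _) (Category.comp_id _) hι
    have h₂ : IsComposite ι := by
      apply IsCover.isComposite
      exact .cancel h₁ (IsComposite.isCover h) (IsComposite.isCover (unitCell_isComposite A))
    have h₃ := IsPaste.singleEq (Category.comp_id _) (Category.comp_id _)
      (((canonicalEmbedding E).globMap_paste μ ι).symm.trans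
        (congrArg (canonicalEmbedding E).globMap hι))
    apply IsCover.isComposite
    exact .cancel_right h₃ (IsComposite.isCover (globMap_isComposite_cons h₂))
      (IsComposite.isCover (globMap_unitCell_isComposite A))

/-- Both directions go through the component at the identities, where the cartesian cells form a
cover and which determines any morphism out of a representable string. -/
theorem repCell_bijective {A A' B B' : E} (p : HPath A A') (f : A ⟶ B) (g : A' ⟶ B')
    (K : Pro B B') : Function.Bijective fun α : Cell p f g K => repCell α := by
  constructor
  · intro α β h
    refine (cartRow_isCover p).bijects.ext ?_
    have e := congrArg (fun φ : EnrMorphism _ _ _ _ => paste (.single (φ.app (idsChain p)))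
      (resCell (𝟙 A ≫ f) (𝟙 A' ≫ g) K) (Category.id_comp _) (Category.id_comp _)) h
    exact paste_eq_cast ((resCell_repApp α (idsChain p)).symm.trans (e.trans
      (resCell_repApp β (idsChain p)))) (Category.id_comp _) (Category.id_comp _)
  · intro φ
    -- The preimage is the component of `φ` at the identities, followed by the cartesian cell over
    -- `K` and descended along the cover.
    obtain ⟨α, hα, -⟩ := (cartRow_isCover p).bijects.existsUnique f g K
      (paste (.single (φ.app (idsChain p))) (resCell (𝟙 A ≫ f) (𝟙 A' ≫ g) K)
        ((Category.id_comp _).trans (Category.id_comp _))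
        ((Category.id_comp _).trans (Category.id_comp _)))
    refine ⟨α, EnrMorphism.ext_idsChain (p := p) ?_⟩
    refine res_ext (f := 𝟙 A ≫ f) (g := 𝟙 A' ≫ g) (Category.id_comp _) (Category.id_comp _) ?_
    refine (resCell_repApp α (idsChain p)).trans ?_
    exact paste_eq_cast hα (Category.id_comp _).symm (Category.id_comp _).symm

end Embedding

/-! ### Transformations and isomorphisms given at a center -/

section Transformations

variable {E : Type u} [VirtualDoubleCategory.{z, w, v} E] {C D : EnrCat.{t} E}

namespace EnrMorphism

/-- The identity transformation of a functor. -/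
def idTransf (F : C ⟶ D) : EnrMorphism (.nil C) F F D.homProfunctor :=
  paste (V := EnrCat.{t} E) (.nil F) (oneMor D) (Category.comp_id _) (Category.comp_id _)

/-- The composite of two transformations. -/
def compTransf {F G H : C ⟶ D} (α : EnrMorphism (.nil C) F G D.homProfunctor)
    (β : EnrMorphism (.nil C) G H D.homProfunctor) : EnrMorphism (.nil C) F H D.homProfunctor :=
  paste (V := EnrCat.{t} E) (.pair α β) (lactMor D.homProfunctor) (Category.comp_id _)
    (Category.comp_id _)

theorem idTransf_app (F : C ⟶ D) (a : C.Obj) : (idTransf F).app (.nil a) =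
    paste (.nil (F.arr a)) (D.one (F.obj a)) (Category.comp_id _) (Category.comp_id _) :=
  eq_of_heq ((vpaste_app _ _ _ _ (.nil a)).trans (heq_paste _ _ _ _ _ _))

theorem compTransf_app {F G H : C ⟶ D} (α : EnrMorphism (.nil C) F G D.homProfunctor)
    (β : EnrMorphism (.nil C) G H D.homProfunctor) (a : C.Obj) : (compTransf α β).app (.nil a) =
    paste (.pair (α.app (.nil a)) (β.app (.nil a))) (D.mul (F.obj a) (G.obj a) (H.obj a))
      (Category.comp_id _) (Category.comp_id _) :=
  eq_of_heq ((vpaste_app _ _ _ _ (.nil a)).trans (heq_paste _ _ _ _ _ _))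

end EnrMorphism

variable [IsVirtualEquipment E]

/-- A cell at a center extends to a transformation. -/
theorem EnrCat.Center.exists_transf (y : C.Center) {C' D' : EnrCat.{t} E} {F : C ⟶ C'} {G : C ⟶ D'}
    {K : EnrProfunctor C' D'}
    (θ : Cell (.nil _) (F.arr y.pt) (G.arr y.pt) (K.obj (F.obj y.pt) (G.obj y.pt))) :
    ∃ α : EnrMorphism (.nil C) F G K, α.app (.nil y.pt) = θ := by
  -- `θ` is factored through `K(F, G)` and extended along the unit `C(y, y)`. It becomes a cell
  -- between values of profunctors at the center, to which `exists_extension` applies; the extension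
  -- is finally composed with the units of `C` and the cartesian morphism.
  obtain ⟨θ₂, hθ₂, -⟩ := (IsComposite.isCover y.one_isComposite).bijects.existsUnique (𝟙 _) (𝟙 _)
    ((K.restrict F G).obj y.pt y.pt) (resLift θ (Category.id_comp _) (Category.id_comp _))
  obtain ⟨φ, hφ⟩ := y.exists_extension y C.homProfunctor (K.restrict F G) θ₂
  refine ⟨paste (V := EnrCat.{t} E) (.single (paste (V := EnrCat.{t} E) (.single
    (EnrMorphism.oneMor C)) φ (Category.id_comp _) (Category.id_comp _)))
    (EnrMorphism.restrictCell F G K) (Category.id_comp _) (Category.id_comp _), ?_⟩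
  refine eq_of_heq ((EnrMorphism.vpaste_app _ _ _ _ (.nil y.pt)).trans ?_)
  refine (heq_paste _ _ _ _ (Category.id_comp _) (Category.id_comp _)).trans (heq_of_eq ?_)
  have e₁ := eq_of_heq (EnrMorphism.one_app φ y.pt)
  have e₂ := e₁.trans ((congrArg (fun x => paste (.single (C.one y.pt)) x (Category.id_comp _)
    (Category.id_comp _)) hφ).trans hθ₂)
  exact (congrArg (fun x => paste (.single x) (K.resAt F G y.pt y.pt) (Category.id_comp _)
    (Category.id_comp _)) e₂).trans (resLift_paste _ _ _)

/-- A transformation exists for every value at the center and is determined by it, so an inverse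
pair of cells at the center extends to an inverse pair of transformations. -/
theorem EnrCat.Center.nonempty_natIso (y : C.Center) {F G : C ⟶ D}
    (α : Cell (.nil _) (F.arr y.pt) (G.arr y.pt) (D.hom (F.obj y.pt) (G.obj y.pt)))
    (β : Cell (.nil _) (G.arr y.pt) (F.arr y.pt) (D.hom (G.obj y.pt) (F.obj y.pt)))
    (h₁ : paste (.pair α β) (D.mul _ _ _) (Category.comp_id _) (Category.comp_id _) =
      paste (.nil (F.arr y.pt)) (D.one (F.obj y.pt)) (Category.comp_id _) (Category.comp_id _))
    (h₂ : paste (.pair β α) (D.mul _ _ _) (Category.comp_id _) (Category.comp_id _) =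
      paste (.nil (G.arr y.pt)) (D.one (G.obj y.pt)) (Category.comp_id _) (Category.comp_id _)) :
    Nonempty (EnrFunctor.NatIso F G) := by
  obtain ⟨φ, rfl⟩ := y.exists_transf (K := D.homProfunctor) α
  obtain ⟨ψ, rfl⟩ := y.exists_transf (K := D.homProfunctor) β
  -- The composite transformation and the identity transformation agree at the center, hence at
  -- every object.
  have e {F G : C ⟶ D} {φ : EnrMorphism (.nil C) F G D.homProfunctor}
      {ψ : EnrMorphism (.nil C) G F D.homProfunctor}
      (h : paste (.pair (φ.app (.nil y.pt)) (ψ.app (.nil y.pt))) (D.mul _ _ _)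
        (Category.comp_id _) (Category.comp_id _) =
        paste (.nil (F.arr y.pt)) (D.one (F.obj y.pt)) (Category.comp_id _) (Category.comp_id _))
      (a : C.Obj) := (EnrMorphism.compTransf_app φ ψ a).symm.trans ((congrArg
    (fun x : EnrMorphism (.nil C) F F D.homProfunctor => x.app (.nil a))
    (EnrMorphism.ext_center_nil y ((EnrMorphism.compTransf_app φ ψ y.pt).trans (h.trans
      (EnrMorphism.idTransf_app F y.pt).symm)))).trans (EnrMorphism.idTransf_app F a))
  exact ⟨φ, ψ, e h₁, e h₂⟩

end Transformations

/-! ### Fullness on arrows -/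

section Full

variable {E : Type u} [VirtualDoubleCategory.{z, w, v} E] [IsVirtualEquipment E]

/-- The transformation between objects of `|B|` which represent the same arrow. -/
noncomputable def repTransf {A B : E} {a b : RepObj B} {h : A ⟶ a.dom} {k : A ⟶ b.dom} {f : A ⟶ B}
    (hf : h ≫ a.arr = f) (hg : k ≫ b.arr = f) : Cell (.nil A) h k (res a.arr b.arr (unit B)) :=
  resLift (paste (.nil f) (unitCell B) (Category.comp_id _) (Category.comp_id _)) hf hg

/-- Over the cartesian cells both factors become the unit of `B` pulled back along `f`, and
multiplying this with itself changes nothing. -/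
theorem repTransf_comp {A B : E} {a b : RepObj B} {h : A ⟶ a.dom} {k : A ⟶ b.dom} {f : A ⟶ B}
    (hf : h ≫ a.arr = f) (hg : k ≫ b.arr = f) :
    paste (.pair (repTransf hf hg) (repTransf hg hf)) (repLact (unit B) a b a) (Category.comp_id _)
      (Category.comp_id _) =
    paste (.nil h) (repOne a) (Category.comp_id _) (Category.comp_id _) := by
  refine res_ext hf hf ?_
  refine (lift_paste _ _ _ _ _ _ _ _ hf hf).trans ?_
  refine (paste_two (resLift_paste _ _ _) (resLift_paste _ _ _) (by rfl) (lam (unit B))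
    (Category.comp_id _) (Category.comp_id _) hf hf
    (Category.comp_id _) (Category.comp_id _)).trans ?_
  refine (unit_lam _).trans (Eq.symm ((lift_paste (.nil h) _ _ _ _ _ _ _ hf hf).trans ?_))
  exact pasteAssoc (.nil hf) (unitCell B) (Category.comp_id _) (Category.comp_id _) hf hf
    (Category.comp_id _) (Category.comp_id _)

theorem exists_natIso_repFun {A B : E} (G : repCat A ⟶ repCat B) :
    ∃ f : A ⟶ B, Nonempty (EnrFunctor.NatIso G (repFun f)) := by
  -- The arrow sought is the one represented by `G(id_A)`: the component of `G` at `id_A` followed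
  -- by the arrow which is the object `G(id_A)` of `|B|`. With this choice `G` and `|f|` represent
  -- the same arrow at the center.
  have hf : 𝟙 A ≫ 𝟙 A ≫ (G.arr (repId A) ≫ RepObj.arr (G.obj (repId A))) =
    G.arr (repId A) ≫ RepObj.arr (G.obj (repId A)) :=
    (Category.id_comp _).trans (Category.id_comp _)
  exact ⟨G.arr (repId A) ≫ RepObj.arr (G.obj (repId A)), (repCenter A).nonempty_natIso
    (repTransf rfl hf) (repTransf hf rfl) (repTransf_comp rfl hf) (repTransf_comp hf rfl)⟩

end Full

theorem VirtualDoubleCategory.castCell_castCell {V : Type u} [VirtualDoubleCategory.{z, w, v} V]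
    {X X' Y Y' : V} {p : HPath X X'} {f f' : X ⟶ Y} {g g' : X' ⟶ Y'} {K : Pro Y Y'} (hf : f = f')
    (hg : g = g') (hf' : f' = f) (hg' : g' = g) (α : Cell p f g K) :
    castCell hf' hg' (castCell hf hg α) = α := by
  subst hf hg
  rfl

/-! ### Coreflectivity on proarrows -/

section Coreflection

variable {E : Type u} [VirtualDoubleCategory.{z, w, v} E] [IsVirtualEquipment E] (A B : E)

/-- A special case of the bijectivity on 2-cells; the transports along `|𝟙| = 𝟙` are bijections. -/
theorem canonicalEmbedding_hor_map_bijective (J K : Hor A B) : Function.Bijective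
    fun α : J ⟶ K => ((canonicalEmbedding E).hor A B).map α := by
  have h := repCell_bijective (.cons J.pro (.nil B)) (𝟙 A) (𝟙 B) K.pro
  constructor
  · intro α β e
    refine h.1 ?_
    have e := congrArg (castCell (repFun_id A).symm (repFun_id B).symm) e
    exact (castCell_castCell _ _ _ _ _).symm.trans (e.trans (castCell_castCell _ _ _ _ _))
  · intro φ
    obtain ⟨α, hα⟩ := h.2 (castCell (repFun_id A).symm (repFun_id B).symm φ)
    exact ⟨α, (congrArg (castCell (repFun_id A) (repFun_id B)) hα).trans
      (castCell_castCell _ _ _ _ _)⟩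

variable {A B}

/-- The unit of the coreflection. -/
noncomputable def toEval (J : Hor A B) :
    J ⟶ (evalHor A B).obj (((canonicalEmbedding E).hor A B).obj J) :=
  (resLift (cellId J.pro) (Category.id_comp _) (Category.id_comp _) :
    Cell _ (𝟙 A) (𝟙 B) (res (𝟙 A) (𝟙 B) J.pro))

theorem toEval_paste (J : Hor A B) : paste (.single (toEval J)) (resCell (𝟙 A) (𝟙 B) J.pro)
    (Category.id_comp _) (Category.id_comp _) = cellId J.pro :=
  resLift_paste _ _ _

/-- `toEval J` is a section of a cartesian cell with identity sides, which is a cover, so it is a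
cover by cancellation. Composing with it is therefore bijective. -/
theorem toEval_isComposite (J : Hor A B) : IsComposite (toEval J) := by
  apply IsCover.isComposite
  exact .cancel_right (IsPaste.singleEq (Category.id_comp _) (Category.id_comp _) (toEval_paste J))
    (IsComposite.isCover (IsCartesian.isComposite (resCell_isCartesian (𝟙 A) (𝟙 B) J.pro)))
    (.ids (.cons J.pro (.nil B)))

/-- After composition with the cartesian cell of `K(id, id)` both sides become `α`. -/
theorem toEval_naturality {J K : Hor A B} (α : J ⟶ K) :
    toEval J ≫ (evalHor A B).map (((canonicalEmbedding E).hor A B).map α) = α ≫ toEval K := by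
  refine res_ext (f := 𝟙 A) (g := 𝟙 B) (Category.id_comp _) (Category.id_comp _) ?_
  have e₁ := pasteAssoc (IsPaste.single (.single (toEval J)) ((evalHor A B).map
    (((canonicalEmbedding E).hor A B).map α)) (Category.id_comp _) (Category.id_comp _))
    (resCell (𝟙 A) (𝟙 B) K.pro) (Category.id_comp _) (Category.id_comp _) (Category.id_comp _)
    (Category.id_comp _) (Category.id_comp _) (Category.id_comp _)
  have e₂ := congrArg (fun x => paste (.single (toEval J)) x (Category.id_comp _)
    (Category.id_comp _)) (resCell_globMap α (idChain (repPro J.pro)))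
  have e₃ := pasteAssoc (IsPaste.singleEq (Category.id_comp _) (Category.id_comp _)
    (toEval_paste J)) α (Category.id_comp _) (Category.id_comp _) (Category.id_comp _)
    (Category.id_comp _) (Category.id_comp _) (Category.id_comp _)
  have e₄ := pasteAssoc (IsPaste.single (.single α) (toEval K) (Category.id_comp _)
    (Category.id_comp _)) (resCell (𝟙 A) (𝟙 B) K.pro) (Category.id_comp _) (Category.id_comp _)
    (Category.id_comp _) (Category.id_comp _) (Category.id_comp _) (Category.id_comp _)
  have e₅ := congrArg (fun x => paste (.single α) x (Category.id_comp _) (Category.id_comp _))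
    (toEval_paste K)
  exact e₁.symm.trans (e₂.trans (e₃.trans ((ids_paste α).trans ((paste_id α).symm.trans
    (e₅.symm.trans e₄)))))

/-- Evaluation identifies morphisms `|J| ⟶ L` with cells `J(id, id) ⟶ L(id, id)`: it is injective
because a morphism is determined at the identities, and surjective by extension from the centers.
Composition with `toEval J` turns the latter bijectively into cells `J ⟶ L(id, id)`. -/
theorem toEval_bijective (J : Hor A B) (L : Hor (repCat A) (repCat B)) : Function.Bijective
    fun φ : ((canonicalEmbedding E).hor A B).obj J ⟶ L => toEval J ≫ (evalHor A B).map φ := by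
  have h := (IsComposite.isCover (toEval_isComposite J)).bijects
  constructor
  · intro φ ψ e
    exact EnrMorphism.ext_idsChain (p := .cons J.pro (.nil B)) (h.ext e)
  · intro α
    obtain ⟨β, hβ, -⟩ := h.existsUnique (𝟙 A) (𝟙 B) ((evalHor A B).obj L).pro α
    obtain ⟨φ, rfl⟩ := (repCenter A).exists_extension (repCenter B) (repPro J.pro) L.pro β
    exact ⟨φ, hβ⟩

variable (A B)

/-- The evaluation at the identities is right adjoint to the canonical embedding. -/
noncomputable def horAdjunction : (canonicalEmbedding E).hor A B ⊣ evalHor A B :=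
  .mkOfHomEquiv
    { homEquiv J L := .ofBijective _ (toEval_bijective J L)
      homEquiv_naturality_left_symm {J' J L} α β := by
        refine (Equiv.symm_apply_eq _).2 ?_
        -- Writing `β` as the transpose of `φ` reduces the claim to the naturality of `toEval`.
        obtain ⟨φ, rfl⟩ := (toEval_bijective J L).2 β
        have e : (Equiv.ofBijective _ (toEval_bijective J L)).symm
          (toEval J ≫ (evalHor A B).map φ) = φ := Equiv.ofBijective_symm_apply_apply _ _ φ
        rw [e]
        exact (Category.assoc α (toEval J) ((evalHor A B).map φ)).symm.trans ((congrArg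
          (· ≫ (evalHor A B).map φ) (toEval_naturality α).symm).trans ((Category.assoc _ _ _).trans
          (congrArg (toEval J' ≫ ·) ((evalHor A B).map_comp _ φ).symm)))
      homEquiv_naturality_right φ ψ :=
        (congrArg (toEval _ ≫ ·) ((evalHor A B).map_comp φ ψ)).trans (Category.assoc _ _ _).symm }

end Coreflection

theorem mainTheorem1 (E : Type u) [VirtualDoubleCategory.{z, w, v} E] [IsVirtualEquipment E] :
    IsVirtualEquipment (EnrCat.{max u v} E) ∧
    (∀ {X Y : E} {p : HPath X Y} {J : Pro X Y} (μ : Cell p (𝟙 X) (𝟙 Y) J),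
      IsComposite μ → IsComposite ((canonicalEmbedding E).globMap μ)) ∧
    (∀ {X X' Y Y' : E} (p : HPath X X') (f : X ⟶ Y) (g : X' ⟶ Y') (K : Pro Y Y'),
      Function.Bijective fun α : Cell p f g K => (canonicalEmbedding E).cellMap α) ∧
    (∀ {A B : E} (G : (canonicalEmbedding E).obj A ⟶ (canonicalEmbedding E).obj B),
      ∃ f : A ⟶ B, Nonempty (EnrFunctor.NatIso G ((canonicalEmbedding E).map f))) ∧
    (∀ A B : E, ((canonicalEmbedding E).hor A B).Full ∧ ((canonicalEmbedding E).hor A B).Faithful ∧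
      Nonempty ((canonicalEmbedding E).hor A B ⊣ evalHor A B)) := by
  refine ⟨inferInstance, fun μ h => globMap_isComposite h, fun p f g K => repCell_bijective p f g K,
    fun G => exists_natIso_repFun G, fun A B => ⟨⟨fun {J K} =>
      (canonicalEmbedding_hor_map_bijective A B J K).2⟩, ⟨fun {J K} =>
      @((canonicalEmbedding_hor_map_bijective A B J K).1)⟩, ⟨horAdjunction A B⟩⟩⟩
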